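/- Conventions. For a finite simple graph $G=(V,E)$ let $|G|=|V|+|E|$. A cluster graph is a graph whose connected components (its clusters) are cliques. A cluster vertex deletion of $G$ is a set $S\subseteq V$ such that $G[V\setminus S]$ is a cluster graph; the cvd number $k(G)$ is the minimum size of such a set, and a cluster vertex deletion of size at most $3k(G)$ is called 3-approximate. Algorithms are programs of a unit-cost random access machine with words of $w$ bits (a value that does not fit into a word is not allowed). Theorem. There is a fully dynamic data structure, given by fixed programs, that represents a graph $G$ on $n$ vertices, starts from the edgeless graph on $n$ vertices (set up in time polynomial in $n$ from a zero memory), and keeps a 3-approximate cluster vertex deletion $X$ of the current graph $G$, distinct labels for the clusters of $G[V\setminus X]$ (write $l_u$ for the label of the cluster of $u\in V\setminus X$ and $C_l$ for the cluster labelled $l$), the label sets $L_x=\{l_u : u\in N(x)\setminus X\}$ for $x\in X$, and the sets $P^+_{x,l}=C_l\cap N(x)$ and $P^-_{x,l}=C_l\setminus N(x)$ for $x\in X$, $l\in L_x$; any $m \le n$ elements (or all, if there are fewer) of any one of the sets $X$, $C_l$, $L_x$, $P^\pm_{x,l}$, or a label $l_u$, can be listed in $O(m+1)$ time. It supports the following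 operations, where $T$ is the number of updates made so far. 1. Adding an edge to $G$, or removing an edge from $G$, takes $O(k^8+k^2\log n)$ time, where $k$ is the maximum of $1$ and of the cvd numbers of $G$ before and after the update. 2. Let $A$ be any static algorithm (a program of the same machine) that, given the list of edges of any graph $H$, outputs a minimum cluster vertex deletion of $H$ in time at most $f(|H|,k(H))$ with words of $g(|H|,k(H))$ bits, where $f$ and $g$ are nondecreasing in both arguments. Then there is a query program, depending only on $A$, that outputs a minimum cluster vertex deletion of the current graph $G$ in time $O\bigl(f(O(\max(1,k)^5),k)\bigr)$, where $k=k(G)$; it leaves the represented data unchanged. The constants are absolute, except that those of item 2 may depend on $A$. Set-up, updates and listings work with every word length $w\ge c\log(n+T+2)$, and queries with every $w\ge c\,(\log(n+T+2)+g(c\max(1,k)^5,k))$. -/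

import Mathlib

/-! ## Random access machine with `w`-bit words -/

namespace RAM

/-- A memory state: `σ a i` is the content of cell `i` of array `a`. A program mentions only finitely
many arrays. -/
abbrev Mem := ℕ → ℕ → ℕ

/-- The memory in which every cell is zero. -/
def Mem.zero : Mem := fun _ _ => 0

/-- Write the arguments of a call into the first cells of array `0`; all other cells keep their
content. -/
def Mem.load (σ : Mem) (args : List ℕ) : Mem :=
  fun a i => if a = 0 then args.getD i (σ a i) else σ a i

/-- Overwrite one cell. -/
def Mem.set (σ : Mem) (a i v : ℕ) : Mem :=
  fun b j => if b = a ∧ j = i then v else σ b j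

/-- The arithmetical, logical and comparison instructions of the machine. -/
inductive BinOp
  | add | sub | mul | div | mod | lt | eq | land | lor | xor | shl | shr

/-- Value of an instruction (subtraction is truncated, comparisons give `1` or `0`). -/
def BinOp.eval : BinOp → ℕ → ℕ → ℕ
  | .add, x, y => x + y
  | .sub, x, y => x - y
  | .mul, x, y => x * y
  | .div, x, y => x / y
  | .mod, x, y => x % y
  | .lt, x, y => if x < y then 1 else 0
  | .eq, x, y => if x = y then 1 else 0
  | .land, x, y => x &&& y
  | .lor, x, y => x ||| y
  | .xor, x, y => x ^^^ y
  | .shl, x, y => x <<< y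
  | .shr, x, y => x >>> y

/-- Expressions: constants, memory cells with a computed address, instructions. -/
inductive Expr
  | const (c : ℕ)
  | cell (a : ℕ) (i : Expr)
  | bin (o : BinOp) (e₁ e₂ : Expr)

/-- Value of an expression. -/
def Expr.eval (σ : Mem) : Expr → ℕ
  | .const c => c
  | .cell a i => σ a (i.eval σ)
  | .bin o e₁ e₂ => o.eval (e₁.eval σ) (e₂.eval σ)

/-- Time for evaluating an expression: one unit for every constant, memory access, instruction. -/
def Expr.cost : Expr → ℕ
  | .const _ => 1
  | .cell _ i => i.cost + 1
  | .bin _ e₁ e₂ => e₁.cost + e₂.cost + 1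

/-- Every value that occurs in the evaluation (addresses included) fits into a `w`-bit word. -/
def Expr.Fits (w : ℕ) (σ : Mem) : Expr → Prop
  | .const c => c < 2 ^ w
  | .cell a i => i.Fits w σ ∧ σ a (i.eval σ) < 2 ^ w
  | .bin o e₁ e₂ =>
      e₁.Fits w σ ∧ e₂.Fits w σ ∧ o.eval (e₁.eval σ) (e₂.eval σ) < 2 ^ w

/-- Programs. -/
inductive Cmd
  | skip
  | assign (a : ℕ) (i e : Expr)
  | seq (c₁ c₂ : Cmd)
  | ite (b : Expr) (c₁ c₂ : Cmd)
  | loop (b : Expr) (c : Cmd)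

/-- `Run w c σ t σ'`: with `w`-bit words, program `c` started in memory `σ` halts after exactly `t`
time units in memory `σ'`. A computation in which a value does not fit into a word has no run.
`assign a i e` stores `e` into cell `i` of array `a`; `loop b c` repeats `c` while `b` is nonzero. -/
inductive Run (w : ℕ) : Cmd → Mem → ℕ → Mem → Prop
  | skip (σ : Mem) : Run w .skip σ 1 σ
  | assign (a : ℕ) (i e : Expr) (σ : Mem) (hi : i.Fits w σ) (he : e.Fits w σ) :
      Run w (.assign a i e) σ (i.cost + e.cost + 1) (σ.set a (i.eval σ) (e.eval σ))
  | seq (c₁ c₂ : Cmd) (σ₁ σ₂ σ₃ : Mem) (t₁ t₂ : ℕ) (h₁ : Run w c₁ σ₁ t₁ σ₂)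
      (h₂ : Run w c₂ σ₂ t₂ σ₃) : Run w (.seq c₁ c₂) σ₁ (t₁ + t₂) σ₃
  | iteTrue (b : Expr) (c₁ c₂ : Cmd) (σ σ' : Mem) (t : ℕ) (hf : b.Fits w σ)
      (hb : b.eval σ ≠ 0) (h : Run w c₁ σ t σ') : Run w (.ite b c₁ c₂) σ (b.cost + 1 + t) σ'
  | iteFalse (b : Expr) (c₁ c₂ : Cmd) (σ σ' : Mem) (t : ℕ) (hf : b.Fits w σ)
      (hb : b.eval σ = 0) (h : Run w c₂ σ t σ') : Run w (.ite b c₁ c₂) σ (b.cost + 1 + t) σ'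
  | loopDone (b : Expr) (c : Cmd) (σ : Mem) (hf : b.Fits w σ) (hb : b.eval σ = 0) :
      Run w (.loop b c) σ (b.cost + 1) σ
  | loopStep (b : Expr) (c : Cmd) (σ₁ σ₂ σ₃ : Mem) (t₁ t₂ : ℕ) (hf : b.Fits w σ₁)
      (hb : b.eval σ₁ ≠ 0) (h₁ : Run w c σ₁ t₁ σ₂) (h₂ : Run w (.loop b c) σ₂ t₂ σ₃) :
      Run w (.loop b c) σ₁ (b.cost + 1 + t₁ + t₂) σ₃

/-- Array `1` holds the list `l`: its length in cell `0`, its entries in the following cells. -/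
def Mem.Output (σ : Mem) (l : List ℕ) : Prop :=
  σ 1 0 = l.length ∧ ∀ (i : ℕ) (h : i < l.length), σ 1 (i + 1) = l[i]

end RAM

/-! ## Cluster vertex deletion -/

namespace ClusterDeletion

open RAM

/-- A cluster graph: every connected component is a clique. -/
def IsClusterGraph {V : Type*} (G : SimpleGraph V) : Prop :=
  ∀ u v : V, G.Reachable u v → u ≠ v → G.Adj u v

/-- `S` is a cluster vertex deletion of `G`: removing it leaves a cluster graph. -/
def IsCVD {n : ℕ} (G : SimpleGraph (Fin n)) (S : Finset (Fin n)) : Prop :=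
  IsClusterGraph (G.induce {v | v ∉ S})

/-- The cvd number: the size of a minimum cluster vertex deletion. -/
noncomputable def cvd {n : ℕ} (G : SimpleGraph (Fin n)) : ℕ :=
  sInf {s | ∃ S : Finset (Fin n), IsCVD G S ∧ S.card = s}

/-- The whole vertex set is a cluster vertex deletion, so the infimum above is a minimum. -/
theorem isCVD_univ {n : ℕ} (G : SimpleGraph (Fin n)) : IsCVD G Finset.univ :=
  fun u => absurd (Finset.mem_univ u.1) u.2

/-- A solution of the problem: a minimum cluster vertex deletion. -/
def IsMinCVD {n : ℕ} (G : SimpleGraph (Fin n)) (S : Finset (Fin n)) : Prop :=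
  IsCVD G S ∧ S.card = cvd G

/-- A 3-approximate solution. -/
def IsApproxCVD {n : ℕ} (G : SimpleGraph (Fin n)) (S : Finset (Fin n)) : Prop :=
  IsCVD G S ∧ S.card ≤ 3 * cvd G

/-- The size `|V| + |E|` of a graph. -/
noncomputable def size {n : ℕ} (G : SimpleGraph (Fin n)) : ℕ :=
  n + G.edgeSet.ncard

/-- Array `1` lists the elements of `S`, each once, in some order. -/
def OutputsSet {n : ℕ} (σ : Mem) (S : Finset (Fin n)) : Prop :=
  ∃ l : List (Fin n), l.Nodup ∧ (∀ v, v ∈ l ↔ v ∈ S) ∧ σ.Output (l.map Fin.val)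

/-! ### Static algorithms -/

/-- The list `L` contains every edge of `G` once, in some orientation. -/
def IsEdgeList {n : ℕ} (G : SimpleGraph (Fin n)) (L : List (Fin n × Fin n)) : Prop :=
  (L.map fun p => s(p.1, p.2)).Nodup ∧ ∀ e, e ∈ (L.map fun p => s(p.1, p.2)) ↔ e ∈ G.edgeSet

/-- Input of a static algorithm: number of vertices, number of edges, the edges. -/
def encodeGraph (n : ℕ) (L : List (Fin n × Fin n)) : List ℕ :=
  n :: L.length :: L.flatMap fun p => [p.1.val, p.2.val]

/-- The program `p` is a static algorithm for Cluster Vertex Deletion: started on any graph `G` (in an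
otherwise zero memory) it outputs a minimum cluster vertex deletion of `G` within time
`f |G| (cvd G)`, and words of `g |G| (cvd G)` bits are long enough for it. -/
def SolvesCVD (p : Cmd) (f g : ℕ → ℕ → ℕ) : Prop :=
  ∀ (n : ℕ) (G : SimpleGraph (Fin n)) (L : List (Fin n × Fin n)), IsEdgeList G L →
    ∀ w : ℕ, g (size G) (cvd G) ≤ w →
      ∃ (t : ℕ) (σ : Mem) (S : Finset (Fin n)),
        Run w p (Mem.zero.load (encodeGraph n L)) t σ ∧ t ≤ f (size G) (cvd G) ∧
          IsMinCVD G S ∧ OutputsSet σ S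

/-- Monotone in the size and in the parameter. -/
def MonotoneBound (f : ℕ → ℕ → ℕ) : Prop :=
  ∀ a a' b b' : ℕ, a ≤ a' → b ≤ b' → f a b ≤ f a' b'

/-! ### The maintained information -/

/-- `ℓ` labels the clusters (the components) of `G[V \ X]` distinctly; its values on `X` are
irrelevant. -/
def IsLabeling {n : ℕ} (G : SimpleGraph (Fin n)) (X : Finset (Fin n)) (ℓ : Fin n → ℕ) : Prop :=
  ∀ u v : {v : Fin n | v ∉ X}, ℓ u = ℓ v ↔ (G.induce {v : Fin n | v ∉ X}).Reachable u v

/-- The maintained sets: the approximate solution `X`, the label `l_u`, the cluster `C_l`, the labels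
`L_x` of the clusters incident to `x`, and the sets `P⁺_{x,l}` and `P⁻_{x,l}`. -/
inductive Item (n : ℕ)
  | solution
  | label (u : Fin n)
  | cluster (l : ℕ)
  | incident (x : Fin n)
  | pos (x : Fin n) (l : ℕ)
  | neg (x : Fin n) (l : ℕ)

/-- The contents of a maintained set, given `G`, `X` and the labels. -/
def Item.content {n : ℕ} (G : SimpleGraph (Fin n)) (X : Finset (Fin n)) (ℓ : Fin n → ℕ) :
    Item n → Set ℕ
  | .solution => {a | ∃ x ∈ X, a = x.val}
  | .label u => {a | u ∉ X ∧ a = ℓ u}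
  | .cluster l => {a | ∃ u ∉ X, ℓ u = l ∧ a = u.val}
  | .incident x => {a | ∃ u ∉ X, G.Adj x u ∧ a = ℓ u}
  | .pos x l => {a | ∃ u ∉ X, ℓ u = l ∧ G.Adj x u ∧ a = u.val}
  | .neg x l => {a | ∃ u ∉ X, ℓ u = l ∧ ¬ G.Adj x u ∧ a = u.val}

/-- The sets that are maintained: `l_u` for `u ∉ X`, `C_l` for the labels `l` of clusters, `L_x` for
`x ∈ X`, and `P⁺_{x,l}`, `P⁻_{x,l}` for `x ∈ X` and `l ∈ L_x`. -/
def Item.Valid {n : ℕ} (G : SimpleGraph (Fin n)) (X : Finset (Fin n)) (ℓ : Fin n → ℕ) :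
    Item n → Prop
  | .solution => True
  | .label u => u ∉ X
  | .cluster l => ∃ u ∉ X, ℓ u = l
  | .incident x => x ∈ X
  | .pos x l => x ∈ X ∧ ∃ u ∉ X, G.Adj x u ∧ l = ℓ u
  | .neg x l => x ∈ X ∧ ∃ u ∉ X, G.Adj x u ∧ l = ℓ u

/-- How the name of a maintained set is passed to a program. -/
def Item.code {n : ℕ} : Item n → List ℕ
  | .solution => [0, 0, 0]
  | .label u => [1, u.val, 0]
  | .cluster l => [2, 0, l]
  | .incident x => [3, x.val, 0]
  | .pos x l => [4, x.val, l]
  | .neg x l => [5, x.val, l]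

/-- Array `1` lists `min m |A|` distinct elements of `A`. -/
def OutputsSome (σ : Mem) (A : Set ℕ) (m : ℕ) : Prop :=
  ∃ l : List ℕ, l.Nodup ∧ (∀ a ∈ l, a ∈ A) ∧ l.length = min m A.ncard ∧ σ.Output l

/-! ### The dynamic data structure -/

/-- A representation relation: `R n T G X ℓ σ` says that the memory `σ` represents, after `T` updates,
the graph `G` on `n` vertices together with the maintained set `X` and the cluster labels `ℓ`. -/
abbrev Representation :=
  (n : ℕ) → ℕ → SimpleGraph (Fin n) → Finset (Fin n) → (Fin n → ℕ) → Mem → Prop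

/-- The program `c`, given `n`, sets up the data structure for the edgeless graph on `n` vertices, in
time polynomial in `n`. -/
def InitSpec (R : Representation) (C : ℕ) (c : Cmd) : Prop :=
  ∀ n w : ℕ, C * Nat.log 2 (n + 2) ≤ w →
    ∃ (t : ℕ) (σ : Mem) (X : Finset (Fin n)) (ℓ : Fin n → ℕ),
      Run w c (Mem.zero.load [n]) t σ ∧ t ≤ (n + 2) ^ C ∧ R n 0 ⊥ X ℓ σ

/-- A represented state has a 3-approximate solution `X` and distinct labels of the clusters. -/
def ContentSpec (R : Representation) : Prop :=
  ∀ (n T : ℕ) (G : SimpleGraph (Fin n)) (X : Finset (Fin n)) (ℓ : Fin n → ℕ) (σ : Mem),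
    R n T G X ℓ σ → IsApproxCVD G X ∧ IsLabeling G X ℓ

/-- The program `c`, given the ends of an edge, changes the represented graph `G` into
`op u v G`, in time `C * (k ^ 8 + k ^ 2 * log n)`, where `k` is the maximum of the cvd numbers before
and after the update, or `1` if both are zero. -/
def UpdateSpec (R : Representation) (C : ℕ) (c : Cmd)
    (op : {n : ℕ} → Fin n → Fin n → SimpleGraph (Fin n) → SimpleGraph (Fin n)) : Prop :=
  ∀ (n T : ℕ) (G : SimpleGraph (Fin n)) (X : Finset (Fin n)) (ℓ : Fin n → ℕ) (σ : Mem),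
    R n T G X ℓ σ → ∀ u v : Fin n, u ≠ v → ∀ w : ℕ, C * Nat.log 2 (n + T + 2) ≤ w →
      ∀ k : ℕ, k = max 1 (max (cvd G) (cvd (op u v G))) →
        ∃ (t : ℕ) (σ' : Mem) (X' : Finset (Fin n)) (ℓ' : Fin n → ℕ),
          Run w c (σ.load [u.val, v.val]) t σ' ∧ t ≤ C * (k ^ 8 + k ^ 2 * Nat.log 2 n) ∧
            R n (T + 1) (op u v G) X' ℓ' σ'

/-- The program `c`, given the name of a maintained set and a number `m`, lists `m` elements of the
set (all of them if there are fewer), in time `C * (m + 1)`. -/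
def ReportSpec (R : Representation) (C : ℕ) (c : Cmd) : Prop :=
  ∀ (n T : ℕ) (G : SimpleGraph (Fin n)) (X : Finset (Fin n)) (ℓ : Fin n → ℕ) (σ : Mem),
    R n T G X ℓ σ → ∀ i : Item n, i.Valid G X ℓ → ∀ m ≤ n, ∀ w : ℕ,
      C * Nat.log 2 (n + T + 2) ≤ w →
        ∃ (t : ℕ) (σ' : Mem), Run w c (σ.load (i.code ++ [m])) t σ' ∧ t ≤ C * (m + 1) ∧
          OutputsSome σ' (i.content G X ℓ) m ∧ R n T G X ℓ σ'

/-- The program `c` outputs a minimum cluster vertex deletion of the represented graph, in time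
`C * f (C * k ^ 5) (cvd G)` with `k = max 1 (cvd G)`. -/
def QuerySpec (R : Representation) (C : ℕ) (c : Cmd) (f g : ℕ → ℕ → ℕ) : Prop :=
  ∀ (n T : ℕ) (G : SimpleGraph (Fin n)) (X : Finset (Fin n)) (ℓ : Fin n → ℕ) (σ : Mem),
    R n T G X ℓ σ → ∀ k : ℕ, k = max 1 (cvd G) → ∀ w : ℕ,
      C * (Nat.log 2 (n + T + 2) + g (C * k ^ 5) (cvd G)) ≤ w →
        ∃ (t : ℕ) (σ' : Mem) (S : Finset (Fin n)), Run w c σ t σ' ∧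
          t ≤ C * f (C * k ^ 5) (cvd G) ∧ IsMinCVD G S ∧ OutputsSet σ' S ∧ R n T G X ℓ σ'

/-- Adding the edge `uv`. -/
def addEdge {n : ℕ} (u v : Fin n) (G : SimpleGraph (Fin n)) : SimpleGraph (Fin n) :=
  G ⊔ SimpleGraph.edge u v

/-- Removing the edge `uv`. -/
def removeEdge {n : ℕ} (u v : Fin n) (G : SimpleGraph (Fin n)) : SimpleGraph (Fin n) :=
  G.deleteEdges {s(u, v)}

end ClusterDeletion

/-! A graph is a cluster graph exactly when no three vertices induce a path. The maintained solution
`X` is kept as a disjoint union of triples, each inducing a path. Every cluster vertex deletion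
meets every triple, so `X` is 3-approximate at all times (`card_le_of_trip`).

Each vertex of `X` owns a slot with tables about the clusters outside of `X`: for every cluster a
permutation that lists the neighbours first, the number of neighbours, and the list of labels for
which this number is nonzero. A vertex is moved between its cluster and `X` in constant time per
vertex of `X` (`moveIn_spec`, `moveOut_spec`). Slots are never reused, so a new slot starts from
zero memory, which codes identity permutations and empty lists.

To change an edge, both ends are brought into `X` and their triples are dissolved (`release_spec`).
The tables only concern pairs with an end outside of `X`, so just the adjacency matrix has to be
changed (`Core.change`). At most six vertices of `X` are then without a triple. The tables of such a
vertex either show a partly adjacent cluster or two incident clusters, which yields a new triple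
with two vertices outside of `X`, or they show that the vertex can leave `X` for a cluster
(`findTriple_spec`, `resolve_spec`). The time is linear in `|X|`, hence in `k`, which is below the
allowed bound.

A query builds a kernel. With `s = |X|`, it marks `X` and, for each vertex of `X` and each of up to
`s + 2` incident clusters, up to `s + 1` neighbours and `s + 1` non-neighbours. A deletion of at
most `s` vertices leaves a marked survivor of each kind that was cut off, so a set of at most `s`
vertices that meets all induced paths of marked vertices meets all induced paths
(`isCVD_of_marked`). The kernel has `O(s ^ 3)` vertices, but only `O(s ^ 2)` in any one cluster, so
it has `O(s ^ 5)` edges, and its minimum solutions are minimum solutions of the whole graph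
(`Repr.kernel_solution`).

The static program runs on the kernel inside a separate family of arrays. Each cell is logged at its
first write, so all traces can be erased in time proportional to the run (`Shifted.run`,
`undo_spec`). The query's own work of order `k ^ 5` is charged to `f`: by an adversary argument, a
correct static algorithm needs at least linear time (`le_time`). -/

namespace RAM

/-! ### Program logic: bounds on values, frames and running times -/

/-- An injective pairing of addresses that the machine can compute. -/
def pr (a b : ℕ) : ℕ := (a + b) * (a + b) + a

-- With `s = a + b` the code lies between `s * s` and `s * s + s`, below the next square. So it
-- determines `s`, and then `a` and `b`.
@[simp] theorem pr_inj {a b c d : ℕ} : pr a b = pr c d ↔ a = c ∧ b = d := by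
  refine ⟨fun h => ?_, fun h => by rw [h.1, h.2]⟩
  unfold pr at h
  have : a + b = c + d := by
    rcases lt_trichotomy (a + b) (c + d) with h' | h' | h'
    · nlinarith
    · exact h'
    · nlinarith
  rw [this] at h
  omega

instance : Add Expr := ⟨.bin .add⟩
instance : Sub Expr := ⟨.bin .sub⟩
instance : Mul Expr := ⟨.bin .mul⟩

namespace Expr

/-- Bitwise exclusive or of two expressions. -/
def xr (e₁ e₂ : Expr) : Expr := .bin .xor e₁ e₂

/-- The test `e₁ < e₂`. -/
def lt (e₁ e₂ : Expr) : Expr := .bin .lt e₁ e₂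

/-- The address `pr e₁ e₂`. -/
def pr (e₁ e₂ : Expr) : Expr := (e₁ + e₂) * (e₁ + e₂) + e₁

/-- Cell `0` of an array, used as a variable. -/
def var (a : ℕ) : Expr := .cell a (.const 0)

/-- The minimum of two expressions. -/
def min (e₁ e₂ : Expr) : Expr := e₁ - (e₁ - e₂)

variable (σ : Mem) (e₁ e₂ : Expr)

@[simp] theorem eval_const (c : ℕ) : (Expr.const c).eval σ = c := rfl
@[simp] theorem eval_cell (a : ℕ) : (Expr.cell a e₁).eval σ = σ a (e₁.eval σ) := rfl
@[simp] theorem eval_var (a : ℕ) : (var a).eval σ = σ a 0 := rfl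
@[simp] theorem eval_add : (e₁ + e₂).eval σ = e₁.eval σ + e₂.eval σ := rfl
@[simp] theorem eval_sub : (e₁ - e₂).eval σ = e₁.eval σ - e₂.eval σ := rfl
@[simp] theorem eval_mul : (e₁ * e₂).eval σ = e₁.eval σ * e₂.eval σ := rfl
@[simp] theorem eval_xr : (xr e₁ e₂).eval σ = e₁.eval σ ^^^ e₂.eval σ := rfl
@[simp] theorem eval_pr : (pr e₁ e₂).eval σ = RAM.pr (e₁.eval σ) (e₂.eval σ) := rfl
@[simp] theorem eval_lt : (lt e₁ e₂).eval σ = if e₁.eval σ < e₂.eval σ then 1 else 0 := rfl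
@[simp] theorem eval_min : (min e₁ e₂).eval σ = Min.min (e₁.eval σ) (e₂.eval σ) := by
  simp only [min, eval_sub]
  omega

/-- If all cells are below `2 ^ b`, the value of the expression is below `2 ^ (b * deg)`. -/
def deg : Expr → ℕ
  | .const _ => 1
  | .cell _ _ => 1
  | .bin .add e₁ e₂ => max e₁.deg e₂.deg + 1
  | .bin .mul e₁ e₂ => e₁.deg + e₂.deg
  | .bin .lt _ _ => 1
  | .bin .eq _ _ => 1
  | .bin _ e₁ e₂ => max e₁.deg e₂.deg

/-- Constants are small, no shifts to the left, all degrees are at most `16`. -/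
def ok : Expr → Bool
  | .const c => c < 256
  | .cell _ i => i.ok
  | .bin .shl _ _ => false
  | .bin o e₁ e₂ => e₁.ok && e₂.ok && decide ((Expr.bin o e₁ e₂).deg ≤ 16)

end Expr

/-- All cells are below `2 ^ b`. -/
def Bd (b : ℕ) (σ : Mem) : Prop := ∀ a i, σ a i < 2 ^ b

theorem Bd.mono {b b' : ℕ} {σ : Mem} (h : Bd b σ) (hb : b ≤ b') : Bd b' σ :=
  fun a i => (h a i).trans_le (Nat.pow_le_pow_right (by norm_num) hb)

/-- The measure `deg` behaves like the degree of a polynomial, and `ok` caps it at 16, so words of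
`16 * b` bits suffice for all intermediate values. An address `pr` of two cells has degree 5 and a
nested address has degree 13, which fits under this cap. -/
theorem Expr.eval_lt_pow {w b : ℕ} {σ : Mem} (hb : 8 ≤ b) (hw : 16 * b ≤ w) (hσ : Bd b σ) (e : Expr)
    (he : e.ok = true) : e.eval σ < 2 ^ (b * e.deg) ∧ e.Fits w σ := by
  have key : ∀ (d x : ℕ), d ≤ 16 → x < 2 ^ (b * d) → x < 2 ^ w := fun d x hd hx =>
    hx.trans_le (Nat.pow_le_pow_right (by norm_num) (by nlinarith))
  have mono : ∀ {d d' x : ℕ}, d ≤ d' → x < 2 ^ (b * d) → x < 2 ^ (b * d') := fun hd hx =>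
    hx.trans_le (Nat.pow_le_pow_right (by norm_num) (by nlinarith))
  have h256 : 256 ≤ 2 ^ b := (show 256 = 2 ^ 8 by norm_num) ▸ Nat.pow_le_pow_right (by norm_num) hb
  have one : ∀ {d x : ℕ}, 1 ≤ d → x ≤ 1 → x < 2 ^ (b * d) := fun hd hx => by
    refine mono hd ?_
    rw [mul_one]
    omega
  induction e with
  | const c =>
    simp only [Expr.ok, decide_eq_true_eq] at he
    have : c < 2 ^ (b * 1) := by rw [mul_one]; omega
    exact ⟨this, key 1 _ (by norm_num) this⟩
  | cell a i ih =>
    have : σ a (i.eval σ) < 2 ^ (b * 1) := by rw [mul_one]; exact hσ a _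
    exact ⟨this, (ih he).2, key 1 _ (by norm_num) this⟩
  | bin o e₁ e₂ h₁ h₂ =>
    have main : ∀ x, x < 2 ^ (b * (Expr.bin o e₁ e₂).deg) → (Expr.bin o e₁ e₂).eval σ = x →
        e₁.ok = true → e₂.ok = true → (Expr.bin o e₁ e₂).deg ≤ 16 →
        (Expr.bin o e₁ e₂).eval σ < 2 ^ (b * (Expr.bin o e₁ e₂).deg) ∧
          (Expr.bin o e₁ e₂).Fits w σ := by
      intro x hx hxe o₁ o₂ hd
      rw [← hxe] at hx
      exact ⟨hx, (h₁ o₁).2, (h₂ o₂).2, key _ _ hd hx⟩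
    cases o <;> simp only [Expr.ok, Bool.and_eq_true, decide_eq_true_eq, reduceCtorEq] at he <;>
      obtain ⟨⟨o₁, o₂⟩, hd⟩ := he <;> refine main _ ?_ rfl o₁ o₂ hd <;>
      have a₁ := (h₁ o₁).1 <;> have a₂ := (h₂ o₂).1 <;> simp only [Expr.deg, Expr.eval, BinOp.eval]
    · have a₁ := mono (le_max_left e₁.deg e₂.deg) a₁
      have a₂ := mono (le_max_right e₁.deg e₂.deg) a₂
      rw [mul_add, pow_add, mul_one]
      nlinarith
    · exact (Nat.sub_le _ _).trans_lt (mono (le_max_left _ _) a₁)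
    · rw [mul_add, pow_add]
      exact Nat.mul_lt_mul'' a₁ a₂
    · exact (Nat.div_le_self _ _).trans_lt (mono (le_max_left _ _) a₁)
    · exact (Nat.mod_le _ _).trans_lt (mono (le_max_left _ _) a₁)
    · exact one le_rfl (by split <;> omega)
    · exact one le_rfl (by split <;> omega)
    · exact Nat.and_le_left.trans_lt (mono (le_max_left _ _) a₁)
    · exact Nat.or_lt_two_pow (mono (le_max_left _ _) a₁) (mono (le_max_right _ _) a₂)
    · exact Nat.xor_lt_two_pow (mono (le_max_left _ _) a₁) (mono (le_max_right _ _) a₂)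
    · exact (Nat.shiftRight_le _ _).trans_lt (mono (le_max_left _ _) a₁)

theorem Bd.eval_lt {b : ℕ} {σ : Mem} (hσ : Bd b σ) (hb : 8 ≤ b) (e : Expr) (he : e.ok = true)
    (hd : e.deg = 1) : e.eval σ < 2 ^ b := by
  have := (e.eval_lt_pow hb le_rfl hσ he).1
  rwa [hd, mul_one] at this

namespace Cmd

/-- A sequence of commands. -/
def block : List Cmd → Cmd
  | [] => .skip
  | c :: l => .seq c (block l)

/-- `for v = 0, 1, ..., N - 1 do c`. -/
def forLoop (v : ℕ) (N : Expr) (c : Cmd) : Cmd :=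
  .seq (.assign v (.const 0) (.const 0))
    (.loop ((Expr.var v).lt N) (.seq c (.assign v (.const 0) (Expr.var v + .const 1))))

/-- Effect of a command without loops. -/
def exec : Cmd → Mem → Mem
  | .skip, σ => σ
  | .assign a i e, σ => σ.set a (i.eval σ) (e.eval σ)
  | .seq c₁ c₂, σ => c₂.exec (c₁.exec σ)
  | .ite b c₁ c₂, σ => if b.eval σ ≠ 0 then c₁.exec σ else c₂.exec σ
  | .loop _ _, σ => σ

/-- A command without loops whose stored values stay below `2 ^ b`. -/
def Sound (b : ℕ) : Cmd → Mem → Prop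
  | .skip, _ => True
  | .assign _ _ e, σ => if e.deg = 1 then True else e.eval σ < 2 ^ b
  | .seq c₁ c₂, σ => c₁.Sound b σ ∧ c₂.Sound b (c₁.exec σ)
  | .ite e c₁ c₂, σ => if e.eval σ ≠ 0 then c₁.Sound b σ else c₂.Sound b σ
  | .loop _ _, _ => False

/-- All expressions are `ok`. -/
def wf : Cmd → Bool
  | .skip => true
  | .assign _ i e => i.ok && e.ok
  | .seq c₁ c₂ => c₁.wf && c₂.wf
  | .ite b c₁ c₂ => b.ok && c₁.wf && c₂.wf
  | .loop b c => b.ok && c.wf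

/-- Time bound for a command without loops. -/
def bound : Cmd → ℕ
  | .skip => 1
  | .assign _ i e => i.cost + e.cost + 1
  | .seq c₁ c₂ => c₁.bound + c₂.bound
  | .ite b c₁ c₂ => b.cost + 1 + (c₁.bound + c₂.bound)
  | .loop _ _ => 0

/-- The arrays that a command can change. -/
def mods : Cmd → List ℕ
  | .skip => []
  | .assign a _ _ => [a]
  | .seq c₁ c₂ => c₁.mods ++ c₂.mods
  | .ite _ c₁ c₂ => c₁.mods ++ c₂.mods
  | .loop _ c => c.mods

end Cmd

theorem Run.frame {w : ℕ} {c : Cmd} {σ σ' : Mem} {t : ℕ} (h : Run w c σ t σ') {a : ℕ}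
    (ha : a ∉ c.mods) : σ' a = σ a := by
  induction h with
  | skip => rfl
  | assign a' i e σ =>
    simp only [Cmd.mods, List.mem_singleton] at ha
    funext j
    simp [Mem.set, ha]
  | seq _ _ _ _ _ _ _ _ _ ih₁ ih₂ =>
    simp only [Cmd.mods, List.mem_append, not_or] at ha
    rw [ih₂ ha.2, ih₁ ha.1]
  | iteTrue _ _ _ _ _ _ _ _ _ ih =>
    simp only [Cmd.mods, List.mem_append, not_or] at ha
    exact ih ha.1
  | iteFalse _ _ _ _ _ _ _ _ _ ih =>
    simp only [Cmd.mods, List.mem_append, not_or] at ha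
    exact ih ha.2
  | loopDone => rfl
  | loopStep _ _ _ _ _ _ _ _ _ _ _ ih₁ ih₂ => rw [ih₂ ha, ih₁ ha]

theorem Bd.set {b : ℕ} {σ : Mem} (hσ : Bd b σ) {a i v : ℕ} (hv : v < 2 ^ b) :
    Bd b (σ.set a i v) := by
  intro a' j
  unfold Mem.set
  split
  · exact hv
  · exact hσ a' j

/-- For a command without loops the final memory can be computed by `exec`, so statements about it
reduce to rewriting. Only stored expressions of degree above one need a separate bound; for the
others `Bd` already gives it. -/
theorem Cmd.run_exec {w b : ℕ} (hb : 8 ≤ b) (hw : 16 * b ≤ w) (c : Cmd) :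
    ∀ {σ : Mem}, Bd b σ → c.wf = true → c.Sound b σ →
      ∃ t, Run w c σ t (c.exec σ) ∧ t ≤ c.bound ∧ Bd b (c.exec σ) := by
  induction c with
  | skip => exact fun {σ} hσ _ _ => ⟨1, .skip σ, le_rfl, hσ⟩
  | assign a i e =>
    intro σ hσ hwf hs
    simp only [wf, Bool.and_eq_true] at hwf
    refine ⟨_, .assign a i e σ (i.eval_lt_pow hb hw hσ hwf.1).2 (e.eval_lt_pow hb hw hσ hwf.2).2,
      le_rfl, hσ.set ?_⟩
    unfold Sound at hs
    split at hs
    · exact hσ.eval_lt hb e hwf.2 ‹_›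
    · exact hs
  | seq c₁ c₂ h₁ h₂ =>
    intro σ hσ hwf hs
    simp only [wf, Bool.and_eq_true] at hwf
    obtain ⟨t₁, r₁, l₁, b₁⟩ := h₁ hσ hwf.1 hs.1
    obtain ⟨t₂, r₂, l₂, b₂⟩ := h₂ b₁ hwf.2 hs.2
    exact ⟨_, .seq _ _ _ _ _ _ _ r₁ r₂, Nat.add_le_add l₁ l₂, b₂⟩
  | ite e c₁ c₂ h₁ h₂ =>
    intro σ hσ hwf hs
    simp only [wf, Bool.and_eq_true] at hwf
    have hf := (e.eval_lt_pow hb hw hσ hwf.1.1).2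
    unfold Sound at hs
    unfold exec bound
    split at hs
    · obtain ⟨t₁, r₁, l₁, b₁⟩ := h₁ hσ hwf.1.2 hs
      rw [if_pos ‹_›]
      exact ⟨_, .iteTrue _ _ _ _ _ _ hf ‹_› r₁, by omega, b₁⟩
    · obtain ⟨t₁, r₁, l₁, b₁⟩ := h₂ hσ hwf.2 hs
      rw [if_neg ‹_›]
      exact ⟨_, .iteFalse _ _ _ _ _ _ hf (not_not.1 ‹_›) r₁, by omega, b₁⟩
  | loop => exact fun _ _ hs => hs.elim

/-- Total correctness with a time bound: started in `σ`, the program halts after at most `B` steps in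
a memory that satisfies `Q`. All cells stay below `2 ^ b`. -/
def Tri (w b : ℕ) (c : Cmd) (σ : Mem) (B : ℕ) (Q : Mem → Prop) : Prop :=
  8 ≤ b → 16 * b ≤ w → Bd b σ →
    ∃ t σ', Run w c σ t σ' ∧ t ≤ B ∧ Bd b σ' ∧ (∀ a, a ∉ c.mods → σ' a = σ a) ∧ Q σ'

namespace Tri

variable {w b : ℕ} {c c₁ c₂ : Cmd} {σ : Mem} {B B₁ B₂ : ℕ} {Q Q₁ : Mem → Prop}

theorem exec (hwf : c.wf = true) (hB : c.bound ≤ B) (hs : 8 ≤ b → Bd b σ → c.Sound b σ)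
    (hQ : Bd b (c.exec σ) → (∀ a, a ∉ c.mods → c.exec σ a = σ a) → Q (c.exec σ)) :
    Tri w b c σ B Q := fun hb hw hσ => by
  obtain ⟨t, r, l, h⟩ := c.run_exec hb hw hσ hwf (hs hb hσ)
  exact ⟨t, _, r, l.trans hB, h, fun a ha => r.frame ha, hQ h fun a ha => r.frame ha⟩

theorem conseq (h : Tri w b c σ B₁ Q₁) (hB : B₁ ≤ B)
    (hQ : ∀ σ', Bd b σ' → (∀ a, a ∉ c.mods → σ' a = σ a) → Q₁ σ' → Q σ') : Tri w b c σ B Q :=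
  fun hb hw hσ => by
    obtain ⟨t, σ', r, l, h, f, q⟩ := h hb hw hσ
    exact ⟨t, σ', r, l.trans hB, h, f, hQ σ' h f q⟩

theorem of_bd (h : 8 ≤ b → Bd b σ → Tri w b c σ B Q) : Tri w b c σ B Q :=
  fun hb hw hσ => h hb hσ hb hw hσ

theorem seq (h₁ : Tri w b c₁ σ B₁ Q₁)
    (h₂ : ∀ σ', Bd b σ' → (∀ a, a ∉ c₁.mods → σ' a = σ a) → Q₁ σ' → Tri w b c₂ σ' B₂ Q)
    (hB : B₁ + B₂ ≤ B) : Tri w b (.seq c₁ c₂) σ B Q := fun hb hw hσ => by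
  obtain ⟨t, σ', r, l, h, f, q⟩ := h₁ hb hw hσ
  obtain ⟨t', σ'', r', l', h', f', q'⟩ := h₂ σ' h f q hb hw h
  have r₂ := Run.seq _ _ _ _ _ _ _ r r'
  exact ⟨_, σ'', r₂, by omega, h', fun a ha => r₂.frame ha, q'⟩

theorem ite {e : Expr} (he : e.ok = true) (h₁ : e.eval σ ≠ 0 → Tri w b c₁ σ B₁ Q)
    (h₂ : e.eval σ = 0 → Tri w b c₂ σ B₁ Q) (hB : e.cost + 1 + B₁ ≤ B) :
    Tri w b (.ite e c₁ c₂) σ B Q := fun hb hw hσ => by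
  have hf := (e.eval_lt_pow hb hw hσ he).2
  by_cases h : e.eval σ = 0
  · obtain ⟨t, σ', r, l, h', f, q⟩ := h₂ h hb hw hσ
    have r₂ := Run.iteFalse _ c₁ _ _ _ _ hf h r
    exact ⟨_, σ', r₂, by omega, h', fun a ha => r₂.frame ha, q⟩
  · obtain ⟨t, σ', r, l, h', f, q⟩ := h₁ h hb hw hσ
    have r₂ := Run.iteTrue _ _ c₂ _ _ _ hf h r
    exact ⟨_, σ', r₂, by omega, h', fun a ha => r₂.frame ha, q⟩

theorem skip (h : Q σ) : Tri w b .skip σ 1 Q :=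
  fun _ _ hσ => ⟨1, σ, .skip σ, le_rfl, hσ, fun _ _ => rfl, h⟩

/-- The invariant for `j` is required of the memory in which the counter already holds `j`. The
bound `N` is evaluated anew in every round, so `hN` asks that it keeps its value under the frame of
the body. Beside the body, a round pays `N.cost + 4` for the test and 6 for the increment. -/
theorem forLoop {v : ℕ} {N : Expr} (N₀ : ℕ) (I : ℕ → Mem → Prop) (hv : v ∉ c.mods)
    (hok : N.ok = true)
    (hN : ∀ j σ', (∀ a, a ∉ c.mods → a ≠ v → σ' a = σ a) → I j σ' → N.eval σ' = N₀)
    (hN' : N₀ < 2 ^ b) (h0 : I 0 (σ.set v 0 0))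
    (hstep : ∀ j < N₀, ∀ σ', Bd b σ' → (∀ a, a ∉ c.mods → a ≠ v → σ' a = σ a) → σ' v 0 = j →
      I j σ' → Tri w b c σ' B₁ (fun σ'' => I (j + 1) (σ''.set v 0 (j + 1))))
    (hB : N.cost + 7 + N₀ * (B₁ + N.cost + 10) ≤ B) :
    Tri w b (.forLoop v N c) σ B (fun σ' => I N₀ σ') := fun hb hw hσ => by
  have hfits : ∀ σ', Bd b σ' → ((Expr.var v).lt N).Fits w σ' := fun σ' h' => by
    refine (Expr.eval_lt_pow hb hw h' _ ?_).2
    simp [Expr.lt, Expr.ok, Expr.var, hok, Expr.deg]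
  have hcost : ((Expr.var v).lt N).cost = N.cost + 3 := by
    simp only [Expr.lt, Expr.var, Expr.cost]
    omega
  -- Induction on the number `m` of rounds that remain.
  have main : ∀ m j σ', j + m = N₀ → Bd b σ' → (∀ a, a ∉ c.mods → a ≠ v → σ' a = σ a) →
      σ' v 0 = j → I j σ' → ∃ t σ'',
        Run w (.loop ((Expr.var v).lt N)
          (.seq c (.assign v (.const 0) (Expr.var v + .const 1)))) σ' t σ'' ∧
        t ≤ N.cost + 4 + m * (B₁ + N.cost + 10) ∧ Bd b σ'' ∧ I N₀ σ'' := by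
    intro m
    induction m with
    | zero =>
      intro j σ' hj hσ' hfr hvj hI
      refine ⟨_, σ', .loopDone _ _ _ (hfits σ' hσ') ?_, ?_, hσ', by rwa [show N₀ = j by omega]⟩
      · simp [hvj, hN j σ' hfr hI]
        omega
      · rw [hcost]
        omega
    | succ m ih =>
      intro j σ' hj hσ' hfr hvj hI
      obtain ⟨t, σ₁, r, l, h₁, f, q⟩ := hstep j (by omega) σ' hσ' hfr hvj hI hb hw hσ'
      have hval : (Expr.var v + .const 1).eval σ₁ = j + 1 := by
        simp [f v hv, hvj]
      have hok1 : (Expr.var v + .const 1).ok = true := rfl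
      have h1 : (1 : ℕ) < 2 ^ w := Nat.one_lt_two_pow (by omega)
      have r₁ : Run w (.assign v (.const 0) (Expr.var v + .const 1)) σ₁ 6 (σ₁.set v 0 (j + 1)) := by
        have := Run.assign (w := w) v (.const 0) (Expr.var v + .const 1) σ₁ (by simp [Expr.Fits])
          (Expr.eval_lt_pow hb hw h₁ _ hok1).2
        rwa [hval] at this
      obtain ⟨t', σ₂, r₂, l', h₂, q₂⟩ := ih (j + 1) (σ₁.set v 0 (j + 1)) (by omega)
        (h₁.set (by omega)) (fun a ha hav => by
          funext i
          simp [Mem.set, hav, f a ha, hfr a ha hav]) (by simp [Mem.set]) q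
      refine ⟨_, σ₂, .loopStep _ _ _ _ _ _ _ (hfits σ' hσ') ?_ (.seq _ _ _ _ _ _ _ r r₁) r₂, ?_,
        h₂, q₂⟩
      · simp [hvj, hN j σ' hfr hI]
        omega
      · rw [hcost]
        have : (m + 1) * (B₁ + N.cost + 10) = m * (B₁ + N.cost + 10) + (B₁ + N.cost + 10) := by ring
        omega
  have h0' : (0 : ℕ) < 2 ^ w := by positivity
  have h0'' : (0 : ℕ) < 2 ^ b := by positivity
  have r₀ : Run w (.assign v (.const 0) (.const 0)) σ 3 (σ.set v 0 0) :=
    Run.assign (w := w) v (.const 0) (.const 0) σ h0' h0'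
  obtain ⟨t, σ', r, l, h, q⟩ := main N₀ 0 (σ.set v 0 0) (by omega) (hσ.set h0'')
    (fun a _ hav => by funext i; simp [Mem.set, hav]) (by simp [Mem.set]) h0
  have r₂ := Run.seq _ _ _ _ _ _ _ r₀ r
  exact ⟨_, σ', r₂, by omega, h, fun a ha => r₂.frame ha, q⟩

end Tri

theorem Mem.set_ne (σ : Mem) {a b : ℕ} (i v : ℕ) (h : b ≠ a) : σ.set a i v b = σ b := by
  funext j
  simp [Mem.set, h]

theorem Mem.set_same (σ : Mem) (a i v : ℕ) : σ.set a i v a = Function.update (σ a) i v := by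
  funext j
  simp [Mem.set, Function.update_apply]

theorem Mem.set_apply (σ : Mem) (a i v b j : ℕ) :
    σ.set a i v b j = if b = a ∧ j = i then v else σ b j := rfl

end RAM


/-! ### Symbolic execution, sparse sets and coded permutations -/

namespace RAM

theorem Cmd.exec_frame (c : Cmd) {a : ℕ} : ∀ {σ : Mem}, a ∉ c.mods → c.exec σ a = σ a := by
  induction c with
  | skip => exact fun _ => rfl
  | assign a' i e =>
    intro σ ha
    simp only [mods, List.mem_singleton] at ha
    exact σ.set_ne _ _ ha
  | seq c₁ c₂ h₁ h₂ =>
    intro σ ha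
    simp only [mods, List.mem_append, not_or] at ha
    exact (h₂ ha.2).trans (h₁ ha.1)
  | ite e c₁ c₂ h₁ h₂ =>
    intro σ ha
    simp only [mods, List.mem_append, not_or] at ha
    unfold exec
    split
    · exact h₁ ha.1
    · exact h₂ ha.2
  | loop => exact fun _ => rfl

section simpLemmas

variable (σ : Mem) (a : ℕ) (i e : Expr) (c c₁ c₂ : Cmd) (l : List Cmd) (b : ℕ)

@[simp] theorem Cmd.exec_skip : Cmd.skip.exec σ = σ := rfl
@[simp] theorem Cmd.exec_assign : (Cmd.assign a i e).exec σ = σ.set a (i.eval σ) (e.eval σ) := rfl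
@[simp] theorem Cmd.exec_seq : (Cmd.seq c₁ c₂).exec σ = c₂.exec (c₁.exec σ) := rfl
@[simp] theorem Cmd.exec_ite :
    (Cmd.ite e c₁ c₂).exec σ = if e.eval σ ≠ 0 then c₁.exec σ else c₂.exec σ := rfl
@[simp] theorem Cmd.exec_nil : (Cmd.block []).exec σ = σ := rfl
@[simp] theorem Cmd.exec_cons : (Cmd.block (c :: l)).exec σ = (Cmd.block l).exec (c.exec σ) := rfl
@[simp] theorem Cmd.sound_skip : Cmd.skip.Sound b σ := trivial
@[simp] theorem Cmd.sound_assign :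
    (Cmd.assign a i e).Sound b σ ↔ if e.deg = 1 then True else e.eval σ < 2 ^ b := Iff.rfl
@[simp] theorem Cmd.sound_seq :
    (Cmd.seq c₁ c₂).Sound b σ ↔ c₁.Sound b σ ∧ c₂.Sound b (c₁.exec σ) := Iff.rfl
@[simp] theorem Cmd.sound_ite : (Cmd.ite e c₁ c₂).Sound b σ ↔
    if e.eval σ ≠ 0 then c₁.Sound b σ else c₂.Sound b σ := Iff.rfl
@[simp] theorem Cmd.sound_nil : (Cmd.block []).Sound b σ := trivial
@[simp] theorem Cmd.sound_cons :
    (Cmd.block (c :: l)).Sound b σ ↔ c.Sound b σ ∧ (Cmd.block l).Sound b (c.exec σ) := Iff.rfl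

variable (e₁ e₂ : Expr)
@[simp] theorem Expr.deg_const (c : ℕ) : (Expr.const c).deg = 1 := rfl
@[simp] theorem Expr.deg_cell : (Expr.cell a e).deg = 1 := rfl
@[simp] theorem Expr.deg_var : (Expr.var a).deg = 1 := rfl
@[simp] theorem Expr.deg_add : (e₁ + e₂).deg = max e₁.deg e₂.deg + 1 := rfl
@[simp] theorem Expr.deg_sub : (e₁ - e₂).deg = max e₁.deg e₂.deg := rfl
@[simp] theorem Expr.deg_mul : (e₁ * e₂).deg = e₁.deg + e₂.deg := rfl
@[simp] theorem Expr.deg_xr : (Expr.xr e₁ e₂).deg = max e₁.deg e₂.deg := rfl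
@[simp] theorem Expr.deg_lt : (Expr.lt e₁ e₂).deg = 1 := rfl

end simpLemmas

theorem exec_cons_assign {σ : Mem} {a x y : ℕ} {i e : Expr} {l : List Cmd} (hi : i.eval σ = x)
    (he : e.eval σ = y) :
    (Cmd.block (.assign a i e :: l)).exec σ = (Cmd.block l).exec (σ.set a x y) := by
  rw [← hi, ← he]
  rfl

/-! ### Sparse sets -/

/-- `elt` lists the `len` elements of `S` without repetition, and `pos` is the inverse. -/
structure SparseSet (len : ℕ) (elt pos : ℕ → ℕ) (S : ℕ → Prop) : Prop where
  mem : ∀ i < len, S (elt i) ∧ pos (elt i) = i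
  idx : ∀ v, S v → pos v < len ∧ elt (pos v) = v

namespace SparseSet

variable {len : ℕ} {elt pos elt' pos' : ℕ → ℕ} {S S' : ℕ → Prop}

theorem congr (h : SparseSet len elt pos S) (he : ∀ i < len, elt' i = elt i)
    (hp : ∀ v, S v → pos' v = pos v) (hS : ∀ v, S' v ↔ S v) : SparseSet len elt' pos' S' where
  mem i hi := by
    rw [he i hi, hS, hp _ (h.mem i hi).1]
    exact h.mem i hi
  idx v hv := by
    have := h.idx v ((hS v).1 hv)
    rw [hp v ((hS v).1 hv), he _ this.1]
    exact this

theorem elt_inj (h : SparseSet len elt pos S) {i j : ℕ} (hi : i < len) (hj : j < len)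
    (he : elt i = elt j) : i = j := by
  rw [← (h.mem i hi).2, ← (h.mem j hj).2, he]

theorem exists_iff (h : SparseSet len elt pos S) (v : ℕ) : S v ↔ ∃ i < len, elt i = v :=
  ⟨fun hv => ⟨pos v, h.idx v hv⟩, fun ⟨i, hi, e⟩ => by
    rw [← e]
    exact (h.mem i hi).1⟩

theorem len_le (h : SparseSet len elt pos S) (T : Finset ℕ) (hT : ∀ v, S v → v ∈ T) :
    len ≤ T.card := by
  rw [← Finset.card_range len]
  refine Finset.card_le_card_of_injOn elt (fun i hi => hT _ (h.mem i (by simpa using hi)).1) ?_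
  intro i hi j hj
  simp only [Finset.coe_range, Set.mem_Iio] at hi hj
  exact h.elt_inj hi hj

theorem len_eq_card (h : SparseSet len elt pos S) (T : Finset ℕ) (hT : ∀ v, S v ↔ v ∈ T) :
    len = T.card := by
  refine le_antisymm (h.len_le T fun v => (hT v).1) ?_
  rw [← Finset.card_range len]
  refine Finset.card_le_card_of_injOn pos (fun v hv => ?_) fun u hu v hv e => ?_
  · simpa using (h.idx v ((hT v).2 hv)).1
  · rw [← (h.idx u ((hT u).2 hu)).2, ← (h.idx v ((hT v).2 hv)).2, e]

theorem len_le_of_lt (h : SparseSet len elt pos S) {n : ℕ} (hn : ∀ v, S v → v < n) : len ≤ n := by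
  simpa using h.len_le (Finset.range n) (by simpa using hn)

theorem add (h : SparseSet len elt pos S) {v : ℕ} (hv : ¬ S v) :
    SparseSet (len + 1) (Function.update elt len v) (Function.update pos v len)
      (fun u => S u ∨ u = v) where
  mem i hi := by
    rcases Nat.lt_succ_iff_lt_or_eq.1 hi with hi | rfl
    · have := h.mem i hi
      rw [Function.update_of_ne hi.ne, Function.update_of_ne (show elt i ≠ v from fun e => hv (by
        rw [← e]; exact this.1))]
      exact ⟨.inl this.1, this.2⟩
    · simp
  idx u hu := by
    by_cases huv : u = v
    · simp [huv]
    · have := h.idx u (hu.resolve_right huv)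
      rw [Function.update_of_ne huv, Function.update_of_ne this.1.ne]
      exact ⟨by omega, this.2⟩

/-- The last element fills the hole left by `v`. The stale position of `v` does no harm, because
`pos` is constrained on members only. -/
theorem remove (h : SparseSet len elt pos S) {v : ℕ} (hv : S v) :
    SparseSet (len - 1) (Function.update elt (pos v) (elt (len - 1)))
      (Function.update pos (elt (len - 1)) (pos v)) (fun u => S u ∧ u ≠ v) := by
  obtain ⟨hp, he⟩ := h.idx v hv
  have hl : len - 1 < len := by omega
  constructor
  · intro i hi
    by_cases hiv : i = pos v
    · subst hiv
      rw [Function.update_self, Function.update_self]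
      refine ⟨⟨(h.mem _ hl).1, fun e => ?_⟩, rfl⟩
      have := (h.mem _ hl).2
      rw [e] at this
      omega
    · have hi' := h.mem i (by omega)
      rw [Function.update_of_ne hiv, Function.update_of_ne]
      · exact ⟨⟨hi'.1, fun e => hiv (by rw [← e, hi'.2])⟩, hi'.2⟩
      · intro e
        have := h.elt_inj (by omega) hl e
        omega
  · rintro u ⟨hu, huv⟩
    obtain ⟨hp', he'⟩ := h.idx u hu
    by_cases hul : u = elt (len - 1)
    · rw [hul, Function.update_self, Function.update_self]
      refine ⟨?_, rfl⟩
      have : pos v ≠ len - 1 := fun e => huv (by rw [hul, ← e, he])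
      omega
    · rw [Function.update_of_ne hul, Function.update_of_ne]
      · refine ⟨?_, he'⟩
        have : pos u ≠ len - 1 := fun e => hul (by rw [← e, he'])
        omega
      · exact fun e => huv (by rw [← he', ← he, e])

end SparseSet

/-- The arrays `L`, `E`, `P` hold, under the key `k`, a sparse set. -/
def Holds (σ : Mem) (L E P k : ℕ) (S : ℕ → Prop) : Prop :=
  SparseSet (σ L k) (fun i => σ E (pr k i)) (fun v => σ P (pr k v)) S

/-- Add `v` to the sparse set with key `k`. -/
def setAdd (L E P : ℕ) (k v : Expr) : Cmd := .block
  [.assign E (.pr k (.cell L k)) v, .assign P (.pr k v) (.cell L k),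
   .assign L k (.cell L k + .const 1)]

/-- Remove `v` from the sparse set with key `k`. -/
def setRemove (L E P : ℕ) (k v : Expr) : Cmd := .block
  [.assign E (.pr k (.cell P (.pr k v))) (.cell E (.pr k (.cell L k - .const 1))),
   .assign P (.pr k (.cell E (.pr k (.cell L k - .const 1)))) (.cell P (.pr k v)),
   .assign L k (.cell L k - .const 1)]

/-- The value of `e` does not depend on the arrays in `l`. -/
def Stable (σ : Mem) (l : List ℕ) (e : Expr) (v : ℕ) : Prop :=
  ∀ τ : Mem, (∀ a, a ∉ l → τ a = σ a) → e.eval τ = v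

theorem Stable.self {σ : Mem} {l : List ℕ} {e : Expr} {v : ℕ} (h : Stable σ l e v) :
    e.eval σ = v := h σ fun _ _ => rfl

theorem Stable.var {σ : Mem} {l : List ℕ} {a : ℕ} (h : a ∉ l) :
    Stable σ l (Expr.var a) (σ a 0) := fun τ hτ => by simp [hτ a h]

theorem Stable.const {σ : Mem} {l : List ℕ} (c : ℕ) : Stable σ l (Expr.const c) c :=
  fun _ _ => rfl

theorem Stable.cell {σ : Mem} {l : List ℕ} {a v : ℕ} {e : Expr} (h : a ∉ l)
    (he : Stable σ l e v) : Stable σ l (Expr.cell a e) (σ a v) := fun τ hτ => by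
  simp [hτ a h, he τ hτ]

theorem Stable.pr {σ : Mem} {l : List ℕ} {v₁ v₂ : ℕ} {e₁ e₂ : Expr} (h₁ : Stable σ l e₁ v₁)
    (h₂ : Stable σ l e₂ v₂) : Stable σ l (Expr.pr e₁ e₂) (pr v₁ v₂) := fun τ hτ => by
  simp [h₁ τ hτ, h₂ τ hτ]

/-- The entries of the arrays under key `k` agree. -/
def SameKey (σ' σ : Mem) (L E P k : ℕ) : Prop :=
  σ' L k = σ L k ∧ ∀ i, σ' E (pr k i) = σ E (pr k i) ∧ σ' P (pr k i) = σ P (pr k i)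

theorem Holds.congr {σ σ' : Mem} {L E P k : ℕ} {S S' : ℕ → Prop} (h : Holds σ L E P k S)
    (hk : SameKey σ' σ L E P k) (hS : ∀ v, S' v ↔ S v) : Holds σ' L E P k S' := by
  unfold Holds
  rw [hk.1]
  exact SparseSet.congr h (fun i _ => (hk.2 i).1) (fun v _ => (hk.2 v).2) hS

section

variable {σ : Mem} {L E P kv vv : ℕ} {k v : Expr} (hLE : L ≠ E) (hLP : L ≠ P) (hEP : E ≠ P)
  (hk : Stable σ [L, E, P] k kv) (hv : Stable σ [L, E, P] v vv)

include hLE hLP hk hv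

/-- The expressions for key and element are evaluated again after each write. Stability under
changes of the three arrays guarantees that they keep their values. -/
theorem exec_setAdd : (setAdd L E P k v).exec σ =
    ((σ.set E (pr kv (σ L kv)) vv).set P (pr kv vv) (σ L kv)).set L kv (σ L kv + 1) := by
  have k0 := hk.self
  have v0 := hv.self
  have k1 := hk (σ.set E (pr kv (σ L kv)) vv) (fun a ha => by
    simp only [List.mem_cons, List.not_mem_nil, or_false, not_or] at ha; exact σ.set_ne _ _ ha.2.1)
  have v1 := hv (σ.set E (pr kv (σ L kv)) vv) (fun a ha => by
    simp only [List.mem_cons, List.not_mem_nil, or_false, not_or] at ha; exact σ.set_ne _ _ ha.2.1)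
  have k2 := hk ((σ.set E (pr kv (σ L kv)) vv).set P (pr kv vv) (σ L kv)) (fun a ha => by
    simp only [List.mem_cons, List.not_mem_nil, or_false, not_or] at ha
    rw [Mem.set_ne _ _ _ ha.2.2, Mem.set_ne _ _ _ ha.2.1])
  simp only [setAdd, Cmd.exec_cons, Cmd.exec_assign, Expr.eval_pr, Expr.eval_cell, k0, v0, k1, v1,
    Mem.set_ne _ _ _ hLE, Mem.set_ne _ _ _ hLP, Cmd.exec_nil, Expr.eval_add, k2, Expr.eval_const]

include hEP in
theorem exec_setRemove : (setRemove L E P k v).exec σ =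
    ((σ.set E (pr kv (σ P (pr kv vv))) (σ E (pr kv (σ L kv - 1)))).set P
      (pr kv (σ E (pr kv (σ L kv - 1)))) (σ P (pr kv vv))).set L kv (σ L kv - 1) := by
  have k0 := hk.self
  have v0 := hv.self
  have k1 := hk (σ.set E (pr kv (σ P (pr kv vv))) (σ E (pr kv (σ L kv - 1)))) (fun a ha => by
    simp only [List.mem_cons, List.not_mem_nil, or_false, not_or] at ha; exact σ.set_ne _ _ ha.2.1)
  have v1 := hv (σ.set E (pr kv (σ P (pr kv vv))) (σ E (pr kv (σ L kv - 1)))) (fun a ha => by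
    simp only [List.mem_cons, List.not_mem_nil, or_false, not_or] at ha; exact σ.set_ne _ _ ha.2.1)
  have k2 := hk ((σ.set E (pr kv (σ P (pr kv vv))) (σ E (pr kv (σ L kv - 1)))).set P
      (pr kv (σ E (pr kv (σ L kv - 1)))) (σ P (pr kv vv))) (fun a ha => by
    simp only [List.mem_cons, List.not_mem_nil, or_false, not_or] at ha
    rw [Mem.set_ne _ _ _ ha.2.2, Mem.set_ne _ _ _ ha.2.1])
  -- Should the first write hit this cell, it writes back what the cell held before.
  have e1 : (σ.set E (pr kv (σ P (pr kv vv))) (σ E (pr kv (σ L kv - 1)))) E (pr kv (σ L kv - 1)) =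
      σ E (pr kv (σ L kv - 1)) := by
    rw [Mem.set_apply]
    split <;> rfl
  simp only [setRemove, Cmd.exec_cons, Cmd.exec_assign, Expr.eval_pr, Expr.eval_cell, k0, v0, k1,
    v1, Mem.set_ne _ _ _ hLE, Mem.set_ne _ _ _ hLP, Mem.set_ne _ _ _ hEP.symm, Cmd.exec_nil,
    Expr.eval_sub, k2, Expr.eval_const, e1]

-- All writes stay under the key `kv`, by injectivity of `pr`. This is what allows many sets to
-- share the same three arrays.
include hEP in
theorem setAdd_spec : (setAdd L E P k v).exec σ L kv = σ L kv + 1 ∧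
    (∀ i, (setAdd L E P k v).exec σ E (pr kv i) =
      Function.update (fun i => σ E (pr kv i)) (σ L kv) vv i) ∧
    (∀ S, Holds σ L E P kv S → ¬ S vv →
      Holds ((setAdd L E P k v).exec σ) L E P kv (fun u => S u ∨ u = vv)) ∧
    ∀ k' ≠ kv, SameKey ((setAdd L E P k v).exec σ) σ L E P k' := by
  rw [exec_setAdd hLE hLP hk hv]
  have hE : ∀ i, (((σ.set E (pr kv (σ L kv)) vv).set P (pr kv vv) (σ L kv)).set L kv (σ L kv + 1)) E
      (pr kv i) = Function.update (fun i => σ E (pr kv i)) (σ L kv) vv i := fun i => by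
    simp [Mem.set_apply, hLE.symm, hEP, Function.update_apply]
  refine ⟨by simp [Mem.set_apply], hE, fun S hS hn => ?_, fun k' hk' => ?_⟩
  · unfold Holds
    rw [show (((σ.set E (pr kv (σ L kv)) vv).set P (pr kv vv) (σ L kv)).set L kv (σ L kv + 1)) L kv =
      σ L kv + 1 by simp [Mem.set_apply]]
    refine SparseSet.congr (SparseSet.add hS hn) (fun i _ => hE i) (fun v _ => ?_) fun _ => Iff.rfl
    simp [Mem.set_apply, hLP.symm, hEP.symm, Function.update_apply]
  · simp [SameKey, Mem.set_apply, hk', hLE, hLP, hLE.symm, hLP.symm, hEP, hEP.symm]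

include hEP in
theorem setRemove_spec : (setRemove L E P k v).exec σ L kv = σ L kv - 1 ∧
    (∀ i, (setRemove L E P k v).exec σ E (pr kv i) =
      Function.update (fun i => σ E (pr kv i)) (σ P (pr kv vv)) (σ E (pr kv (σ L kv - 1))) i) ∧
    (∀ S, Holds σ L E P kv S → S vv →
      Holds ((setRemove L E P k v).exec σ) L E P kv (fun u => S u ∧ u ≠ vv)) ∧
    ∀ k' ≠ kv, SameKey ((setRemove L E P k v).exec σ) σ L E P k' := by
  rw [exec_setRemove hLE hLP hEP hk hv]
  generalize hσ' : ((σ.set E (pr kv (σ P (pr kv vv))) (σ E (pr kv (σ L kv - 1)))).set P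
      (pr kv (σ E (pr kv (σ L kv - 1)))) (σ P (pr kv vv))).set L kv (σ L kv - 1) = σ'
  have hL : σ' L kv = σ L kv - 1 := by simp [← hσ', Mem.set_apply]
  have hE : ∀ i, σ' E (pr kv i) = Function.update (fun i => σ E (pr kv i)) (σ P (pr kv vv))
      (σ E (pr kv (σ L kv - 1))) i := fun i => by
    simp [← hσ', Mem.set_apply, hLE.symm, hEP, Function.update_apply]
  refine ⟨hL, hE, fun S hS hn => ?_, fun k' hk' => ?_⟩
  · unfold Holds
    rw [hL]
    refine SparseSet.congr (SparseSet.remove hS hn) (fun i _ => hE i)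
      (fun v _ => ?_) (fun _ => Iff.rfl)
    simp [← hσ', Mem.set_apply, hLP.symm, hEP.symm, Function.update_apply]
  · simp [← hσ', SameKey, Mem.set_apply, hk', hLE, hLP, hLE.symm, hLP.symm, hEP, hEP.symm]

theorem sound_setAdd {b : ℕ} (hd : v.deg = 1) (h : σ L kv + 1 < 2 ^ b) :
    (setAdd L E P k v).Sound b σ := by
  have k0 := hk.self
  have v0 := hv.self
  have k1 := hk (σ.set E (pr kv (σ L kv)) vv) (fun a ha => by
    simp only [List.mem_cons, List.not_mem_nil, or_false, not_or] at ha; exact σ.set_ne _ _ ha.2.1)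
  have v1 := hv (σ.set E (pr kv (σ L kv)) vv) (fun a ha => by
    simp only [List.mem_cons, List.not_mem_nil, or_false, not_or] at ha; exact σ.set_ne _ _ ha.2.1)
  have k2 := hk ((σ.set E (pr kv (σ L kv)) vv).set P (pr kv vv) (σ L kv)) (fun a ha => by
    simp only [List.mem_cons, List.not_mem_nil, or_false, not_or] at ha
    rw [Mem.set_ne _ _ _ ha.2.2, Mem.set_ne _ _ _ ha.2.1])
  simp [setAdd, hd, k0, v0, k1, v1, k2, Mem.set_ne _ _ _ hLE, Mem.set_ne _ _ _ hLP, h]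

omit hLE hLP hk hv in
theorem sound_setRemove {b : ℕ} : (setRemove L E P k v).Sound b σ := by
  simp [setRemove]

end

/-! ### Permutations -/

/-- Array `A` holds, under the key `k`, the permutation `π` (a zero array holds the identity). -/
def Codes (σ : Mem) (A k : ℕ) (π : Equiv.Perm ℕ) : Prop := ∀ i, σ A (pr k i) ^^^ i = π i

/-- Value at `i` of the permutation in array `A` with key `k`. -/
def permAt (A : ℕ) (k i : Expr) : Expr := .xr (.cell A (.pr k i)) i

/-- Compose the permutation in array `A` with the transposition of `p` and `q`; array `B` holds the
inverse. Uses the variables `30` and `31`. -/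
def permSwap (A B : ℕ) (k p q : Expr) : Cmd := .block
  [.assign 30 (.const 0) (permAt A k p), .assign 31 (.const 0) (permAt A k q),
   .assign A (.pr k p) (.xr (.var 31) p), .assign A (.pr k q) (.xr (.var 30) q),
   .assign B (.pr k (.var 31)) (.xr p (.var 31)), .assign B (.pr k (.var 30)) (.xr q (.var 30))]

/-- Composition with a transposition on the right exchanges two images, so it changes two cells of
the permutation and two of its inverse. The case `p = q` needs no special care, since then old
values are written again. -/
theorem permSwap_spec {σ : Mem} {A B kv pv qv : ℕ} {k p q : Expr} (hAB : A ≠ B) (hA : A ≠ 30)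
    (hA' : A ≠ 31) (hB : B ≠ 30) (hB' : B ≠ 31) (hk : Stable σ [A, B, 30, 31] k kv)
    (hp : Stable σ [A, B, 30, 31] p pv) (hq : Stable σ [A, B, 30, 31] q qv)
    {π : Equiv.Perm ℕ} (h₁ : Codes σ A kv π) (h₂ : Codes σ B kv π⁻¹) :
    Codes ((permSwap A B k p q).exec σ) A kv (π * Equiv.swap pv qv) ∧
    Codes ((permSwap A B k p q).exec σ) B kv (π * Equiv.swap pv qv)⁻¹ ∧
    ∀ k' ≠ kv, ∀ i, (permSwap A B k p q).exec σ A (pr k' i) = σ A (pr k' i) ∧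
      (permSwap A B k p q).exec σ B (pr k' i) = σ B (pr k' i) := by
  have key : (permSwap A B k p q).exec σ =
      (((((σ.set 30 0 (π pv)).set 31 0 (π qv)).set A (pr kv pv) (π qv ^^^ pv)).set A (pr kv qv)
        (π pv ^^^ qv)).set B (pr kv (π qv)) (pv ^^^ π qv)).set B (pr kv (π pv)) (qv ^^^ π pv) := by
    have ev : ∀ τ : Mem, (∀ a, a ∉ [A, B, 30, 31] → τ a = σ a) →
        k.eval τ = kv ∧ p.eval τ = pv ∧ q.eval τ = qv := fun τ h => ⟨hk τ h, hp τ h, hq τ h⟩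
    have e0 := ev σ fun _ _ => rfl
    have e1 := ev (σ.set 30 0 (π pv)) (fun a ha => by
      simp only [List.mem_cons, List.not_mem_nil, or_false, not_or] at ha
      rw [Mem.set_ne _ _ _ ha.2.2.1])
    have e2 := ev ((σ.set 30 0 (π pv)).set 31 0 (π qv)) (fun a ha => by
      simp only [List.mem_cons, List.not_mem_nil, or_false, not_or] at ha
      rw [Mem.set_ne _ _ _ ha.2.2.2, Mem.set_ne _ _ _ ha.2.2.1])
    have e3 := ev (((σ.set 30 0 (π pv)).set 31 0 (π qv)).set A (pr kv pv) (π qv ^^^ pv))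
      (fun a ha => by
      simp only [List.mem_cons, List.not_mem_nil, or_false, not_or] at ha
      rw [Mem.set_ne _ _ _ ha.1, Mem.set_ne _ _ _ ha.2.2.2, Mem.set_ne _ _ _ ha.2.2.1])
    have e4 := ev ((((σ.set 30 0 (π pv)).set 31 0 (π qv)).set A (pr kv pv) (π qv ^^^ pv)).set A
      (pr kv qv) (π pv ^^^ qv)) (fun a ha => by
      simp only [List.mem_cons, List.not_mem_nil, or_false, not_or] at ha
      rw [Mem.set_ne _ _ _ ha.1, Mem.set_ne _ _ _ ha.1, Mem.set_ne _ _ _ ha.2.2.2,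
        Mem.set_ne _ _ _ ha.2.2.1])
    have e5 := ev (((((σ.set 30 0 (π pv)).set 31 0 (π qv)).set A (pr kv pv) (π qv ^^^ pv)).set A
      (pr kv qv) (π pv ^^^ qv)).set B (pr kv (π qv)) (pv ^^^ π qv)) (fun a ha => by
      simp only [List.mem_cons, List.not_mem_nil, or_false, not_or] at ha
      rw [Mem.set_ne _ _ _ ha.2.1, Mem.set_ne _ _ _ ha.1, Mem.set_ne _ _ _ ha.1,
        Mem.set_ne _ _ _ ha.2.2.2, Mem.set_ne _ _ _ ha.2.2.1])
    have h₁' : ∀ i, σ A (pr kv i) = π i ^^^ i := fun i => by rw [← h₁ i, Nat.xor_xor_cancel_right]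
    rw [permSwap, exec_cons_assign (x := 0) rfl (y := π pv) (by simp [permAt, e0, h₁ pv]),
      exec_cons_assign (x := 0) rfl (y := π qv) (by simp [permAt, e1, Mem.set_ne _ _ _ hA, h₁ qv]),
      exec_cons_assign (x := pr kv pv) (by simp [e2]) (y := π qv ^^^ pv)
        (by simp [e2, Mem.set_apply]),
      exec_cons_assign (x := pr kv qv) (by simp [e3]) (y := π pv ^^^ qv)
        (by simp [e3, Mem.set_apply, hA.symm]),
      exec_cons_assign (x := pr kv (π qv)) (by simp [e4, Mem.set_apply, hA'.symm])
        (y := pv ^^^ π qv) (by simp [e4, Mem.set_apply, hA'.symm]),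
      exec_cons_assign (x := pr kv (π pv)) (by simp [e5, Mem.set_apply, hA.symm, hB.symm])
        (y := qv ^^^ π pv) (by simp [e5, Mem.set_apply, hA.symm, hB.symm]), Cmd.exec_nil]
  rw [key]
  refine ⟨fun i => ?_, fun j => ?_, fun k' hk' i => ?_⟩
  · simp only [Mem.set_apply, hAB, hA, hA', false_and, if_false, true_and, pr_inj, Equiv.Perm.mul_apply]
    by_cases hiq : i = qv
    · subst hiq
      simp
    · by_cases hip : i = pv
      · subst hip
        simp [hiq]
      · simp [hiq, hip, Equiv.swap_apply_of_ne_of_ne, h₁ i]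
  · simp only [Mem.set_apply, hAB.symm, hB, hB', false_and, if_false, true_and, pr_inj, mul_inv_rev,
      Equiv.swap_inv, Equiv.Perm.mul_apply]
    by_cases hjp : j = π pv
    · subst hjp
      simp
    · by_cases hjq : j = π qv
      · subst hjq
        simp [(EmbeddingLike.apply_eq_iff_eq π).not.1 hjp]
      · rw [if_neg hjp, if_neg hjq, h₂ j, Equiv.swap_apply_of_ne_of_ne]
        · exact fun e => hjp (by rw [← e]; simp)
        · exact fun e => hjq (by rw [← e]; simp)
  · simp [Mem.set_apply, hk', hA, hA', hB, hB', hAB, hAB.symm]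

theorem sound_permSwap {b : ℕ} {σ : Mem} {A B : ℕ} {k p q : Expr} (hp : p.deg = 1)
    (hq : q.deg = 1) : (permSwap A B k p q).Sound b σ := by
  simp [permSwap, permAt, hp, hq]

/-- `π` lists the indices of the elements of a set (given by the first `len` values of `elt`), those
with the property `A` first. -/
structure Splits (len : ℕ) (elt : ℕ → ℕ) (c : ℕ) (π : Equiv.Perm ℕ) (A : ℕ → Prop) : Prop where
  fix : ∀ i, len ≤ i → π i = i
  le : c ≤ len
  iff : ∀ i < len, (i < c ↔ A (elt (π i)))

namespace Splits

variable {len c : ℕ} {elt elt' : ℕ → ℕ} {π : Equiv.Perm ℕ} {A A' : ℕ → Prop}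

theorem lt_iff (h : Splits len elt c π A) (i : ℕ) : π i < len ↔ i < len := by
  constructor
  · intro hi
    by_contra hl
    rw [h.fix i (by omega)] at hi
    omega
  · intro hi
    by_contra hl
    have : π (π i) = π i := h.fix _ (by omega)
    have := π.injective this
    omega

theorem inv_lt_iff (h : Splits len elt c π A) (i : ℕ) : π⁻¹ i < len ↔ i < len := by
  rw [← h.lt_iff]
  simp

theorem congr (h : Splits len elt c π A) (he : ∀ i < len, elt' i = elt i)
    (hA : ∀ i < len, (A' (elt i) ↔ A (elt i))) : Splits len elt' c π A' :=
  ⟨h.fix, h.le, fun i hi => by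
    have := (h.lt_iff i).2 hi
    rw [h.iff i hi, he _ this, hA _ this]⟩

theorem full (h : ∀ i < len, A (elt i)) : Splits len elt len 1 A :=
  ⟨fun _ _ => rfl, le_rfl, fun i hi => by simpa [hi] using h i hi⟩

theorem empty (h : ∀ i < len, ¬ A (elt i)) : Splits len elt 0 1 A :=
  ⟨fun _ _ => rfl, by omega, fun i hi => by simpa [hi] using h i hi⟩

/-- Links the counter to incidence: labels with nonzero count are those of the clusters that contain
a neighbour. -/
theorem pos_iff (h : Splits len elt c π A) : c ≠ 0 ↔ ∃ i < len, A (elt i) := by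
  constructor
  · intro hc
    have h0 : 0 < len := by have := h.le; omega
    exact ⟨π 0, (h.lt_iff 0).2 h0, (h.iff 0 h0).1 (by omega)⟩
  · rintro ⟨i, hi, hA⟩ rfl
    have := h.iff (π⁻¹ i) ((h.inv_lt_iff i).2 hi)
    simp [hA] at this

theorem add_not (h : Splits len elt c π A) (he : ∀ i < len, elt' i = elt i)
    (ha : ¬ A (elt' len)) : Splits (len + 1) elt' c π A where
  fix i hi := h.fix i (by omega)
  le := by have := h.le; omega
  iff i hi := by
    rcases Nat.lt_succ_iff_lt_or_eq.1 hi with hi | rfl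
    · rw [h.iff i hi, he _ ((h.lt_iff i).2 hi)]
    · rw [h.fix i le_rfl]
      simp [ha, h.le]

/-- The new index `len` was fixed by `π`. Exchanging it with position `c` puts it at the end of the
first part and sends the displaced element to the end of the list. -/
theorem add (h : Splits len elt c π A) (he : ∀ i < len, elt' i = elt i)
    (ha : A (elt' len)) : Splits (len + 1) elt' (c + 1) (π * Equiv.swap c len) A where
  fix i hi := by
    have := h.le
    rw [Equiv.Perm.mul_apply, Equiv.swap_apply_of_ne_of_ne (by omega) (by omega)]
    exact h.fix i (by omega)
  le := by have := h.le; omega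
  iff i hi := by
    have hc := h.le
    have hπ : π len = len := h.fix len le_rfl
    rw [Equiv.Perm.mul_apply]
    by_cases hic : i = c
    · subst hic
      rw [Equiv.swap_apply_left, hπ]
      simp [ha]
    · by_cases hil : i = len
      · subst hil
        have hlt : c < i := by omega
        rw [Equiv.swap_apply_right, he _ ((h.lt_iff c).2 hlt), ← h.iff c hlt]
        omega
      · rw [Equiv.swap_apply_of_ne_of_ne hic hil, he _ ((h.lt_iff i).2 (by omega)),
          ← h.iff i (by omega)]
        omega

/-- Deletion of the element with index `i`, which is replaced by the last one. In a first step, an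
element with the property `A` is moved to the second part. -/
theorem remove {i c' : ℕ} {π₁ : Equiv.Perm ℕ} (h : Splits len elt c π A) (hi : i < len)
    (h₁ : A (elt i) → c' = c - 1 ∧ π₁ = π * Equiv.swap (π⁻¹ i) (c - 1))
    (h₂ : ¬ A (elt i) → c' = c ∧ π₁ = π)
    (he : ∀ j < len - 1, elt' j = if j = i then elt (len - 1) else elt j) :
    Splits (len - 1) elt' c'
      (Equiv.swap i (len - 1) * (π₁ * Equiv.swap (π₁⁻¹ i) (len - 1))) A := by
  have hle := h.le
  -- In both cases index `i` ends up at a position `q` of the second part: either it was there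
  -- already, or it was exchanged with the last position `c - 1` of the first part, which then
  -- shrinks by one.
  obtain ⟨fix₁, q, hq, hql, hqc, hc', iff₁⟩ : (∀ r, len ≤ r → π₁ r = r) ∧ ∃ q, π₁ q = i ∧ q < len ∧
      c' ≤ q ∧ c' ≤ len ∧ ∀ r < len, r ≠ q → (r < c' ↔ A (elt (π₁ r))) := by
    have hq : π⁻¹ i < len := (h.inv_lt_iff i).2 hi
    by_cases hA : A (elt i)
    · obtain ⟨rfl, rfl⟩ := h₁ hA
      have hqc : π⁻¹ i < c := (h.iff _ hq).2 (by simpa using hA)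
      refine ⟨fun r hr => ?_, c - 1, by simp, by omega, le_rfl, by omega, fun r hr hrc => ?_⟩
      · rw [Equiv.Perm.mul_apply, Equiv.swap_apply_of_ne_of_ne (by omega) (by omega), h.fix r hr]
      · rw [Equiv.Perm.mul_apply]
        by_cases hrq : r = π⁻¹ i
        · rw [hrq, Equiv.swap_apply_left, ← h.iff _ (by omega)]
          omega
        · rw [Equiv.swap_apply_of_ne_of_ne hrq hrc, ← h.iff r hr]
          omega
    · obtain ⟨rfl, rfl⟩ := h₂ hA
      have := h.iff _ hq
      rw [show π₁ (π₁⁻¹ i) = i by simp] at this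
      simp only [hA, iff_false] at this
      exact ⟨h.fix, π₁⁻¹ i, by simp, hq, by omega, hle, fun r hr _ => h.iff r hr⟩
  have hq' : π₁⁻¹ i = q := by rw [← hq]; simp
  have lt₁ : ∀ r, r < len → π₁ r < len := fun r hr => by
    by_contra hl
    have := π₁.injective (fix₁ (π₁ r) (by omega))
    omega
  rw [hq']
  -- The right factor moves `i` to the last position. The left factor renames index `len - 1`, whose
  -- element now has the index `i`.
  constructor
  · intro r hr
    simp only [Equiv.Perm.mul_apply]
    by_cases hrl : r = len - 1
    · rw [hrl, Equiv.swap_apply_right, hq, Equiv.swap_apply_left]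
    · rw [Equiv.swap_apply_of_ne_of_ne (a := q) (by omega) hrl, fix₁ r (by omega),
        Equiv.swap_apply_of_ne_of_ne (by omega) hrl]
  · omega
  · intro r hr
    simp only [Equiv.Perm.mul_apply]
    obtain ⟨r', hr', hr'q, hr'c, hs⟩ : ∃ r', r' < len ∧ r' ≠ q ∧ (r < c' ↔ r' < c') ∧
        Equiv.swap q (len - 1) r = r' := by
      by_cases hrq : r = q
      · refine ⟨len - 1, by omega, by omega, by omega, by rw [hrq, Equiv.swap_apply_left]⟩
      · exact ⟨r, by omega, hrq, Iff.rfl, Equiv.swap_apply_of_ne_of_ne hrq (by omega)⟩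
    rw [hs, hr'c, iff₁ r' hr' hr'q]
    have hne : π₁ r' ≠ i := fun e => hr'q (π₁.injective (e.trans hq.symm))
    have hlt := lt₁ r' hr'
    by_cases hl : π₁ r' = len - 1
    · rw [hl, Equiv.swap_apply_right, he i (by omega), if_pos rfl]
    · rw [Equiv.swap_apply_of_ne_of_ne hne hl, he _ (by omega), if_neg hne]

end Splits

end RAM


namespace RAM

/-! ### The tables of a vertex of the solution

Arrays: `2` number of vertices, `3` adjacency matrix, `4` slots, `5` labels, `6` triples, `7` next
label, `8` next slot, `10`-`12` the solution, `13`-`15` the clusters, `16`-`18` the incident labels of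
a slot, `19` the sizes of the sets `P⁺`, `20` and `21` the permutations that sort clusters into `P⁺`
and `P⁻`, and their inverses. -/

/-- The tables for slot `s` describe, for clusters of sizes `clen` with elements `celt`, the vertices
with the property `A`. -/
def SlotOK (σ : Mem) (s : ℕ) (clen : ℕ → ℕ) (celt : ℕ → ℕ → ℕ) (A : ℕ → Prop) : Prop :=
  Holds σ 16 17 18 s (fun l => σ 19 (pr s l) ≠ 0) ∧
  ∀ l, ∃ π : Equiv.Perm ℕ, Codes σ 20 (pr s l) π ∧ Codes σ 21 (pr s l) π⁻¹ ∧
    Splits (clen l) (celt l) (σ 19 (pr s l)) π A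

/-- The tables for slot `s` agree. -/
def SameSlot (σ' σ : Mem) (s : ℕ) : Prop :=
  SameKey σ' σ 16 17 18 s ∧ ∀ l, σ' 19 (pr s l) = σ 19 (pr s l) ∧
    ∀ i, σ' 20 (pr (pr s l) i) = σ 20 (pr (pr s l) i) ∧ σ' 21 (pr (pr s l) i) = σ 21 (pr (pr s l) i)

/-- The tables differ only in slot `s`, and there only for the label `l`. -/
def OnlyAt (σ' σ : Mem) (s l : ℕ) : Prop :=
  (∀ k ≠ pr s l, σ' 19 k = σ 19 k ∧
    ∀ i, σ' 20 (pr k i) = σ 20 (pr k i) ∧ σ' 21 (pr k i) = σ 21 (pr k i)) ∧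
  ∀ s' ≠ s, SameKey σ' σ 16 17 18 s'

theorem SameSlot.trans {σ σ' σ'' : Mem} {s : ℕ} (h₁ : SameSlot σ'' σ' s) (h₂ : SameSlot σ' σ s) :
    SameSlot σ'' σ s :=
  ⟨⟨h₁.1.1.trans h₂.1.1, fun i => ⟨(h₁.1.2 i).1.trans (h₂.1.2 i).1, (h₁.1.2 i).2.trans (h₂.1.2 i).2⟩⟩,
    fun l => ⟨(h₁.2 l).1.trans (h₂.2 l).1, fun i => ⟨((h₁.2 l).2 i).1.trans ((h₂.2 l).2 i).1,
      ((h₁.2 l).2 i).2.trans ((h₂.2 l).2 i).2⟩⟩⟩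

theorem SameSlot.of_eq {σ σ' : Mem} (h : ∀ a, 16 ≤ a → a ≤ 21 → σ' a = σ a) (s : ℕ) :
    SameSlot σ' σ s := by
  simp [SameSlot, SameKey, h]

theorem OnlyAt.trans {σ σ' σ'' : Mem} {s l : ℕ} (h₁ : OnlyAt σ'' σ' s l) (h₂ : OnlyAt σ' σ s l) :
    OnlyAt σ'' σ s l :=
  ⟨fun k hk => ⟨(h₁.1 k hk).1.trans (h₂.1 k hk).1, fun i =>
    ⟨((h₁.1 k hk).2 i).1.trans ((h₂.1 k hk).2 i).1, ((h₁.1 k hk).2 i).2.trans ((h₂.1 k hk).2 i).2⟩⟩,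
   fun s' hs' => ⟨(h₁.2 s' hs').1.trans (h₂.2 s' hs').1, fun i =>
    ⟨((h₁.2 s' hs').2 i).1.trans ((h₂.2 s' hs').2 i).1,
      ((h₁.2 s' hs').2 i).2.trans ((h₂.2 s' hs').2 i).2⟩⟩⟩

theorem OnlyAt.of_eq {σ σ' : Mem} (h : ∀ a, 16 ≤ a → a ≤ 21 → σ' a = σ a) (s l : ℕ) :
    OnlyAt σ' σ s l := by
  simp [OnlyAt, SameKey, h]

theorem OnlyAt.sameSlot {σ σ' : Mem} {s l s' : ℕ} (h : OnlyAt σ' σ s l) (hs : s' ≠ s) :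
    SameSlot σ' σ s' :=
  ⟨h.2 s' hs, fun l' => h.1 (pr s' l') (by simp [hs])⟩

theorem Codes.congr {σ σ' : Mem} {A k : ℕ} {π : Equiv.Perm ℕ} (h : Codes σ A k π)
    (he : ∀ i, σ' A (pr k i) = σ A (pr k i)) : Codes σ' A k π := fun i => by rw [he, h i]

theorem SlotOK.congr {σ σ' : Mem} {s : ℕ} {clen clen' : ℕ → ℕ} {celt celt' : ℕ → ℕ → ℕ}
    {A A' : ℕ → Prop} (h : SlotOK σ s clen celt A) (hs : SameSlot σ' σ s)
    (hl : ∀ l, clen' l = clen l) (he : ∀ l, ∀ i < clen l, celt' l i = celt l i)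
    (hA : ∀ l, ∀ i < clen l, (A' (celt l i) ↔ A (celt l i))) : SlotOK σ' s clen' celt' A' := by
  refine ⟨h.1.congr hs.1 fun l => by rw [(hs.2 l).1], fun l => ?_⟩
  obtain ⟨π, h₁, h₂, h₃⟩ := h.2 l
  refine ⟨π, h₁.congr fun i => ((hs.2 l).2 i).1, h₂.congr fun i => ((hs.2 l).2 i).2, ?_⟩
  rw [(hs.2 l).1, hl]
  exact h₃.congr (he l) (hA l)

/-- Assembling the tables of a slot after a change for one label. -/
theorem SlotOK.of_onlyAt {σ σ' : Mem} {s L : ℕ} {clen clen' : ℕ → ℕ} {celt celt' : ℕ → ℕ → ℕ}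
    {A : ℕ → Prop} (h : SlotOK σ s clen celt A) (ho : OnlyAt σ' σ s L)
    (hl : ∀ l ≠ L, clen' l = clen l ∧ celt' l = celt l)
    (hH : Holds σ' 16 17 18 s (fun l => σ' 19 (pr s l) ≠ 0))
    (hL : ∃ π : Equiv.Perm ℕ, Codes σ' 20 (pr s L) π ∧ Codes σ' 21 (pr s L) π⁻¹ ∧
      Splits (clen' L) (celt' L) (σ' 19 (pr s L)) π A) : SlotOK σ' s clen' celt' A := by
  refine ⟨hH, fun l => ?_⟩
  by_cases hlL : l = L
  · exact hlL ▸ hL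
  · obtain ⟨π, h₁, h₂, h₃⟩ := h.2 l
    have := ho.1 (pr s l) (by simp [hlL])
    refine ⟨π, h₁.congr fun i => (this.2 i).1, h₂.congr fun i => (this.2 i).2, ?_⟩
    rw [this.1, (hl l hlL).1, (hl l hlL).2]
    exact h₃

/-- Move the vertex with index `25` of the cluster `24` from `P⁺` to `P⁻`, in slot `29`. -/
def slotDrop : Cmd := .block
  [.assign 32 (.const 0) (permAt 21 (.pr (.var 29) (.var 24)) (.var 25)),
   .assign 33 (.const 0) (.cell 19 (.pr (.var 29) (.var 24)) - .const 1),
   permSwap 20 21 (.pr (.var 29) (.var 24)) (.var 32) (.var 33),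
   .assign 19 (.pr (.var 29) (.var 24)) (.var 33),
   .ite (.var 33) .skip (setRemove 16 17 18 (.var 29) (.var 24))]

/-- The vertex is exchanged with the last one of `P⁺` and the border between the parts moves down by
one. If the count reaches zero, the label also leaves the list of incident labels. -/
theorem slotDrop_spec {σ : Mem} {π : Equiv.Perm ℕ}
    (hH : Holds σ 16 17 18 (σ 29 0) (fun l => σ 19 (pr (σ 29 0) l) ≠ 0))
    (h₁ : Codes σ 20 (pr (σ 29 0) (σ 24 0)) π) (h₂ : Codes σ 21 (pr (σ 29 0) (σ 24 0)) π⁻¹)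
    (hc : σ 19 (pr (σ 29 0) (σ 24 0)) ≠ 0) :
    Codes (slotDrop.exec σ) 20 (pr (σ 29 0) (σ 24 0))
      (π * Equiv.swap (π⁻¹ (σ 25 0)) (σ 19 (pr (σ 29 0) (σ 24 0)) - 1)) ∧
    Codes (slotDrop.exec σ) 21 (pr (σ 29 0) (σ 24 0))
      (π * Equiv.swap (π⁻¹ (σ 25 0)) (σ 19 (pr (σ 29 0) (σ 24 0)) - 1))⁻¹ ∧
    slotDrop.exec σ 19 (pr (σ 29 0) (σ 24 0)) = σ 19 (pr (σ 29 0) (σ 24 0)) - 1 ∧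
    Holds (slotDrop.exec σ) 16 17 18 (σ 29 0) (fun l => slotDrop.exec σ 19 (pr (σ 29 0) l) ≠ 0) ∧
    OnlyAt (slotDrop.exec σ) σ (σ 29 0) (σ 24 0) := by
  generalize hs : σ 29 0 = s at *
  generalize hL : σ 24 0 = L at *
  generalize hi : σ 25 0 = i at *
  generalize hc' : σ 19 (pr s L) = c at *
  set σ₁ : Mem := (σ.set 32 0 (π⁻¹ i)).set 33 0 (c - 1) with hσ₁
  have v₁ : ∀ a, a ≠ 32 → a ≠ 33 → σ₁ a = σ a := fun a h h' => by
    rw [hσ₁, Mem.set_ne _ _ _ h', Mem.set_ne _ _ _ h]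
  have a32 : σ₁ 32 0 = π⁻¹ i := by simp [hσ₁, Mem.set_apply]
  have a33 : σ₁ 33 0 = c - 1 := by simp [hσ₁, Mem.set_apply]
  have st : ∀ a, a ∉ [20, 21, 30, 31] → Stable σ₁ [20, 21, 30, 31] (.var a) (σ₁ a 0) :=
    fun a ha => Stable.var ha
  obtain ⟨p₁, p₂, p₃⟩ := permSwap_spec (A := 20) (B := 21) (σ := σ₁) (by decide) (by decide)
    (by decide) (by decide) (by decide) ((st 29 (by decide)).pr (st 24 (by decide)))
    (st 32 (by decide)) (st 33 (by decide))
    (π := π) (by rw [v₁ 29 (by decide) (by decide), v₁ 24 (by decide) (by decide), hs, hL]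
                 exact h₁.congr fun i => by rw [v₁ 20 (by decide) (by decide)])
    (by rw [v₁ 29 (by decide) (by decide), v₁ 24 (by decide) (by decide), hs, hL]
        exact h₂.congr fun i => by rw [v₁ 21 (by decide) (by decide)])
  set σ₂ := (permSwap 20 21 (.pr (.var 29) (.var 24)) (.var 32) (.var 33)).exec σ₁ with hσ₂
  rw [v₁ 29 (by decide) (by decide), v₁ 24 (by decide) (by decide), hs, hL] at p₁ p₂ p₃
  rw [a32, a33] at p₁ p₂
  have v₂ : ∀ a, a ∉ [20, 21, 30, 31, 32, 33] → σ₂ a = σ a := fun a ha => by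
    simp only [List.mem_cons, List.not_mem_nil, or_false, not_or] at ha
    rw [hσ₂, Cmd.exec_frame, v₁ a ha.2.2.2.2.1 ha.2.2.2.2.2]
    simp [permSwap, Cmd.block, Cmd.mods, ha]
  have b33 : σ₂ 33 0 = c - 1 := by rw [hσ₂, Cmd.exec_frame _ (by decide), a33]
  set σ₃ := σ₂.set 19 (pr s L) (c - 1) with hσ₃
  have ex : slotDrop.exec σ =
      if c - 1 ≠ 0 then σ₃ else (setRemove 16 17 18 (.var 29) (.var 24)).exec σ₃ := by
    rw [slotDrop, exec_cons_assign (x := 0) rfl (y := π⁻¹ i) (by simp [permAt, hs, hL, hi, h₂ i]),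
      exec_cons_assign (x := 0) rfl (y := c - 1) (by simp [Mem.set_apply, hs, hL, hc']),
      Cmd.exec_cons, ← hσ₁, ← hσ₂, exec_cons_assign (x := pr s L)
        (by simp [v₂ 29 (by decide), v₂ 24 (by decide), hs, hL]) (y := c - 1) (by simp [b33]), ← hσ₃]
    simp [hσ₃, Mem.set_apply, b33]
  have o₃ : OnlyAt σ₃ σ s L := by
    refine ⟨fun k hk => ?_, fun s' _ => ?_⟩
    · simp only [hσ₃, Mem.set_apply, hk, and_false, if_false, v₂ 19 (by decide), true_and,
        show (20 : ℕ) ≠ 19 by decide, show (21 : ℕ) ≠ 19 by decide, false_and]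
      intro i
      rw [(p₃ k hk i).1, (p₃ k hk i).2, v₁ 20 (by decide) (by decide), v₁ 21 (by decide) (by decide)]
      exact ⟨rfl, rfl⟩
    · simp [SameKey, hσ₃, Mem.set_apply, v₂]
  have c₃ : ∀ l, σ₃ 19 (pr s l) = if l = L then c - 1 else σ 19 (pr s l) := fun l => by
    simp [hσ₃, Mem.set_apply, v₂]
  have q₁ : Codes σ₃ 20 (pr s L) (π * Equiv.swap (π⁻¹ i) (c - 1)) := p₁.congr fun i => by
    simp [hσ₃, Mem.set_apply]
  have q₂ : Codes σ₃ 21 (pr s L) (π * Equiv.swap (π⁻¹ i) (c - 1))⁻¹ := p₂.congr fun i => by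
    simp [hσ₃, Mem.set_apply]
  have hH₃ : Holds σ₃ 16 17 18 s (fun l => σ 19 (pr s l) ≠ 0) :=
    hH.congr (by simp [SameKey, hσ₃, Mem.set_apply, v₂]) fun _ => Iff.rfl
  rw [ex]
  split
  · rename_i hne
    refine ⟨q₁, q₂, by simp [c₃], hH₃.congr ⟨rfl, fun _ => ⟨rfl, rfl⟩⟩ fun l => ?_, o₃⟩
    rw [c₃]
    split
    · simp [*]
    · rfl
  · rename_i hne
    obtain ⟨_, _, r₃, r₄⟩ := setRemove_spec (σ := σ₃) (L := 16) (E := 17) (P := 18) (k := .var 29)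
      (v := .var 24) (by decide) (by decide) (by decide) (Stable.var (by decide))
      (Stable.var (by decide))
    have e29 : σ₃ 29 0 = s := by simp [hσ₃, Mem.set_apply, v₂, hs]
    have e24 : σ₃ 24 0 = L := by simp [hσ₃, Mem.set_apply, v₂, hL]
    rw [e29, e24] at r₃
    rw [e29] at r₄
    have fr : ∀ a, a ∉ [16, 17, 18] →
        (setRemove 16 17 18 (.var 29) (.var 24)).exec σ₃ a = σ₃ a := fun a ha =>
      Cmd.exec_frame _ (by simpa [setRemove, Cmd.block, Cmd.mods, and_comm, and_left_comm] using ha)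
    refine ⟨q₁.congr fun i => by rw [fr 20 (by decide)], q₂.congr fun i => by rw [fr 21 (by decide)],
      by rw [fr 19 (by decide), c₃, if_pos rfl], ?_, OnlyAt.trans ⟨fun k _ => ?_, r₄⟩ o₃⟩
    · refine (r₃ _ hH₃ (by rw [hc']; exact hc)).congr ⟨rfl, fun _ => ⟨rfl, rfl⟩⟩ fun l => ?_
      rw [fr 19 (by decide), c₃]
      split
      · simp [*]
      · simp [*]
    · rw [fr 19 (by decide), fr 20 (by decide), fr 21 (by decide)]
      exact ⟨rfl, fun _ => ⟨rfl, rfl⟩⟩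

/-- Remove the vertex `22` with index `25` of the cluster `24` from the tables of the vertex with
index `27` in the solution; `26` is the index of the last vertex of the cluster. -/
def slotRemove : Cmd := .block
  [.assign 28 (.const 0) (.cell 11 (.pr (.const 0) (.var 27))),
   .assign 29 (.const 0) (.cell 4 (.var 28)),
   .ite (.cell 3 (.pr (.var 28) (.var 22))) slotDrop .skip,
   .assign 32 (.const 0) (permAt 21 (.pr (.var 29) (.var 24)) (.var 25)),
   permSwap 20 21 (.pr (.var 29) (.var 24)) (.var 32) (.var 26),
   permSwap 21 20 (.pr (.var 29) (.var 24)) (.var 25) (.var 26)]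

/-- The effect on one slot of deleting a vertex from a cluster, following `Splits.remove`. Here
`celt'` is the cluster after its last vertex has filled the hole; a neighbour is first moved from
`P⁺` to `P⁻`. -/
theorem slotRemove_spec {σ : Mem} {s L : ℕ} {clen clen' : ℕ → ℕ} {celt celt' : ℕ → ℕ → ℕ}
    {A : ℕ → Prop} (hs : σ 4 (σ 11 (pr 0 (σ 27 0))) = s) (hL : σ 24 0 = L)
    (h : SlotOK σ s clen celt A) (hi : σ 25 0 < clen L) (hj : σ 26 0 = clen L - 1)
    (hA : σ 3 (pr (σ 11 (pr 0 (σ 27 0))) (σ 22 0)) ≠ 0 ↔ A (celt L (σ 25 0)))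
    (hl : ∀ l ≠ L, clen' l = clen l ∧ celt' l = celt l) (hlen : clen' L = clen L - 1)
    (he : ∀ j < clen L - 1,
      celt' L j = if j = σ 25 0 then celt L (clen L - 1) else celt L j) :
    SlotOK (slotRemove.exec σ) s clen' celt' A ∧ OnlyAt (slotRemove.exec σ) σ s L := by
  obtain ⟨π, h₁, h₂, h₃⟩ := h.2 L
  set i := σ 25 0 with hi'
  set σ₁ := (σ.set 28 0 (σ 11 (pr 0 (σ 27 0)))).set 29 0 s with hσ₁
  have v₁ : ∀ a, a ≠ 28 → a ≠ 29 → σ₁ a = σ a := fun a h h' => by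
    rw [hσ₁, Mem.set_ne _ _ _ h', Mem.set_ne _ _ _ h]
  have a29 : σ₁ 29 0 = s := by simp [hσ₁, Mem.set_apply]
  have o₁ : OnlyAt σ₁ σ s L := OnlyAt.of_eq (fun a h h' => v₁ a (by omega) (by omega)) _ _
  have s₁ : SameSlot σ₁ σ s := SameSlot.of_eq (fun a h h' => v₁ a (by omega) (by omega)) _
  set σ₂ := (Cmd.ite (.cell 3 (.pr (.var 28) (.var 22))) slotDrop .skip).exec σ₁ with hσ₂
  have v₂ : ∀ a, a ∉ [16, 17, 18, 19, 20, 21, 28, 29, 30, 31, 32, 33] → σ₂ a = σ a := fun a ha => by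
    simp only [List.mem_cons, List.not_mem_nil, or_false, not_or] at ha
    rw [hσ₂, Cmd.exec_frame, v₁ a (by omega) (by omega)]
    simp only [slotDrop, permSwap, setRemove, Cmd.block, Cmd.mods, List.append_nil,
      List.mem_cons, List.not_mem_nil, or_false, List.nil_append, List.cons_append]
    omega
  have b29 : σ₂ 29 0 = s := by rw [hσ₂, Cmd.exec_frame _ (by decide), a29]
  have e3 : (Expr.cell 3 (.pr (.var 28) (.var 22))).eval σ₁ =
      σ 3 (pr (σ 11 (pr 0 (σ 27 0))) (σ 22 0)) := by
    simp [hσ₁, Mem.set_apply]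
  obtain ⟨π₁, c', hc', k₁, k₂, k₃, k₄, t₁, t₂⟩ : ∃ (π₁ : Equiv.Perm ℕ) (c' : ℕ),
      σ₂ 19 (pr s L) = c' ∧ Codes σ₂ 20 (pr s L) π₁ ∧ Codes σ₂ 21 (pr s L) π₁⁻¹ ∧
      Holds σ₂ 16 17 18 s (fun l => σ₂ 19 (pr s l) ≠ 0) ∧ OnlyAt σ₂ σ s L ∧
      (A (celt L i) → c' = σ 19 (pr s L) - 1 ∧
        π₁ = π * Equiv.swap (π⁻¹ i) (σ 19 (pr s L) - 1)) ∧
      (¬ A (celt L i) → c' = σ 19 (pr s L) ∧ π₁ = π) := by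
    by_cases hAi : A (celt L i)
    · have hc : σ 19 (pr s L) ≠ 0 := h₃.pos_iff.2 ⟨i, hi, hAi⟩
      have e24 : σ₁ 24 0 = L := by rw [v₁ 24 (by decide) (by decide), hL]
      have e25 : σ₁ 25 0 = i := by rw [v₁ 25 (by decide) (by decide)]
      have e19 : σ₁ 19 = σ 19 := v₁ 19 (by decide) (by decide)
      obtain ⟨d₁, d₂, d₃, d₄, d₅⟩ := slotDrop_spec (σ := σ₁) (π := π)
        (by rw [a29]; exact h.1.congr s₁.1 fun l => by rw [(s₁.2 l).1])
        (by rw [a29, e24]; exact h₁.congr fun i => ((s₁.2 L).2 i).1)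
        (by rw [a29, e24]; exact h₂.congr fun i => ((s₁.2 L).2 i).2)
        (by rw [a29, e24, e19]; exact hc)
      rw [a29, e24] at d₁ d₂ d₃ d₅
      rw [a29] at d₄
      rw [e25, e19] at d₁ d₂
      rw [e19] at d₃
      have : σ₂ = slotDrop.exec σ₁ := by rw [hσ₂, Cmd.exec_ite, e3, if_pos (hA.2 hAi)]
      rw [this]
      exact ⟨_, _, d₃, d₁, d₂, d₄, d₅.trans o₁, fun _ => ⟨rfl, rfl⟩, fun h => (h hAi).elim⟩
    · have : σ₂ = σ₁ := by rw [hσ₂, Cmd.exec_ite, e3, if_neg (by rwa [hA]), Cmd.exec_skip]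
      rw [this]
      exact ⟨π, _, (s₁.2 L).1, h₁.congr fun i => ((s₁.2 L).2 i).1,
        h₂.congr fun i => ((s₁.2 L).2 i).2, h.1.congr s₁.1 fun l => by rw [(s₁.2 l).1], o₁,
        fun h => (hAi h).elim, fun _ => ⟨rfl, rfl⟩⟩
  set σ₃ := σ₂.set 32 0 (π₁⁻¹ i) with hσ₃
  have v₃ : ∀ a, a ≠ 32 → σ₃ a = σ₂ a := fun a ha => Mem.set_ne _ _ _ ha
  have c29 : σ₃ 29 0 = s := by rw [v₃ 29 (by decide), b29]
  have c24 : σ₃ 24 0 = L := by rw [v₃ 24 (by decide), v₂ 24 (by decide), hL]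
  have c25 : σ₃ 25 0 = i := by rw [v₃ 25 (by decide), v₂ 25 (by decide)]
  have c26 : σ₃ 26 0 = clen L - 1 := by rw [v₃ 26 (by decide), v₂ 26 (by decide), hj]
  have c32 : σ₃ 32 0 = π₁⁻¹ i := by simp [hσ₃, Mem.set_apply]
  have st : ∀ a, a ∉ [20, 21, 30, 31] → Stable σ₃ [20, 21, 30, 31] (.var a) (σ₃ a 0) :=
    fun a ha => Stable.var ha
  obtain ⟨p₁, p₂, p₃⟩ := permSwap_spec (A := 20) (B := 21) (σ := σ₃) (by decide) (by decide)
    (by decide) (by decide) (by decide) ((st 29 (by decide)).pr (st 24 (by decide)))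
    (st 32 (by decide)) (st 26 (by decide)) (π := π₁)
    (by rw [c29, c24]; exact k₁.congr fun i => by rw [v₃ 20 (by decide)])
    (by rw [c29, c24]; exact k₂.congr fun i => by rw [v₃ 21 (by decide)])
  set σ₄ := (permSwap 20 21 (.pr (.var 29) (.var 24)) (.var 32) (.var 26)).exec σ₃ with hσ₄
  rw [c29, c24, c32, c26] at p₁ p₂
  rw [c29, c24] at p₃
  have v₄ : ∀ a, a ∉ [20, 21, 30, 31] → σ₄ a = σ₃ a := fun a ha => by
    simp only [List.mem_cons, List.not_mem_nil, or_false, not_or] at ha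
    exact Cmd.exec_frame _ (by simp [permSwap, Cmd.block, Cmd.mods, ha])
  have st : ∀ a, a ∉ [21, 20, 30, 31] → Stable σ₄ [21, 20, 30, 31] (.var a) (σ₄ a 0) :=
    fun a ha => Stable.var ha
  have d29 : σ₄ 29 0 = s := by rw [v₄ 29 (by decide), c29]
  have d24 : σ₄ 24 0 = L := by rw [v₄ 24 (by decide), c24]
  have d25 : σ₄ 25 0 = i := by rw [v₄ 25 (by decide), c25]
  have d26 : σ₄ 26 0 = clen L - 1 := by rw [v₄ 26 (by decide), c26]
  -- With the roles of the two arrays exchanged, the inverse is multiplied on the right, that is,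
  -- the permutation itself is multiplied on the left.
  obtain ⟨q₁, q₂, q₃⟩ := permSwap_spec (A := 21) (B := 20) (σ := σ₄) (by decide) (by decide)
    (by decide) (by decide) (by decide) ((st 29 (by decide)).pr (st 24 (by decide)))
    (st 25 (by decide)) (st 26 (by decide)) (π := (π₁ * Equiv.swap (π₁⁻¹ i) (clen L - 1))⁻¹)
    (by rw [d29, d24]; exact p₂) (by rw [d29, d24, inv_inv]; exact p₁)
  set σ₅ := (permSwap 21 20 (.pr (.var 29) (.var 24)) (.var 25) (.var 26)).exec σ₄ with hσ₅
  rw [d29, d24, d25, d26] at q₁ q₂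
  rw [d29, d24] at q₃
  have v₅ : ∀ a, a ∉ [20, 21, 30, 31] → σ₅ a = σ₄ a := fun a ha => by
    simp only [List.mem_cons, List.not_mem_nil, or_false, not_or] at ha
    exact Cmd.exec_frame _ (by simp [permSwap, Cmd.block, Cmd.mods, ha])
  have ex : slotRemove.exec σ = σ₅ := by
    rw [slotRemove, exec_cons_assign (x := 0) rfl (y := σ 11 (pr 0 (σ 27 0))) (by simp),
      exec_cons_assign (x := 0) rfl (y := s) (by simp [Mem.set_apply, hs]), Cmd.exec_cons, ← hσ₁, ← hσ₂,
      exec_cons_assign (x := 0) rfl (y := π₁⁻¹ i) (by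
        simp [permAt, b29, v₂ 24 (by decide), hL, v₂ 25 (by decide), ← hi', k₂ i]), Cmd.exec_cons,
      Cmd.exec_cons, Cmd.exec_nil]
  have v₅' : ∀ a, a ∉ [20, 21, 30, 31, 32] → σ₅ a = σ₂ a := fun a ha => by
    simp only [List.mem_cons, List.not_mem_nil, or_false, not_or] at ha
    rw [v₅ a (by simp; omega), v₄ a (by simp; omega), v₃ a (by omega)]
  have o₅ : OnlyAt σ₅ σ s L := by
    refine OnlyAt.trans ⟨fun k hk => ?_, fun s' _ => ?_⟩ k₄
    · rw [v₅' 19 (by decide)]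
      refine ⟨rfl, fun i => ?_⟩
      rw [(q₃ k hk i).1, (q₃ k hk i).2, (p₃ k hk i).1, (p₃ k hk i).2, v₃ 20 (by decide),
        v₃ 21 (by decide)]
      exact ⟨rfl, rfl⟩
    · simp [SameKey, v₅']
  rw [ex]
  refine ⟨h.of_onlyAt o₅ hl (k₃.congr (by simp [SameKey, v₅']) fun l => by
    rw [v₅' 19 (by decide)]) ⟨Equiv.swap i (clen L - 1) *
      (π₁ * Equiv.swap (π₁⁻¹ i) (clen L - 1)), ?_, ?_, ?_⟩, o₅⟩
  · convert q₂ using 1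
    rw [mul_inv_rev, inv_inv, Equiv.swap_inv]
  · convert q₁ using 1
    rw [mul_inv_rev _ (π₁ * _), Equiv.swap_inv]
  · rw [hlen, v₅' 19 (by decide), hc']
    exact h₃.remove hi t₁ t₂ he

/-- Add the vertex `23`, with index `25` in the cluster `24`, to the tables of the vertex with index
`27` in the solution. -/
def slotInsert : Cmd := .block
  [.assign 28 (.const 0) (.cell 11 (.pr (.const 0) (.var 27))),
   .assign 29 (.const 0) (.cell 4 (.var 28)),
   .ite (.cell 3 (.pr (.var 28) (.var 23))) (.block
     [.assign 33 (.const 0) (.cell 19 (.pr (.var 29) (.var 24))),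
      .ite (.var 33) .skip (setAdd 16 17 18 (.var 29) (.var 24)),
      permSwap 20 21 (.pr (.var 29) (.var 24)) (.var 33) (.var 25),
      .assign 19 (.pr (.var 29) (.var 24)) (.var 33 + .const 1)]) .skip]

/-- A vertex appended to a cluster falls among the non-neighbours, so nothing has to change in the
tables unless it is adjacent. Then it is exchanged with position `c`, as in `Splits.add`, and the
label becomes incident if the count was zero. -/
theorem slotInsert_spec {σ : Mem} {s L : ℕ} {clen clen' : ℕ → ℕ} {celt celt' : ℕ → ℕ → ℕ}
    {A : ℕ → Prop} (hs : σ 4 (σ 11 (pr 0 (σ 27 0))) = s) (hL : σ 24 0 = L)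
    (h : SlotOK σ s clen celt A) (hi : σ 25 0 = clen L)
    (hA : σ 3 (pr (σ 11 (pr 0 (σ 27 0))) (σ 23 0)) ≠ 0 ↔ A (celt' L (clen L)))
    (hl : ∀ l ≠ L, clen' l = clen l ∧ celt' l = celt l) (hlen : clen' L = clen L + 1)
    (he : ∀ j < clen L, celt' L j = celt L j) :
    SlotOK (slotInsert.exec σ) s clen' celt' A ∧ OnlyAt (slotInsert.exec σ) σ s L := by
  obtain ⟨π, h₁, h₂, h₃⟩ := h.2 L
  set σ₁ := (σ.set 28 0 (σ 11 (pr 0 (σ 27 0)))).set 29 0 s with hσ₁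
  have v₁ : ∀ a, a ≠ 28 → a ≠ 29 → σ₁ a = σ a := fun a h h' => by
    rw [hσ₁, Mem.set_ne _ _ _ h', Mem.set_ne _ _ _ h]
  have a29 : σ₁ 29 0 = s := by simp [hσ₁, Mem.set_apply]
  have o₁ : OnlyAt σ₁ σ s L := OnlyAt.of_eq (fun a h h' => v₁ a (by omega) (by omega)) _ _
  have s₁ : SameSlot σ₁ σ s := SameSlot.of_eq (fun a h h' => v₁ a (by omega) (by omega)) _
  have e3 : (Expr.cell 3 (.pr (.var 28) (.var 23))).eval σ₁ =
      σ 3 (pr (σ 11 (pr 0 (σ 27 0))) (σ 23 0)) := by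
    simp [hσ₁, Mem.set_apply]
  have ex : slotInsert.exec σ = if σ 3 (pr (σ 11 (pr 0 (σ 27 0))) (σ 23 0)) ≠ 0 then
      (Cmd.block [.assign 33 (.const 0) (.cell 19 (.pr (.var 29) (.var 24))),
      .ite (.var 33) .skip (setAdd 16 17 18 (.var 29) (.var 24)),
      permSwap 20 21 (.pr (.var 29) (.var 24)) (.var 33) (.var 25),
      .assign 19 (.pr (.var 29) (.var 24)) (.var 33 + .const 1)]).exec σ₁ else σ₁ := by
    rw [slotInsert, exec_cons_assign (x := 0) rfl (y := σ 11 (pr 0 (σ 27 0))) (by simp),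
      exec_cons_assign (x := 0) rfl (y := s) (by simp [Mem.set_apply, hs]), Cmd.exec_cons, ← hσ₁,
      Cmd.exec_nil, Cmd.exec_ite, e3, Cmd.exec_skip]
  rw [ex]
  split
  · rename_i hne
    set c := σ 19 (pr s L) with hc
    set σ₂ := σ₁.set 33 0 c with hσ₂
    have v₂ : ∀ a, a ∉ [28, 29, 33] → σ₂ a = σ a := fun a ha => by
      simp only [List.mem_cons, List.not_mem_nil, or_false, not_or] at ha
      rw [hσ₂, Mem.set_ne _ _ _ ha.2.2, v₁ a ha.1 ha.2.1]
    have b29 : σ₂ 29 0 = s := by rw [hσ₂, Mem.set_ne _ _ _ (by decide), a29]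
    have b24 : σ₂ 24 0 = L := by rw [v₂ 24 (by decide), hL]
    have b33 : σ₂ 33 0 = c := by simp [hσ₂, Mem.set_apply]
    have o₂ : OnlyAt σ₂ σ s L := OnlyAt.of_eq (fun a h h' => v₂ a (by simp; omega)) _ _
    have s₂ : SameSlot σ₂ σ s := SameSlot.of_eq (fun a h h' => v₂ a (by simp; omega)) _
    have hH₂ : Holds σ₂ 16 17 18 s (fun l => σ 19 (pr s l) ≠ 0) := h.1.congr s₂.1 fun _ => Iff.rfl
    set σ₃ := (Cmd.ite (.var 33) .skip (setAdd 16 17 18 (.var 29) (.var 24))).exec σ₂ with hσ₃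
    have v₃ : ∀ a, a ∉ [16, 17, 18] → σ₃ a = σ₂ a := fun a ha => by
      simp only [List.mem_cons, List.not_mem_nil, or_false, not_or] at ha
      exact Cmd.exec_frame _ (by simp [setAdd, Cmd.block, Cmd.mods, ha])
    obtain ⟨k₃, k₄⟩ : Holds σ₃ 16 17 18 s (fun l => l = L ∨ σ 19 (pr s l) ≠ 0) ∧
        ∀ s' ≠ s, SameKey σ₃ σ₂ 16 17 18 s' := by
      by_cases hc0 : c = 0
      · have : σ₃ = (setAdd 16 17 18 (.var 29) (.var 24)).exec σ₂ := by simp [hσ₃, b33, hc0]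
        obtain ⟨_, _, r₃, r₄⟩ := setAdd_spec (σ := σ₂) (L := 16) (E := 17) (P := 18) (k := .var 29)
          (v := .var 24) (by decide) (by decide) (by decide) (Stable.var (by decide))
          (Stable.var (by decide))
        rw [b29, b24] at r₃
        rw [b29] at r₄
        rw [this]
        refine ⟨(r₃ _ hH₂ (by rw [← hc]; simpa using hc0)).congr
          ⟨rfl, fun _ => ⟨rfl, rfl⟩⟩ fun l => or_comm, r₄⟩
      · have : σ₃ = σ₂ := by simp [hσ₃, b33, hc0]
        rw [this]
        refine ⟨hH₂.congr ⟨rfl, fun _ => ⟨rfl, rfl⟩⟩ fun l => ⟨?_, .inr⟩,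
          fun _ _ => ⟨rfl, fun _ => ⟨rfl, rfl⟩⟩⟩
        rintro (rfl | h)
        exacts [hc0, h]
    have o₃ : OnlyAt σ₃ σ₂ s L :=
      ⟨fun k _ => by simp [v₃], k₄⟩
    have c29 : σ₃ 29 0 = s := by rw [v₃ 29 (by decide), b29]
    have c24 : σ₃ 24 0 = L := by rw [v₃ 24 (by decide), b24]
    have c25 : σ₃ 25 0 = clen L := by rw [v₃ 25 (by decide), v₂ 25 (by decide), hi]
    have c33 : σ₃ 33 0 = c := by rw [v₃ 33 (by decide), b33]
    have st : ∀ a, a ∉ [20, 21, 30, 31] → Stable σ₃ [20, 21, 30, 31] (.var a) (σ₃ a 0) :=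
      fun a ha => Stable.var ha
    obtain ⟨p₁, p₂, p₃⟩ := permSwap_spec (A := 20) (B := 21) (σ := σ₃) (by decide) (by decide)
      (by decide) (by decide) (by decide) ((st 29 (by decide)).pr (st 24 (by decide)))
      (st 33 (by decide)) (st 25 (by decide)) (π := π)
      (by rw [c29, c24]; exact h₁.congr fun i => by rw [v₃ 20 (by decide), v₂ 20 (by decide)])
      (by rw [c29, c24]; exact h₂.congr fun i => by rw [v₃ 21 (by decide), v₂ 21 (by decide)])
    set σ₄ := (permSwap 20 21 (.pr (.var 29) (.var 24)) (.var 33) (.var 25)).exec σ₃ with hσ₄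
    rw [c29, c24, c33, c25] at p₁ p₂
    rw [c29, c24] at p₃
    have v₄ : ∀ a, a ∉ [20, 21, 30, 31] → σ₄ a = σ₃ a := fun a ha => by
      simp only [List.mem_cons, List.not_mem_nil, or_false, not_or] at ha
      exact Cmd.exec_frame _ (by simp [permSwap, Cmd.block, Cmd.mods, ha])
    set σ₅ := σ₄.set 19 (pr s L) (c + 1) with hσ₅
    have v₅ : ∀ a, a ≠ 19 → σ₅ a = σ₄ a := fun a ha => Mem.set_ne _ _ _ ha
    have ex : (Cmd.block [.assign 33 (.const 0) (.cell 19 (.pr (.var 29) (.var 24))),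
        .ite (.var 33) .skip (setAdd 16 17 18 (.var 29) (.var 24)),
        permSwap 20 21 (.pr (.var 29) (.var 24)) (.var 33) (.var 25),
        .assign 19 (.pr (.var 29) (.var 24)) (.var 33 + .const 1)]).exec σ₁ = σ₅ := by
      rw [exec_cons_assign (x := 0) rfl (y := c) (by
        simp [a29, v₁, hL, hc]), ← hσ₂, Cmd.exec_cons, ← hσ₃, Cmd.exec_cons, ← hσ₄,
        exec_cons_assign (x := pr s L) (by simp [v₄, c29, c24]) (y := c + 1) (by simp [v₄, c33]),
        Cmd.exec_nil]
    have c₅ : ∀ l, σ₅ 19 (pr s l) = if l = L then c + 1 else σ 19 (pr s l) := fun l => by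
      simp [hσ₅, Mem.set_apply, v₂, v₃, v₄]
    have o₅ : OnlyAt σ₅ σ s L := by
      refine OnlyAt.trans ⟨fun k hk => ?_, fun s' hs' => ?_⟩ (o₃.trans o₂)
      · simp only [hσ₅, Mem.set_apply, hk, and_false, if_false, v₄ 19 (by decide), true_and,
          show (20 : ℕ) ≠ 19 by decide, show (21 : ℕ) ≠ 19 by decide, false_and]
        exact fun i => p₃ k hk i
      · simp [SameKey, v₅, v₄]
    rw [ex]
    refine ⟨h.of_onlyAt o₅ hl (k₃.congr (by simp [SameKey, v₅, v₄]) fun l => ?_)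
      ⟨π * Equiv.swap c (clen L), p₁.congr fun i => by rw [v₅ 20 (by decide)],
        p₂.congr fun i => by rw [v₅ 21 (by decide)], ?_⟩, o₅⟩
    · rw [c₅]
      split <;> simp [*]
    · rw [c₅, if_pos rfl, hlen]
      exact h₃.add he (hA.1 hne)
  · rename_i hne
    refine ⟨h.of_onlyAt o₁ hl (h.1.congr s₁.1 fun l => by rw [(s₁.2 l).1]) ⟨π,
      h₁.congr fun i => ((s₁.2 L).2 i).1, h₂.congr fun i => ((s₁.2 L).2 i).2, ?_⟩, o₁⟩
    rw [hlen, (s₁.2 L).1]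
    exact h₃.add_not he (by rwa [← hA])

theorem sound_slotRemove {b : ℕ} {σ : Mem} : slotRemove.Sound b σ := by
  have hp : ∀ A B k a c τ, (permSwap A B k (.var a) (.var c)).Sound b τ := fun A B k a c τ =>
    sound_permSwap rfl rfl
  simp only [slotRemove, slotDrop, permAt, Cmd.sound_cons, Cmd.sound_assign, Cmd.sound_ite,
    Cmd.sound_nil, Cmd.sound_skip, Expr.deg_cell, Expr.deg_sub, Expr.deg_xr, Expr.deg_var, max_self,
    Expr.deg_const, if_true, hp, sound_setRemove, ite_self, and_self]

theorem sound_slotInsert {b : ℕ} {σ : Mem}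
    (h : σ 16 (σ 4 (σ 11 (pr 0 (σ 27 0)))) + 1 < 2 ^ b)
    (h' : σ 19 (pr (σ 4 (σ 11 (pr 0 (σ 27 0)))) (σ 24 0)) + 1 < 2 ^ b) : slotInsert.Sound b σ := by
  have hp : ∀ A B k a c τ, (permSwap A B k (.var a) (.var c)).Sound b τ := fun A B k a c τ =>
    sound_permSwap rfl rfl
  have hs : ∀ τ : Mem, τ 16 (τ 29 0) + 1 < 2 ^ b →
      (setAdd 16 17 18 (.var 29) (.var 24)).Sound b τ := fun τ e =>
    sound_setAdd (by decide) (by decide) (Stable.var (by decide)) (Stable.var (by decide)) rfl e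
  simp only [slotInsert, Cmd.sound_cons, Cmd.sound_assign, Cmd.sound_ite,
    Cmd.sound_nil, Cmd.sound_skip, Expr.deg_cell, Expr.deg_var, max_self,
    Expr.deg_const, if_true, hp, true_and, and_true, Expr.deg_add]
  split
  · refine ⟨?_, ?_⟩
    · split
      · trivial
      · exact hs _ (by simpa [Mem.set_apply] using h)
    · rw [if_neg (by decide), Expr.eval_add, Expr.eval_var, Cmd.exec_frame _ (by decide),
        Cmd.exec_frame _ (by decide)]
      simpa [Mem.set_apply] using h'
  · trivial

end RAM


/-! ### The invariant of the memory, and moving a vertex into the solution -/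

namespace RAM

namespace Splits

variable {len c : ℕ} {elt : ℕ → ℕ} {π : Equiv.Perm ℕ} {A : ℕ → Prop}

theorem forall_not (h : Splits len elt c π A) (hc : c = 0) : ∀ i < len, ¬ A (elt i) :=
  fun i hi hA => h.pos_iff.2 ⟨i, hi, hA⟩ hc

theorem forall_of_eq (h : Splits len elt c π A) (hc : c = len) : ∀ i < len, A (elt i) := by
  intro i hi
  have := (h.iff (π⁻¹ i) ((h.inv_lt_iff i).2 hi)).1 (by rw [hc, h.inv_lt_iff]; exact hi)
  simpa using this

end Splits

theorem SameKey.of_eq {σ σ' : Mem} {L E P : ℕ} (h₁ : σ' L = σ L) (h₂ : σ' E = σ E) (h₃ : σ' P = σ P)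
    (k : ℕ) : SameKey σ' σ L E P k := by
  simp [SameKey, h₁, h₂, h₃]

/-- The tables for slot `s` have never been used. -/
def Fresh (σ : Mem) (s : ℕ) : Prop :=
  σ 16 s = 0 ∧ ∀ l, σ 19 (pr s l) = 0 ∧ ∀ i, σ 20 (pr (pr s l) i) = 0 ∧ σ 21 (pr (pr s l) i) = 0

theorem Fresh.congr {σ σ' : Mem} {s : ℕ} (h : Fresh σ s) (hs : SameSlot σ' σ s) : Fresh σ' s := by
  refine ⟨by rw [hs.1.1, h.1], fun l => ⟨by rw [(hs.2 l).1, (h.2 l).1], fun i => ?_⟩⟩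
  rw [((hs.2 l).2 i).1, ((hs.2 l).2 i).2]
  exact (h.2 l).2 i

/-- The memory represents the graph `A` on the vertices below `n`; the vertices with a slot form a
cluster vertex deletion. -/
structure Core (σ : Mem) (n : ℕ) (A : SimpleGraph ℕ) : Prop where
  num : σ 2 0 = n
  adj : ∀ u v, σ 3 (pr u v) ≠ 0 ↔ A.Adj u v
  lt : ∀ u v, A.Adj u v → u < n
  slot : ∀ v, σ 4 v ≠ 0 → v < n ∧ σ 4 v < σ 8 0
  slot_inj : ∀ u v, σ 4 u ≠ 0 → σ 4 u = σ 4 v → u = v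
  slot_pos : σ 8 0 ≠ 0
  sol : Holds σ 10 11 12 0 (fun v => σ 4 v ≠ 0)
  clu : ∀ l, Holds σ 13 14 15 l (fun v => v < n ∧ σ 4 v = 0 ∧ σ 5 v = l)
  lab : ∀ v < n, σ 4 v = 0 → σ 5 v < σ 7 0
  clique : ∀ u v, u < n → v < n → σ 4 u = 0 → σ 4 v = 0 → u ≠ v → (A.Adj u v ↔ σ 5 u = σ 5 v)
  tab : ∀ x, σ 4 x ≠ 0 → SlotOK σ (σ 4 x) (σ 13) (fun l i => σ 14 (pr l i)) (A.Adj x)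
  fresh : ∀ s, σ 8 0 ≤ s → Fresh σ s

namespace Core

variable {σ : Mem} {n : ℕ} {A : SimpleGraph ℕ}

theorem clen_le (h : Core σ n A) (l : ℕ) : σ 13 l ≤ n :=
  SparseSet.len_le_of_lt (h.clu l) fun _ hv => hv.1

theorem xlen_le (h : Core σ n A) : σ 10 0 ≤ n :=
  SparseSet.len_le_of_lt h.sol fun v hv => (h.slot v hv).1

theorem lab_lt_of_clen (h : Core σ n A) {l : ℕ} (hl : σ 13 l ≠ 0) : l < σ 7 0 := by
  obtain ⟨h₁, h₂, h₃⟩ := ((h.clu l).mem 0 (by omega)).1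
  exact h₃ ▸ h.lab _ h₁ h₂

/-- A vertex of the cluster `l` by its index. -/
theorem exists_idx (h : Core σ n A) {v : ℕ} (hv : v < n) (hv' : σ 4 v = 0) :
    ∃ i < σ 13 (σ 5 v), σ 14 (pr (σ 5 v) i) = v :=
  ⟨_, (h.clu (σ 5 v)).idx v ⟨hv, hv', rfl⟩⟩

theorem not_adj_of_cnt (h : Core σ n A) {x v : ℕ} (hx : σ 4 x ≠ 0) (hv : v < n) (hv' : σ 4 v = 0)
    (hc : σ 19 (pr (σ 4 x) (σ 5 v)) = 0) : ¬ A.Adj x v := by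
  obtain ⟨π, -, -, hs⟩ := (h.tab x hx).2 (σ 5 v)
  obtain ⟨i, hi, he⟩ := h.exists_idx hv hv'
  have : ¬ A.Adj x (σ 14 (pr (σ 5 v) i)) := hs.forall_not hc i hi
  rwa [he] at this

theorem adj_of_cnt (h : Core σ n A) {x v : ℕ} (hx : σ 4 x ≠ 0) (hv : v < n) (hv' : σ 4 v = 0)
    (hc : σ 19 (pr (σ 4 x) (σ 5 v)) = σ 13 (σ 5 v)) : A.Adj x v := by
  obtain ⟨π, -, -, hs⟩ := (h.tab x hx).2 (σ 5 v)
  obtain ⟨i, hi, he⟩ := h.exists_idx hv hv'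
  have : A.Adj x (σ 14 (pr (σ 5 v) i)) := hs.forall_of_eq hc i hi
  rwa [he] at this

theorem slotNe (h : Core σ n A) {i j : ℕ} (hi : i < σ 10 0) (hj : j < σ 10 0) (hij : i ≠ j) :
    σ 4 (σ 11 (pr 0 i)) ≠ σ 4 (σ 11 (pr 0 j)) := fun e =>
  hij (h.sol.elt_inj hi hj (h.slot_inj _ _ (h.sol.mem i hi).1 e))

end Core

/-- A loop over the solution that changes the tables of every vertex of it. -/
theorem forSlots {w b B : ℕ} {body : Cmd} {σ : Mem} {clen clen' : ℕ → ℕ} {celt celt' : ℕ → ℕ → ℕ}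
    {A : ℕ → ℕ → Prop} (hm : ∀ a ∈ body.mods, 16 ≤ a ∧ a ≠ 27)
    (hn : σ 10 0 < 2 ^ b)
    (hne : ∀ i < σ 10 0, ∀ j < σ 10 0, i ≠ j → σ 4 (σ 11 (pr 0 i)) ≠ σ 4 (σ 11 (pr 0 j)))
    (h : ∀ i < σ 10 0, SlotOK σ (σ 4 (σ 11 (pr 0 i))) clen celt (A (σ 11 (pr 0 i))))
    (hb : ∀ τ, ∀ j < σ 10 0, τ 27 0 = j → (∀ a, a ∉ body.mods → a ≠ 27 → τ a = σ a) →
      SlotOK τ (σ 4 (σ 11 (pr 0 j))) clen celt (A (σ 11 (pr 0 j))) →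
      Tri w b body τ B (fun τ' => SlotOK τ' (σ 4 (σ 11 (pr 0 j))) clen' celt' (A (σ 11 (pr 0 j))) ∧
        ∀ s ≠ σ 4 (σ 11 (pr 0 j)), SameSlot τ' τ s)) :
    Tri w b (.forLoop 27 (.cell 10 (.const 0)) body) σ (9 + σ 10 0 * (B + 12)) (fun τ =>
      (∀ i < σ 10 0, SlotOK τ (σ 4 (σ 11 (pr 0 i))) clen' celt' (A (σ 11 (pr 0 i)))) ∧
      ∀ s, (∀ i < σ 10 0, σ 4 (σ 11 (pr 0 i)) ≠ s) → SameSlot τ σ s) := by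
  have set27 : ∀ (τ : Mem) i v s, SameSlot (τ.set 27 i v) τ s := fun τ i v s =>
    SameSlot.of_eq (fun a _ h' => Mem.set_ne _ _ _ (by omega)) s
  -- Slots of the vertices treated so far hold the new tables, those of the remaining vertices still
  -- the old ones, and slots outside of the solution never change.
  refine Tri.conseq (Tri.forLoop (σ 10 0) (fun j τ => (∀ i < σ 10 0, if i < j then
      SlotOK τ (σ 4 (σ 11 (pr 0 i))) clen' celt' (A (σ 11 (pr 0 i))) else
      SlotOK τ (σ 4 (σ 11 (pr 0 i))) clen celt (A (σ 11 (pr 0 i)))) ∧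
      ∀ s, (∀ i < σ 10 0, σ 4 (σ 11 (pr 0 i)) ≠ s) → SameSlot τ σ s) (B₁ := B)
    (fun hv => (hm 27 hv).2 rfl) (by decide) ?_ hn ⟨fun i hi => ?_, fun s _ => set27 _ _ _ _⟩ ?_ le_rfl)
    (le_of_eq (by simp only [Expr.cost])) ?_
  · intro j τ fr _
    simp [fr 10 (fun h => by have := (hm _ h).1; omega) (by decide)]
  · rw [if_neg (by omega)]
    exact (h i hi).congr (set27 _ _ _ _) (fun _ => rfl) (fun _ _ _ => rfl) fun _ _ _ => Iff.rfl
  · intro j hj τ _ fr hτ ⟨I₁, I₂⟩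
    have hcur := I₁ j hj
    rw [if_neg (lt_irrefl j)] at hcur
    refine (hb τ j hj hτ fr hcur).conseq le_rfl fun τ' _ _ ⟨p₁, p₂⟩ => ⟨fun i hi => ?_, fun s hs => ?_⟩
    · by_cases hij : i = j
      · subst hij
        rw [if_pos (by omega)]
        exact p₁.congr (set27 _ _ _ _) (fun _ => rfl) (fun _ _ _ => rfl) fun _ _ _ => Iff.rfl
      · have s' := (set27 τ' 0 (j + 1) _).trans (p₂ _ (hne i hi j hj hij))
        have := I₁ i hi
        by_cases hlt : i < j
        · rw [if_pos hlt] at this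
          rw [if_pos (by omega)]
          exact this.congr s' (fun _ => rfl) (fun _ _ _ => rfl) fun _ _ _ => Iff.rfl
        · rw [if_neg hlt] at this
          rw [if_neg (by omega)]
          exact this.congr s' (fun _ => rfl) (fun _ _ _ => rfl) fun _ _ _ => Iff.rfl
    · exact ((set27 τ' 0 (j + 1) s).trans (p₂ s (hs j hj).symm)).trans (I₂ s hs)
  · rintro τ _ _ ⟨I₁, I₂⟩
    refine ⟨fun i hi => ?_, I₂⟩
    have := I₁ i hi
    rwa [if_pos hi] at this

/-- Move the vertex `22` from its cluster to the solution. -/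
def moveIn : Cmd := .seq
  (.block [.assign 24 (.const 0) (.cell 5 (.var 22)),
    .assign 25 (.const 0) (.cell 15 (.pr (.var 24) (.var 22))),
    .assign 26 (.const 0) (.cell 13 (.var 24) - .const 1)])
  (.seq (.forLoop 27 (.cell 10 (.const 0)) slotRemove)
  (.block [setRemove 13 14 15 (.var 24) (.var 22),
    .assign 4 (.var 22) (.var 8),
    setAdd 10 11 12 (.const 0) (.var 22),
    .ite (.cell 13 (.var 24)) (.block [.assign 19 (.pr (.var 8) (.var 24)) (.cell 13 (.var 24)),
      setAdd 16 17 18 (.var 8) (.var 24)]) .skip,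
    .assign 8 (.const 0) (.var 8 + .const 1)]))

/-- The vertex `z` receives a slot that was never used. It is adjacent to all other vertices of its
old cluster and to nothing else outside of the solution, so identity permutations are correct for
all clusters, with count `len - 1` for the one label and zero otherwise. This costs constant time,
and a single loop over the solution deletes `z` from the other tables. -/
theorem moveIn_spec {w b n : ℕ} {σ : Mem} {A : SimpleGraph ℕ} (h : Core σ n A) (hz : σ 22 0 < n)
    (hz' : σ 4 (σ 22 0) = 0) (hn : n + 1 < 2 ^ b) (hs : σ 8 0 + 1 < 2 ^ b) :
    Tri w b moveIn σ (600 + σ 10 0 * 1600) (fun σ' => Core σ' n A ∧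
      σ' 4 = Function.update (σ 4) (σ 22 0) (σ 8 0) ∧ σ' 8 0 = σ 8 0 + 1 ∧
      σ' 10 0 = σ 10 0 + 1) := by
  set z := σ 22 0 with hzdef
  set L := σ 5 z with hLdef
  set i := σ 15 (pr L z) with hidef
  set len := σ 13 L with hlen
  set S := σ 8 0 with hS
  obtain ⟨hi, hie⟩ : i < len ∧ σ 14 (pr L i) = z := (h.clu L).idx z ⟨hz, hz', rfl⟩
  -- The clusters after the deletion of `z`, whose index is taken over by the last vertex of its
  -- cluster.
  set clen' := Function.update (σ 13) L (len - 1) with hclen'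
  set celt' : ℕ → ℕ → ℕ := fun l => if l = L then
    Function.update (fun j => σ 14 (pr L j)) i (σ 14 (pr L (len - 1))) else fun j => σ 14 (pr l j)
    with hcelt'
  set σ₁ := ((σ.set 24 0 L).set 25 0 i).set 26 0 (len - 1) with hσ₁
  have v₁ : ∀ a, a ∉ [24, 25, 26] → σ₁ a = σ a := fun a ha => by
    simp only [List.mem_cons, List.not_mem_nil, or_false, not_or] at ha
    rw [hσ₁, Mem.set_ne _ _ _ ha.2.2, Mem.set_ne _ _ _ ha.2.1, Mem.set_ne _ _ _ ha.1]
  have a24 : σ₁ 24 0 = L := by simp [hσ₁, Mem.set_apply]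
  have a25 : σ₁ 25 0 = i := by simp [hσ₁, Mem.set_apply]
  have a26 : σ₁ 26 0 = len - 1 := by simp [hσ₁, Mem.set_apply]
  have e10 : σ₁ 10 0 = σ 10 0 := by rw [v₁ 10 (by decide)]
  have e11 : σ₁ 11 = σ 11 := v₁ 11 (by decide)
  have e4 : σ₁ 4 = σ 4 := v₁ 4 (by decide)
  refine Tri.seq (B₁ := 30) (B₂ := 560 + σ 10 0 * 1600) (Q₁ := fun τ => τ = σ₁)
    (Tri.exec (by decide) (by decide) (fun _ _ => by simp) fun _ _ => ?_) ?_ (by omega)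
  · rw [exec_cons_assign (x := 0) rfl (y := L) (by simp [← hzdef, ← hLdef]),
      exec_cons_assign (x := 0) rfl (y := i) (by simp [Mem.set_apply, ← hzdef, ← hidef]),
      exec_cons_assign (x := 0) rfl (y := len - 1) (by simp [Mem.set_apply, ← hlen]), Cmd.exec_nil]
  rintro _ - - rfl
  have hsX : ∀ j < σ 10 0, σ 4 (σ 11 (pr 0 j)) ≠ 0 := fun j hj => (h.sol.mem j hj).1
  have loop := forSlots (w := w) (b := b) (B := 1400) (body := slotRemove) (σ := σ₁) (clen := σ 13)
    (clen' := clen') (celt := fun l j => σ 14 (pr l j)) (celt' := celt') (A := fun x => A.Adj x)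
    (by decide) (by rw [e10]; have := h.xlen_le; omega)
    (by rw [e10, e11, e4]; exact fun i hi j hj => h.slotNe hi hj)
    (by
      rw [e10, e11, e4]
      exact fun j hj => (h.tab _ (hsX j hj)).congr
        (SameSlot.of_eq (fun a h h' => v₁ a (by simp; omega)) _) (fun _ => rfl) (fun _ _ _ => rfl)
        fun _ _ _ => Iff.rfl)
    (by
      rw [e10, e11, e4]
      intro τ j hj hτ fr hok
      have f : ∀ a, a ∉ slotRemove.mods → a ≠ 27 → a ∉ [24, 25, 26] → τ a = σ a :=
        fun a h₁ h₂ h₃ => (fr a h₁ h₂).trans (v₁ a h₃)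
      have f11 : τ 11 = σ 11 := f 11 (by decide) (by decide) (by decide)
      have f4 : τ 4 = σ 4 := f 4 (by decide) (by decide) (by decide)
      have f3 : τ 3 = σ 3 := f 3 (by decide) (by decide) (by decide)
      have f22 : τ 22 0 = z := by rw [f 22 (by decide) (by decide) (by decide)]
      have f24 : τ 24 0 = L := by rw [fr 24 (by decide) (by decide), a24]
      have f25 : τ 25 0 = i := by rw [fr 25 (by decide) (by decide), a25]
      have f26 : τ 26 0 = len - 1 := by rw [fr 26 (by decide) (by decide), a26]
      refine Tri.exec (by decide) (by decide) (fun _ _ => sound_slotRemove) fun _ _ => ?_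
      obtain ⟨p₁, p₂⟩ := slotRemove_spec (σ := τ) (s := σ 4 (σ 11 (pr 0 j))) (L := L)
        (clen := σ 13) (clen' := clen') (celt := fun l j => σ 14 (pr l j)) (celt' := celt')
        (A := A.Adj (σ 11 (pr 0 j))) (by rw [hτ, f11, f4]) f24 hok (by rw [f25]; exact hi)
        (by rw [f26])
        (by rw [f3, f11, hτ, f22, f25, hie]; exact h.adj _ _)
        (fun l hl => ⟨by simp [hclen', hl], by simp [hcelt', hl]⟩) (by simp [hclen', ← hlen])
        (fun r _ => by simp [hcelt', f25, Function.update_apply, ← hlen])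
      exact ⟨p₁, fun s hs => p₂.sameSlot hs⟩)
  rw [e10, e11, e4] at loop
  refine Tri.seq loop (B₂ := 500) ?_ (by omega)
  rintro τ - fr ⟨q₁, q₂⟩
  have f : ∀ a, a ∉ slotRemove.mods → a ≠ 27 → a ∉ [24, 25, 26] → τ a = σ a :=
    fun a h₁ h₂ h₃ => (fr a (by
      simp only [Cmd.forLoop, Cmd.mods, List.mem_append, List.mem_singleton, not_or]
      exact ⟨h₂, h₁, h₂⟩)).trans (v₁ a h₃)
  have f22 : τ 22 0 = z := by rw [f 22 (by decide) (by decide) (by decide)]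
  have f24 : τ 24 0 = L := by rw [fr 24 (by decide), a24]
  -- The loop only touches slots in use, and these lie below `S`.
  have fr16 : ∀ s, S ≤ s → Fresh τ s := fun s hs => by
    refine (h.fresh s hs).congr ((q₂ s fun j hj e => ?_).trans
      (SameSlot.of_eq (fun a h h' => v₁ a (by simp; omega)) _))
    have := (h.slot _ (hsX j hj)).2
    omega
  -- the remaining assignments
  obtain ⟨r₁, r₂, r₃, r₄⟩ := setRemove_spec (σ := τ) (L := 13) (E := 14) (P := 15) (k := .var 24)
    (v := .var 22) (by decide) (by decide) (by decide) (Stable.var (by decide))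
    (Stable.var (by decide))
  set τ₁ := (setRemove 13 14 15 (.var 24) (.var 22)).exec τ with hτ₁
  have v₁' : ∀ a, a ∉ [13, 14, 15] → τ₁ a = τ a := fun a ha => by
    simp only [List.mem_cons, List.not_mem_nil, or_false, not_or] at ha
    exact Cmd.exec_frame _ (by simp [setRemove, Cmd.block, Cmd.mods, ha])
  rw [f24, f22] at r₂ r₃
  rw [f24] at r₁ r₄
  set τ₂ := τ₁.set 4 z S with hτ₂
  have v₂ : ∀ a, a ≠ 4 → τ₂ a = τ₁ a := fun a ha => Mem.set_ne _ _ _ ha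
  have b22 : τ₂ 22 0 = z := by rw [v₂ 22 (by decide), v₁' 22 (by decide), f22]
  have b24 : τ₂ 24 0 = L := by rw [v₂ 24 (by decide), v₁' 24 (by decide), f24]
  have b8 : τ₂ 8 0 = S := by
    rw [v₂ 8 (by decide), v₁' 8 (by decide), f 8 (by decide) (by decide) (by decide)]
  obtain ⟨s₁, s₂, s₃, s₄⟩ := setAdd_spec (σ := τ₂) (L := 10) (E := 11) (P := 12) (k := .const 0)
    (v := .var 22) (by decide) (by decide) (by decide) (Stable.const 0) (Stable.var (by decide))
  have hsound₃ : τ₂ 10 0 + 1 < 2 ^ b → (setAdd 10 11 12 (.const 0) (.var 22)).Sound b τ₂ := fun hh =>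
    sound_setAdd (by decide) (by decide) (Stable.const 0) (Stable.var (by decide)) rfl hh
  set τ₃ := (setAdd 10 11 12 (.const 0) (.var 22)).exec τ₂ with hτ₃
  have v₃ : ∀ a, a ∉ [10, 11, 12] → τ₃ a = τ₂ a := fun a ha => by
    simp only [List.mem_cons, List.not_mem_nil, or_false, not_or] at ha
    exact Cmd.exec_frame _ (by simp [setAdd, Cmd.block, Cmd.mods, ha])
  have g : ∀ a, a ∉ slotRemove.mods → a ∉ [4, 10, 11, 12, 13, 14, 15, 24, 25, 26, 27] →
      τ₃ a = σ a := fun a h₁ h₂ => by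
    simp only [List.mem_cons, List.not_mem_nil, or_false, not_or] at h₂
    rw [v₃ a (by simp [h₂]), v₂ a h₂.1, v₁' a (by simp [h₂]), f a h₁ (by simp [h₂]) (by simp [h₂])]
  have c13 : τ₃ 13 L = len - 1 := by
    rw [v₃ 13 (by decide), v₂ 13 (by decide), r₁, f 13 (by decide) (by decide) (by decide)]
  have c8 : τ₃ 8 0 = S := by rw [v₃ 8 (by decide), b8]
  have c24 : τ₃ 24 0 = L := by rw [v₃ 24 (by decide), b24]
  have same₃ : ∀ s, SameSlot τ₃ τ s := fun s => SameSlot.of_eq (fun a h h' => by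
    rw [v₃ a (by simp; omega), v₂ a (by omega), v₁' a (by simp; omega)]) s
  have c16 : τ₃ 16 S = 0 := by rw [(same₃ S).1.1]; exact (fr16 S le_rfl).1
  -- the tables of the new slot
  set τ₄ := (Cmd.ite (.cell 13 (.var 24)) (.block [.assign 19 (.pr (.var 8) (.var 24))
    (.cell 13 (.var 24)), setAdd 16 17 18 (.var 8) (.var 24)]) .skip).exec τ₃ with hτ₄
  have v₄ : ∀ a, a ∉ [16, 17, 18, 19] → τ₄ a = τ₃ a := fun a ha => by
    simp only [List.mem_cons, List.not_mem_nil, or_false, not_or] at ha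
    exact Cmd.exec_frame _ (by simp [setAdd, Cmd.block, Cmd.mods, ha])
  obtain ⟨n₁, n₂, n₃⟩ : Holds τ₄ 16 17 18 S (fun l => τ₄ 19 (pr S l) ≠ 0) ∧
      (∀ l, τ₄ 19 (pr S l) = if l = L then len - 1 else 0) ∧ OnlyAt τ₄ τ₃ S L := by
    have z19 : ∀ l, τ₃ 19 (pr S l) = 0 := fun l => by
      rw [((same₃ S).2 l).1]; exact ((fr16 S le_rfl).2 l).1
    have hemp : Holds τ₃ 16 17 18 S (fun _ => False) := by
      unfold Holds
      rw [c16]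
      exact ⟨fun i hi => by omega, fun _ h => h.elim⟩
    by_cases hl0 : len - 1 = 0
    · have : τ₄ = τ₃ := by simp [hτ₄, c24, c13, hl0]
      rw [this]
      refine ⟨hemp.congr ⟨rfl, fun _ => ⟨rfl, rfl⟩⟩ fun l => by simp [z19], fun l => ?_,
        OnlyAt.of_eq (fun _ _ _ => rfl) _ _⟩
      rw [z19, hl0, ite_self]
    · set τ' := τ₃.set 19 (pr S L) (len - 1) with hτ'
      have w' : ∀ a, a ≠ 19 → τ' a = τ₃ a := fun a ha => Mem.set_ne _ _ _ ha
      have : τ₄ = (setAdd 16 17 18 (.var 8) (.var 24)).exec τ' := by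
        rw [hτ₄, Cmd.exec_ite, if_pos (by simp [c24, c13, hl0]), exec_cons_assign (x := pr S L)
          (by simp [c8, c24]) (y := len - 1) (by simp [c24, c13]), Cmd.exec_cons, Cmd.exec_nil]
      obtain ⟨_, _, t₃, t₄⟩ := setAdd_spec (σ := τ') (L := 16) (E := 17) (P := 18) (k := .var 8)
        (v := .var 24) (by decide) (by decide) (by decide) (Stable.var (by decide))
        (Stable.var (by decide))
      rw [w' 8 (by decide), c8, w' 24 (by decide), c24] at t₃
      rw [w' 8 (by decide), c8] at t₄
      have fr' : ∀ a, a ∉ [16, 17, 18] → τ₄ a = τ' a := fun a ha => by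
        simp only [List.mem_cons, List.not_mem_nil, or_false, not_or] at ha
        rw [this]
        exact Cmd.exec_frame _ (by simp [setAdd, Cmd.block, Cmd.mods, ha])
      have c19 : ∀ l, τ₄ 19 (pr S l) = if l = L then len - 1 else 0 := fun l => by
        rw [fr' 19 (by decide), hτ']
        simp [Mem.set_apply, z19]
      refine ⟨?_, c19, ⟨fun k hk => ?_, fun s' hs' => ?_⟩⟩
      · rw [this]
        refine (t₃ (fun _ => False) (hemp.congr (by simp [SameKey, w']) fun _ => Iff.rfl)
          id).congr ⟨rfl, fun _ => ⟨rfl, rfl⟩⟩ fun l => ?_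
        rw [← this, c19]
        simp [hl0]
      · rw [fr' 19 (by decide), fr' 20 (by decide), fr' 21 (by decide)]
        simp [hτ', Mem.set_apply, hk]
      · rw [this]
        have := t₄ s' hs'
        simpa [SameKey, w'] using this
  set τ₅ := τ₄.set 8 0 (S + 1) with hτ₅
  have v₅ : ∀ a, a ≠ 8 → τ₅ a = τ₄ a := fun a ha => Mem.set_ne _ _ _ ha
  have ex : (Cmd.block [setRemove 13 14 15 (.var 24) (.var 22), .assign 4 (.var 22) (.var 8),
      setAdd 10 11 12 (.const 0) (.var 22),
      .ite (.cell 13 (.var 24)) (.block [.assign 19 (.pr (.var 8) (.var 24)) (.cell 13 (.var 24)),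
        setAdd 16 17 18 (.var 8) (.var 24)]) .skip,
      .assign 8 (.const 0) (.var 8 + .const 1)]).exec τ = τ₅ := by
    rw [Cmd.exec_cons, ← hτ₁, exec_cons_assign (x := z) (by simp [v₁', f22]) (y := S)
      (by rw [Expr.eval_var, ← b8, v₂ 8 (by decide)]), ← hτ₂, Cmd.exec_cons, ← hτ₃, Cmd.exec_cons,
      ← hτ₄, exec_cons_assign (x := 0) rfl (y := S + 1) (by simp [v₄, c8]), Cmd.exec_nil]
  have g' : ∀ a, a ∉ slotRemove.mods → a ∉ [4, 8, 10, 11, 12, 13, 14, 15, 24, 25, 26, 27] →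
      τ₅ a = σ a := fun a h₁ h₂ => by
    simp only [List.mem_cons, List.not_mem_nil, or_false, not_or] at h₂
    rw [v₅ a (by simp [h₂]), v₄ a (by
      simp only [List.mem_cons, List.not_mem_nil, or_false, not_or]
      refine ⟨?_, ?_, ?_, ?_⟩ <;> rintro rfl <;> exact h₁ (by decide)), g a h₁ (by simp [h₂])]
  have g4 : τ₅ 4 = Function.update (σ 4) z S := by
    rw [v₅ 4 (by decide), v₄ 4 (by decide), v₃ 4 (by decide), hτ₂, Mem.set_same, v₁' 4 (by decide),
      f 4 (by decide) (by decide) (by decide)]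
  have g5 : τ₅ 5 = σ 5 := g' 5 (by decide) (by decide)
  have g10 : τ₅ 10 0 = σ 10 0 + 1 := by
    rw [v₅ 10 (by decide), v₄ 10 (by decide), s₁, v₂ 10 (by decide), v₁' 10 (by decide),
      f 10 (by decide) (by decide) (by decide)]
  have g13 : ∀ l, τ₅ 13 l = clen' l := fun l => by
    rw [v₅ 13 (by decide), v₄ 13 (by decide), v₃ 13 (by decide), v₂ 13 (by decide), hclen',
      Function.update_apply]
    split
    · subst l
      rw [r₁, f 13 (by decide) (by decide) (by decide)]
    · rw [(r₄ l ‹_›).1, f 13 (by decide) (by decide) (by decide)]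
  have g14 : ∀ l j, τ₅ 14 (pr l j) = celt' l j := fun l j => by
    rw [v₅ 14 (by decide), v₄ 14 (by decide), v₃ 14 (by decide), v₂ 14 (by decide)]
    by_cases hl : l = L
    · subst l
      simp only [hcelt', if_pos]
      rw [r₂, f 13 (by decide) (by decide) (by decide), f 14 (by decide) (by decide) (by decide),
        f 15 (by decide) (by decide) (by decide)]
    · simp only [hcelt', if_neg hl]
      rw [((r₄ l hl).2 j).1, f 14 (by decide) (by decide) (by decide)]
  have same₅ : ∀ s ≠ S, SameSlot τ₅ τ s := fun s hs =>
    ((SameSlot.of_eq (fun a _ h' => v₅ a (by omega)) s).trans (n₃.sameSlot hs)).trans (same₃ s)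
  refine Tri.exec (by decide) (by decide) (fun _ _ => ?_) fun _ _ => ?_
  · simp only [Cmd.sound_cons, Cmd.sound_nil, and_true, sound_setRemove, true_and, Cmd.sound_assign,
      Expr.deg_var, if_true]
    rw [← hτ₁, show (Cmd.assign 4 (.var 22) (.var 8)).exec τ₁ = τ₂ by
      rw [hτ₂, Cmd.exec_assign]
      simp [v₁', f22, ← b8, v₂], ← hτ₃, ← hτ₄]
    refine ⟨hsound₃ ?_, ?_, ?_⟩
    · rw [v₂ 10 (by decide), v₁' 10 (by decide), f 10 (by decide) (by decide) (by decide)]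
      have := h.xlen_le
      omega
    · rw [Cmd.sound_ite]
      split
      · simp only [Cmd.sound_cons, Cmd.sound_assign, Cmd.sound_nil, and_true, Expr.deg_cell, if_true,
          true_and]
        refine sound_setAdd (by decide) (by decide) (Stable.var (by decide)) (Stable.var (by decide))
          rfl ?_
        simp only [Cmd.exec_assign, Mem.set_apply]
        simp only [show (16 : ℕ) ≠ 19 by decide, show (8 : ℕ) ≠ 19 by decide, false_and, if_false,
          c8, c16]
        omega
      · trivial
    · rw [if_neg (by decide)]
      simpa [v₄, c8] using hs
  · rw [ex]
    have hSpos : S ≠ 0 := h.slot_pos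
    have zlt : ∀ x, σ 4 x ≠ 0 → x ≠ z := fun x hx e => hx (e ▸ hz')
    have g8 : τ₅ 8 0 = S + 1 := by simp [hτ₅, Mem.set_apply]
    refine ⟨?_, g4, g8, g10⟩
    constructor
    · rw [g' 2 (by decide) (by decide), h.num]
    · rw [g' 3 (by decide) (by decide)]
      exact h.adj
    · exact h.lt
    · intro v
      rw [g4, g8, Function.update_apply]
      split
      · subst v
        exact fun _ => ⟨hz, by omega⟩
      · intro hv
        have := h.slot v hv
        exact ⟨this.1, by omega⟩
    · intro u v
      rw [g4, Function.update_apply, Function.update_apply]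
      split <;> split
      · rintro - -
        simp [*]
      · intro _ e
        have := (h.slot v (by rw [← e]; exact hSpos)).2
        omega
      · intro hu e
        have := (h.slot u hu).2
        omega
      · exact h.slot_inj u v
    · rw [g8]
      omega
    · have e : ∀ a, 10 ≤ a → a ≤ 12 → τ₂ a = σ a := fun a h h' => by
        rw [v₂ a (by omega), v₁' a (by simp; omega), f a (fun hm => ?_) (by omega) (by simp; omega)]
        have : ∀ a ∈ slotRemove.mods, 16 ≤ a := by decide
        have := this a hm
        omega
      have : Holds τ₂ 10 11 12 0 (fun v => σ 4 v ≠ 0) := h.sol.congr (SameKey.of_eq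
        (e 10 (by decide) (by decide)) (e 11 (by decide) (by decide)) (e 12 (by decide) (by decide)) 0)
        fun _ => Iff.rfl
      refine (s₃ _ this (by rw [b22]; simpa using hz')).congr (SameKey.of_eq
        ((v₅ 10 (by decide)).trans (v₄ 10 (by decide))) ((v₅ 11 (by decide)).trans (v₄ 11 (by decide)))
        ((v₅ 12 (by decide)).trans (v₄ 12 (by decide))) 0) fun v => ?_
      rw [g4, Function.update_apply, b22]
      by_cases hvz : v = z
      · simp [hvz, hSpos]
      · simp [hvz]
    · intro l
      have e : ∀ a, 13 ≤ a → a ≤ 15 → τ₅ a = τ₁ a := fun a h h' => by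
        rw [v₅ a (by omega), v₄ a (by simp; omega), v₃ a (by simp; omega), v₂ a (by omega)]
      have k₅ : SameKey τ₅ τ₁ 13 14 15 l := SameKey.of_eq (e 13 (by decide) (by decide))
        (e 14 (by decide) (by decide)) (e 15 (by decide) (by decide)) l
      have hτl : Holds τ 13 14 15 l (fun v => v < n ∧ σ 4 v = 0 ∧ σ 5 v = l) :=
        (h.clu l).congr (SameKey.of_eq (f 13 (by decide) (by decide) (by decide))
          (f 14 (by decide) (by decide) (by decide)) (f 15 (by decide) (by decide) (by decide)) l)
          fun _ => Iff.rfl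
      rw [g4, g5]
      by_cases hl : l = L
      · rw [hl] at k₅ hτl ⊢
        refine (r₃ _ hτl ⟨hz, hz', rfl⟩).congr k₅ fun v => ?_
        rw [Function.update_apply]
        by_cases hvz : v = z
        · simp [hvz, hSpos]
        · simp [hvz]
      · refine (hτl.congr (r₄ l hl) fun _ => Iff.rfl).congr k₅ fun v => ?_
        rw [Function.update_apply]
        by_cases hvz : v = z
        · simp [hvz, hSpos, Ne.symm hl, ← hLdef]
        · simp [hvz]
    · intro v hv
      rw [g4, g5, g' 7 (by decide) (by decide), Function.update_apply]
      split
      · exact fun e => (hSpos e).elim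
      · exact h.lab v hv
    · intro u v hu hv
      rw [g4, g5, Function.update_apply, Function.update_apply]
      split
      · exact fun e => (hSpos e).elim
      · split
        · exact fun _ e => (hSpos e).elim
        · exact h.clique u v hu hv
    · intro x
      rw [g4, Function.update_apply]
      split
      · intro _
        subst x
        refine ⟨n₁.congr (SameSlot.of_eq (fun a _ h' => v₅ a (by omega)) S).1 fun l => by
          rw [v₅ 19 (by decide)], fun l => ⟨1, fun j => ?_, fun j => ?_, ?_⟩⟩
        · rw [v₅ 20 (by decide), v₄ 20 (by decide), ((((same₃ S).2 l).2 j).1),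
            (((fr16 S le_rfl).2 l).2 j).1]
          simp
        · rw [v₅ 21 (by decide), v₄ 21 (by decide), ((((same₃ S).2 l).2 j).2),
            (((fr16 S le_rfl).2 l).2 j).2]
          simp
        -- What is left in the clusters was outside of the solution before and differs from `z`, so
        -- its adjacency to `z` is decided by the labels.
        · have old : ∀ j < τ₅ 13 l, (τ₅ 14 (pr l j)) < n ∧ σ 4 (τ₅ 14 (pr l j)) = 0 ∧
              σ 5 (τ₅ 14 (pr l j)) = l ∧ τ₅ 14 (pr l j) ≠ z := by
            intro j hj
            rw [g14]
            rw [g13] at hj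
            by_cases hl : l = L
            · subst l
              simp only [hclen', Function.update_self] at hj
              simp only [hcelt', if_pos, Function.update_apply]
              have key : ∀ r < len, r ≠ i → σ 14 (pr L r) < n ∧ σ 4 (σ 14 (pr L r)) = 0 ∧
                  σ 5 (σ 14 (pr L r)) = L ∧ σ 14 (pr L r) ≠ z := fun r hr hri =>
                ⟨((h.clu L).mem r hr).1.1, ((h.clu L).mem r hr).1.2.1, ((h.clu L).mem r hr).1.2.2,
                  fun e => hri ((h.clu L).elt_inj hr hi (e.trans hie.symm))⟩
              split
              · exact key _ (by omega) (by omega)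
              · exact key _ (by omega) (by omega)
            · simp only [hclen', Function.update_of_ne hl] at hj
              simp only [hcelt', if_neg hl]
              have := ((h.clu l).mem j hj).1
              exact ⟨this.1, this.2.1, this.2.2, fun e => hl (by
                have := this.2.2
                rw [← this, e])⟩
          rw [v₅ 19 (by decide), n₂]
          split
          · subst l
            have : len - 1 = τ₅ 13 L := by rw [g13]; simp [hclen']
            rw [this]
            refine Splits.full fun j hj => ?_
            obtain ⟨o₁, o₂, o₃, o₄⟩ := old j hj
            exact (h.clique _ _ hz o₁ hz' o₂ o₄.symm).2 o₃.symm
          · refine Splits.empty fun j hj => ?_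
            obtain ⟨o₁, o₂, o₃, o₄⟩ := old j hj
            rw [h.clique _ _ hz o₁ hz' o₂ o₄.symm, o₃]
            exact Ne.symm ‹_›
      · intro hx
        obtain ⟨j, hj, rfl⟩ := (h.sol.exists_iff x).1 hx
        exact (q₁ j hj).congr (same₅ _ (by have := (h.slot _ hx).2; omega)) g13
          (fun l r _ => g14 l r) fun _ _ _ => Iff.rfl
    · intro s hs'
      rw [g8] at hs'
      exact (fr16 s (by omega)).congr (same₅ s (by omega))

end RAM


/-! ### Moving a vertex out of the solution -/

namespace RAM

/-- Move the vertex `23` from the solution to the cluster it is adjacent to, or to a new one. -/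
def moveOut : Cmd := .seq
  (.block [.assign 29 (.const 0) (.cell 4 (.var 23)),
    .ite (.cell 16 (.var 29)) (.assign 24 (.const 0) (.cell 17 (.pr (.var 29) (.const 0))))
      (.block [.assign 24 (.const 0) (.var 7), .assign 7 (.const 0) (.var 7 + .const 1)]),
    setRemove 10 11 12 (.const 0) (.var 23),
    .assign 4 (.var 23) (.const 0),
    .assign 5 (.var 23) (.var 24),
    .assign 25 (.const 0) (.cell 13 (.var 24)),
    setAdd 13 14 15 (.var 24) (.var 23)])
  (.forLoop 27 (.cell 10 (.const 0)) slotInsert)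

/-- The condition `hr` says that the vertex `a` has no neighbour outside of the solution, or that it
is incident to a single cluster and adjacent to all of it. In the first case it founds a cluster
with a new label, in the second it joins the cluster. Its slot is abandoned and will not be used
again. -/
theorem moveOut_spec {w b n : ℕ} {σ : Mem} {A : SimpleGraph ℕ} (h : Core σ n A)
    (ha : σ 4 (σ 23 0) ≠ 0)
    (hr : σ 16 (σ 4 (σ 23 0)) = 0 ∨ σ 16 (σ 4 (σ 23 0)) = 1 ∧
      σ 19 (pr (σ 4 (σ 23 0)) (σ 17 (pr (σ 4 (σ 23 0)) 0))) = σ 13 (σ 17 (pr (σ 4 (σ 23 0)) 0)))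
    (hn : n + 1 < 2 ^ b) (hs : σ 7 0 + 2 < 2 ^ b) :
    Tri w b moveOut σ (600 + σ 10 0 * 600) (fun σ' => Core σ' n A ∧
      σ' 4 = Function.update (σ 4) (σ 23 0) 0 ∧ σ' 7 0 ≤ σ 7 0 + 1 ∧ σ' 10 0 ≤ σ 10 0) := by
  set a := σ 23 0 with hadef
  set s := σ 4 a with hsdef
  have han : a < n := (h.slot a ha).1
  -- the new label
  set τ₀ := (Cmd.block [.assign 29 (.const 0) (.cell 4 (.var 23)),
    .ite (.cell 16 (.var 29)) (.assign 24 (.const 0) (.cell 17 (.pr (.var 29) (.const 0))))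
      (.block [.assign 24 (.const 0) (.var 7), .assign 7 (.const 0) (.var 7 + .const 1)])]).exec σ
    with hτ₀
  have v₀ : ∀ c, c ∉ [7, 24, 29] → τ₀ c = σ c := fun c hc => by
    simp only [List.mem_cons, List.not_mem_nil, or_false, not_or] at hc
    exact Cmd.exec_frame _ (by simp [Cmd.block, Cmd.mods, hc])
  -- The label `L` is chosen so that, outside of the solution, `a` is adjacent exactly to the
  -- vertices labelled `L`. A new label qualifies when `a` has no neighbours there, since no such
  -- vertex carries it yet.
  obtain ⟨L, a24, hLlt, hLle, hLge, hadj⟩ : ∃ L, τ₀ 24 0 = L ∧ L < τ₀ 7 0 ∧ τ₀ 7 0 ≤ σ 7 0 + 1 ∧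
      σ 7 0 ≤ τ₀ 7 0 ∧ ∀ v < n, σ 4 v = 0 → (A.Adj a v ↔ σ 5 v = L) := by
    have htab := h.tab a ha
    have cnt0 : ∀ v < n, σ 4 v = 0 → (∀ i < σ 16 s, σ 17 (pr s i) ≠ σ 5 v) → ¬ A.Adj a v := by
      intro v hv hv' hi
      refine h.not_adj_of_cnt ha hv hv' ?_
      by_contra hc
      obtain ⟨i, hi', he⟩ := (SparseSet.exists_iff htab.1 (σ 5 v)).1 hc
      exact hi i hi' he
    rcases hr with hr | ⟨hr, hc⟩
    · refine ⟨σ 7 0, ?_, ?_, ?_, ?_, fun v hv hv' => ?_⟩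
      · simp [hτ₀, Mem.set_apply, ← hadef, ← hsdef, hr]
      · simp [hτ₀, Mem.set_apply, ← hadef, ← hsdef, hr]
      · simp [hτ₀, Mem.set_apply, ← hadef, ← hsdef, hr]
      · simp [hτ₀, Mem.set_apply, ← hadef, ← hsdef, hr]
      · have := h.lab v hv hv'
        simp only [cnt0 v hv hv' (fun i hi => by rw [hr] at hi; omega), false_iff]
        omega
    · refine ⟨σ 17 (pr s 0), ?_, ?_, ?_, ?_, fun v hv hv' => ?_⟩
      · simp [hτ₀, Mem.set_apply, ← hadef, ← hsdef, hr]
      · rw [show τ₀ 7 0 = σ 7 0 by simp [hτ₀, Mem.set_apply, ← hadef, ← hsdef, hr]]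
        refine h.lab_lt_of_clen ?_
        rw [← hc]
        exact (htab.1.mem 0 (by rw [hr]; exact one_pos)).1
      · simp [hτ₀, Mem.set_apply, ← hadef, ← hsdef, hr]
      · simp [hτ₀, Mem.set_apply, ← hadef, ← hsdef, hr]
      · constructor
        · intro hav
          by_contra hl
          refine cnt0 v hv hv' (fun i hi => ?_) hav
          rw [hr] at hi
          rw [show i = 0 by omega]
          exact Ne.symm hl
        · intro e
          exact h.adj_of_cnt ha hv hv' (by rw [e]; exact hc)
  set len := σ 13 L with hlen
  set clen' := Function.update (σ 13) L (len + 1) with hclen'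
  set celt' : ℕ → ℕ → ℕ := fun l => if l = L then
    Function.update (fun j => σ 14 (pr L j)) len a else fun j => σ 14 (pr l j) with hcelt'
  have a23 : τ₀ 23 0 = a := by rw [v₀ 23 (by decide)]
  obtain ⟨r₁, r₂, r₃, -⟩ := setRemove_spec (σ := τ₀) (L := 10) (E := 11) (P := 12) (k := .const 0)
    (v := .var 23) (by decide) (by decide) (by decide) (Stable.const 0) (Stable.var (by decide))
  set τ₁ := (setRemove 10 11 12 (.const 0) (.var 23)).exec τ₀ with hτ₁
  have v₁ : ∀ c, c ∉ [10, 11, 12] → τ₁ c = τ₀ c := fun c hc => by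
    simp only [List.mem_cons, List.not_mem_nil, or_false, not_or] at hc
    exact Cmd.exec_frame _ (by simp [setRemove, Cmd.block, Cmd.mods, hc])
  rw [a23] at r₃
  have hX₀ : Holds τ₀ 10 11 12 0 (fun v => σ 4 v ≠ 0) := h.sol.congr (SameKey.of_eq
    (v₀ 10 (by decide)) (v₀ 11 (by decide)) (v₀ 12 (by decide)) 0) fun _ => Iff.rfl
  have hX₁ := r₃ _ hX₀ ha
  set τ₂ := τ₁.set 4 a 0 with hτ₂
  have v₂ : ∀ c, c ≠ 4 → τ₂ c = τ₁ c := fun c hc => Mem.set_ne _ _ _ hc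
  set τ₃ := τ₂.set 5 a L with hτ₃
  have v₃ : ∀ c, c ≠ 5 → τ₃ c = τ₂ c := fun c hc => Mem.set_ne _ _ _ hc
  set τ₄ := τ₃.set 25 0 len with hτ₄
  have v₄ : ∀ c, c ≠ 25 → τ₄ c = τ₃ c := fun c hc => Mem.set_ne _ _ _ hc
  have f₄ : ∀ c, c ∉ [4, 5, 7, 10, 11, 12, 24, 25, 29] → τ₄ c = σ c := fun c hc => by
    simp only [List.mem_cons, List.not_mem_nil, or_false, not_or] at hc
    rw [v₄ c (by simp [hc]), v₃ c (by simp [hc]), v₂ c (by simp [hc]), v₁ c (by simp [hc]),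
      v₀ c (by simp [hc])]
  have c23 : τ₄ 23 0 = a := by rw [f₄ 23 (by decide)]
  have c24 : τ₄ 24 0 = L := by
    rw [v₄ 24 (by decide), v₃ 24 (by decide), v₂ 24 (by decide), v₁ 24 (by decide), a24]
  obtain ⟨s₁, s₂, s₃, s₄⟩ := setAdd_spec (σ := τ₄) (L := 13) (E := 14) (P := 15) (k := .var 24)
    (v := .var 23) (by decide) (by decide) (by decide) (Stable.var (by decide))
    (Stable.var (by decide))
  have hsound : τ₄ 13 (τ₄ 24 0) + 1 < 2 ^ b → (setAdd 13 14 15 (.var 24) (.var 23)).Sound b τ₄ :=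
    fun hh => sound_setAdd (by decide) (by decide) (Stable.var (by decide)) (Stable.var (by decide))
      rfl hh
  set τ₅ := (setAdd 13 14 15 (.var 24) (.var 23)).exec τ₄ with hτ₅
  have v₅ : ∀ c, c ∉ [13, 14, 15] → τ₅ c = τ₄ c := fun c hc => by
    simp only [List.mem_cons, List.not_mem_nil, or_false, not_or] at hc
    exact Cmd.exec_frame _ (by simp [setAdd, Cmd.block, Cmd.mods, hc])
  rw [c23, c24] at s₃
  rw [c24] at s₁ s₂ s₄
  rw [c23] at s₂
  have f₅ : ∀ c, c ∉ [4, 5, 7, 10, 11, 12, 13, 14, 15, 24, 25, 29] → τ₅ c = σ c := fun c hc => by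
    simp only [List.mem_cons, List.not_mem_nil, or_false, not_or] at hc
    rw [v₅ c (by simp [hc]), f₄ c (by simp [hc])]
  have g4 : τ₅ 4 = Function.update (σ 4) a 0 := by
    rw [v₅ 4 (by decide), v₄ 4 (by decide), v₃ 4 (by decide), hτ₂, Mem.set_same, v₁ 4 (by decide),
      v₀ 4 (by decide)]
  have g5 : τ₅ 5 = Function.update (σ 5) a L := by
    rw [v₅ 5 (by decide), v₄ 5 (by decide), hτ₃, Mem.set_same, v₂ 5 (by decide), v₁ 5 (by decide),
      v₀ 5 (by decide)]
  have g7 : τ₅ 7 = τ₀ 7 := by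
    rw [v₅ 7 (by decide), v₄ 7 (by decide), v₃ 7 (by decide), v₂ 7 (by decide), v₁ 7 (by decide)]
  have g10 : ∀ c, c ∈ [10, 11, 12] → τ₅ c = τ₁ c := fun c hc => by
    simp only [List.mem_cons, List.not_mem_nil, or_false] at hc
    rw [v₅ c (by simp; omega), v₄ c (by omega), v₃ c (by omega), v₂ c (by omega)]
  have g13 : ∀ l, τ₅ 13 l = clen' l := fun l => by
    rw [hclen', Function.update_apply]
    split
    · subst l
      rw [s₁, f₄ 13 (by decide)]
    · rw [(s₄ l ‹_›).1, f₄ 13 (by decide)]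
  have g14 : ∀ l j, τ₅ 14 (pr l j) = celt' l j := fun l j => by
    by_cases hl : l = L
    · subst l
      simp only [hcelt', if_pos]
      rw [s₂, f₄ 13 (by decide), f₄ 14 (by decide)]
    · simp only [hcelt', if_neg hl]
      rw [((s₄ l hl).2 j).1, f₄ 14 (by decide)]
  have hX₅ : Holds τ₅ 10 11 12 0 (fun v => τ₅ 4 v ≠ 0) := by
    refine hX₁.congr (SameKey.of_eq (g10 10 (by decide)) (g10 11 (by decide)) (g10 12 (by decide)) 0)
      fun v => ?_
    rw [g4, Function.update_apply]
    by_cases hva : v = a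
    · simp [hva]
    · simp [hva]
  have xle : τ₅ 10 0 ≤ σ 10 0 := by
    rw [g10 10 (by decide), r₁, v₀ 10 (by decide)]
    omega
  have s5 : ∀ x, τ₅ 4 x ≠ 0 → x ≠ a ∧ τ₅ 4 x = σ 4 x ∧ σ 4 x ≠ 0 := fun x hx => by
    rw [g4, Function.update_apply] at hx ⊢
    by_cases hxa : x = a
    · simp [hxa] at hx
    · exact ⟨hxa, if_neg hxa, by simpa [hxa] using hx⟩
  have inj5 : ∀ u v, τ₅ 4 u ≠ 0 → τ₅ 4 u = τ₅ 4 v → u = v := fun u v hu e => by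
    obtain ⟨-, e₁, h₁⟩ := s5 u hu
    obtain ⟨-, e₂, -⟩ := s5 v (by rw [← e]; exact hu)
    exact h.slot_inj u v h₁ (by rw [← e₁, ← e₂, e])
  have same5 : ∀ s, SameSlot τ₅ σ s := fun s => SameSlot.of_eq (fun c h h' => f₅ c (by simp; omega)) s
  refine Tri.seq (B₁ := 500) (B₂ := 20 + σ 10 0 * 600) (Q₁ := fun τ => τ = τ₅)
    (Tri.exec (by decide) (by decide) (fun _ _ => ?_) fun _ _ => ?_) ?_ (by omega)
  · have e₀ : (Cmd.ite (.cell 16 (.var 29)) (.assign 24 (.const 0)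
        (.cell 17 (.pr (.var 29) (.const 0))))
        (.block [.assign 24 (.const 0) (.var 7), .assign 7 (.const 0) (.var 7 + .const 1)])).exec
        ((Cmd.assign 29 (.const 0) (.cell 4 (.var 23))).exec σ) = τ₀ := rfl
    simp only [Cmd.sound_cons, Cmd.sound_nil, and_true, sound_setRemove, true_and, Cmd.sound_assign,
      Expr.deg_var, Expr.deg_cell, Expr.deg_const, if_true, e₀]
    refine ⟨?_, ?_⟩
    · rw [Cmd.sound_ite]
      split
      · simp
      · simp [Mem.set_apply]
        omega
    · rw [← hτ₁, show (Cmd.assign 4 (.var 23) (.const 0)).exec τ₁ = τ₂ by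
          simp [hτ₂, v₁, a23], show (Cmd.assign 5 (.var 23) (.var 24)).exec τ₂ = τ₃ by
          simp [hτ₃, v₂, v₁, a23, a24], show (Cmd.assign 25 (.const 0) (.cell 13 (.var 24))).exec τ₃ =
          τ₄ by simp [hτ₄, v₃, v₂, v₁, v₀, a24, hlen]]
      refine hsound ?_
      rw [f₄ 13 (by decide)]
      have := h.clen_le (τ₄ 24 0)
      omega
  · rw [Cmd.exec_cons, Cmd.exec_cons, show (Cmd.ite (.cell 16 (.var 29)) (.assign 24 (.const 0)
        (.cell 17 (.pr (.var 29) (.const 0))))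
        (.block [.assign 24 (.const 0) (.var 7), .assign 7 (.const 0) (.var 7 + .const 1)])).exec
        ((Cmd.assign 29 (.const 0) (.cell 4 (.var 23))).exec σ) = τ₀ from rfl, Cmd.exec_cons, ← hτ₁,
      exec_cons_assign (x := a) (by simp [v₁, a23]) (y := 0) rfl, ← hτ₂,
      exec_cons_assign (x := a) (by simp [v₂, v₁, a23]) (y := L) (by simp [v₂, v₁, a24]), ← hτ₃,
      exec_cons_assign (x := 0) rfl (y := len) (by simp [v₃, v₂, v₁, v₀, a24, hlen]), ← hτ₄,
      Cmd.exec_cons, ← hτ₅, Cmd.exec_nil]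
  rintro _ - - rfl
  refine Tri.conseq (forSlots (B := 500) (clen := σ 13) (clen' := clen')
    (celt := fun l j => σ 14 (pr l j)) (celt' := celt') (A := fun x => A.Adj x) (by decide)
    (by have := h.xlen_le; omega)
    (fun i hi j hj hij e => hij (hX₅.elt_inj hi hj (inj5 _ _ (hX₅.mem i hi).1 e)))
    (fun i hi => by
      obtain ⟨-, e, hx⟩ := s5 _ (hX₅.mem i hi).1
      rw [e]
      exact (h.tab _ hx).congr (same5 _) (fun _ => rfl) (fun _ _ _ => rfl) fun _ _ _ => Iff.rfl)
    (fun τ j hj hτ fr hok => ?_)) (by nlinarith) ?_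
  · have f : ∀ c, c ∉ slotInsert.mods → c ≠ 27 →
        c ∉ [4, 5, 7, 10, 11, 12, 13, 14, 15, 24, 25, 29] → τ c = σ c :=
      fun c h₁ h₂ h₃ => (fr c h₁ h₂).trans (f₅ c h₃)
    have f11 : τ 11 = τ₅ 11 := fr 11 (by decide) (by decide)
    have f4 : τ 4 = τ₅ 4 := fr 4 (by decide) (by decide)
    have f3 : τ 3 = σ 3 := f 3 (by decide) (by decide) (by decide)
    have f23 : τ 23 0 = a := by rw [f 23 (by decide) (by decide) (by decide)]
    have f24 : τ 24 0 = L := by rw [fr 24 (by decide) (by decide), v₅ 24 (by decide), c24]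
    have f25 : τ 25 0 = len := by
      rw [fr 25 (by decide) (by decide), v₅ 25 (by decide)]
      simp [hτ₄, Mem.set_apply]
    have cl : ∀ l, τ 19 (pr (τ₅ 4 (τ₅ 11 (pr 0 j))) l) ≤ σ 13 l := fun l => by
      obtain ⟨π, -, -, hsp⟩ := hok.2 l
      exact hsp.le
    refine Tri.exec (by decide) (by decide) (fun _ _ => sound_slotInsert ?_ ?_) fun _ _ => ?_
    · rw [hτ, f11, f4]
      -- Incident labels belong to nonempty clusters and hence lie below the next label, which
      -- bounds the length of their list.
      have := SparseSet.len_le_of_lt hok.1 (n := σ 7 0) fun l hl => h.lab_lt_of_clen (by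
        have := cl l
        omega)
      omega
    · rw [hτ, f11, f4, f24]
      have := cl L
      have := h.clen_le L
      omega
    · obtain ⟨p₁, p₂⟩ := slotInsert_spec (σ := τ) (s := τ₅ 4 (τ₅ 11 (pr 0 j))) (L := L)
        (clen := σ 13) (clen' := clen') (celt := fun l j => σ 14 (pr l j)) (celt' := celt')
        (A := A.Adj (τ₅ 11 (pr 0 j))) (by rw [hτ, f11, f4]) f24 hok f25
        (by
          rw [f3, f11, hτ, f23]
          simp only [hcelt', if_pos, ← hlen, Function.update_self]
          exact h.adj _ _)
        (fun l hl => ⟨by simp [hclen', hl], by simp [hcelt', hl]⟩) (by simp [hclen', ← hlen])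
        (fun r hr => by
          have : r ≠ len := by omega
          simp [hcelt', this])
      exact ⟨p₁, fun s hs => p₂.sameSlot hs⟩
  rintro τ - fr ⟨q₁, q₂⟩
  have f : ∀ c, c ∉ slotInsert.mods → c ≠ 27 → τ c = τ₅ c := fun c h₁ h₂ => fr c (by
    simp only [Cmd.forLoop, Cmd.mods, List.mem_append, List.mem_singleton, not_or]
    exact ⟨h₂, h₁, h₂⟩)
  have k4 : τ 4 = Function.update (σ 4) a 0 := by rw [f 4 (by decide) (by decide), g4]
  have k5 : τ 5 = Function.update (σ 5) a L := by rw [f 5 (by decide) (by decide), g5]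
  have k7 : τ 7 = τ₀ 7 := by rw [f 7 (by decide) (by decide), g7]
  have k8 : τ 8 = σ 8 := by rw [f 8 (by decide) (by decide), f₅ 8 (by decide)]
  have k4' : τ 4 = τ₅ 4 := f 4 (by decide) (by decide)
  refine ⟨?_, k4, by rw [k7]; exact hLle, by rw [f 10 (by decide) (by decide)]; exact xle⟩
  constructor
  · rw [f 2 (by decide) (by decide), f₅ 2 (by decide), h.num]
  · rw [f 3 (by decide) (by decide), f₅ 3 (by decide)]
    exact h.adj
  · exact h.lt
  · intro v
    rw [k4', k8]
    intro hv
    obtain ⟨-, e, h'⟩ := s5 v hv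
    rw [e]
    exact h.slot v h'
  · rw [k4']
    exact inj5
  · rw [k8]
    exact h.slot_pos
  · rw [k4']
    exact hX₅.congr (SameKey.of_eq (f 10 (by decide) (by decide)) (f 11 (by decide) (by decide))
      (f 12 (by decide) (by decide)) 0) fun _ => Iff.rfl
  · intro l
    have k : SameKey τ τ₅ 13 14 15 l := SameKey.of_eq (f 13 (by decide) (by decide))
      (f 14 (by decide) (by decide)) (f 15 (by decide) (by decide)) l
    have h₄ : Holds τ₄ 13 14 15 l (fun v => v < n ∧ σ 4 v = 0 ∧ σ 5 v = l) :=
      (h.clu l).congr (SameKey.of_eq (f₄ 13 (by decide)) (f₄ 14 (by decide)) (f₄ 15 (by decide)) l)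
        fun _ => Iff.rfl
    rw [k4, k5]
    by_cases hl : l = L
    · subst l
      refine (s₃ _ h₄ fun hh => ha hh.2.1).congr k fun v => ?_
      simp only [Function.update_apply]
      by_cases hva : v = a
      · simp [hva, han]
      · simp [hva]
    · refine (h₄.congr (s₄ l hl) fun _ => Iff.rfl).congr k fun v => ?_
      simp only [Function.update_apply]
      by_cases hva : v = a
      · simp [hva, ha, Ne.symm hl, ← hsdef]
      · simp [hva]
  · intro v hv
    simp only [k4, k5, k7, Function.update_apply]
    split
    · exact fun _ => hLlt
    · exact fun hv' => (h.lab v hv hv').trans_le hLge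
  · intro u v hu hv
    simp only [k4, k5, Function.update_apply]
    by_cases hua : u = a
    · by_cases hva : v = a
      · simp [hua, hva]
      · simp only [hua, hva, if_true, if_false]
        intro _ hv' _
        rw [hadj v hv hv', eq_comm]
    · by_cases hva : v = a
      · simp only [hua, hva, if_true, if_false]
        intro hu' _ _
        rw [A.adj_comm, hadj u hu hu']
      · simp only [hua, hva, if_false]
        exact h.clique u v hu hv
  · intro x hx
    rw [k4'] at hx ⊢
    obtain ⟨i, hi, rfl⟩ := (hX₅.exists_iff x).1 hx
    refine (q₁ i hi).congr (SameSlot.of_eq (fun _ _ _ => rfl) _) (fun l => ?_) (fun l r _ => ?_)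
      fun _ _ _ => Iff.rfl
    · rw [f 13 (by decide) (by decide), g13]
    · rw [f 14 (by decide) (by decide), g14]
  · intro s' hs'
    rw [k8] at hs'
    refine (h.fresh s' hs').congr ((q₂ s' fun i hi e => ?_).trans (same5 s'))
    obtain ⟨-, e', hx⟩ := s5 _ (hX₅.mem i hi).1
    have := (h.slot _ hx).2
    omega

end RAM


namespace RAM

/-! ### Packing induced paths -/

/-- An induced path with middle vertex `c`. -/
def IsPath3 (A : SimpleGraph ℕ) (c a b : ℕ) : Prop := A.Adj c a ∧ A.Adj c b ∧ a ≠ b ∧ ¬ A.Adj a b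

/-- Three vertices that induce a path, in some order. -/
def IsTriple (A : SimpleGraph ℕ) (x y z : ℕ) : Prop :=
  IsPath3 A x y z ∨ IsPath3 A y z x ∨ IsPath3 A z x y

theorem IsTriple.rotate {A : SimpleGraph ℕ} {x y z : ℕ} (h : IsTriple A x y z) : IsTriple A y z x := by
  rcases h with h | h | h
  · exact .inr (.inr h)
  · exact .inl h
  · exact .inr (.inl h)

theorem IsTriple.ne {A : SimpleGraph ℕ} {x y z : ℕ} (h : IsTriple A x y z) : x ≠ y ∧ y ≠ z ∧ z ≠ x := by
  rcases h with ⟨h₁, h₂, h₃, -⟩ | ⟨h₁, h₂, h₃, -⟩ | ⟨h₁, h₂, h₃, -⟩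
  · exact ⟨h₁.ne, h₃, h₂.ne'⟩
  · exact ⟨h₂.ne', h₁.ne, h₃⟩
  · exact ⟨h₃, h₂.ne', h₁.ne⟩

/-- Array `6` links the members of disjoint triples of the solution. -/
def Trip (σ : Mem) (A : SimpleGraph ℕ) : Prop :=
  ∀ x, σ 6 x ≠ 0 → ∃ y z, σ 4 x ≠ 0 ∧ σ 6 x = y + 1 ∧ σ 6 y = z + 1 ∧ σ 6 z = x + 1 ∧ IsTriple A x y z

/-- A vertex of the solution without a triple. -/
def Free (σ : Mem) (x : ℕ) : Prop := σ 4 x ≠ 0 ∧ σ 6 x = 0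

theorem Trip.slot {σ : Mem} {A : SimpleGraph ℕ} (h : Trip σ A) {x : ℕ} (hx : σ 6 x ≠ 0) : σ 4 x ≠ 0 := by
  obtain ⟨y, z, h, -⟩ := h x hx
  exact h

theorem Trip.congr {σ σ' : Mem} {A : SimpleGraph ℕ} (h : Trip σ A) (h6 : σ' 6 = σ 6)
    (h4 : ∀ x, σ 6 x ≠ 0 → σ' 4 x ≠ 0) : Trip σ' A := by
  intro x hx
  rw [h6] at hx ⊢
  obtain ⟨y, z, -, h'⟩ := h x hx
  exact ⟨y, z, h4 x hx, h'⟩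

theorem Core.congr {σ σ' : Mem} {n : ℕ} {A : SimpleGraph ℕ} (h : Core σ n A)
    (he : ∀ a, 2 ≤ a → a ≤ 21 → a ≠ 6 → σ' a = σ a) : Core σ' n A := by
  have e : ∀ a, 2 ≤ a → a ≤ 21 → a ≠ 6 → σ' a = σ a := he
  obtain ⟨h₁, h₂, h₃, h₄, h₅, h₆, h₇, h₈, h₉, h₁₀, h₁₁, h₁₂⟩ := h
  have e4 : σ' 4 = σ 4 := he 4 (by decide) (by decide) (by decide)
  have e5 : σ' 5 = σ 5 := he 5 (by decide) (by decide) (by decide)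
  have e8 : σ' 8 = σ 8 := he 8 (by decide) (by decide) (by decide)
  have e13 : σ' 13 = σ 13 := he 13 (by decide) (by decide) (by decide)
  have e14 : σ' 14 = σ 14 := he 14 (by decide) (by decide) (by decide)
  have ss : ∀ s, SameSlot σ' σ s := fun s =>
    SameSlot.of_eq (fun a h h' => he a (by omega) h' (by omega)) s
  constructor
  · rwa [he 2 (by decide) (by decide) (by decide)]
  · rwa [he 3 (by decide) (by decide) (by decide)]
  · exact h₃
  · rwa [e4, e8]
  · rwa [e4]
  · rwa [e8]
  · rw [e4]
    exact h₇.congr (SameKey.of_eq (he 10 (by decide) (by decide) (by decide))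
      (he 11 (by decide) (by decide) (by decide)) (he 12 (by decide) (by decide) (by decide)) 0)
      fun _ => Iff.rfl
  · intro l
    rw [e4, e5]
    exact (h₈ l).congr (SameKey.of_eq e13 e14 (he 15 (by decide) (by decide) (by decide)) l)
      fun _ => Iff.rfl
  · rwa [e4, e5, he 7 (by decide) (by decide) (by decide)]
  · rwa [e4, e5]
  · rw [e4, e13, e14]
    exact fun x hx => (h₁₁ x hx).congr (ss _) (fun _ => rfl) (fun _ _ _ => rfl) fun _ _ _ => Iff.rfl
  · rw [e8]
    exact fun s hs => (h₁₂ s hs).congr (ss s)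

/-- Search for two vertices `35`, `36` outside of the solution that form a triple with vertex `34` of
the solution; variable `39` tells whether they exist. -/
def findTriple : Cmd := .block
  [.assign 37 (.const 0) (.cell 4 (.var 34)), .assign 39 (.const 0) (.const 0),
   .ite (.cell 16 (.var 37)) (.block
    [.assign 38 (.const 0) (.cell 17 (.pr (.var 37) (.const 0))),
     .assign 35 (.const 0)
      (.cell 14 (.pr (.var 38) (permAt 20 (.pr (.var 37) (.var 38)) (.const 0)))),
     .ite (.lt (.cell 19 (.pr (.var 37) (.var 38))) (.cell 13 (.var 38)))
      (.block [.assign 39 (.const 0) (.const 1), .assign 36 (.const 0)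
        (.cell 14 (.pr (.var 38) (permAt 20 (.pr (.var 37) (.var 38))
          (.cell 19 (.pr (.var 37) (.var 38))))))])
      (.ite (.lt (.const 1) (.cell 16 (.var 37)))
        (.block [.assign 39 (.const 0) (.const 1),
          .assign 38 (.const 0) (.cell 17 (.pr (.var 37) (.const 1))), .assign 36 (.const 0)
          (.cell 14 (.pr (.var 38) (permAt 20 (.pr (.var 37) (.var 38)) (.const 0))))]) .skip)])
    .skip]

/-- If the cluster of the first incident label `L` is only partly adjacent to `a`, a neighbour and a
non-neighbour in it form a path with `a` whose middle is the neighbour. Otherwise a second incident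
label provides two non-adjacent neighbours, with `a` in the middle. If neither occurs, what remains
is precisely the condition under which `a` may be moved out. -/
theorem findTriple_spec {σ : Mem} {n : ℕ} {A : SimpleGraph ℕ} (h : Core σ n A)
    (ha : σ 4 (σ 34 0) ≠ 0) :
    (findTriple.exec σ 39 0 = 0 ∧ (σ 16 (σ 4 (σ 34 0)) = 0 ∨ σ 16 (σ 4 (σ 34 0)) = 1 ∧
      σ 19 (pr (σ 4 (σ 34 0)) (σ 17 (pr (σ 4 (σ 34 0)) 0))) =
        σ 13 (σ 17 (pr (σ 4 (σ 34 0)) 0)))) ∨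
    (findTriple.exec σ 39 0 = 1 ∧ findTriple.exec σ 35 0 < n ∧ findTriple.exec σ 36 0 < n ∧
      σ 4 (findTriple.exec σ 35 0) = 0 ∧ σ 4 (findTriple.exec σ 36 0) = 0 ∧
      IsTriple A (σ 34 0) (findTriple.exec σ 35 0) (findTriple.exec σ 36 0)) := by
  set a := σ 34 0 with hadef
  set s := σ 4 a with hsdef
  have htab := h.tab a ha
  rw [← hsdef] at htab
  obtain ⟨hL, hC⟩ := htab
  set L := σ 17 (pr s 0) with hLdef
  have an : ∀ {v}, σ 4 v = 0 → a ≠ v := fun hv e => ha (by rw [hsdef, e]; exact hv)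
  by_cases h0 : σ 16 s = 0
  · refine .inl ⟨?_, .inl h0⟩
    simp [findTriple, Mem.set_apply, ← hadef, ← hsdef, h0]
  have hcL : σ 19 (pr s L) ≠ 0 := (hL.mem 0 (by omega)).1
  obtain ⟨π, hπ, -, hsp⟩ := hC L
  have hle := hsp.le
  have h0len : 0 < σ 13 L := by omega
  have hi0 : π 0 < σ 13 L := (hsp.lt_iff 0).2 h0len
  have e0 : σ 20 (pr (pr s L) 0) = π 0 := by simpa using hπ 0
  obtain ⟨⟨p₁, p₂, p₃⟩, -⟩ := (h.clu L).mem _ hi0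
  have pa : A.Adj a (σ 14 (pr L (π 0))) := (hsp.iff 0 h0len).1 (by omega)
  by_cases hc : σ 19 (pr s L) < σ 13 L
  -- Position `c` comes directly after the neighbours and so holds a non-neighbour.
  · set c := σ 19 (pr s L) with hcdef
    have hic : π c < σ 13 L := (hsp.lt_iff c).2 hc
    obtain ⟨⟨q₁, q₂, q₃⟩, -⟩ := (h.clu L).mem _ hic
    have qa : ¬ A.Adj a (σ 14 (pr L (π c))) := fun hq => absurd ((hsp.iff c hc).2 hq) (lt_irrefl _)
    have e35 : findTriple.exec σ 35 0 = σ 14 (pr L (π 0)) := by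
      simp [findTriple, permAt, Mem.set_apply, ← hadef, ← hsdef, h0, ← hLdef, ← hcdef, hc, hπ c, e0]
    have e36 : findTriple.exec σ 36 0 = σ 14 (pr L (π c)) := by
      simp [findTriple, permAt, Mem.set_apply, ← hadef, ← hsdef, h0, ← hLdef, ← hcdef, hc, hπ c]
    refine .inr ⟨?_, ?_⟩
    · simp [findTriple, permAt, Mem.set_apply, ← hadef, ← hsdef, h0, ← hLdef, ← hcdef, hc]
    rw [e35, e36]
    have hne : σ 14 (pr L (π 0)) ≠ σ 14 (pr L (π c)) := fun e => qa (e ▸ pa)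
    exact ⟨p₁, q₁, p₂, q₂, .inr (.inl ⟨(h.clique _ _ p₁ q₁ p₂ q₂ hne).2 (by rw [p₃, q₃]), pa.symm,
      (an q₂).symm, fun h => qa h.symm⟩)⟩
  · by_cases h1 : 1 < σ 16 s
    · set L' := σ 17 (pr s 1) with hL'def
      have hLL : L ≠ L' := fun e => by
        have := hL.elt_inj (show 0 < σ 16 s by omega) h1 e
        omega
      have hcL' : σ 19 (pr s L') ≠ 0 := (hL.mem 1 h1).1
      obtain ⟨π', hπ', -, hsp'⟩ := hC L'
      have hle' := hsp'.le
      have hi0' : π' 0 < σ 13 L' := (hsp'.lt_iff 0).2 (by omega)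
      have e0' : σ 20 (pr (pr s L') 0) = π' 0 := by simpa using hπ' 0
      obtain ⟨⟨q₁, q₂, q₃⟩, -⟩ := (h.clu L').mem _ hi0'
      have qa : A.Adj a (σ 14 (pr L' (π' 0))) := (hsp'.iff 0 (by omega)).1 (by omega)
      have e35 : findTriple.exec σ 35 0 = σ 14 (pr L (π 0)) := by
        simp [findTriple, permAt, Mem.set_apply, ← hadef, ← hsdef, h0, ← hLdef, hc, e0, h1]
      have e36 : findTriple.exec σ 36 0 = σ 14 (pr L' (π' 0)) := by
        simp [findTriple, permAt, Mem.set_apply, ← hadef, ← hsdef, h0, ← hLdef, hc, e0, h1, e0',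
          ← hL'def]
      refine .inr ⟨?_, ?_⟩
      · simp [findTriple, permAt, Mem.set_apply, ← hadef, ← hsdef, h0, ← hLdef, hc, h1]
      rw [e35, e36]
      have hne : σ 14 (pr L (π 0)) ≠ σ 14 (pr L' (π' 0)) := fun e => hLL (by rw [← p₃, ← q₃, e])
      exact ⟨p₁, q₁, p₂, q₂, .inl ⟨pa, qa, hne, fun h' => hLL (by
        rw [← p₃, ← q₃]; exact (h.clique _ _ p₁ q₁ p₂ q₂ hne).1 h')⟩⟩
    · refine .inl ⟨?_, .inr ⟨by omega, by omega⟩⟩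
      simp [findTriple, permAt, Mem.set_apply, ← hadef, ← hsdef, h0, ← hLdef, hc, h1]

theorem sound_findTriple {b : ℕ} {σ : Mem} : findTriple.Sound b σ := by
  simp [findTriple]

/-- Put vertex `34` of the solution into a triple, or move it out of the solution. -/
def resolve : Cmd := .seq findTriple (.ite (.var 39)
  (.seq (.assign 22 (.const 0) (.var 35)) (.seq moveIn (.seq (.assign 22 (.const 0) (.var 36))
    (.seq moveIn (.block [.assign 6 (.var 34) (.var 35 + .const 1),
      .assign 6 (.var 35) (.var 36 + .const 1), .assign 6 (.var 36) (.var 34 + .const 1)])))))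
  (.seq (.assign 23 (.const 0) (.var 34)) moveOut))

/-- The treated vertex stops being free and no vertex becomes free: whatever enters the solution is
linked into the new triple at once. The call uses at most one new label and at most two new slots.
-/
theorem resolve_spec {w b n : ℕ} {σ : Mem} {A : SimpleGraph ℕ} (h : Core σ n A) (ht : Trip σ A)
    (ha : Free σ (σ 34 0)) (hn : n + 1 < 2 ^ b) (h7 : σ 7 0 + 2 < 2 ^ b) (h8 : σ 8 0 + 2 < 2 ^ b) :
    Tri w b resolve σ (4000 + σ 10 0 * 3200) (fun σ' => Core σ' n A ∧ Trip σ' A ∧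
      (∀ x, Free σ' x → Free σ x ∧ x ≠ σ 34 0) ∧
      σ' 7 0 ≤ σ 7 0 + 1 ∧ σ' 8 0 ≤ σ 8 0 + 2 ∧ σ' 10 0 ≤ σ 10 0 + 2) := by
  refine Tri.seq (B₁ := 600) (B₂ := 3400 + σ 10 0 * 3200) (Q₁ := fun τ => τ = findTriple.exec σ)
    (Tri.exec (by decide) (by decide) (fun _ _ => sound_findTriple) fun _ _ => rfl) ?_ (by omega)
  rintro _ - fr rfl
  have hf := findTriple_spec h ha.1
  set τ := findTriple.exec σ with hτ
  set a := σ 34 0 with hadef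
  have f : ∀ c, c ∉ [35, 36, 37, 38, 39] → τ c = σ c := fun c hc => by
    simp only [List.mem_cons, List.not_mem_nil, or_false, not_or] at hc
    exact fr c (by simp [findTriple, Cmd.block, Cmd.mods, hc])
  have hcore : ∀ {σ' τ : Mem}, Core σ' n A → (∀ c, 2 ≤ c → c ≤ 21 → c ≠ 6 → τ c = σ' c) → Core τ n A :=
    fun h he => h.congr he
  have h₀ : Core τ n A := h.congr fun c _ _ _ => f c (by simp; omega)
  have t34 : τ 34 0 = a := by rw [f 34 (by decide)]
  refine Tri.ite (B₁ := 3390 + σ 10 0 * 3200) (by decide) (fun hb => ?_) (fun hb => ?_)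
    (by simp [Expr.cost, Expr.var]; omega)
  · simp only [Expr.eval_var] at hb
    obtain ⟨h', -⟩ | ⟨-, hP, hQ, hP', hQ', hT⟩ := hf
    · exact (hb h').elim
    generalize hP₀ : τ 35 0 = P at *
    generalize hQ₀ : τ 36 0 = Q at *
    obtain ⟨naP, nPQ, nQa⟩ := hT.ne
    have e : ∀ c, c ≤ 21 → τ c = σ c := fun c hc => f c (by simp; omega)
    refine Tri.seq (B₁ := 10) (B₂ := 3380 + σ 10 0 * 3200) (Q₁ := fun τ' => τ' = τ.set 22 0 P)
      (Tri.exec (by decide) (by decide) (fun _ _ => by simp) fun _ _ => by simp [hP₀]) ?_ (by omega)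
    rintro _ - - rfl
    have g : ∀ c, c ≠ 22 → (τ.set 22 0 P) c = τ c := fun c hc => Mem.set_ne _ _ _ hc
    have g22 : (τ.set 22 0 P) 22 0 = P := by simp [Mem.set_apply]
    have m₁ := moveIn_spec (w := w) (b := b) (h₀.congr fun c _ h _ => g c (by omega) :
      Core (τ.set 22 0 P) n A) (by rw [g22]; exact hP)
      (by rw [g22, g 4 (by decide), e 4 (by decide)]; exact hP') hn
      (by rw [g 8 (by decide), e 8 (by decide)]; omega)
    rw [g22, g 4 (by decide), g 8 (by decide), g 10 (by decide), e 4 (by decide), e 8 (by decide),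
      e 10 (by decide)] at m₁
    refine Tri.seq m₁ (B₂ := 2700 + σ 10 0 * 1600) ?_ (by omega)
    rintro τ₁ - fr₁ ⟨c₁, s₁, n₁, x₁⟩
    have v₁ : ∀ c, c ∉ moveIn.mods → c ≠ 22 → τ₁ c = τ c := fun c hc hc' => by
      rw [fr₁ c hc, g c hc']
    refine Tri.seq (B₁ := 10) (B₂ := 2690 + σ 10 0 * 1600) (Q₁ := fun τ' => τ' = τ₁.set 22 0 Q)
      (Tri.exec (by decide) (by decide) (fun _ _ => by simp) fun _ _ => by
        simp [v₁ 36 (by decide) (by decide), hQ₀]) ?_ (by omega)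
    rintro _ - - rfl
    have g' : ∀ c, c ≠ 22 → (τ₁.set 22 0 Q) c = τ₁ c := fun c hc => Mem.set_ne _ _ _ hc
    have g22' : (τ₁.set 22 0 Q) 22 0 = Q := by simp [Mem.set_apply]
    have m₂ := moveIn_spec (w := w) (b := b) (c₁.congr fun c _ h _ => g' c (by omega) :
      Core (τ₁.set 22 0 Q) n A) (by rw [g22']; exact hQ)
      (by rw [g22', g' 4 (by decide), s₁, Function.update_of_ne nPQ.symm]; exact hQ') hn
      (by rw [g' 8 (by decide), n₁]; omega)
    rw [g22', g' 4 (by decide), g' 8 (by decide), g' 10 (by decide), s₁, n₁, x₁] at m₂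
    refine Tri.seq m₂ (B₂ := 100) ?_ (by omega)
    rintro τ₂ - fr₂ ⟨c₂, s₂, n₂, x₂⟩
    have v₂ : ∀ c, c ∉ moveIn.mods → c ≠ 22 → τ₂ c = τ c := fun c hc hc' => by
      rw [fr₂ c hc, g' c hc', v₁ c hc hc']
    have h6 : τ₂ 6 = σ 6 := by rw [v₂ 6 (by decide) (by decide), e 6 (by decide)]
    have h7' : τ₂ 7 = σ 7 := by rw [v₂ 7 (by decide) (by decide), e 7 (by decide)]
    have w34 : τ₂ 34 0 = a := by rw [v₂ 34 (by decide) (by decide), t34]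
    have w35 : τ₂ 35 0 = P := by rw [v₂ 35 (by decide) (by decide), hP₀]
    have w36 : τ₂ 36 0 = Q := by rw [v₂ 36 (by decide) (by decide), hQ₀]
    have hSpos : σ 8 0 ≠ 0 := h.slot_pos
    have slot' : ∀ x, τ₂ 4 x ≠ 0 ↔ σ 4 x ≠ 0 ∨ x = P ∨ x = Q := fun x => by
      rw [s₂, Function.update_apply, Function.update_apply]
      split
      · simp [*]
      · split <;> simp [*]
    -- Vertices outside of the solution carry no links, so `P` and `Q` belong to no older triple.
    have nxt0 : ∀ {x}, σ 4 x = 0 → σ 6 x = 0 := fun hx => by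
      by_contra h'
      exact ht.slot h' hx
    have key : ∀ σ' : Mem, σ' = ((τ₂.set 6 a (P + 1)).set 6 P (Q + 1)).set 6 Q (a + 1) →
        (∀ c, c ≠ 6 → σ' c = τ₂ c) ∧ σ' 6 a = P + 1 ∧ σ' 6 P = Q + 1 ∧ σ' 6 Q = a + 1 ∧
        ∀ x, x ≠ a → x ≠ P → x ≠ Q → σ' 6 x = σ 6 x := by
      rintro σ' rfl
      refine ⟨fun c hc => by rw [Mem.set_ne _ _ _ hc, Mem.set_ne _ _ _ hc, Mem.set_ne _ _ _ hc],
        ?_, ?_, ?_, fun x hxa hxP hxQ => ?_⟩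
      · simp [Mem.set_apply, naP, nQa.symm]
      · simp [Mem.set_apply, nPQ]
      · simp [Mem.set_apply]
      · simp [Mem.set_apply, hxa, hxP, hxQ, h6]
    refine Tri.exec (by decide) (by decide) (fun hb₁ hb₂ => ?_) fun _ _ => ?_
    · have := (h.slot a ha.1).1
      simp [Mem.set_apply, w34, w35, w36]
      omega
    · rw [exec_cons_assign (x := a) (by simp [w34]) (y := P + 1) (by simp [w35]),
        exec_cons_assign (x := P) (by simp [Mem.set_apply, w35]) (y := Q + 1)
          (by simp [Mem.set_apply, w36]),
        exec_cons_assign (x := Q) (by simp [Mem.set_apply, w36]) (y := a + 1)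
          (by simp [Mem.set_apply, w34]), Cmd.exec_nil]
      obtain ⟨k, ka, kP, kQ, ko⟩ := key _ rfl
      generalize ((τ₂.set 6 a (P + 1)).set 6 P (Q + 1)).set 6 Q (a + 1) = σ' at *
      have k4 : σ' 4 = τ₂ 4 := k 4 (by decide)
      refine ⟨c₂.congr fun c _ _ hc => k c hc, fun x hx => ?_, fun x hx => ?_, ?_, ?_, ?_⟩
      · rw [k4, slot']
        by_cases hxa : x = a
        · subst hxa
          exact ⟨P, Q, .inl ha.1, ka, kP, kQ, hT⟩
        by_cases hxP : x = P
        · subst hxP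
          exact ⟨Q, a, .inr (.inl rfl), kP, kQ, ka, hT.rotate⟩
        by_cases hxQ : x = Q
        · subst hxQ
          exact ⟨a, P, .inr (.inr rfl), kQ, ka, kP, hT.rotate.rotate⟩
        rw [ko x hxa hxP hxQ] at hx ⊢
        obtain ⟨y, z, j₁, j₂, j₃, j₄, j₅⟩ := ht x hx
        have ny : σ 6 y ≠ 0 := by omega
        have nz : σ 6 z ≠ 0 := by omega
        have fin : ∀ {v}, σ 6 v ≠ 0 → σ' 6 v = σ 6 v := fun {v} hv =>
          ko v (fun e => hv (e ▸ ha.2)) (fun e => hv (e ▸ nxt0 hP')) (fun e => hv (e ▸ nxt0 hQ'))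
        exact ⟨y, z, .inl j₁, j₂, by rw [fin ny, j₃], by rw [fin nz, j₄], j₅⟩
      · obtain ⟨y₁, y₂⟩ := hx
        have xa : x ≠ a := fun e => by rw [e, ka] at y₂; omega
        have xP : x ≠ P := fun e => by rw [e, kP] at y₂; omega
        have xQ : x ≠ Q := fun e => by rw [e, kQ] at y₂; omega
        rw [k4, slot'] at y₁
        rw [ko x xa xP xQ] at y₂
        exact ⟨⟨by tauto, y₂⟩, xa⟩
      · rw [k 7 (by decide), h7']
        omega
      · rw [k 8 (by decide), n₂]
      · rw [k 10 (by decide), x₂]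
  · simp only [Expr.eval_var] at hb
    obtain ⟨-, hr⟩ | ⟨h', -⟩ := hf
    swap
    · omega
    refine Tri.seq (B₁ := 10) (B₂ := 3300 + σ 10 0 * 3200) (Q₁ := fun τ' => τ' = τ.set 23 0 a)
      (Tri.exec (by decide) (by decide) (fun _ _ => by simp) fun _ _ => by simp [t34]) ?_ (by omega)
    rintro _ - - rfl
    have g : ∀ c, c ∉ [23, 35, 36, 37, 38, 39] → (τ.set 23 0 a) c = σ c := fun c hc => by
      simp only [List.mem_cons, List.not_mem_nil, or_false, not_or] at hc
      rw [Mem.set_ne _ _ _ hc.1, f c (by simp [hc])]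
    have g23 : (τ.set 23 0 a) 23 0 = a := by simp [Mem.set_apply]
    generalize τ.set 23 0 a = τ₁ at *
    have e : ∀ c, c ≤ 21 → τ₁ c = σ c := fun c hc => g c (by simp; omega)
    have := moveOut_spec (w := w) (b := b) (h.congr fun c _ h _ => e c h : Core τ₁ n A)
      (by rw [g23, e 4 (by decide)]; exact ha.1)
      (by rw [g23, e 4 (by decide), e 16 (by decide), e 17 (by decide), e 19 (by decide),
        e 13 (by decide)]; exact hr) hn (by rw [e 7 (by decide)]; exact h7)
    rw [g23, e 4 (by decide), e 7 (by decide), e 10 (by decide)] at this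
    refine this.conseq (by omega) fun σ' _ fr' ⟨r₁, r₂, r₃, r₄⟩ => ?_
    have f6 : σ' 6 = σ 6 := by rw [fr' 6 (by decide), e 6 (by decide)]
    have f8 : σ' 8 = σ 8 := by rw [fr' 8 (by decide), e 8 (by decide)]
    refine ⟨r₁, ht.congr f6 fun x hx => ?_, fun x hx => ?_, r₃, by rw [f8]; omega, by omega⟩
    · rw [r₂, Function.update_apply, if_neg]
      · exact ht.slot hx
      · exact fun e => hx (e ▸ ha.2)
    · obtain ⟨x₁, x₂⟩ := hx
      rw [r₂, Function.update_apply] at x₁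
      rw [f6] at x₂
      split at x₁
      · exact (x₁ rfl).elim
      · exact ⟨⟨x₁, x₂⟩, ‹_›⟩

end RAM


/-! ### Edge updates -/

namespace RAM

/-- Bring vertex `44` into the solution and dissolve its triple, whose other members are `45` and
`46`. -/
def release : Cmd := .ite (.cell 4 (.var 44))
  (.ite (.cell 6 (.var 44)) (.block [.assign 45 (.const 0) (.cell 6 (.var 44) - .const 1),
    .assign 46 (.const 0) (.cell 6 (.var 45) - .const 1), .assign 6 (.var 44) (.const 0),
    .assign 6 (.var 45) (.const 0), .assign 6 (.var 46) (.const 0)])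
    (.block [.assign 45 (.const 0) (.var 44), .assign 46 (.const 0) (.var 44)]))
  (.seq (.block [.assign 22 (.const 0) (.var 44), .assign 45 (.const 0) (.var 44),
    .assign 46 (.const 0) (.var 44)]) moveIn)

/-- Only the vertex and its two former partners can become free. Without partners, the variables
`45` and `46` repeat the vertex itself, so that the caller can treat all cases alike. -/
theorem release_spec {w b n : ℕ} {σ : Mem} {A : SimpleGraph ℕ} (h : Core σ n A) (ht : Trip σ A)
    (hz : σ 44 0 < n) (hn : n + 1 < 2 ^ b) (h8 : σ 8 0 + 1 < 2 ^ b) :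
    Tri w b release σ (700 + σ 10 0 * 1600) (fun σ' => Core σ' n A ∧ Trip σ' A ∧
      Free σ' (σ 44 0) ∧ (∀ x, Free σ x → Free σ' x) ∧
      (∀ x, Free σ' x → Free σ x ∨ x = σ 44 0 ∨ x = σ' 45 0 ∨ x = σ' 46 0) ∧
      σ' 8 0 ≤ σ 8 0 + 1 ∧ σ' 10 0 ≤ σ 10 0 + 1) := by
  set a := σ 44 0 with hadef
  refine Tri.ite (B₁ := 690 + σ 10 0 * 1600) (by decide) (fun ha => ?_) (fun ha => ?_)
    (by simp [Expr.cost, Expr.var]; omega)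
  · simp only [Expr.eval_cell, Expr.eval_var, ← hadef] at ha
    refine Tri.ite (B₁ := 680 + σ 10 0 * 1600) (by decide) (fun hx => ?_) (fun hx => ?_)
      (by simp [Expr.cost, Expr.var]; omega)
    · simp only [Expr.eval_cell, Expr.eval_var, ← hadef] at hx
      obtain ⟨y, z, -, ay, yz, za, hT⟩ := ht a hx
      obtain ⟨nay, nyz, nza⟩ := hT.ne
      refine Tri.exec (by decide) (le_trans (b := 100) (by decide) (by omega)) (fun _ _ => by simp)
        fun _ _ => ?_
      rw [exec_cons_assign (x := 0) rfl (y := y) (by simp [← hadef, ay]),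
        exec_cons_assign (x := 0) rfl (y := z) (by simp [Mem.set_apply, yz]),
        exec_cons_assign (x := a) (by simp [Mem.set_apply, hadef]) (y := 0) rfl,
        exec_cons_assign (x := y) (by simp [Mem.set_apply]) (y := 0) rfl,
        exec_cons_assign (x := z) (by simp [Mem.set_apply]) (y := 0) rfl, Cmd.exec_nil]
      set σ' := ((((σ.set 45 0 y).set 46 0 z).set 6 a 0).set 6 y 0).set 6 z 0 with hσ'
      have v : ∀ c, c ∉ [6, 45, 46] → σ' c = σ c := fun c hc => by
        simp only [List.mem_cons, List.not_mem_nil, or_false, not_or] at hc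
        rw [hσ', Mem.set_ne _ _ _ hc.1, Mem.set_ne _ _ _ hc.1, Mem.set_ne _ _ _ hc.1,
          Mem.set_ne _ _ _ hc.2.2, Mem.set_ne _ _ _ hc.2.1]
      have k6 : ∀ x, σ' 6 x = if x = a ∨ x = y ∨ x = z then 0 else σ 6 x := fun x => by
        simp only [hσ', Mem.set_apply]
        by_cases hxa : x = a <;> by_cases hxy : x = y <;> by_cases hxz : x = z <;> simp [*]
      have k4 : σ' 4 = σ 4 := v 4 (by decide)
      have e45 : σ' 45 0 = y := by simp [hσ', Mem.set_apply]
      have e46 : σ' 46 0 = z := by simp [hσ', Mem.set_apply]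
      refine ⟨h.congr fun c _ _ _ => v c (by simp; omega), fun x hx' => ?_, ⟨by rwa [k4], ?_⟩,
        fun x hx' => ⟨by rw [k4]; exact hx'.1, ?_⟩, fun x hx' => ?_, ?_, ?_⟩
      · rw [k6] at hx'
        by_cases hxs : x = a ∨ x = y ∨ x = z
        · simp [hxs] at hx'
        rw [if_neg hxs] at hx'
        simp only [not_or] at hxs
        -- Links run around cycles of length three, so a triple that starts outside of the dissolved
        -- one never enters it.
        obtain ⟨y', z', j₁, j₂, j₃, j₄, j₅⟩ := ht x hx'
        refine ⟨y', z', by rwa [k4], by rw [k6, if_neg (by tauto), j₂], ?_, ?_, j₅⟩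
        · rw [k6, if_neg, j₃]
          grind
        · rw [k6, if_neg, j₄]
          rintro (rfl | rfl | rfl)
          · exact hxs.2.1 (by omega)
          · exact hxs.2.2 (by omega)
          · exact hxs.1 (by omega)
      · rw [k6, if_pos (.inl rfl)]
      · rw [k6]
        split
        · rfl
        · exact hx'.2
      · obtain ⟨x₁, x₂⟩ := hx'
        rw [k4] at x₁
        rw [k6] at x₂
        rw [e45, e46]
        split at x₂
        · tauto
        · exact .inl ⟨x₁, x₂⟩
      · rw [v 8 (by decide)]
        omega
      · rw [v 10 (by decide)]
        omega
    · simp only [Expr.eval_cell, Expr.eval_var, ← hadef] at hx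
      refine Tri.exec (by decide) (le_trans (b := 100) (by decide) (by omega)) (fun _ _ => by simp)
        fun _ fr => ?_
      have f : ∀ c, c ∉ [45, 46] → _ = σ c := fun c hc => fr c (by simpa [Cmd.block, Cmd.mods] using hc)
      generalize (Cmd.exec _ σ) = σ' at *
      have k4 : σ' 4 = σ 4 := f 4 (by decide)
      have k6 : σ' 6 = σ 6 := f 6 (by decide)
      refine ⟨h.congr fun c _ _ _ => f c (by simp; omega), ht.congr k6 fun x hx => ?_,
        ⟨by rwa [k4], by rwa [k6]⟩, fun x => ?_, fun x => ?_, ?_, ?_⟩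
      · rw [k4]
        exact ht.slot hx
      · rw [Free, Free, k4, k6]
        exact id
      · rw [Free, Free, k4, k6]
        exact .inl
      · rw [f 8 (by decide)]
        omega
      · rw [f 10 (by decide)]
        omega
  · simp only [Expr.eval_cell, Expr.eval_var, ← hadef] at ha
    refine Tri.seq (B₁ := 30) (B₂ := 650 + σ 10 0 * 1600) (Q₁ := fun τ => τ 22 0 = a)
      (Tri.exec (by decide) (by decide) (fun _ _ => by simp) fun _ _ => by
        simp [Mem.set_apply, ← hadef]) ?_ (by omega)
    intro τ _ fr hτ
    have f : ∀ c, c ∉ [22, 45, 46] → τ c = σ c := fun c hc => fr c (by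
      simpa [Cmd.block, Cmd.mods] using hc)
    have f4 : τ 4 = σ 4 := f 4 (by decide)
    have := moveIn_spec (w := w) (b := b) (h.congr fun c _ _ _ => f c (by simp; omega) : Core τ n A)
      (by rwa [hτ]) (by rwa [hτ, f4]) hn (by rwa [f 8 (by decide)])
    rw [hτ, f4, f 8 (by decide), f 10 (by decide)] at this
    refine this.conseq (by omega) fun σ' _ fr' ⟨r₁, r₂, r₃, r₄⟩ => ?_
    have k6 : σ' 6 = σ 6 := by rw [fr' 6 (by decide), f 6 (by decide)]
    have hS := h.slot_pos
    have slot' : ∀ x, σ' 4 x ≠ 0 ↔ σ 4 x ≠ 0 ∨ x = a := fun x => by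
      rw [r₂, Function.update_apply]
      by_cases hxa : x = a
      · simp [hxa, hS]
      · simp [hxa]
    refine ⟨r₁, ht.congr k6 fun x hx => (slot' x).2 (.inl (ht.slot hx)),
      ⟨(slot' a).2 (.inr rfl), ?_⟩, fun x hx => ⟨(slot' x).2 (.inl hx.1), by rw [k6]; exact hx.2⟩,
      fun x hx => ?_, by omega, by omega⟩
    · rw [k6]
      by_contra h'
      exact ht.slot h' ha
    · obtain ⟨x₁, x₂⟩ := hx
      rw [k6] at x₂
      rcases (slot' x).1 x₁ with h' | h'
      · exact .inl ⟨h', x₂⟩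
      · exact .inr (.inl h')

/-- Change the adjacency of the vertices in cells `0` and `1` of the input. -/
def update (c : ℕ) : Cmd := .seq
  (.block [.assign 42 (.const 0) (.var 0), .assign 43 (.const 0) (.cell 0 (.const 1)),
    .assign 44 (.const 0) (.var 42)])
  (.seq release (.seq
    (.block [.assign 40 (.const 0) (.var 42), .assign 40 (.const 1) (.var 45),
      .assign 40 (.const 2) (.var 46), .assign 44 (.const 0) (.var 43)])
    (.seq release (.seq
      (.block [.assign 40 (.const 3) (.var 43), .assign 40 (.const 4) (.var 45),
        .assign 40 (.const 5) (.var 46), .assign 3 (.pr (.var 42) (.var 43)) (.const c),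
        .assign 3 (.pr (.var 43) (.var 42)) (.const c)])
      (.forLoop 41 (.const 6) (.ite (.cell 4 (.cell 40 (.var 41)))
        (.ite (.cell 6 (.cell 40 (.var 41))) .skip
          (.seq (.assign 34 (.const 0) (.cell 40 (.var 41))) resolve)) .skip))))))

/-- Both ends of the changed edge are in the solution, whereas the tables and the clique condition
only speak of pairs with an end outside of it. -/
theorem Core.change {σ σ' : Mem} {n u v : ℕ} {A A' : SimpleGraph ℕ} (h : Core σ n A)
    (hu : σ 4 u ≠ 0) (hv : σ 4 v ≠ 0) (he : ∀ a, 2 ≤ a → a ≤ 21 → a ≠ 3 → a ≠ 6 → σ' a = σ a)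
    (hA : ∀ x y, σ' 3 (pr x y) ≠ 0 ↔ A'.Adj x y)
    (hAA : ∀ x y, ¬ (x = u ∧ y = v) → ¬ (x = v ∧ y = u) → (A'.Adj x y ↔ A.Adj x y)) :
    Core σ' n A' := by
  obtain ⟨h₁, h₂, h₃, h₄, h₅, h₆, h₇, h₈, h₉, h₁₀, h₁₁, h₁₂⟩ := h
  have e4 : σ' 4 = σ 4 := he 4 (by decide) (by decide) (by decide) (by decide)
  have e5 : σ' 5 = σ 5 := he 5 (by decide) (by decide) (by decide) (by decide)
  have e8 : σ' 8 = σ 8 := he 8 (by decide) (by decide) (by decide) (by decide)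
  have e13 : σ' 13 = σ 13 := he 13 (by decide) (by decide) (by decide) (by decide)
  have e14 : σ' 14 = σ 14 := he 14 (by decide) (by decide) (by decide) (by decide)
  have ss : ∀ s, SameSlot σ' σ s := fun s =>
    SameSlot.of_eq (fun a h h' => he a (by omega) h' (by omega) (by omega)) s
  constructor
  · rwa [he 2 (by decide) (by decide) (by decide) (by decide)]
  · exact hA
  · intro x y hxy
    by_cases hxu : x = u
    · exact hxu ▸ (h₄ u hu).1
    by_cases hxv : x = v
    · exact hxv ▸ (h₄ v hv).1
    exact h₃ x y ((hAA x y (by tauto) (by tauto)).1 hxy)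
  · rwa [e4, e8]
  · rwa [e4]
  · rwa [e8]
  · rw [e4]
    exact h₇.congr (SameKey.of_eq (he 10 (by decide) (by decide) (by decide) (by decide))
      (he 11 (by decide) (by decide) (by decide) (by decide))
      (he 12 (by decide) (by decide) (by decide) (by decide)) 0) fun _ => Iff.rfl
  · intro l
    rw [e4, e5]
    exact (h₈ l).congr (SameKey.of_eq e13 e14 (he 15 (by decide) (by decide) (by decide) (by decide))
      l) fun _ => Iff.rfl
  · rwa [e4, e5, he 7 (by decide) (by decide) (by decide) (by decide)]
  · rw [e4, e5]
    intro x y hx hy hx' hy' hxy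
    rw [hAA x y (fun e => hu (e.1 ▸ hx')) (fun e => hv (e.1 ▸ hx'))]
    exact h₁₀ x y hx hy hx' hy' hxy
  · rw [e4, e13, e14]
    refine fun x hx => (h₁₁ x hx).congr (ss _) (fun _ => rfl) (fun _ _ _ => rfl) fun l i hi => ?_
    have := ((h₈ l).mem i hi).1.2.1
    exact hAA _ _ (fun e => hv (e.2 ▸ this)) (fun e => hu (e.2 ▸ this))
  · rw [e8]
    exact fun s hs => (h₁₂ s hs).congr (ss s)

/-- The ends of the changed edge belong to no triple, so adjacency within the triples stays the
same. -/
theorem Trip.change {σ σ' : Mem} {u v : ℕ} {A A' : SimpleGraph ℕ} (h : Trip σ A)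
    (hu : σ 6 u = 0) (hv : σ 6 v = 0) (h4 : σ' 4 = σ 4) (h6 : σ' 6 = σ 6)
    (hAA : ∀ x y, ¬ (x = u ∧ y = v) → ¬ (x = v ∧ y = u) → (A'.Adj x y ↔ A.Adj x y)) :
    Trip σ' A' := by
  intro x hx
  rw [h6] at hx ⊢
  rw [h4]
  obtain ⟨y, z, j₁, j₂, j₃, j₄, j₅⟩ := h x hx
  refine ⟨y, z, j₁, j₂, j₃, j₄, ?_⟩
  have e : ∀ {p q}, σ 6 p ≠ 0 → (A'.Adj p q ↔ A.Adj p q) := fun hp =>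
    hAA _ _ (fun e => hp (e.1 ▸ hu)) (fun e => hp (e.1 ▸ hv))
  have hy : σ 6 y ≠ 0 := by omega
  have hz : σ 6 z ≠ 0 := by omega
  simpa only [IsTriple, IsPath3, e hx, e hy, e hz] using j₅

/-- After both releases at most six vertices are free: the two ends and their former partners. They
are noted in array `40`, possibly with repetitions, and resolved one by one. The releases use at
most two slots, the resolutions at most twelve slots and six labels. -/
theorem update_spec {w b n c : ℕ} {σ : Mem} {A A' : SimpleGraph ℕ} (hc : c < 2)
    (h : Core σ n A) (ht : Trip σ A) (hfree : ∀ x, ¬ Free σ x) (hu : σ 0 0 < n) (hv : σ 0 1 < n)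
    (hA' : ∀ x y, A'.Adj x y ↔ if (x = σ 0 0 ∧ y = σ 0 1) ∨ (x = σ 0 1 ∧ y = σ 0 0) then c ≠ 0
      else A.Adj x y)
    (hn : n + 1 < 2 ^ b) (h7 : σ 7 0 + 8 < 2 ^ b) (h8 : σ 8 0 + 16 < 2 ^ b) :
    Tri w b (update c) σ (400000 + σ 10 0 * 40000) (fun σ' => Core σ' n A' ∧ Trip σ' A' ∧
      (∀ x, ¬ Free σ' x) ∧ σ' 7 0 ≤ σ 7 0 + 6 ∧ σ' 8 0 ≤ σ 8 0 + 14) := by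
  set u := σ 0 0 with hudef
  set v := σ 0 1 with hvdef
  have hAA : ∀ x y, ¬ (x = u ∧ y = v) → ¬ (x = v ∧ y = u) → (A'.Adj x y ↔ A.Adj x y) :=
    fun x y h₁ h₂ => by rw [hA', if_neg (by tauto)]
  refine Tri.seq (B₁ := 50) (B₂ := 399900 + σ 10 0 * 40000)
    (Q₁ := fun τ => τ 42 0 = u ∧ τ 43 0 = v ∧ τ 44 0 = u)
    (Tri.exec (by decide) (by decide) (fun _ _ => by simp) fun _ _ => by
      simp [Mem.set_apply, ← hudef, ← hvdef]) ?_ (by omega)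
  rintro τ₁ - fr₁ ⟨a42, a43, a44⟩
  have f₁ : ∀ a, a ∉ [42, 43, 44] → τ₁ a = σ a := fun a ha => fr₁ a (by
    simpa [Cmd.block, Cmd.mods] using ha)
  have r := release_spec (w := w) (b := b) (h.congr fun a _ _ _ => f₁ a (by simp; omega) : Core τ₁ n A)
    (ht.congr (f₁ 6 (by decide)) fun x hx => by rw [f₁ 4 (by decide)]; exact ht.slot hx)
    (by rwa [a44]) hn (by rw [f₁ 8 (by decide)]; omega)
  rw [a44, f₁ 8 (by decide), f₁ 10 (by decide)] at r
  refine Tri.seq r (B₂ := 399000 + σ 10 0 * 38000) ?_ (by omega)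
  rintro τ₂ - fr₂ ⟨c₂, t₂, u₂, -, o₂, n₂, x₂⟩
  have o₂' : ∀ x, Free τ₂ x → x = u ∨ x = τ₂ 45 0 ∨ x = τ₂ 46 0 := fun x hx => by
    refine (o₂ x hx).resolve_left fun hx => hfree x ?_
    rwa [Free, f₁ 4 (by decide), f₁ 6 (by decide)] at hx
  have b42 : τ₂ 42 0 = u := by rw [fr₂ 42 (by decide), a42]
  have b43 : τ₂ 43 0 = v := by rw [fr₂ 43 (by decide), a43]
  have b7 : τ₂ 7 = σ 7 := by rw [fr₂ 7 (by decide), f₁ 7 (by decide)]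
  refine Tri.seq (B₁ := 50) (B₂ := 398900 + σ 10 0 * 38000)
    (Q₁ := fun τ => τ 40 0 = u ∧ τ 40 1 = τ₂ 45 0 ∧ τ 40 2 = τ₂ 46 0 ∧ τ 44 0 = v)
    (Tri.exec (by decide) (by decide) (fun _ _ => by simp) fun _ _ => by
      simp [Mem.set_apply, b42, b43]) ?_ (by omega)
  rintro τ₃ - fr₃ ⟨d0, d1, d2, d44⟩
  have f₃ : ∀ a, a ∉ [40, 44] → τ₃ a = τ₂ a := fun a ha => fr₃ a (by
    simpa [Cmd.block, Cmd.mods] using ha)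
  have r := release_spec (w := w) (b := b) (c₂.congr fun a _ _ _ => f₃ a (by simp; omega) : Core τ₃ n A)
    (t₂.congr (f₃ 6 (by decide)) fun x hx => by rw [f₃ 4 (by decide)]; exact t₂.slot hx)
    (by rwa [d44]) hn (by rw [f₃ 8 (by decide)]; omega)
  rw [d44, f₃ 8 (by decide), f₃ 10 (by decide)] at r
  refine Tri.seq r (B₂ := 390000 + σ 10 0 * 36000) ?_ (by omega)
  rintro τ₄ - fr₄ ⟨c₄, t₄, v₄, p₄, o₄, n₄, x₄⟩
  have fe : ∀ x, Free τ₂ x ↔ Free τ₃ x := fun x => by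
    rw [Free, Free, f₃ 4 (by decide), f₃ 6 (by decide)]
  have u₄ : Free τ₄ u := p₄ u ((fe u).1 u₂)
  have o₄' : ∀ x, Free τ₄ x → x = u ∨ x = τ₂ 45 0 ∨ x = τ₂ 46 0 ∨ x = v ∨ x = τ₄ 45 0 ∨
      x = τ₄ 46 0 := fun x hx => by
    rcases o₄ x hx with h' | h'
    · have := o₂' x ((fe x).2 h')
      tauto
    · tauto
  have e42 : τ₄ 42 0 = u := by rw [fr₄ 42 (by decide), f₃ 42 (by decide), b42]
  have e43 : τ₄ 43 0 = v := by rw [fr₄ 43 (by decide), f₃ 43 (by decide), b43]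
  have e7 : τ₄ 7 = σ 7 := by rw [fr₄ 7 (by decide), f₃ 7 (by decide), b7]
  have e40 : τ₄ 40 = τ₃ 40 := fr₄ 40 (by decide)
  have hcb : ∀ {b : ℕ}, 8 ≤ b → c < 2 ^ b := fun hb =>
    lt_of_lt_of_le (by omega) (Nat.pow_le_pow_right (n := 2) (by norm_num) hb)
  refine Tri.seq (B₁ := 150) (B₂ := 389000 + σ 10 0 * 36000)
    (Q₁ := fun τ => (∀ x, Free τ₄ x → ∃ i < 6, τ 40 i = x) ∧
      (∀ x y, τ 3 (pr x y) ≠ 0 ↔ A'.Adj x y))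
    (Tri.exec ?_ ?_ (fun hb _ => ?_) fun _ _ => ?_) ?_ (by omega)
  · interval_cases c <;> decide
  · interval_cases c <;> decide
  · simp
  · have h3 : τ₄ 3 = σ 3 := by
      rw [fr₄ 3 (by decide), f₃ 3 (by decide), fr₂ 3 (by decide), f₁ 3 (by decide)]
    rw [exec_cons_assign (x := 3) rfl (y := v) (by simp [e43]),
      exec_cons_assign (x := 4) rfl (y := τ₄ 45 0) (by simp [Mem.set_apply]),
      exec_cons_assign (x := 5) rfl (y := τ₄ 46 0) (by simp [Mem.set_apply]),
      exec_cons_assign (x := pr u v) (by simp [Mem.set_apply, e42, e43]) (y := c) rfl,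
      exec_cons_assign (x := pr v u) (by simp [Mem.set_apply, e42, e43]) (y := c) rfl, Cmd.exec_nil]
    refine ⟨fun x hx => ?_, fun x y => ?_⟩
    · rcases o₄' x hx with rfl | rfl | rfl | rfl | rfl | rfl
      · exact ⟨0, by norm_num, by simp [Mem.set_apply, e40, d0]⟩
      · exact ⟨1, by norm_num, by simp [Mem.set_apply, e40, d1]⟩
      · exact ⟨2, by norm_num, by simp [Mem.set_apply, e40, d2]⟩
      · exact ⟨3, by norm_num, by simp [Mem.set_apply]⟩
      · exact ⟨4, by norm_num, by simp [Mem.set_apply]⟩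
      · exact ⟨5, by norm_num, by simp [Mem.set_apply]⟩
    · simp only [Mem.set_apply, true_and, pr_inj, hA', show (3 : ℕ) ≠ 40 by decide, false_and, if_false,
        h3, ← h.adj x y]
      by_cases h₁ : x = u ∧ y = v <;> by_cases h₂ : x = v ∧ y = u <;> simp [h₁, h₂]
  rintro τ₅ - fr₅ ⟨td, ad⟩
  have f₅ : ∀ a, a ∉ [3, 40] → τ₅ a = τ₄ a := fun a ha => fr₅ a (by
    simp only [List.mem_cons, List.not_mem_nil, or_false, not_or] at ha
    simp [Cmd.block, Cmd.mods, ha])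
  have c₅ : Core τ₅ n A' := c₄.change u₄.1 v₄.1 (fun a _ _ _ _ => f₅ a (by simp; omega)) ad hAA
  have t₅ : Trip τ₅ A' := t₄.change u₄.2 v₄.2 (f₅ 4 (by decide)) (f₅ 6 (by decide)) hAA
  have x₅ : τ₅ 10 0 ≤ σ 10 0 + 2 := by rw [f₅ 10 (by decide)]; omega
  have n₅ : τ₅ 8 0 ≤ σ 8 0 + 2 := by rw [f₅ 8 (by decide)]; omega
  have l₅ : τ₅ 7 0 = σ 7 0 := by rw [f₅ 7 (by decide), e7]
  -- Every vertex that is still free is noted at an index not yet treated; after six rounds none can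
  -- be left.
  refine Tri.conseq (Tri.forLoop 6 (fun j τ => Core τ n A' ∧ Trip τ A' ∧
    (∀ x, Free τ x → ∃ i, j ≤ i ∧ i < 6 ∧ τ₅ 40 i = x) ∧ τ 7 0 ≤ σ 7 0 + j ∧
    τ 8 0 ≤ σ 8 0 + 2 + 2 * j ∧ τ 10 0 ≤ σ 10 0 + 2 + 2 * j)
    (B₁ := 60000 + σ 10 0 * 4000) (by decide) (by decide) (fun _ _ _ _ => rfl) ?_ ?_ ?_ le_rfl)
    ?_ ?_
  · have : 2 ^ 3 ≤ 2 ^ b := by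
      by_contra h'
      omega
    omega
  · have g : ∀ a, a ≠ 41 → (τ₅.set 41 0 0) a = τ₅ a := fun a ha => Mem.set_ne _ _ _ ha
    refine ⟨c₅.congr fun a _ _ _ => g a (by omega), t₅.congr (g 6 (by decide)) fun x hx => by
      rw [g 4 (by decide)]; exact t₅.slot hx, fun x hx => ?_, ?_, ?_, ?_⟩
    · rw [Free, g 4 (by decide), g 6 (by decide), f₅ 4 (by decide), f₅ 6 (by decide)] at hx
      obtain ⟨i, hi, e⟩ := td x hx
      exact ⟨i, by omega, hi, e⟩
    · rw [g 7 (by decide)]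
      omega
    · rw [g 8 (by decide)]
      omega
    · rw [g 10 (by decide)]
      omega
  · intro j hj τ _ fr hτ ⟨i₁, i₂, i₃, i₄, i₅, i₆⟩
    have t40 : τ 40 = τ₅ 40 := fr 40 (by decide) (by decide)
    have done : ∀ τ' : Mem, Core τ' n A' → Trip τ' A' →
        (∀ x, Free τ' x → ∃ i, j + 1 ≤ i ∧ i < 6 ∧ τ₅ 40 i = x) → τ' 7 0 ≤ σ 7 0 + j + 1 →
        τ' 8 0 ≤ σ 8 0 + 2 + 2 * j + 2 → τ' 10 0 ≤ σ 10 0 + 2 + 2 * j + 2 →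
        Core (τ'.set 41 0 (j + 1)) n A' ∧ Trip (τ'.set 41 0 (j + 1)) A' ∧
        (∀ x, Free (τ'.set 41 0 (j + 1)) x → ∃ i, j + 1 ≤ i ∧ i < 6 ∧ τ₅ 40 i = x) ∧
        (τ'.set 41 0 (j + 1)) 7 0 ≤ σ 7 0 + (j + 1) ∧
        (τ'.set 41 0 (j + 1)) 8 0 ≤ σ 8 0 + 2 + 2 * (j + 1) ∧
        (τ'.set 41 0 (j + 1)) 10 0 ≤ σ 10 0 + 2 + 2 * (j + 1) := by
      intro τ' q₁ q₂ q₃ q₄ q₅ q₆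
      have g : ∀ a, a ≠ 41 → (τ'.set 41 0 (j + 1)) a = τ' a := fun a ha => Mem.set_ne _ _ _ ha
      refine ⟨q₁.congr fun a _ _ _ => g a (by omega), q₂.congr (g 6 (by decide)) fun x hx => by
        rw [g 4 (by decide)]; exact q₂.slot hx, fun x hx => q₃ x ?_, ?_, ?_, ?_⟩
      · rwa [Free, g 4 (by decide), g 6 (by decide)] at hx
      · rw [g 7 (by decide)]
        omega
      · rw [g 8 (by decide)]
        omega
      · rw [g 10 (by decide)]
        omega
    have skip' : ¬ Free τ (τ₅ 40 j) → ∀ x, Free τ x → ∃ i, j + 1 ≤ i ∧ i < 6 ∧ τ₅ 40 i = x := by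
      intro hnf x hx
      obtain ⟨i, h₁, h₂, rfl⟩ := i₃ x hx
      refine ⟨i, ?_, h₂, rfl⟩
      rcases h₁.eq_or_lt with rfl | h₁
      · exact (hnf hx).elim
      · exact h₁
    refine Tri.ite (B₁ := 59990 + σ 10 0 * 4000) (by decide) (fun hs => ?_) (fun hs => ?_)
      (by simp [Expr.cost, Expr.var]; omega)
    · simp only [Expr.eval_cell, Expr.eval_var, hτ, t40] at hs
      refine Tri.ite (B₁ := 59980 + σ 10 0 * 4000) (by decide) (fun hx => ?_) (fun hx => ?_)
        (by simp [Expr.cost, Expr.var]; omega)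
      · simp only [Expr.eval_cell, Expr.eval_var, hτ, t40] at hx
        exact (Tri.skip (done τ i₁ i₂ (skip' fun h' => hx h'.2) (by omega) (by omega)
          (by omega))).conseq (by omega) fun _ _ _ => id
      · simp only [Expr.eval_cell, Expr.eval_var, hτ, t40] at hx
        refine Tri.seq (B₁ := 10) (B₂ := 59900 + σ 10 0 * 4000)
          (Q₁ := fun τ' => τ' = τ.set 34 0 (τ₅ 40 j)) (Tri.exec (by decide) (by decide)
          (fun _ _ => by simp) fun _ _ => by simp [hτ, t40]) ?_ (by omega)
        rintro _ - - rfl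
        have g : ∀ a, a ≠ 34 → (τ.set 34 0 (τ₅ 40 j)) a = τ a := fun a ha => Mem.set_ne _ _ _ ha
        have g34 : (τ.set 34 0 (τ₅ 40 j)) 34 0 = τ₅ 40 j := by simp [Mem.set_apply]
        have gF : ∀ x, Free (τ.set 34 0 (τ₅ 40 j)) x ↔ Free τ x := fun x => by
          rw [Free, Free, g 4 (by decide), g 6 (by decide)]
        have := resolve_spec (w := w) (b := b) (i₁.congr fun a _ _ _ => g a (by omega) :
          Core (τ.set 34 0 (τ₅ 40 j)) n A') (i₂.congr (g 6 (by decide)) fun x hx => by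
          rw [g 4 (by decide)]; exact i₂.slot hx) (by rw [g34, gF]; exact ⟨hs, hx⟩) hn
          (by rw [g 7 (by decide)]; omega) (by rw [g 8 (by decide)]; omega)
        rw [g34, g 7 (by decide), g 8 (by decide), g 10 (by decide)] at this
        refine this.conseq (by omega) fun τ' _ _ ⟨q₁, q₂, q₃, q₄, q₅, q₆⟩ =>
          done τ' q₁ q₂ (fun x hx => ?_) (by omega) (by omega) (by omega)
        obtain ⟨hx', hne⟩ := q₃ x hx
        obtain ⟨i, h₁, h₂, rfl⟩ := i₃ x ((gF x).1 hx')
        refine ⟨i, ?_, h₂, rfl⟩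
        rcases h₁.eq_or_lt with rfl | h₁
        · exact (hne rfl).elim
        · exact h₁
    · simp only [Expr.eval_cell, Expr.eval_var, hτ, t40] at hs
      exact (Tri.skip (done τ i₁ i₂ (skip' fun h' => h'.1 hs) (by omega) (by omega)
        (by omega))).conseq (by omega) fun _ _ _ => id
  · simp only [Expr.cost]
    omega
  · rintro τ _ _ ⟨q₁, q₂, q₃, q₄, q₅, -⟩
    refine ⟨q₁, q₂, fun x hx => ?_, by omega, by omega⟩
    obtain ⟨i, h₁, h₂, -⟩ := q₃ x hx
    omega

end RAM


namespace ClusterDeletion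

open RAM

/-! ### Cluster vertex deletions and induced paths -/

/-- Without induced paths on three vertices, adjacency is transitive on distinct vertices, so the
ends of a walk are adjacent by induction on the walk. -/
theorem isClusterGraph_iff {V : Type*} (G : SimpleGraph V) :
    IsClusterGraph G ↔ ∀ c a b, G.Adj c a → G.Adj c b → a ≠ b → G.Adj a b := by
  refine ⟨fun h c a b h₁ h₂ hab => h a b (h₁.symm.reachable.trans h₂.reachable) hab, fun h u v => ?_⟩
  rintro ⟨p⟩ huv
  induction p with
  | nil => exact (huv rfl).elim
  | @cons u w v hadj p ih =>
    by_cases hwv : w = v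
    · exact hwv ▸ hadj
    · exact h w u v hadj.symm (ih hwv) huv

theorem isCVD_iff {n : ℕ} (G : SimpleGraph (Fin n)) (S : Finset (Fin n)) :
    IsCVD G S ↔ ∀ c a b, c ∉ S → a ∉ S → b ∉ S → G.Adj c a → G.Adj c b → a ≠ b → G.Adj a b := by
  rw [IsCVD, isClusterGraph_iff]
  constructor
  · intro h c a b hc ha hb h₁ h₂ hab
    exact h ⟨c, hc⟩ ⟨a, ha⟩ ⟨b, hb⟩ h₁ h₂ (by simpa using hab)
  · rintro h ⟨c, hc⟩ ⟨a, ha⟩ ⟨b, hb⟩ h₁ h₂ hab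
    exact h c a b hc ha hb h₁ h₂ (by simpa using hab)

theorem cvd_le {n : ℕ} {G : SimpleGraph (Fin n)} {S : Finset (Fin n)} (h : IsCVD G S) :
    cvd G ≤ S.card := Nat.sInf_le ⟨S, h, rfl⟩

theorem exists_isMinCVD {n : ℕ} (G : SimpleGraph (Fin n)) : ∃ S, IsMinCVD G S := by
  obtain ⟨S, h₁, h₂⟩ := Nat.sInf_mem (s := {s | ∃ S : Finset (Fin n), IsCVD G S ∧ S.card = s})
    ⟨_, _, isCVD_univ G, rfl⟩
  exact ⟨S, h₁, h₂⟩

/-- The graph `G` on the natural numbers. -/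
def natGraph {n : ℕ} (G : SimpleGraph (Fin n)) : SimpleGraph ℕ where
  Adj u v := ∃ (hu : u < n) (hv : v < n), G.Adj ⟨u, hu⟩ ⟨v, hv⟩
  symm := ⟨fun _ _ ⟨hu, hv, h⟩ => ⟨hv, hu, h.symm⟩⟩
  loopless := ⟨fun _ ⟨_, _, h⟩ => h.ne rfl⟩

theorem natGraph_adj {n : ℕ} {G : SimpleGraph (Fin n)} {u v : Fin n} :
    (natGraph G).Adj u v ↔ G.Adj u v := ⟨fun ⟨_, _, h⟩ => h, fun h => ⟨u.2, v.2, h⟩⟩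

/-- A solution that is a union of disjoint triples is 3-approximate. -/
theorem card_le_of_trip {n : ℕ} {G : SimpleGraph (Fin n)} {σ : Mem} (ht : Trip σ (natGraph G))
    {X S : Finset (Fin n)} (hX : ∀ v ∈ X, σ 6 (v : ℕ) ≠ 0) (hS : IsCVD G S) :
    X.card ≤ 3 * S.card := by
  classical
  rw [isCVD_iff] at hS
  set X' := X.map Fin.valEmbedding
  set S' := S.map Fin.valEmbedding with hS'
  -- In a triple linked from `x` to `y` to `z` and back, some member lies in `S'`. Hence `x` is in
  -- `S'`, or it is reached from `S'` by one or two links. These three sets have at most the size of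
  -- `S'` each.
  have hsub : X' ⊆ S' ∪ S'.image (fun s => σ 6 s - 1) ∪ S'.image (fun s => σ 6 (σ 6 s - 1) - 1) := by
    intro x hx
    obtain ⟨v, hv, rfl⟩ := Finset.mem_map.1 hx
    obtain ⟨y, z, -, h₁, h₂, h₃, hT⟩ := ht _ (hX v hv)
    simp only [Fin.valEmbedding_apply] at *
    have key : ∀ {c a b : ℕ}, IsPath3 (natGraph G) c a b → c ∈ S' ∨ a ∈ S' ∨ b ∈ S' := by
      rintro c a b ⟨⟨hc, ha, p₁⟩, ⟨_, hb, p₂⟩, p₃, p₄⟩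
      by_contra hno
      simp only [not_or, hS', Finset.mem_map, Fin.valEmbedding_apply, not_exists, not_and] at hno
      refine p₄ ⟨ha, hb, hS ⟨c, hc⟩ ⟨a, ha⟩ ⟨b, hb⟩ (fun h => hno.1 _ h rfl)
        (fun h => hno.2.1 _ h rfl) (fun h => hno.2.2 _ h rfl) p₁ p₂ (by simpa using p₃)⟩
    have : (v : ℕ) ∈ S' ∨ y ∈ S' ∨ z ∈ S' := by
      rcases hT with h | h | h <;> have := key h <;> tauto
    simp only [Finset.mem_union, Finset.mem_image]
    rcases this with h | h | h
    · exact .inl (.inl h)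
    · exact .inr ⟨y, h, by simp [h₂, h₃]⟩
    · exact .inl (.inr ⟨z, h, by simp [h₃]⟩)
  have := Finset.card_le_card hsub
  have h₁ := Finset.card_union_le (S' ∪ S'.image (fun s => σ 6 s - 1))
    (S'.image (fun s => σ 6 (σ 6 s - 1) - 1))
  have h₂ := Finset.card_union_le S' (S'.image (fun s => σ 6 s - 1))
  have h₃ : (S'.image (fun s => σ 6 s - 1)).card ≤ S'.card := Finset.card_image_le
  have h₄ : (S'.image (fun s => σ 6 (σ 6 s - 1) - 1)).card ≤ S'.card := Finset.card_image_le
  have h₅ : X'.card = X.card := Finset.card_map _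
  have h₆ : S'.card = S.card := Finset.card_map _
  omega

/-! ### The representation -/

/-- The number of bits of the stored values. -/
def bits (n T : ℕ) : ℕ := 12 * Nat.log 2 (n + T + 2)

theorem le_bits (n T : ℕ) : 12 ≤ bits n T := by
  have : 1 ≤ Nat.log 2 (n + T + 2) := Nat.log_pos (by norm_num) (by omega)
  unfold bits
  omega

/-- Doubling the logarithm makes up for its rounding, so a sixth power fits into 12 logarithms.
Queries need this room, since the bound on their edge counter is cubic in `n`. -/
theorem pow_lt_bits (n T : ℕ) : (n + T + 2) ^ 6 < 2 ^ bits n T := by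
  have h1 : 1 ≤ Nat.log 2 (n + T + 2) := Nat.log_pos (by norm_num) (by omega)
  have h2 : n + T + 2 < 2 ^ (Nat.log 2 (n + T + 2) + 1) := Nat.lt_pow_succ_log_self (by norm_num) _
  have h3 : n + T + 2 < 2 ^ (2 * Nat.log 2 (n + T + 2)) :=
    h2.trans_le (Nat.pow_le_pow_right (by norm_num) (by omega))
  calc (n + T + 2) ^ 6 < (2 ^ (2 * Nat.log 2 (n + T + 2))) ^ 6 :=
        Nat.pow_lt_pow_left h3 (by norm_num)
    _ = 2 ^ bits n T := by rw [← pow_mul, bits]; congr 1; ring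

theorem mul_lt_bits (n T : ℕ) : 32 * (n + T + 2) < 2 ^ bits n T := by
  refine lt_of_le_of_lt ?_ (pow_lt_bits n T)
  have : 2 ^ 5 ≤ (n + T + 2) ^ 5 := Nat.pow_le_pow_left (by omega) 5
  rw [pow_succ (n + T + 2) 5]
  exact Nat.mul_le_mul_right _ (by omega)

theorem bits_mono {n T T' : ℕ} (h : T ≤ T') : bits n T ≤ bits n T' :=
  Nat.mul_le_mul_left _ (Nat.log_mono_right (by omega))

/-- The representation relation of the data structure. -/
structure Repr (n T : ℕ) (G : SimpleGraph (Fin n)) (X : Finset (Fin n)) (ℓ : Fin n → ℕ) (σ : Mem) :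
    Prop where
  core : Core σ n (natGraph G)
  trip : Trip σ (natGraph G)
  not_free : ∀ x, ¬ Free σ x
  mem : ∀ v : Fin n, v ∈ X ↔ σ 4 v ≠ 0
  label : ∀ v : Fin n, v ∉ X → ℓ v = σ 5 v
  nlab : σ 7 0 ≤ n + 16 * T
  nslot : σ 8 0 ≤ n + 16 * T + 1
  bd : Bd (bits n T) σ
  zero : ∀ a, a = 60 ∨ a = 61 ∨ 80 ≤ a → ∀ i, σ a i = 0

namespace Repr

variable {n T : ℕ} {G : SimpleGraph (Fin n)} {X : Finset (Fin n)} {ℓ : Fin n → ℕ} {σ : Mem}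

theorem congr (h : Repr n T G X ℓ σ) {σ' : Mem} (hb : Bd (bits n T) σ')
    (he : ∀ a, 2 ≤ a → a ≤ 21 → σ' a = σ a) (hz : ∀ a, a = 60 ∨ a = 61 ∨ 80 ≤ a → ∀ i, σ' a i = 0) :
    Repr n T G X ℓ σ' where
  core := h.core.congr fun a h₁ h₂ _ => he a h₁ h₂
  trip := h.trip.congr (he 6 (by decide) (by decide)) fun x hx => by
    rw [he 4 (by decide) (by decide)]
    exact h.trip.slot hx
  not_free x := by
    rw [Free, he 4 (by decide) (by decide), he 6 (by decide) (by decide)]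
    exact h.not_free x
  mem v := by rw [he 4 (by decide) (by decide), h.mem]
  label v hv := by rw [he 5 (by decide) (by decide), h.label v hv]
  nlab := by rw [he 7 (by decide) (by decide)]; exact h.nlab
  nslot := by rw [he 8 (by decide) (by decide)]; exact h.nslot
  bd := hb
  zero := hz

theorem nxt_ne (h : Repr n T G X ℓ σ) : ∀ v ∈ X, σ 6 (v : ℕ) ≠ 0 := fun v hv h0 =>
  h.not_free v ⟨(h.mem v).1 hv, h0⟩

theorem xlen (h : Repr n T G X ℓ σ) : σ 10 0 = X.card := by
  rw [SparseSet.len_eq_card h.core.sol (X.map Fin.valEmbedding) fun v => ?_, Finset.card_map]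
  simp only [Finset.mem_map, Fin.valEmbedding_apply]
  constructor
  · intro hv
    exact ⟨⟨v, (h.core.slot v hv).1⟩, (h.mem _).2 hv, rfl⟩
  · rintro ⟨u, hu, rfl⟩
    exact (h.mem u).1 hu

theorem card_le (h : Repr n T G X ℓ σ) : X.card ≤ 3 * cvd G := by
  obtain ⟨S, h₁, h₂⟩ := exists_isMinCVD G
  rw [← h₂]
  exact card_le_of_trip h.trip h.nxt_ne h₁

theorem slot_zero (h : Repr n T G X ℓ σ) {v : Fin n} (hv : v ∉ X) : σ 4 (v : ℕ) = 0 := by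
  by_contra h'
  exact hv ((h.mem v).2 h')

theorem adj_iff (h : Repr n T G X ℓ σ) {u v : Fin n} (hu : u ∉ X) (hv : v ∉ X) (huv : u ≠ v) :
    G.Adj u v ↔ ℓ u = ℓ v := by
  rw [h.label u hu, h.label v hv, ← h.core.clique u v u.2 v.2 (h.slot_zero hu) (h.slot_zero hv)
    (by simpa [Fin.ext_iff] using huv), natGraph_adj]

end Repr

/-- Outside of the solution, distinct vertices are adjacent exactly if their labels agree. So
adjacency is transitive there, and labels are constant along walks. -/
theorem contentSpec_repr : ContentSpec @Repr := by
  intro n T G X ℓ σ h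
  refine ⟨⟨?_, h.card_le⟩, fun u v => ⟨fun e => ?_, ?_⟩⟩
  · rw [isCVD_iff]
    intro c a b hc ha hb h₁ h₂ hab
    rw [h.adj_iff ha hb hab, ← (h.adj_iff hc ha h₁.ne).1 h₁, (h.adj_iff hc hb h₂.ne).1 h₂]
  · by_cases huv : u = v
    · exact huv ▸ .rfl
    · exact SimpleGraph.Adj.reachable ((h.adj_iff u.2 v.2 (fun e => huv (Subtype.ext e))).2 e)
  · rintro ⟨p⟩
    induction p with
    | nil => rfl
    | @cons u w v hadj p ih =>
      rw [← ih]
      exact (h.adj_iff u.2 w.2 (fun e => hadj.ne (Subtype.ext e))).1 hadj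

/-- Set-up for the edgeless graph. -/
def setUp : Cmd := .seq (.assign 2 (.const 0) (.var 0))
  (.seq (.forLoop 41 (.var 2) (.block [.assign 5 (.var 41) (.var 41),
    .assign 13 (.var 41) (.const 1), .assign 14 (.pr (.var 41) (.const 0)) (.var 41)]))
  (.block [.assign 7 (.const 0) (.var 2), .assign 8 (.const 0) (.const 1)]))

/-- In the edgeless graph every vertex is a cluster of its own and serves as its own label. Zero
memory is already correct for the adjacency matrix, the solution, the positions in the clusters and
all slots. -/
theorem initSpec_repr {C : ℕ} (hC : 1000 ≤ C) : InitSpec @Repr C setUp := by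
  intro n w hw
  set σ := Mem.zero.load [n] with hσ
  have h0 : σ 0 0 = n := rfl
  have hz : ∀ a, a ≠ 0 → ∀ i, σ a i = 0 := fun a ha i => by simp [hσ, Mem.load, ha, Mem.zero]
  have hn : 32 * (n + 0 + 2) < 2 ^ bits n 0 := mul_lt_bits n 0
  have hb : Bd (bits n 0) σ := fun a i => by
    by_cases ha : a = 0
    · subst ha
      rcases i with _ | i
      · rw [h0]; omega
      · simp [hσ, Mem.load, Mem.zero]
    · rw [hz a ha]; omega
  have hbits : 16 * bits n 0 ≤ w := by
    unfold bits
    have : 1000 * Nat.log 2 (n + 2) ≤ C * Nat.log 2 (n + 2) := Nat.mul_le_mul_right _ hC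
    rw [add_zero]
    omega
  have tri : Tri w (bits n 0) setUp σ (200 + n * 200) (fun τ =>
      τ 2 0 = n ∧ (∀ i, τ 5 i = if i < n then i else 0) ∧ (∀ i, τ 13 i = if i < n then 1 else 0) ∧
      (∀ i < n, τ 14 (pr i 0) = i) ∧ τ 7 0 = n ∧ τ 8 0 = 1) := by
    refine Tri.seq (B₁ := 10) (B₂ := 190 + n * 200) (Q₁ := fun τ => τ 2 0 = n)
      (Tri.exec (by decide) (by decide) (fun _ _ => by simp) fun _ _ => by
        simp [Mem.set_apply, h0]) ?_ (by omega)
    intro τ _ fr h2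
    refine Tri.seq (B₁ := 20 + n * 100) (B₂ := 50) (Q₁ := fun τ' =>
        (∀ i, τ' 5 i = if i < n then i else 0) ∧ (∀ i, τ' 13 i = if i < n then 1 else 0) ∧
        (∀ i < n, τ' 14 (pr i 0) = i)) (Tri.forLoop n (fun j τ' =>
        (∀ i, τ' 5 i = if i < j then i else 0) ∧ (∀ i, τ' 13 i = if i < j then 1 else 0) ∧
        (∀ i < j, τ' 14 (pr i 0) = i)) (B₁ := 50) (by decide) (by decide)
        (fun j τ' f _ => by simp [f 2 (by decide) (by decide), h2]) (by omega) ?_ ?_ ?_) ?_ (by omega)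
    · have e : ∀ a, a = 5 ∨ a = 13 → ∀ i, τ a i = 0 := fun a ha i => by
        rw [fr a (by rcases ha with rfl | rfl <;> decide), hz a (by omega)]
      exact ⟨fun i => by simp [Mem.set_apply, e], fun i => by simp [Mem.set_apply, e],
        fun i hi => by omega⟩
    · intro j hj τ' _ f hτ' ⟨i₁, i₂, i₃⟩
      refine Tri.exec (by decide) (by decide) (fun _ _ => by simp) fun _ _ => ?_
      refine ⟨fun i => ?_, fun i => ?_, fun i hi => ?_⟩
      · simp only [Cmd.exec_cons, Cmd.exec_nil, Cmd.exec_assign, Mem.set_apply, Expr.eval_var, hτ']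
        simp [i₁]
        by_cases hij : i = j
        · simp [hij]
        · simp [hij, show i ≤ j ↔ i < j by omega]
      · simp only [Cmd.exec_cons, Cmd.exec_nil, Cmd.exec_assign, Mem.set_apply, Expr.eval_var, hτ']
        simp [i₂, Mem.set_apply, hτ']
        by_cases hij : i = j
        · simp [hij]
        · simp [hij, show i ≤ j ↔ i < j by omega]
      · simp [Mem.set_apply, hτ']
        by_cases hij : i = j
        · simp [hij]
        · simp [hij, i₃ i (by omega)]
    · simp only [Expr.cost, Expr.var]
      omega
    · rintro τ' - f ⟨i₁, i₂, i₃⟩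
      have e2 : τ' 2 0 = n := by rw [f 2 (by decide), h2]
      refine Tri.exec (by decide) (by decide) (fun _ _ => by simp) fun _ f' => ?_
      refine ⟨?_, ?_, ?_, ?_, ?_, ?_⟩
      · rw [f' 2 (by decide), e2]
      · rwa [f' 5 (by decide)]
      · rwa [f' 13 (by decide)]
      · rwa [f' 14 (by decide)]
      · simp [Mem.set_apply, e2]
      · simp [Mem.set_apply]
  obtain ⟨t, τ, r, ht, hbd, fr, h2, h5, h13, h14, h7, h8⟩ :=
    tri ((le_bits n 0).trans' (by norm_num)) hbits hb
  have z : ∀ a, a ∉ [0, 2, 5, 7, 8, 13, 14, 41] → ∀ i, τ a i = 0 := fun a ha i => by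
    simp only [List.mem_cons, List.not_mem_nil, or_false, not_or] at ha
    rw [fr a (by simp [setUp, Cmd.forLoop, Cmd.block, Cmd.mods, ha]), hz a ha.1]
  have z4 := z 4 (by decide)
  refine ⟨t, τ, ∅, fun v => v, r, ht.trans ?_, ?_⟩
  · calc 200 + n * 200 ≤ (n + 2) * 2 ^ 9 := by omega
      _ ≤ (n + 2) * (n + 2) ^ 9 := Nat.mul_le_mul_left _ (Nat.pow_le_pow_left (by omega) _)
      _ = (n + 2) ^ 10 := by ring
      _ ≤ (n + 2) ^ C := Nat.pow_le_pow_right (by omega) (by omega)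
  · refine ⟨?_, fun x hx => ?_, fun x hx => ?_, fun v => ?_, fun v _ => ?_, by omega, by omega, hbd,
      fun a ha => z a (by simp; omega)⟩
    · constructor
      · exact h2
      · intro u v
        rw [z 3 (by decide)]
        simp [natGraph]
      · rintro u v ⟨hu, -⟩
        exact hu
      · exact fun v hv => (hv (z4 v)).elim
      · exact fun v _ hv => (hv (z4 v)).elim
      · omega
      · rw [Holds, z 10 (by decide)]
        exact ⟨fun i hi => by omega, fun v hv => (hv (z4 v)).elim⟩
      · intro l
        rw [Holds, h13]
        refine ⟨fun i hi => ?_, fun v ⟨hv, _, e⟩ => ?_⟩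
        · split at hi
          · obtain rfl : i = 0 := by omega
            rw [h14 l ‹_›, z4, h5, if_pos ‹_›, z 15 (by decide)]
            simp [*]
          · omega
        · rw [h5, if_pos hv] at e
          subst e
          rw [z 15 (by decide), if_pos hv, h14 v hv]
          simp
      · intro v hv _
        rw [h5, if_pos hv, h7]
        exact hv
      · intro u v hu hv _ _ huv
        rw [h5, h5, if_pos hu, if_pos hv]
        simp [natGraph, huv]
      · exact fun v hv => (hv (z4 v)).elim
      · intro s _
        simp [Fresh, z 16 (by decide), z 19 (by decide), z 20 (by decide), z 21 (by decide)]
    · exact (hx (z 6 (by decide) x)).elim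
    · exact hx.1 (z4 x)
    · simp [z4]
    · rw [h5, if_pos v.2]

/-- A common proof for insertion, with `c = 1`, and removal, with `c = 0`. The running time is
linear in `X.card`, which is at most `3 * k`. -/
theorem updateSpec_repr {C c : ℕ} (hC : 1000000 ≤ C) (hc : c < 2)
    (op : {n : ℕ} → Fin n → Fin n → SimpleGraph (Fin n) → SimpleGraph (Fin n))
    (hop : ∀ {n : ℕ} (G : SimpleGraph (Fin n)) (u v : Fin n), u ≠ v → ∀ x y,
      (op u v G).Adj x y ↔ if (x = u ∧ y = v) ∨ (x = v ∧ y = u) then c ≠ 0 else G.Adj x y) :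
    UpdateSpec @Repr C (update c) op := by
  intro n T G X ℓ σ h u v huv w hw k hk
  -- The new state is measured with `T + 1`. This raises the logarithm by at most one, and the
  -- logarithm is at least one.
  have hlog : Nat.log 2 (n + T + 3) ≤ Nat.log 2 (n + T + 2) + 1 := by
    have := Nat.log_mono_right (b := 2) (show n + T + 3 ≤ (n + T + 2) * 2 by omega)
    rwa [Nat.log_mul_base (by norm_num) (by omega)] at this
  have h1 : 1 ≤ Nat.log 2 (n + T + 2) := Nat.log_pos (by norm_num) (by omega)
  have hb : 16 * bits n (T + 1) ≤ w := by
    have : 1000000 * Nat.log 2 (n + T + 2) ≤ C * Nat.log 2 (n + T + 2) := Nat.mul_le_mul_right _ hC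
    unfold bits
    rw [show n + (T + 1) + 2 = n + T + 3 by ring]
    omega
  have hN := mul_lt_bits n (T + 1)
  set σ₁ := σ.load [u.val, v.val] with hσ₁
  have l0 : σ₁ 0 0 = u := rfl
  have l1 : σ₁ 0 1 = v := rfl
  have l : ∀ a, a ≠ 0 → σ₁ a = σ a := fun a ha => by
    funext i
    simp [hσ₁, Mem.load, ha]
  have hb₁ : Bd (bits n (T + 1)) σ₁ := fun a i => by
    by_cases h0 : a = 0
    · subst h0
      rcases i with _ | _ | i
      · rw [l0]; omega
      · rw [l1]; omega
      · exact (h.bd.mono (bits_mono (Nat.le_succ T))) 0 (i + 2)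
    · rw [l a h0]
      exact (h.bd.mono (bits_mono (Nat.le_succ T))) a i
  have hnl := h.nlab
  have hns := h.nslot
  have tri := update_spec (w := w) (b := bits n (T + 1)) (A' := natGraph (op u v G)) hc
    (h.core.congr fun a _ _ _ => l a (by omega) : Core σ₁ n _) (h.trip.congr (l 6 (by decide)) fun x hx => by
      rw [l 4 (by decide)]; exact h.trip.slot hx)
    (fun x => by rw [Free, l 4 (by decide), l 6 (by decide)]; exact h.not_free x)
    (by rw [l0]; exact u.2) (by rw [l1]; exact v.2)
    (fun x y => by
      rw [l0, l1]
      by_cases hx : x < n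
      · by_cases hy : y < n
        · have := hop G u v huv ⟨x, hx⟩ ⟨y, hy⟩
          simp only [Fin.ext_iff] at this
          simpa [natGraph, hx, hy] using this
        · rw [if_neg (fun e => by have := u.2; have := v.2; omega)]
          simp [natGraph, hy]
      · rw [if_neg (fun e => by have := u.2; have := v.2; omega)]
        simp [natGraph, hx])
    (by omega) (by rw [l 7 (by decide)]; omega) (by rw [l 8 (by decide)]; omega)
  obtain ⟨t, σ', r, ht, hbd, fr, c', t', f', n₇, n₈⟩ :=
    tri ((le_bits n _).trans' (by norm_num)) hb hb₁
  rw [l 7 (by decide)] at n₇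
  rw [l 8 (by decide)] at n₈
  classical
  refine ⟨t, σ', Finset.univ.filter fun v => σ' 4 v ≠ 0, fun v => σ' 5 v, r, ht.trans ?_,
    ⟨c', t', f', fun v => by simp, fun _ _ => rfl, by omega, by omega, hbd, fun a ha i => ?_⟩⟩
  · rw [l 10 (by decide), h.xlen]
    have h3 := h.card_le
    have hk1 : 1 ≤ k := by omega
    have hk2 : cvd G ≤ k := by omega
    have hk8 : k ≤ k ^ 8 := Nat.le_self_pow (by norm_num) k
    calc 400000 + X.card * 40000 ≤ 1000000 * k ^ 8 := by omega
      _ ≤ C * (k ^ 8 + k ^ 2 * Nat.log 2 n) := Nat.mul_le_mul hC (by omega)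
  · have : ∀ a ∈ (update c).mods, a < 60 := by
      -- The list of modified arrays does not depend on the constant that is written, so one
      -- evaluation covers both values of `c`.
      have : ∀ a ∈ (update 0).mods, a < 60 := by decide +kernel
      exact this
    rw [fr a (fun hm => by have := this a hm; omega), l a (by omega), h.zero a ha]

theorem addEdge_adj {n : ℕ} (G : SimpleGraph (Fin n)) (u v : Fin n) (huv : u ≠ v) (x y : Fin n) :
    (addEdge u v G).Adj x y ↔
      if (x = u ∧ y = v) ∨ (x = v ∧ y = u) then (1 : ℕ) ≠ 0 else G.Adj x y := by
  rw [addEdge, SimpleGraph.sup_adj, SimpleGraph.edge_adj]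
  split_ifs with h
  · rcases h with ⟨rfl, rfl⟩ | ⟨rfl, rfl⟩
    · simp [huv]
    · simp [huv.symm]
  · tauto

theorem removeEdge_adj {n : ℕ} (G : SimpleGraph (Fin n)) (u v : Fin n) (_ : u ≠ v) (x y : Fin n) :
    (removeEdge u v G).Adj x y ↔
      if (x = u ∧ y = v) ∨ (x = v ∧ y = u) then (0 : ℕ) ≠ 0 else G.Adj x y := by
  rw [removeEdge, SimpleGraph.deleteEdges_adj]
  simp only [Set.mem_singleton_iff, Sym2.eq_iff]
  split_ifs with h
  · tauto
  · tauto

end ClusterDeletion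


/-! ### Listing the maintained sets -/

namespace ClusterDeletion

open RAM

/-- Output the values of `e` for `41 = 0, 1, ...`, at most `N` of them and at most as many as cell `3`
of the input asks for. -/
def lister (N e : Expr) : Cmd := .seq (.assign 1 (.const 0) (.min (.cell 0 (.const 3)) N))
  (.forLoop 41 (.var 1) (.assign 1 (.var 41 + .const 1) e))

/-- The length of the answer is written first and then serves as the loop bound. The body leaves it
alone, because it writes at positive addresses only. -/
theorem lister_spec {w b m N₀ : ℕ} {N e : Expr} {σ : Mem} {f : ℕ → ℕ} (hN : N.ok = true)
    (hNd : N.deg = 1) (hNc : N.cost ≤ 60) (he : e.ok = true) (hed : e.deg = 1) (hec : e.cost ≤ 300)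
    (hN₀ : N.eval σ = N₀) (hm : σ 0 3 = m)
    (hf : ∀ τ : Mem, (∀ a, a ≠ 1 → a ≠ 41 → τ a = σ a) → τ 41 0 < N₀ → e.eval τ = f (τ 41 0)) :
    Tri w b (lister N e) σ (400 + m * 400) (fun τ =>
      τ.Output ((List.range (min m N₀)).map f)) := by
  have v : ∀ τ : Mem, (∀ i, i < min m N₀ → τ 1 (i + 1) = f i) → τ 1 0 = min m N₀ →
      τ.Output ((List.range (min m N₀)).map f) := fun τ h h0 => by
    refine ⟨by simpa using h0, fun i hi => ?_⟩
    simp only [List.length_map, List.length_range] at hi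
    simp [h i hi]
  have hcost : N.cost ≤ 60 := hNc
  refine Tri.of_bd fun hb hσ => ?_
  have hmb : m < 2 ^ b := hm ▸ hσ 0 3
  refine Tri.seq (B₁ := 200) (B₂ := 200 + m * 400) (Q₁ := fun τ => τ = σ.set 1 0 (min m N₀))
    (Tri.exec ?_ ?_ (fun _ _ => ?_) fun _ _ => ?_) ?_ (by omega)
  · have : (Expr.min (.cell 0 (.const 3)) N).ok = true := by
      change ((true && ((true && N.ok) && decide (max 1 N.deg ≤ 16))) &&
        decide (max 1 (max 1 N.deg) ≤ 16)) = true
      simp [hN, hNd]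
    simp [Cmd.wf, this, Expr.ok]
  · change 1 + ((2 + (2 + N.cost + 1) + 1)) + 1 ≤ 200
    omega
  · simp [Expr.min, hNd]
  · simp [hN₀, hm]
  rintro _ - - rfl
  refine Tri.conseq (Tri.forLoop (min m N₀) (fun j τ => (∀ i, i < j → τ 1 (i + 1) = f i) ∧
    τ 1 0 = min m N₀) (B₁ := 320) ?_ (by decide) (fun _ _ _ h => h.2) (by omega) ?_ ?_
    le_rfl) ?_ fun τ _ _ h => v τ h.1 h.2
  · simp [Cmd.mods]
  · exact ⟨fun i hi => by omega, by simp [Mem.set_apply]⟩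
  · intro j hj τ _ fr hτ ⟨i₁, i₂⟩
    refine Tri.exec ?_ ?_ (fun _ _ => ?_) fun _ _ => ?_
    · have : (Expr.var 41 + Expr.const 1).ok = true := by decide
      simp [Cmd.wf, this, he]
    · change 4 + e.cost + 1 ≤ 320
      omega
    · simp [hed]
    · have hev : e.eval τ = f j := by
        rw [hf τ (fun a h1 h41 => ?_) (by rw [hτ]; omega), hτ]
        rw [fr a (by simpa [Cmd.mods] using h1) h41, Mem.set_ne _ _ _ h1]
      refine ⟨fun i hi => ?_, ?_⟩
      · simp only [Cmd.exec_assign, Expr.eval_add, Expr.eval_var, Expr.eval_const, hτ, hev,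
          Mem.set_apply]
        by_cases hij : i = j
        · simp [hij]
        · simp [hij, i₁ i (by omega)]
      · simp [Mem.set_apply, hτ, i₂]
  · simp only [Expr.cost, Expr.var]
    have : min m N₀ * (320 + (1 + 1) + 10) ≤ m * 400 := by
      refine Nat.mul_le_mul (min_le_left _ _) (by norm_num)
    omega

theorem outputsSome_of_output {σ : Mem} {m N : ℕ} {f : ℕ → ℕ} {A : Set ℕ}
    (h : σ.Output ((List.range (min m N)).map f)) (hf : ∀ i < N, ∀ j < N, f i = f j → i = j)
    (hA : ∀ a, a ∈ A ↔ ∃ i < N, f i = a) : OutputsSome σ A m := by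
  refine ⟨_, ?_, ?_, ?_, h⟩
  · refine List.Nodup.map_on (fun i hi j hj e => ?_) List.nodup_range
    simp only [List.mem_range] at hi hj
    exact hf i (by omega) j (by omega) e
  · intro a ha
    simp only [List.mem_map, List.mem_range] at ha
    obtain ⟨i, hi, e⟩ := ha
    exact (hA a).2 ⟨i, by omega, e⟩
  · have : A = f '' (Set.Iio N) := by
      ext a
      simp [hA]
    rw [this, Set.InjOn.ncard_image (s := Set.Iio N) (fun i hi j hj e => hf i hi j hj e)]
    simp [Set.ncard_eq_toFinset_card']

/-- Expressions for the key of the tables of vertex `x` and label `l` in the input. -/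
def inputKey : Expr := .pr (.cell 4 (.cell 0 (.const 1))) (.cell 0 (.const 2))

/-- List a maintained set. -/
def reporter : Cmd :=
  .ite (.lt (.var 0) (.const 1)) (lister (.var 10) (.cell 11 (.pr (.const 0) (.var 41))))
  (.ite (.lt (.var 0) (.const 2)) (lister (.const 1) (.cell 5 (.cell 0 (.const 1))))
  (.ite (.lt (.var 0) (.const 3)) (lister (.cell 13 (.cell 0 (.const 2)))
    (.cell 14 (.pr (.cell 0 (.const 2)) (.var 41))))
  (.ite (.lt (.var 0) (.const 4)) (lister (.cell 16 (.cell 4 (.cell 0 (.const 1))))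
    (.cell 17 (.pr (.cell 4 (.cell 0 (.const 1))) (.var 41))))
  (.ite (.lt (.var 0) (.const 5)) (lister (.cell 19 inputKey)
    (.cell 14 (.pr (.cell 0 (.const 2)) (permAt 20 inputKey (.var 41)))))
  (lister (.cell 13 (.cell 0 (.const 2)) - .cell 19 inputKey) (.cell 14 (.pr (.cell 0 (.const 2))
    (permAt 20 inputKey (.cell 19 inputKey + .var 41)))))))))

namespace Repr

variable {n T : ℕ} {G : SimpleGraph (Fin n)} {X : Finset (Fin n)} {ℓ : Fin n → ℕ} {σ : Mem}

theorem label_lt (h : Repr n T G X ℓ σ) {u : Fin n} (hu : u ∉ X) : ℓ u < σ 7 0 := by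
  rw [h.label u hu]
  exact h.core.lab u u.2 (h.slot_zero hu)

theorem solution_iff (h : Repr n T G X ℓ σ) (a : ℕ) :
    a ∈ (Item.solution (n := n)).content G X ℓ ↔ ∃ i < σ 10 0, σ 11 (pr 0 i) = a := by
  rw [← SparseSet.exists_iff h.core.sol a]
  constructor
  · rintro ⟨x, hx, rfl⟩
    exact (h.mem x).1 hx
  · intro ha
    exact ⟨⟨a, (h.core.slot a ha).1⟩, (h.mem _).2 ha, rfl⟩

theorem exists_iff (h : Repr n T G X ℓ σ) (l a : ℕ) :
    (∃ u ∉ X, ℓ u = l ∧ a = u.val) ↔ a < n ∧ σ 4 a = 0 ∧ σ 5 a = l := by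
  constructor
  · rintro ⟨u, hu, hl, rfl⟩
    exact ⟨u.2, h.slot_zero hu, (h.label u hu).symm.trans hl⟩
  · rintro ⟨ha, h0, hl⟩
    have hu : (⟨a, ha⟩ : Fin n) ∉ X := fun hm => (h.mem _).1 hm h0
    exact ⟨⟨a, ha⟩, hu, (h.label _ hu).trans hl, rfl⟩

theorem cluster_iff (h : Repr n T G X ℓ σ) (l a : ℕ) :
    a ∈ (Item.cluster (n := n) l).content G X ℓ ↔ ∃ i < σ 13 l, σ 14 (pr l i) = a := by
  rw [← SparseSet.exists_iff (h.core.clu l) a]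
  exact h.exists_iff l a

theorem cnt_ne_zero_iff (h : Repr n T G X ℓ σ) {x : Fin n} (hx : x ∈ X) (l : ℕ) :
    σ 19 (pr (σ 4 x) l) ≠ 0 ↔ ∃ u ∉ X, G.Adj x u ∧ l = ℓ u := by
  have hx' := (h.mem x).1 hx
  obtain ⟨π, -, -, hs⟩ := (h.core.tab x hx').2 l
  have hp : σ 19 (pr (σ 4 x) l) ≠ 0 ↔ ∃ i < σ 13 l, (natGraph G).Adj x (σ 14 (pr l i)) := hs.pos_iff
  rw [hp]
  constructor
  · rintro ⟨i, hi, ha⟩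
    obtain ⟨u, hu, hl, e⟩ := (h.cluster_iff l _).2 ⟨i, hi, rfl⟩
    rw [e] at ha
    exact ⟨u, hu, natGraph_adj.1 ha, hl.symm⟩
  · rintro ⟨u, hu, ha, rfl⟩
    obtain ⟨i, hi, e⟩ := (h.cluster_iff _ _).1 ⟨u, hu, rfl, rfl⟩
    exact ⟨i, hi, by rw [e]; exact natGraph_adj.2 ha⟩

theorem incident_iff (h : Repr n T G X ℓ σ) {x : Fin n} (hx : x ∈ X) (a : ℕ) :
    a ∈ (Item.incident x).content G X ℓ ↔ ∃ i < σ 16 (σ 4 x), σ 17 (pr (σ 4 x) i) = a := by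
  have hx' := (h.mem x).1 hx
  have hL := (h.core.tab x hx').1
  rw [← SparseSet.exists_iff hL a, h.cnt_ne_zero_iff hx]
  exact Iff.rfl

/-- The permutation for a vertex of the solution and a cluster. -/
theorem exists_perm (h : Repr n T G X ℓ σ) {x : Fin n} (hx : x ∈ X) (l : ℕ) :
    ∃ π : Equiv.Perm ℕ, Codes σ 20 (pr (σ 4 x) l) π ∧ (∀ i, π i < σ 13 l ↔ i < σ 13 l) ∧
      σ 19 (pr (σ 4 x) l) ≤ σ 13 l ∧
      (∀ a, a ∈ (Item.pos x l).content G X ℓ ↔ ∃ i < σ 19 (pr (σ 4 x) l), σ 14 (pr l (π i)) = a) ∧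
      ∀ a, a ∈ (Item.neg x l).content G X ℓ ↔
        ∃ i, σ 19 (pr (σ 4 x) l) ≤ i ∧ i < σ 13 l ∧ σ 14 (pr l (π i)) = a := by
  obtain ⟨π, h₁, -, hs⟩ := (h.core.tab x ((h.mem x).1 hx)).2 l
  have hiff : ∀ i < σ 13 l, (i < σ 19 (pr (σ 4 x) l) ↔ (natGraph G).Adj x (σ 14 (pr l (π i)))) :=
    hs.iff
  have main : ∀ a, (∃ u ∉ X, ℓ u = l ∧ a = u.val) ↔ ∃ i < σ 13 l, σ 14 (pr l (π i)) = a := by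
    intro a
    refine (h.cluster_iff l a).trans ⟨fun ⟨i, hi, e⟩ => ⟨π⁻¹ i, (hs.inv_lt_iff i).2 hi, by simpa⟩,
      fun ⟨i, hi, e⟩ => ⟨π i, (hs.lt_iff i).2 hi, e⟩⟩
  refine ⟨π, h₁, hs.lt_iff, hs.le, fun a => ⟨?_, ?_⟩, fun a => ⟨?_, ?_⟩⟩
  · rintro ⟨u, hu, hl, ha, rfl⟩
    obtain ⟨i, hi, e⟩ := (main u).1 ⟨u, hu, hl, rfl⟩
    exact ⟨i, (hiff i hi).2 (by rw [e]; exact natGraph_adj.2 ha), e⟩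
  · rintro ⟨i, hi, e⟩
    have hi' : i < σ 13 l := hi.trans_le hs.le
    obtain ⟨u, hu, hl, rfl⟩ := (main a).2 ⟨i, hi', e⟩
    have := (hiff i hi').1 hi
    rw [e] at this
    exact ⟨u, hu, hl, natGraph_adj.1 this, rfl⟩
  · rintro ⟨u, hu, hl, ha, rfl⟩
    obtain ⟨i, hi, e⟩ := (main u).1 ⟨u, hu, hl, rfl⟩
    refine ⟨i, ?_, hi, e⟩
    by_contra hc
    have := (hiff i hi).1 (by omega)
    rw [e] at this
    exact ha (natGraph_adj.1 this)
  · rintro ⟨i, hc, hi, e⟩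
    obtain ⟨u, hu, hl, rfl⟩ := (main a).2 ⟨i, hi, e⟩
    refine ⟨u, hu, hl, fun ha => ?_, rfl⟩
    have := (hiff i hi).2 (by rw [e]; exact natGraph_adj.2 ha)
    omega

end Repr

theorem reportSpec_repr {C : ℕ} (hC : 1000 ≤ C) : ReportSpec @Repr C reporter := by
  intro n T G X ℓ σ h item hvalid m hm w hw
  have hb : 16 * bits n T ≤ w := by
    have : 1000 * Nat.log 2 (n + T + 2) ≤ C * Nat.log 2 (n + T + 2) := Nat.mul_le_mul_right _ hC
    unfold bits
    omega
  have hN := mul_lt_bits n T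
  have hnl := h.nlab
  set σ₁ := σ.load (item.code ++ [m]) with hσ₁
  have l : ∀ a, a ≠ 0 → σ₁ a = σ a := fun a ha => by
    funext i
    simp [hσ₁, Mem.load, ha]
  -- A label passed as an argument fits because validity makes it the label of an existing cluster.
  have hcode : ∀ c ∈ item.code, c < 2 ^ bits n T := by
    have hl : ∀ {u : Fin n}, u ∉ X → ℓ u < 2 ^ bits n T := fun hu => by
      have := h.label_lt hu
      omega
    have hx : ∀ u : Fin n, u.val < 2 ^ bits n T := fun u => by
      have := u.2
      omega
    have h5 : ∀ c, c ≤ 5 → c < 2 ^ bits n T := by omega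
    rcases item with _ | u | l | x | ⟨x, l⟩ | ⟨x, l⟩ <;>
      simp only [Item.code, List.mem_cons, List.not_mem_nil, or_false] <;> rintro c (rfl | rfl | rfl)
    all_goals first | exact hx _ | (refine h5 _ ?_; omega) | skip
    · obtain ⟨u, hu, rfl⟩ := hvalid
      exact hl hu
    · obtain ⟨_, u, hu, _, rfl⟩ := hvalid
      exact hl hu
    · obtain ⟨_, u, hu, _, rfl⟩ := hvalid
      exact hl hu
  have hb₁ : Bd (bits n T) σ₁ := fun a i => by
    by_cases h0 : a = 0
    · subst h0
      have : σ₁ 0 i = (item.code ++ [m]).getD i (σ 0 i) := rfl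
      rw [this, List.getD_eq_getElem?_getD]
      by_cases hi : i < (item.code ++ [m]).length
      · rw [List.getElem?_eq_getElem hi, Option.getD_some]
        have := List.getElem_mem hi
        rcases List.mem_append.1 this with h' | h'
        · exact hcode _ h'
        · rw [List.mem_singleton.1 h']
          omega
      · rw [List.getElem?_eq_none (by omega), Option.getD_none]
        exact h.bd 0 i
    · rw [l a h0]
      exact h.bd a i
  have a3 : σ₁ 0 3 = m := by
    rcases item with _ | u | l | x | ⟨x, l⟩ | ⟨x, l⟩ <;> rfl
  suffices tri : Tri w (bits n T) reporter σ₁ (500 + m * 400) (fun τ =>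
      OutputsSome τ (item.content G X ℓ) m) by
    obtain ⟨t, σ', r, ht, hbd, fr, ho⟩ := tri ((le_bits n T).trans' (by norm_num)) hb hb₁
    have hmods : ∀ a ∈ reporter.mods, a = 1 ∨ a = 41 := by decide +kernel
    refine ⟨t, σ', r, ht.trans ?_, ho, h.congr hbd (fun a h₁ h₂ => ?_) fun a ha i => ?_⟩
    · calc 500 + m * 400 ≤ 1000 * (m + 1) := by omega
        _ ≤ C * (m + 1) := Nat.mul_le_mul_right _ hC
    · rw [fr a (fun hm => by have := hmods a hm; omega), l a (by omega)]
    · rw [fr a (fun hm => by have := hmods a hm; omega), l a (by omega), h.zero a ha]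
  have step : ∀ {c₁ c₂ : Cmd} {j B : ℕ} {Q : Mem → Prop}, j < 256 →
      (σ₁ 0 0 < j → Tri w (bits n T) c₁ σ₁ B Q) → (¬ σ₁ 0 0 < j → Tri w (bits n T) c₂ σ₁ B Q) →
      Tri w (bits n T) (.ite (.lt (.var 0) (.const j)) c₁ c₂) σ₁ (B + 5) Q := by
    intro c₁ c₂ j B Q hj h₁ h₂
    refine Tri.ite (B₁ := B) ?_ (fun he => h₁ ?_) (fun he => h₂ ?_) ?_
    · change (decide (0 < 256) && decide (j < 256) && decide (1 ≤ 16)) = true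
      simp [hj]
    · by_contra h'
      simp [h'] at he
    · intro h'
      simp [h'] at he
    · simp only [Expr.cost, Expr.lt, Expr.var]
      omega
  have fin : ∀ {N e : Expr} {N₀ : ℕ} {f : ℕ → ℕ}, (N.ok = true ∧ N.deg = 1 ∧ N.cost ≤ 60) →
      (e.ok = true ∧ e.deg = 1 ∧ e.cost ≤ 300) → N.eval σ₁ = N₀ →
      (∀ τ : Mem, (∀ a, a ≠ 1 → a ≠ 41 → τ a = σ₁ a) → τ 41 0 < N₀ → e.eval τ = f (τ 41 0)) →
      (∀ i < N₀, ∀ j < N₀, f i = f j → i = j) →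
      (∀ a, a ∈ item.content G X ℓ ↔ ∃ i < N₀, f i = a) →
      Tri w (bits n T) (lister N e) σ₁ (400 + m * 400) (fun τ =>
        OutputsSome τ (item.content G X ℓ) m) := by
    intro N e N₀ f h₁ h₂ h₃ h₄ h₅ h₆
    exact (lister_spec h₁.1 h₁.2.1 h₁.2.2 h₂.1 h₂.2.1 h₂.2.2 h₃ a3 h₄).conseq le_rfl
      fun τ _ _ ho => outputsSome_of_output ho h₅ h₆
  have e : ∀ {τ : Mem}, (∀ a, a ≠ 1 → a ≠ 41 → τ a = σ₁ a) → ∀ a, a ∉ [0, 1, 41] → τ a = σ a := by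
    intro τ hτ a ha
    simp only [List.mem_cons, List.not_mem_nil, or_false, not_or] at ha
    rw [hτ a ha.2.1 ha.2.2, l a ha.1]
  unfold reporter
  have i0 : ∀ {τ : Mem}, (∀ a, a ≠ 1 → a ≠ 41 → τ a = σ₁ a) → τ 0 = σ₁ 0 := fun hτ =>
    hτ 0 (by decide) (by decide)
  have nb : 16 ≤ 256 := by norm_num
  refine Tri.conseq (B₁ := 400 + m * 400 + 5 + 5 + 5 + 5 + 5) ?_ (by omega) fun _ _ _ => id
  rcases item with _ | u | l' | x | ⟨x, l'⟩ | ⟨x, l'⟩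
  · have k0 : σ₁ 0 0 = 0 := rfl
    refine step (by decide) (fun _ => Tri.conseq (fin (N₀ := σ 10 0) (f := fun i => σ 11 (pr 0 i))
      (by decide) (by decide) ?_ ?_ ?_ ?_) (by omega) fun _ _ _ => id) fun h' => by omega
    · simp [l 10]
    · intro τ hτ _
      simp [e hτ 11 (by decide)]
    · exact fun i hi j hj he => h.core.sol.elt_inj hi hj he
    · exact h.solution_iff
  · have k0 : σ₁ 0 0 = 1 := rfl
    have k1 : σ₁ 0 1 = u := rfl
    refine step (by decide) (fun h' => by omega) fun _ => step (by decide) (fun _ =>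
      Tri.conseq (fin (N₀ := 1) (f := fun _ => σ 5 u) (by decide) (by decide) rfl ?_ ?_ ?_)
      (by omega) fun _ _ _ => id) fun h' => by omega
    · intro τ hτ _
      simp [e hτ 5 (by decide), i0 hτ, k1]
    · intro i hi j hj _
      omega
    · intro a
      have hu : u ∉ X := hvalid
      simp only [Item.content, Set.mem_ofPred_eq, h.label u hu, hu, not_false_iff, true_and]
      exact ⟨fun h => ⟨0, by norm_num, h.symm⟩, fun ⟨_, _, h⟩ => h.symm⟩
  · have k0 : σ₁ 0 0 = 2 := rfl
    have k2 : σ₁ 0 2 = l' := rfl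
    refine step (by decide) (fun h' => by omega) fun _ => step (by decide) (fun h' => by omega)
      fun _ => step (by decide) (fun _ => Tri.conseq (fin (N₀ := σ 13 l')
      (f := fun i => σ 14 (pr l' i)) (by decide) (by decide) ?_ ?_ ?_ ?_)
      (by omega) fun _ _ _ => id) fun h' => by omega
    · simp [l 13, k2]
    · intro τ hτ _
      simp [e hτ 14 (by decide), i0 hτ, k2]
    · exact fun i hi j hj he => (h.core.clu l').elt_inj hi hj he
    · exact h.cluster_iff l'
  · have k0 : σ₁ 0 0 = 3 := rfl
    have k1 : σ₁ 0 1 = x := rfl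
    have hx : x ∈ X := hvalid
    refine step (by decide) (fun h' => by omega) fun _ => step (by decide) (fun h' => by omega)
      fun _ => step (by decide) (fun h' => by omega) fun _ => step (by decide) (fun _ =>
      Tri.conseq (fin (N₀ := σ 16 (σ 4 x)) (f := fun i => σ 17 (pr (σ 4 x) i)) (by decide)
      (by decide) ?_ ?_ ?_ ?_) (by omega) fun _ _ _ => id) fun h' => by omega
    · simp [l 16, l 4, k1]
    · intro τ hτ _
      simp [e hτ 17 (by decide), e hτ 4 (by decide), i0 hτ, k1]
    · exact fun i hi j hj he => (h.core.tab x ((h.mem x).1 hx)).1.elt_inj hi hj he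
    · exact h.incident_iff hx
  · have k0 : σ₁ 0 0 = 4 := rfl
    have k1 : σ₁ 0 1 = x := rfl
    have k2 : σ₁ 0 2 = l' := rfl
    have hx : x ∈ X := hvalid.1
    obtain ⟨π, hπ, hlt, hle, hpos, -⟩ := h.exists_perm hx l'
    refine step (by decide) (fun h' => by omega) fun _ => step (by decide) (fun h' => by omega)
      fun _ => step (by decide) (fun h' => by omega) fun _ => step (by decide) (fun h' => by omega)
      fun _ => step (by decide) (fun _ => Tri.conseq (fin (N₀ := σ 19 (pr (σ 4 x) l'))
      (f := fun i => σ 14 (pr l' (π i))) (by decide) (by decide) ?_ ?_ ?_ ?_) (by omega)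
      fun _ _ _ => id) fun h' => by omega
    · simp [l 19, l 4, k1, k2, inputKey]
    · intro τ hτ _
      simp [e hτ 14 (by decide), e hτ 4 (by decide), e hτ 20 (by decide), i0 hτ, k1, k2, inputKey,
        permAt, hπ _]
    · exact fun i hi j hj he => π.injective ((h.core.clu l').elt_inj ((hlt i).2 (by omega))
        ((hlt j).2 (by omega)) he)
    · exact hpos
  · have k0 : σ₁ 0 0 = 5 := rfl
    have k1 : σ₁ 0 1 = x := rfl
    have k2 : σ₁ 0 2 = l' := rfl
    have hx : x ∈ X := hvalid.1
    obtain ⟨π, hπ, hlt, hle, -, hneg⟩ := h.exists_perm hx l'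
    refine step (by decide) (fun h' => by omega) fun _ => step (by decide) (fun h' => by omega)
      fun _ => step (by decide) (fun h' => by omega) fun _ => step (by decide) (fun h' => by omega)
      fun _ => step (by decide) (fun h' => by omega) fun _ => Tri.conseq
      (fin (N₀ := σ 13 l' - σ 19 (pr (σ 4 x) l'))
      (f := fun i => σ 14 (pr l' (π (σ 19 (pr (σ 4 x) l') + i)))) (by decide) (by decide)
      ?_ ?_ ?_ ?_) (by omega) fun _ _ _ => id
    · simp [l 19, l 13, l 4, k1, k2, inputKey]
    · intro τ hτ _
      simp [e hτ 14 (by decide), e hτ 4 (by decide), e hτ 20 (by decide), e hτ 19 (by decide), i0 hτ,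
        k1, k2, inputKey,
        permAt, hπ _]
    · intro i hi j hj he
      have := π.injective ((h.core.clu l').elt_inj ((hlt _).2 (by omega)) ((hlt _).2 (by omega)) he)
      omega
    · intro a
      rw [hneg]
      constructor
      · rintro ⟨i, h₁, h₂, rfl⟩
        exact ⟨i - σ 19 (pr (σ 4 x) l'), by omega, by rw [Nat.add_sub_cancel' h₁]⟩
      · rintro ⟨i, h₁, rfl⟩
        exact ⟨_, Nat.le_add_right _ i, by omega, rfl⟩

end ClusterDeletion


/-! ### Why the marked vertices suffice -/

namespace ClusterDeletion

/-- Deleting at most `s` vertices from the whole graph leaves a cluster graph if it does so for the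
marked vertices `M`, provided that `M` contains the solution `X` of size at most `s`, and for every
`x ∈ X` enough vertices of enough incident clusters. -/
theorem isCVD_of_marked {n s : ℕ} {G : SimpleGraph (Fin n)} {X S : Finset (Fin n)} {lab : Fin n → ℕ}
    {M : Fin n → Prop} {Λ : Fin n → Finset ℕ}
    (hlab : ∀ u v, u ∉ X → v ∉ X → u ≠ v → (G.Adj u v ↔ lab u = lab v))
    (hX : ∀ x ∈ X, M x)
    (hΛ : ∀ x ∈ X, (∀ u ∉ X, G.Adj x u → lab u ∈ Λ x) ∨ s + 2 ≤ (Λ x).card)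
    (hne : ∀ x ∈ X, ∀ l ∈ Λ x, ∃ u ∉ X, M u ∧ G.Adj x u ∧ lab u = l)
    (hpos : ∀ x ∈ X, ∀ l ∈ Λ x, (∀ u ∉ X, lab u = l → G.Adj x u → M u) ∨
      ∃ F : Finset (Fin n), s + 1 ≤ F.card ∧ ∀ u ∈ F, u ∉ X ∧ M u ∧ lab u = l ∧ G.Adj x u)
    (hneg : ∀ x ∈ X, ∀ l ∈ Λ x, (∀ u ∉ X, lab u = l → ¬ G.Adj x u → M u) ∨
      ∃ F : Finset (Fin n), s + 1 ≤ F.card ∧ ∀ u ∈ F, u ∉ X ∧ M u ∧ lab u = l ∧ ¬ G.Adj x u)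
    (hS : S.card ≤ s)
    (h : ∀ c a b, M c → M a → M b → c ∉ S → a ∉ S → b ∉ S → G.Adj c a → G.Adj c b → a ≠ b →
      G.Adj a b) : IsCVD G S := by
  classical
  -- a set of more than `s` vertices has a survivor
  have surv : ∀ F : Finset (Fin n), s + 1 ≤ F.card → ∃ u ∈ F, u ∉ S := fun F hF => by
    by_contra hno
    push Not at hno
    have := Finset.card_le_card (show F ⊆ S from hno)
    omega
  -- all incident labels are covered
  have cov : ∀ x ∈ X, x ∉ S → ∀ u ∉ X, G.Adj x u → lab u ∈ Λ x := by
    intro x hx hxS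
    -- With `s + 2` selected labels, two chosen neighbours of `x` in different clusters would
    -- survive, giving an induced path of marked vertices centred at `x`.
    refine (hΛ x hx).resolve_right fun hc => ?_
    have : Nonempty (Fin n) := ⟨x⟩
    choose! p hp using hne x hx
    have inj : Set.InjOn p (Λ x) := fun l hl l' hl' e => by
      rw [← (hp l hl).2.2.2, ← (hp l' hl').2.2.2, e]
    have hcard : (Λ x).card = ((Λ x).image p).card := (Finset.card_image_of_injOn inj).symm
    obtain ⟨u, hu, huS⟩ := surv ((Λ x).image p) (by omega)
    obtain ⟨v, hv, hvS⟩ := surv (((Λ x).image p).erase u) (by rw [Finset.card_erase_of_mem hu]; omega)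
    obtain ⟨hvu, hv'⟩ := Finset.mem_erase.1 hv
    obtain ⟨l, hl, rfl⟩ := Finset.mem_image.1 hu
    obtain ⟨l', hl', rfl⟩ := Finset.mem_image.1 hv'
    obtain ⟨a₁, a₂, a₃, a₄⟩ := hp l hl
    obtain ⟨b₁, b₂, b₃, b₄⟩ := hp l' hl'
    have := h x _ _ (hX x hx) a₂ b₂ hxS huS hvS a₃ b₃ hvu.symm
    rw [hlab _ _ a₁ b₁ hvu.symm, a₄, b₄] at this
    exact hvu (by rw [this])
  -- marked survivors with the same adjacency to one vertex of the solution
  have repPos : ∀ x ∈ X, x ∉ S → ∀ u ∉ X, u ∉ S → G.Adj x u →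
      ∃ u' ∉ X, u' ∉ S ∧ M u' ∧ lab u' = lab u ∧ G.Adj x u' := by
    intro x hx hxS u hu huS ha
    rcases hpos x hx _ (cov x hx hxS u hu ha) with h' | ⟨F, hF, h'⟩
    · exact ⟨u, hu, huS, h' u hu rfl ha, rfl, ha⟩
    · obtain ⟨v, hv, hvS⟩ := surv F hF
      obtain ⟨h₁, h₂, h₃, h₄⟩ := h' v hv
      exact ⟨v, h₁, hvS, h₂, h₃, h₄⟩
  -- A surviving vertex of the solution sees all or none of the survivors of a cluster. Otherwise a
  -- marked neighbour `p` and a marked non-neighbour `q` in that cluster would form, with `x`, an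
  -- induced path centred at `p`.
  have homog : ∀ x ∈ X, x ∉ S → ∀ u v, u ∉ X → v ∉ X → u ∉ S → v ∉ S → lab u = lab v →
      G.Adj x u → G.Adj x v := by
    intro x hx hxS u v hu hv huS hvS hl ha
    by_contra hn
    obtain ⟨p, p₁, p₂, p₃, p₄, p₅⟩ := repPos x hx hxS u hu huS ha
    obtain ⟨q, q₁, q₂, q₃, q₄, q₅⟩ : ∃ q ∉ X, q ∉ S ∧ M q ∧ lab q = lab u ∧ ¬ G.Adj x q := by
      rcases hneg x hx _ (cov x hx hxS u hu ha) with h' | ⟨F, hF, h'⟩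
      · exact ⟨v, hv, hvS, h' v hv hl.symm hn, hl.symm, hn⟩
      · obtain ⟨q, hq, hqS⟩ := surv F hF
        obtain ⟨h₁, h₂, h₃, h₄⟩ := h' q hq
        exact ⟨q, h₁, hqS, h₂, h₃, h₄⟩
    have hpq : p ≠ q := fun e => q₅ (e ▸ p₅)
    have hxq : x ≠ q := fun e => q₁ (e ▸ hx)
    exact q₅ (h p x q p₃ (hX x hx) q₃ p₂ hxS q₂ p₅.symm
      ((hlab p q p₁ q₁ hpq).2 (p₄.trans q₄.symm)) hxq)
  -- It also sees survivors of one cluster only, since marked neighbours in two clusters would form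
  -- an induced path centred at `x`.
  have single : ∀ x ∈ X, x ∉ S → ∀ u v, u ∉ X → v ∉ X → u ∉ S → v ∉ S → G.Adj x u → G.Adj x v →
      lab u = lab v := by
    intro x hx hxS u v hu hv huS hvS ha hb
    obtain ⟨p, p₁, p₂, p₃, p₄, p₅⟩ := repPos x hx hxS u hu huS ha
    obtain ⟨q, q₁, q₂, q₃, q₄, q₅⟩ := repPos x hx hxS v hv hvS hb
    by_cases hpq : p = q
    · rw [← p₄, ← q₄, hpq]
    · rw [← p₄, ← q₄]
      exact (hlab p q p₁ q₁ hpq).1 (h x p q (hX x hx) p₃ q₃ hxS p₂ q₂ p₅ q₅ hpq)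
  -- replace a vertex outside of the solution that has a neighbour in it
  have rep : ∀ u ∉ X, u ∉ S → (∃ x ∈ X, x ∉ S ∧ G.Adj x u) →
      ∃ u' ∉ X, u' ∉ S ∧ M u' ∧ ∀ y ∈ X, y ∉ S → (G.Adj y u' ↔ G.Adj y u) := by
    rintro u hu huS ⟨x, hx, hxS, ha⟩
    obtain ⟨p, p₁, p₂, p₃, p₄, p₅⟩ := repPos x hx hxS u hu huS ha
    exact ⟨p, p₁, p₂, p₃, fun y hy hyS => ⟨homog y hy hyS p u p₁ hu p₂ huS p₄,
      homog y hy hyS u p hu p₁ huS p₂ p₄.symm⟩⟩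
  rw [isCVD_iff]
  intro c a b hc ha hb h₁ h₂ hab
  by_contra hn
  -- A path inside the solution is marked already. If two of its vertices are in the solution, the
  -- third is replaced by a marked vertex with the same neighbours among the surviving solution. If
  -- there is only one, `single` applies when it is the centre and `homog` when it is an end. With
  -- none, the labels of the clusters are contradicted.
  by_cases cX : c ∈ X <;> by_cases aX : a ∈ X <;> by_cases bX : b ∈ X
  · exact hn (h c a b (hX c cX) (hX a aX) (hX b bX) hc ha hb h₁ h₂ hab)
  · obtain ⟨u, u₁, u₂, u₃, u₄⟩ := rep b bX hb ⟨c, cX, hc, h₂⟩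
    exact hn ((u₄ a aX ha).1 (h c a u (hX c cX) (hX a aX) u₃ hc ha u₂ h₁ ((u₄ c cX hc).2 h₂)
      fun e => u₁ (e ▸ aX)))
  · obtain ⟨u, u₁, u₂, u₃, u₄⟩ := rep a aX ha ⟨c, cX, hc, h₁⟩
    exact hn ((u₄ b bX hb).1 (h c u b (hX c cX) u₃ (hX b bX) hc u₂ hb ((u₄ c cX hc).2 h₁) h₂
      fun e => u₁ (e ▸ bX)).symm).symm
  · exact hn ((hlab a b aX bX hab).2 (single c cX hc a b aX bX ha hb h₁ h₂))
  · obtain ⟨u, u₁, u₂, u₃, u₄⟩ := rep c cX hc ⟨a, aX, ha, h₁.symm⟩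
    exact hn (h u a b u₃ (hX a aX) (hX b bX) u₂ ha hb ((u₄ a aX ha).2 h₁.symm).symm
      ((u₄ b bX hb).2 h₂.symm).symm hab)
  · exact hn (homog a aX ha c b cX bX hc hb ((hlab c b cX bX h₂.ne).1 h₂) h₁.symm)
  · exact hn (homog b bX hb c a cX aX hc ha ((hlab c a cX aX h₁.ne).1 h₁) h₂.symm).symm
  · refine hn ((hlab a b aX bX hab).2 ?_)
    rw [← (hlab c a cX aX h₁.ne).1 h₁, ← (hlab c b cX bX h₂.ne).1 h₂]

end ClusterDeletion


/-! ### Storing the graph of the marked vertices -/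

namespace RAM

/-- The first `cnt` pairs in cells `2, 3, 4, ...` of array `80` are the pairs in relation `P`; the
following cells are zero. -/
structure Edges (σ : Mem) (cnt : ℕ) (P : ℕ → ℕ → Prop) : Prop where
  mem : ∀ e < cnt, P (σ 80 (2 + e + e)) (σ 80 (3 + e + e))
  exists_of : ∀ a b, P a b → ∃ e < cnt, σ 80 (2 + e + e) = a ∧ σ 80 (3 + e + e) = b
  inj : ∀ e < cnt, ∀ e' < cnt, σ 80 (2 + e + e) = σ 80 (2 + e' + e') →
    σ 80 (3 + e + e) = σ 80 (3 + e' + e') → e = e'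
  zero : ∀ i, 2 + cnt + cnt ≤ i → σ 80 i = 0

theorem Edges.congr {σ σ' : Mem} {cnt : ℕ} {P P' : ℕ → ℕ → Prop} (h : Edges σ cnt P)
    (he : σ' 80 = σ 80) (hP : ∀ a b, P' a b ↔ P a b) : Edges σ' cnt P' := by
  obtain ⟨h₁, h₂, h₃, h₄⟩ := h
  constructor <;> rw [he] <;> simpa only [hP]

/-- Append the pair of `e` and variable `72`. -/
def emit (e : Expr) : Cmd := .block [.assign 80 (.const 2 + .var 66 + .var 66) e,
  .assign 80 (.const 3 + .var 66 + .var 66) (.var 72), .assign 66 (.const 0) (.var 66 + .const 1)]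

/-- The cells behind the list stay zero, as they must: the list will be the input of a program that
expects an otherwise zero memory. -/
theorem emit_spec {σ : Mem} {e : Expr} {P : ℕ → ℕ → Prop} (h : Edges σ (σ 66 0) P)
    (hn : ¬ P (e.eval σ) (σ 72 0)) :
    (emit e).exec σ 66 0 = σ 66 0 + 1 ∧ Edges ((emit e).exec σ) (σ 66 0 + 1)
      (fun a b => P a b ∨ a = e.eval σ ∧ b = σ 72 0) := by
  set c := σ 66 0 with hc
  rw [emit, exec_cons_assign (x := 2 + c + c) (by simp [hc]) rfl,
    exec_cons_assign (x := 3 + c + c) (by simp [hc, Mem.set_apply]) (y := σ 72 0)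
      (by simp [Mem.set_apply]),
    exec_cons_assign (x := 0) rfl (y := c + 1) (by simp [Mem.set_apply, hc]), Cmd.exec_nil]
  set σ' := ((σ.set 80 (2 + c + c) (e.eval σ)).set 80 (3 + c + c) (σ 72 0)).set 66 0 (c + 1) with hσ'
  have a₁ : σ' 80 (2 + c + c) = e.eval σ := by
    simp [hσ', Mem.set_apply]
  have a₂ : σ' 80 (3 + c + c) = σ 72 0 := by simp [hσ', Mem.set_apply]
  have a₃ : ∀ i, i < 2 + c + c → σ' 80 i = σ 80 i := fun i hi => by
    simp [hσ', Mem.set_apply, show i ≠ 2 + c + c by omega, show i ≠ 3 + c + c by omega]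
  have o : ∀ e < c, σ' 80 (2 + e + e) = σ 80 (2 + e + e) ∧ σ' 80 (3 + e + e) = σ 80 (3 + e + e) :=
    fun e he => ⟨a₃ _ (by omega), a₃ _ (by omega)⟩
  refine ⟨by simp [hσ', Mem.set_apply], ⟨fun e he => ?_, fun a b hab => ?_, fun e he e' he' h₁ h₂ => ?_,
    fun i hi => ?_⟩⟩
  · rcases Nat.lt_succ_iff_lt_or_eq.1 he with he | rfl
    · rw [(o e he).1, (o e he).2]
      exact .inl (h.mem e he)
    · exact .inr ⟨a₁, a₂⟩
  · rcases hab with hab | ⟨rfl, rfl⟩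
    · obtain ⟨e, he, h₁, h₂⟩ := h.exists_of a b hab
      exact ⟨e, by omega, by rw [(o e he).1, h₁], by rw [(o e he).2, h₂]⟩
    · exact ⟨c, by omega, a₁, a₂⟩
  · rcases Nat.lt_succ_iff_lt_or_eq.1 he with he | rfl <;>
      rcases Nat.lt_succ_iff_lt_or_eq.1 he' with he' | rfl
    · rw [(o e he).1, (o e' he').1] at h₁
      rw [(o e he).2, (o e' he').2] at h₂
      exact h.inj e he e' he' h₁ h₂
    · rw [(o e he).1, a₁] at h₁
      rw [(o e he).2, a₂] at h₂
      exact (hn (h₁ ▸ h₂ ▸ h.mem e he)).elim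
    · rw [(o e' he').1, a₁] at h₁
      rw [(o e' he').2, a₂] at h₂
      exact (hn (h₁ ▸ h₂ ▸ h.mem e' he')).elim
    · rfl
  · simp only [hσ', Mem.set_apply]
    rw [if_neg (by omega), if_neg (by omega), if_neg (by omega)]
    exact h.zero i (by omega)

theorem sound_emit {b : ℕ} {σ : Mem} {e : Expr} (he : e.deg = 1) (h : σ 66 0 + 1 < 2 ^ b) :
    (emit e).Sound b σ := by
  simp [emit, he, Mem.set_apply, h]

/-- The marked vertices `M`, the marked vertices of every cluster, and the edges between marked
vertices (all as indices) are stored. -/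
structure Marked (σ : Mem) (A : SimpleGraph ℕ) (M : ℕ → Prop) (K : ℕ) : Prop where
  elt : SparseSet (σ 64 0) (σ 65) (fun v => σ 60 v - 1) M
  mark_iff : ∀ v, σ 60 v ≠ 0 ↔ M v
  bucket : ∀ l, Holds σ 61 62 63 l (fun i => i < σ 64 0 ∧ σ 4 (σ 65 i) = 0 ∧ σ 5 (σ 65 i) = l)
  edge : Edges σ (σ 66 0) (fun a b => a < b ∧ b < σ 64 0 ∧ A.Adj (σ 65 a) (σ 65 b))
  count : σ 66 0 ≤ σ 64 0 * K

/-- Mark vertex `71`. -/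
def mark : Cmd := .ite (.cell 60 (.var 71)) .skip (.seq (.assign 72 (.const 0) (.var 64))
  (.seq (.forLoop 70 (.var 10) (.seq (.assign 73 (.const 0) (.cell 11 (.pr (.const 0) (.var 70))))
    (.ite (.cell 60 (.var 73)) (.ite (.cell 3 (.pr (.var 73) (.var 71)))
      (emit (.cell 60 (.var 73) - .const 1)) .skip) .skip)))
  (.seq (.ite (.cell 4 (.var 71)) .skip
    (.seq (.forLoop 70 (.cell 61 (.cell 5 (.var 71)))
      (emit (.cell 62 (.pr (.cell 5 (.var 71)) (.var 70)))))
    (setAdd 61 62 63 (.cell 5 (.var 71)) (.var 72))))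
  (.block [.assign 65 (.var 72) (.var 71), .assign 60 (.var 71) (.var 72 + .const 1),
    .assign 64 (.const 0) (.var 72 + .const 1)]))))

/-- The earlier neighbours of a new vertex are found without a search through all marked vertices.
Those in the solution are tested by the adjacency matrix; those outside form exactly the bucket of
its cluster, if the vertex is outside of the solution too. For a vertex of the solution the bucket
would be wrong, so `hord` demands that the solution is marked first. The number of candidates, and
with it the time, is bounded by `K`. -/
theorem mark_spec {w b n K : ℕ} {σ : Mem} {A : SimpleGraph ℕ} {M : ℕ → Prop} (h : Core σ n A)
    (hM : Marked σ A M K) (hv : σ 71 0 < n) (hlt : ∀ u, M u → u < n)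
    (hord : σ 4 (σ 71 0) ≠ 0 → ∀ u, M u → σ 4 u ≠ 0)
    (hK : σ 10 0 + σ 61 (σ 5 (σ 71 0)) ≤ K) (hb : (n + 1) * K + n + 2 < 2 ^ b) :
    Tri w b mark σ (200 + K * 100) (fun σ' => Marked σ' A (fun u => M u ∨ u = σ 71 0) K) := by
  set v := σ 71 0 with hvdef
  set idx := σ 64 0 with hidx
  have hidxn : idx ≤ n := hM.elt.len_le_of_lt hlt
  have hE : σ 66 0 ≤ idx * K := hM.count
  have hEb : σ 66 0 + K + 1 < 2 ^ b := by
    have : idx * K ≤ n * K := Nat.mul_le_mul_right _ hidxn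
    have : (n + 1) * K = n * K + K := by ring
    omega
  refine Tri.ite (B₁ := 190 + K * 100) (by decide) (fun hm => ?_) (fun hm => ?_)
    (by simp [Expr.cost, Expr.var]; omega)
  · simp only [Expr.eval_cell, Expr.eval_var, ← hvdef] at hm
    refine Tri.conseq (Tri.skip (Q := fun τ => Marked τ A (fun u => M u ∨ u = v) K) ?_) (by omega)
      fun _ _ _ => id
    have hMv := (hM.mark_iff v).1 hm
    have : (fun u => M u ∨ u = v) = M := by
      funext u
      refine propext ⟨?_, .inl⟩
      rintro (h | rfl)
      · exact h
      · exact hMv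
    rwa [this]
  simp only [Expr.eval_cell, Expr.eval_var, ← hvdef] at hm
  have hMv : ¬ M v := fun h' => (hM.mark_iff v).2 h' hm
  refine Tri.seq (B₁ := 10) (B₂ := 180 + K * 100) (Q₁ := fun τ => τ = σ.set 72 0 idx)
    (Tri.exec (by decide) (by decide) (fun _ _ => by simp) fun _ _ => by simp [hidx]) ?_ (by omega)
  rintro _ - - rfl
  have f₀ : ∀ a, a ≠ 72 → (σ.set 72 0 idx) a = σ a := fun a ha => Mem.set_ne _ _ _ ha
  have f72 : (σ.set 72 0 idx) 72 0 = idx := by simp [Mem.set_apply]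
  generalize σ.set 72 0 idx = σ₀ at *
  set P : ℕ → ℕ → Prop := fun a b => a < b ∧ b < idx ∧ A.Adj (σ 65 a) (σ 65 b) with hP
  -- After `j` rounds: the old edges, and those between the new index `idx` and marked neighbours
  -- among the first `j` vertices of the solution. Array `60` holds indices increased by one, so
  -- that zero means unmarked.
  set P₁ : ℕ → ℕ → ℕ → Prop := fun j a b =>
    P a b ∨ b = idx ∧ ∃ i < j, σ 60 (σ 11 (pr 0 i)) = a + 1 ∧ A.Adj (σ 11 (pr 0 i)) v with hP₁
  -- edges to marked vertices of the solution
  refine Tri.seq (B₁ := 20 + σ 10 0 * 100) (B₂ := 150 + σ 61 (σ 5 v) * 100)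
    (Tri.forLoop (σ 10 0) (fun j τ => Edges τ (τ 66 0) (P₁ j) ∧ τ 66 0 ≤ σ 66 0 + j) (B₁ := 80)
      (by decide) (by decide) (fun j τ fr _ => by simp [fr 10 (by decide) (by decide), f₀]) (by omega)
      ?_ ?_ (by simp only [Expr.cost, Expr.var]; omega)) ?_ (by
        have : σ 10 0 * 100 + σ 61 (σ 5 v) * 100 ≤ K * 100 := by omega
        omega)
  · refine ⟨?_, by simp [Mem.set_apply, f₀]⟩
    have e66 : (σ₀.set 70 0 0) 66 0 = σ 66 0 := by simp [Mem.set_apply, f₀]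
    rw [e66]
    refine hM.edge.congr (by rw [Mem.set_ne _ _ _ (by decide), f₀ 80 (by decide)]) fun a b => ?_
    simp [hP₁, hP, hidx]
  · intro j hj τ _ fr hτ ⟨i₁, i₂⟩
    have f : ∀ a, a ∉ [66, 70, 72, 73, 80] → τ a = σ a := fun a ha => by
      simp only [List.mem_cons, List.not_mem_nil, or_false, not_or] at ha
      rw [fr a (by simp [emit, Cmd.block, Cmd.mods, ha]) ha.2.1, f₀ a ha.2.2.1]
    have g72 : τ 72 0 = idx := by rw [fr 72 (by decide) (by decide), f72]
    set y := σ 11 (pr 0 j) with hy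
    refine Tri.seq (B₁ := 15) (B₂ := 65) (Q₁ := fun τ' => τ' = τ.set 73 0 y)
      (Tri.exec (by decide) (by decide) (fun _ _ => by simp) fun _ _ => by
        simp [f 11 (by decide), hτ, hy]) ?_ (by omega)
    rintro _ - - rfl
    have k : ∀ a, a ∉ [66, 70, 72, 73, 80] → (τ.set 73 0 y) a = σ a := fun a ha => by
      rw [Mem.set_ne, f a ha]
      simp only [List.mem_cons, List.not_mem_nil, or_false, not_or] at ha
      exact ha.2.2.2.1
    have k73 : (τ.set 73 0 y) 73 0 = y := by simp [Mem.set_apply]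
    have k72 : (τ.set 73 0 y) 72 0 = idx := by rw [Mem.set_ne _ _ _ (by decide), g72]
    have k66 : (τ.set 73 0 y) 66 0 = τ 66 0 := by rw [Mem.set_ne _ _ _ (by decide)]
    have kE : Edges (τ.set 73 0 y) ((τ.set 73 0 y) 66 0) (P₁ j) := by
      rw [k66]
      exact i₁.congr (Mem.set_ne _ _ _ (by decide)) fun _ _ => Iff.rfl
    generalize τ.set 73 0 y = τ₁ at *
    have fin : ∀ τ' : Mem, τ' 66 0 ≤ σ 66 0 + (j + 1) → Edges τ' (τ' 66 0) (P₁ (j + 1)) →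
        Edges (τ'.set 70 0 (j + 1)) ((τ'.set 70 0 (j + 1)) 66 0) (P₁ (j + 1)) ∧
        (τ'.set 70 0 (j + 1)) 66 0 ≤ σ 66 0 + (j + 1) := fun τ' h₁ h₂ => by
      have : (τ'.set 70 0 (j + 1)) 66 = τ' 66 := Mem.set_ne _ _ _ (by decide)
      rw [this]
      exact ⟨h₂.congr (Mem.set_ne _ _ _ (by decide)) fun _ _ => Iff.rfl, h₁⟩
    have noop : ¬ (σ 60 y ≠ 0 ∧ A.Adj y v) → ∀ a b, P₁ (j + 1) a b ↔ P₁ j a b := by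
      intro hno a b
      simp only [hP₁]
      refine or_congr Iff.rfl (and_congr Iff.rfl ⟨?_, fun ⟨i, hi, h'⟩ => ⟨i, by omega, h'⟩⟩)
      rintro ⟨i, hi, h₁, h₂⟩
      rcases Nat.lt_succ_iff_lt_or_eq.1 hi with hi | rfl
      · exact ⟨i, hi, h₁, h₂⟩
      · exact (hno ⟨by rw [← hy] at h₁; omega, h₂⟩).elim
    have done : ¬ (σ 60 y ≠ 0 ∧ A.Adj y v) → Tri w b .skip τ₁ 1 (fun τ' =>
        Edges (τ'.set 70 0 (j + 1)) ((τ'.set 70 0 (j + 1)) 66 0) (P₁ (j + 1)) ∧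
        (τ'.set 70 0 (j + 1)) 66 0 ≤ σ 66 0 + (j + 1)) := fun hno =>
      Tri.skip (fin τ₁ (by omega) (kE.congr rfl (noop hno)))
    refine Tri.ite (B₁ := 60) (by decide) (fun h60 => ?_) (fun h60 => ?_) (by decide)
    · simp only [Expr.eval_cell, Expr.eval_var, k73, k 60 (by decide)] at h60
      refine Tri.ite (B₁ := 40) (by decide) (fun h3 => ?_) (fun h3 => ?_) (by decide)
      · simp only [Expr.eval_cell, Expr.eval_var, Expr.eval_pr, k73, k 71 (by decide), k 3 (by decide),
          ← hvdef, h.adj] at h3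
        have ev : (Expr.cell 60 (.var 73) - .const 1).eval τ₁ = σ 60 y - 1 := by
          simp [k73, k 60 (by decide)]
        obtain ⟨s₁, s₂⟩ := emit_spec kE (e := .cell 60 (.var 73) - .const 1) (by
          rw [ev, k72]
          rintro (⟨-, hlt, -⟩ | ⟨-, i, hi, h₁, -⟩)
          · exact lt_irrefl _ hlt
          -- Equal indices come from the same marked vertex, hence from the same position in the
          -- solution, which contradicts `i < j`.
          · have e : σ 60 (σ 11 (pr 0 i)) - 1 = σ 60 y - 1 := by omega
            have m₁ := (hM.mark_iff _).1 (show σ 60 (σ 11 (pr 0 i)) ≠ 0 by omega)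
            have m₂ := (hM.mark_iff _).1 h60
            have e₁ := (hM.elt.idx _ m₁).2
            have e₂ := (hM.elt.idx _ m₂).2
            rw [e] at e₁
            have := h.sol.elt_inj (show i < σ 10 0 by omega) hj (e₁.symm.trans e₂)
            omega)
        rw [ev, k72] at s₂
        refine Tri.exec (by decide) (by decide) (fun _ _ => sound_emit (by decide) (by omega))
          fun _ _ => fin _ (by omega) ?_
        rw [s₁]
        refine s₂.congr rfl fun a b => ?_
        simp only [hP₁]
        constructor
        · rintro (h' | ⟨h', i, hi, h₁, h₂⟩)
          · exact .inl (.inl h')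
          · rcases Nat.lt_succ_iff_lt_or_eq.1 hi with hi | rfl
            · exact .inl (.inr ⟨h', i, hi, h₁, h₂⟩)
            · exact .inr ⟨by rw [← hy] at h₁; omega, h'⟩
        · rintro ((h' | ⟨h', i, hi, h₁, h₂⟩) | ⟨rfl, h'⟩)
          · exact .inl h'
          · exact .inr ⟨h', i, by omega, h₁, h₂⟩
          · exact .inr ⟨h', j, by omega, by rw [← hy]; omega, h3⟩
      · simp only [Expr.eval_cell, Expr.eval_var, Expr.eval_pr, k73, k 71 (by decide), k 3 (by decide),
          ← hvdef] at h3
        exact (done fun h' => (h.adj y v).2 h'.2 h3).conseq (by omega) fun _ _ _ => id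
    · simp only [Expr.eval_cell, Expr.eval_var, k73, k 60 (by decide)] at h60
      exact (done fun h' => h'.1 h60).conseq (by omega) fun _ _ _ => id
  rintro τ - fr ⟨e₁, e₂⟩
  have f : ∀ a, a ∉ [66, 70, 72, 73, 80] → τ a = σ a := fun a ha => by
    simp only [List.mem_cons, List.not_mem_nil, or_false, not_or] at ha
    rw [fr a (by simp [Cmd.forLoop, emit, Cmd.block, Cmd.mods, ha]), f₀ a ha.2.2.1]
  have g72 : τ 72 0 = idx := by rw [fr 72 (by decide), f72]
  -- the last step
  have fin : ∀ τ' : Mem, (∀ a, a ∉ [61, 62, 63, 66, 70, 72, 73, 80] → τ' a = σ a) → τ' 72 0 = idx →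
      τ' 66 0 ≤ (idx + 1) * K →
      (∀ l, Holds τ' 61 62 63 l (fun i => i < idx ∧ σ 4 (σ 65 i) = 0 ∧ σ 5 (σ 65 i) = l ∨
        i = idx ∧ σ 4 v = 0 ∧ σ 5 v = l)) →
      Edges τ' (τ' 66 0) (fun a b => P a b ∨ b = idx ∧ a < idx ∧ A.Adj (σ 65 a) v) →
      Tri w b (.block [.assign 65 (.var 72) (.var 71), .assign 60 (.var 71) (.var 72 + .const 1),
        .assign 64 (.const 0) (.var 72 + .const 1)]) τ' 30
        (fun σ' => Marked σ' A (fun u => M u ∨ u = v) K) := by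
    intro τ' fr' h72 hcnt hbuck hedge
    refine Tri.exec (by decide) (by decide) (fun _ _ => ?_) fun _ _ => ?_
    · simp [Mem.set_apply, h72]
      have : idx + 1 < 2 ^ b := by
        have : 0 ≤ (n + 1) * K := Nat.zero_le _
        omega
      simp [this]
    rw [exec_cons_assign (x := idx) (by simp [h72]) (y := v) (by simp [fr' 71 (by decide), hvdef]),
      exec_cons_assign (x := v) (by simp [Mem.set_apply, fr' 71 (by decide), hvdef]) (y := idx + 1)
        (by simp [Mem.set_apply, h72]),
      exec_cons_assign (x := 0) rfl (y := idx + 1) (by simp [Mem.set_apply, h72]), Cmd.exec_nil]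
    set σ' := ((τ'.set 65 idx v).set 60 v (idx + 1)).set 64 0 (idx + 1) with hσ'
    have r : ∀ a, a ∉ [60, 64, 65] → σ' a = τ' a := fun a ha => by
      simp only [List.mem_cons, List.not_mem_nil, or_false, not_or] at ha
      rw [hσ', Mem.set_ne _ _ _ ha.2.1, Mem.set_ne _ _ _ ha.1, Mem.set_ne _ _ _ ha.2.2]
    have r64 : σ' 64 0 = idx + 1 := by simp [hσ', Mem.set_apply]
    have r65 : σ' 65 = Function.update (σ 65) idx v := by
      rw [hσ', Mem.set_ne _ _ _ (by decide), Mem.set_ne _ _ _ (by decide), Mem.set_same,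
        fr' 65 (by decide)]
    have r60 : σ' 60 = Function.update (σ 60) v (idx + 1) := by
      rw [hσ', Mem.set_ne _ _ _ (by decide), Mem.set_same, Mem.set_ne _ _ _ (by decide),
        fr' 60 (by decide)]
    have r4 : σ' 4 = σ 4 := by rw [r 4 (by decide), fr' 4 (by decide)]
    have r5 : σ' 5 = σ 5 := by rw [r 5 (by decide), fr' 5 (by decide)]
    have r66 : σ' 66 = τ' 66 := r 66 (by decide)
    constructor
    · rw [r64, r65]
      refine SparseSet.congr (hM.elt.add hMv) (fun _ _ => rfl) (fun u _ => ?_) fun _ => Iff.rfl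
      rw [r60, Function.update_apply, Function.update_apply]
      split <;> simp [hidx]
    · intro u
      rw [r60, Function.update_apply]
      by_cases huv : u = v
      · simp [huv]
      · simp [huv, hM.mark_iff]
    · intro l
      refine (hbuck l).congr (SameKey.of_eq (r 61 (by decide)) (r 62 (by decide)) (r 63 (by decide)) l)
        fun i => ?_
      rw [r64, r65, r4, r5, Function.update_apply]
      by_cases hi : i = idx
      · simp [hi]
      · simp only [hi, if_false, false_and, or_false, show i < idx + 1 ↔ i < idx by omega]
    · rw [r66, r64, r65]
      refine hedge.congr (r 80 (by decide)) fun a b => ?_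
      simp only [hP, Function.update_apply]
      by_cases hb : b = idx
      · subst hb
        by_cases ha : a < idx
        · simp [ha, ha.ne]
        · simp [ha]
      · by_cases ha : a = idx
        · subst ha
          simp only [hb, false_and, or_false]
          constructor
          · rintro ⟨h₁, h₂, -⟩
            omega
          · rintro ⟨h₁, h₂, -⟩
            omega
        · simp only [hb, ha, if_false, false_and, or_false]
          constructor
          · rintro ⟨h₁, h₂, h₃⟩
            exact ⟨h₁, by omega, h₃⟩
          · rintro ⟨h₁, h₂, h₃⟩
            exact ⟨h₁, by omega, h₃⟩
    · rw [r66, r64]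
      exact hcnt
  -- membership in terms of indices
  have key₁ : ∀ a, (∃ i < σ 10 0, σ 60 (σ 11 (pr 0 i)) = a + 1 ∧ A.Adj (σ 11 (pr 0 i)) v) ↔
      a < idx ∧ σ 4 (σ 65 a) ≠ 0 ∧ A.Adj (σ 65 a) v := by
    intro a
    constructor
    · rintro ⟨i, hi, h₁, h₂⟩
      have m := (hM.mark_iff (σ 11 (pr 0 i))).1 (by omega)
      obtain ⟨p₁, p₂⟩ := hM.elt.idx _ m
      simp only [h₁, Nat.add_sub_cancel] at p₁ p₂
      rw [p₂]
      exact ⟨p₁, (h.sol.mem i hi).1, h₂⟩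
    · rintro ⟨h₁, h₂, h₃⟩
      obtain ⟨i, hi, e⟩ := (h.sol.exists_iff _).1 h₂
      obtain ⟨m, hm'⟩ := hM.elt.mem a h₁
      have := (hM.mark_iff _).2 m
      exact ⟨i, hi, by rw [e]; omega, by rw [e]; exact h₃⟩
  refine Tri.seq (B₁ := 110 + σ 61 (σ 5 v) * 100) (B₂ := 30)
    (Q₁ := fun τ' => (∀ a, a ∉ [61, 62, 63, 66, 70, 72, 73, 80] → τ' a = σ a) ∧ τ' 72 0 = idx ∧
      τ' 66 0 ≤ (idx + 1) * K ∧
      (∀ l, Holds τ' 61 62 63 l (fun i => i < idx ∧ σ 4 (σ 65 i) = 0 ∧ σ 5 (σ 65 i) = l ∨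
        i = idx ∧ σ 4 v = 0 ∧ σ 5 v = l)) ∧
      Edges τ' (τ' 66 0) (fun a b => P a b ∨ b = idx ∧ a < idx ∧ A.Adj (σ 65 a) v)) ?_
    (fun τ' _ _ ⟨q₁, q₂, q₃, q₄, q₅⟩ => fin τ' q₁ q₂ q₃ q₄ q₅) (by omega)
  have hcnt : ∀ c, c ≤ σ 66 0 + σ 10 0 + σ 61 (σ 5 v) → c ≤ (idx + 1) * K := fun c hc => by
    have : (idx + 1) * K = idx * K + K := by ring
    omega
  refine Tri.ite (B₁ := 100 + σ 61 (σ 5 v) * 100) (by decide) (fun h4 => ?_) (fun h4 => ?_)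
    (by simp [Expr.cost, Expr.var]; omega)
  · simp only [Expr.eval_cell, Expr.eval_var, f 71 (by decide), f 4 (by decide), ← hvdef] at h4
    refine Tri.conseq (Tri.skip (Q := fun τ' => τ' = τ) rfl) (by omega) ?_
    rintro _ - - rfl
    refine ⟨fun a ha => f a (by
      simp only [List.mem_cons, List.not_mem_nil, or_false, not_or] at ha ⊢
      simp [ha]), g72, hcnt _ (by omega), fun l => ?_, e₁.congr rfl fun a b => ?_⟩
    · refine (hM.bucket l).congr (SameKey.of_eq (f 61 (by decide)) (f 62 (by decide)) (f 63 (by decide))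
        l) fun i => ?_
      simp [h4, hidx]
    · simp only [hP₁, key₁]
      refine or_congr Iff.rfl (and_congr Iff.rfl ⟨fun ⟨h₁, h₂⟩ => ⟨h₁, ?_, h₂⟩,
        fun ⟨h₁, h₂, h₃⟩ => ⟨h₁, h₃⟩⟩)
      exact hord h4 _ (hM.elt.mem a h₁).1
  simp only [Expr.eval_cell, Expr.eval_var, f 71 (by decide), f 4 (by decide), ← hvdef] at h4
  set L := σ 5 v with hL
  -- edges to marked vertices of the same cluster
  set P₂ : ℕ → ℕ → ℕ → Prop := fun j a b =>
    P₁ (σ 10 0) a b ∨ b = idx ∧ ∃ i < j, σ 62 (pr L i) = a with hP₂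
  have hbn : σ 61 L < 2 ^ b := by omega
  refine Tri.seq (B₁ := 20 + σ 61 L * 100) (B₂ := 70)
    (Tri.forLoop (σ 61 L) (fun j τ => Edges τ (τ 66 0) (P₂ j) ∧ τ 66 0 ≤ σ 66 0 + σ 10 0 + j)
      (B₁ := 80) (by decide) (by decide) (fun j τ' fr' _ => by
        simp [fr' 61 (by decide) (by decide), fr' 5 (by decide) (by decide),
          fr' 71 (by decide) (by decide), f 61 (by decide), f 5 (by decide), f 71 (by decide), hL,
          hvdef]) hbn
      ?_ ?_ (by simp only [Expr.cost, Expr.var]; omega)) ?_ (by omega)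
  · refine ⟨?_, by simp [Mem.set_apply, e₂]⟩
    have e66 : (τ.set 70 0 0) 66 0 = τ 66 0 := by simp [Mem.set_apply]
    rw [e66]
    refine e₁.congr (Mem.set_ne _ _ _ (by decide)) fun a b => ?_
    simp [hP₂]
  · intro j hj τ' _ fr' hτ ⟨i₁, i₂⟩
    have k : ∀ a, a ∉ [66, 70, 72, 73, 80] → τ' a = σ a := fun a ha => by
      rw [fr' a ?_ ?_, f a ha] <;> simp only [List.mem_cons, List.not_mem_nil, or_false, not_or] at ha
      · simp [emit, Cmd.block, Cmd.mods, ha]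
      · exact ha.2.1
    have k72 : τ' 72 0 = idx := by rw [fr' 72 (by decide) (by decide), g72]
    have ev : (Expr.cell 62 (.pr (.cell 5 (.var 71)) (.var 70))).eval τ' = σ 62 (pr L j) := by
      simp [k 62 (by decide), k 5 (by decide), k 71 (by decide), hτ, hL, hvdef]
    -- Members of the bucket are distinct and lie outside of the solution, so this pair has not been
    -- emitted before.
    obtain ⟨⟨b₁, b₂, b₃⟩, -⟩ := (hM.bucket L).mem j hj
    obtain ⟨s₁, s₂⟩ := emit_spec i₁ (e := .cell 62 (.pr (.cell 5 (.var 71)) (.var 70))) (by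
      rw [ev, k72]
      rintro ((⟨-, hlt, -⟩ | ⟨-, h'⟩) | ⟨-, i, hi, h'⟩)
      · exact lt_irrefl _ hlt
      · exact ((key₁ _).1 h').2.1 b₂
      · have := (hM.bucket L).elt_inj (show i < σ 61 L by omega) hj h'
        omega)
    rw [ev, k72] at s₂
    refine Tri.exec (by decide) (by decide) (fun _ _ => sound_emit (by decide) (by omega))
      fun _ _ => ?_
    generalize (emit (.cell 62 (.pr (.cell 5 (.var 71)) (.var 70)))).exec τ' = τ'' at *
    have : (τ''.set 70 0 (j + 1)) 66 = τ'' 66 := Mem.set_ne _ _ _ (by decide)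
    rw [this]
    refine ⟨?_, by omega⟩
    rw [s₁]
    refine s₂.congr (Mem.set_ne _ _ _ (by decide)) fun a b => ?_
    simp only [hP₂]
    constructor
    · rintro (h' | ⟨h', i, hi, h₁⟩)
      · exact .inl (.inl h')
      · rcases Nat.lt_succ_iff_lt_or_eq.1 hi with hi | rfl
        · exact .inl (.inr ⟨h', i, hi, h₁⟩)
        · exact .inr ⟨h₁.symm, h'⟩
    · rintro ((h' | ⟨h', i, hi, h₁⟩) | ⟨rfl, h'⟩)
      · exact .inl h'
      · exact .inr ⟨h', i, by omega, h₁⟩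
      · exact .inr ⟨h', j, by omega, rfl⟩
  rintro τ' - fr' ⟨i₁, i₂⟩
  have k : ∀ a, a ∉ [66, 70, 72, 73, 80] → τ' a = σ a := fun a ha => by
    rw [fr' a ?_, f a ha]
    simp only [List.mem_cons, List.not_mem_nil, or_false, not_or] at ha
    simp [Cmd.forLoop, emit, Cmd.block, Cmd.mods, ha]
  have k72 : τ' 72 0 = idx := by rw [fr' 72 (by decide), g72]
  have st : Stable τ' [61, 62, 63] (.cell 5 (.var 71)) L := by
    have := Stable.cell (σ := τ') (l := [61, 62, 63]) (a := 5) (by decide)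
      (Stable.var (a := 71) (by decide))
    rwa [k 5 (by decide), k 71 (by decide), ← hvdef, ← hL] at this
  have st' : Stable τ' [61, 62, 63] (.var 72) idx := k72 ▸ Stable.var (by decide)
  obtain ⟨-, -, s₃, s₄⟩ := setAdd_spec (L := 61) (E := 62) (P := 63) (by decide) (by decide) (by decide) st st'
  refine Tri.exec (by decide) (by decide) (fun _ _ => sound_setAdd (by decide) (by decide) st st' rfl ?_)
    fun _ fr'' => ⟨fun a ha => ?_, ?_, ?_, fun l => ?_, ?_⟩
  · rw [k 61 (by decide)]
    omega
  · simp only [List.mem_cons, List.not_mem_nil, or_false, not_or] at ha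
    rw [fr'' a (by simp [setAdd, Cmd.block, Cmd.mods, ha]), k a (by simp [ha])]
  · rw [fr'' 72 (by decide), k72]
  · rw [fr'' 66 (by decide)]
    exact hcnt _ i₂
  · have hold : Holds τ' 61 62 63 l (fun i => i < idx ∧ σ 4 (σ 65 i) = 0 ∧ σ 5 (σ 65 i) = l) :=
      (hM.bucket l).congr (SameKey.of_eq (k 61 (by decide)) (k 62 (by decide)) (k 63 (by decide)) l)
        fun _ => Iff.rfl
    by_cases hl : l = L
    · subst hl
      refine (s₃ _ hold fun h' => lt_irrefl _ h'.1).congr ⟨rfl, fun _ => ⟨rfl, rfl⟩⟩ fun i => ?_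
      simp [h4, hL]
    · refine hold.congr (s₄ l hl) fun i => ?_
      simp [Ne.symm hl]
  · rw [fr'' 66 (by decide)]
    refine i₁.congr (fr'' 80 (by decide)) fun a b => ?_
    simp only [hP₂, hP₁, key₁, or_assoc]
    refine or_congr Iff.rfl ?_
    rw [← and_or_left]
    refine and_congr Iff.rfl ?_
    rw [← SparseSet.exists_iff (hM.bucket L) a]
    -- Outside of the solution, the neighbours of `v` are the other vertices with the label `L`.
    constructor
    · rintro ⟨h₁, h₂⟩
      have ha := (hM.elt.mem a h₁).1
      by_cases h' : σ 4 (σ 65 a) = 0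
      · exact .inr ⟨h₁, h', (h.clique _ _ (hlt _ ha) hv h' h4 fun e => hMv (e ▸ ha)).1 h₂⟩
      · exact .inl ⟨h₁, h', h₂⟩
    · rintro (⟨h₁, -, h₃⟩ | ⟨h₁, h₂, h₃⟩)
      · exact ⟨h₁, h₃⟩
      · have ha := (hM.elt.mem a h₁).1
        exact ⟨h₁, (h.clique _ _ (hlt _ ha) hv h₂ h4 fun e => hMv (e ▸ ha)).2 h₃⟩

end RAM


/-! ### The kernel and its size -/

namespace RAM

/-- Vertex `v` is among the vertices that are marked because of the vertex with index `j` of the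
solution, its incident label with index `i`, and the number `r`. -/
def Target (σ : Mem) (j i r v : ℕ) : Prop :=
  i < σ 16 (σ 4 (σ 11 (pr 0 j))) ∧ ∃ s l c, s = σ 4 (σ 11 (pr 0 j)) ∧ l = σ 17 (pr s i) ∧
    c = σ 19 (pr s l) ∧ ((r < c ∧ v = σ 14 (pr l (σ 20 (pr (pr s l) r) ^^^ r))) ∨
      (c + r < σ 13 l ∧ v = σ 14 (pr l (σ 20 (pr (pr s l) (c + r)) ^^^ (c + r)))))

/-- The vertices to be marked. -/
def Kernel (σ : Mem) (v : ℕ) : Prop :=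
  σ 4 v ≠ 0 ∨ ∃ j < σ 10 0, ∃ i < σ 10 0 + 2, ∃ r < σ 10 0 + 1, Target σ j i r v

/-- Bound for the number of edges that a vertex of the kernel adds. -/
def kernelDeg (s : ℕ) : ℕ := s + 2 * (s * (s + 1))

section

variable {σ τ : Mem} {n : ℕ} {A : SimpleGraph ℕ} {M : ℕ → Prop} {K : ℕ}

theorem Target.spec (h : Core σ n A) {j i r v : ℕ} (hj : j < σ 10 0) (ht : Target σ j i r v) :
    v < n ∧ σ 4 v = 0 ∧ σ 5 v = σ 17 (pr (σ 4 (σ 11 (pr 0 j))) i) := by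
  obtain ⟨-, s, l, c, rfl, rfl, rfl, h'⟩ := ht
  have hx := (h.sol.mem j hj).1
  obtain ⟨π, hπ, -, hs⟩ := (h.tab _ hx).2 (σ 17 (pr (σ 4 (σ 11 (pr 0 j))) i))
  have key : ∀ q < σ 13 (σ 17 (pr (σ 4 (σ 11 (pr 0 j))) i)), v = σ 14 (pr (σ 17 (pr (σ 4 (σ 11 (pr 0 j))) i))
      (σ 20 (pr (pr (σ 4 (σ 11 (pr 0 j))) (σ 17 (pr (σ 4 (σ 11 (pr 0 j))) i))) q) ^^^ q)) →
      v < n ∧ σ 4 v = 0 ∧ σ 5 v = σ 17 (pr (σ 4 (σ 11 (pr 0 j))) i) := by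
    rintro q hq rfl
    rw [hπ q]
    exact ((h.clu _).mem _ ((hs.lt_iff q).2 hq)).1
  rcases h' with ⟨h₁, h₂⟩ | ⟨h₁, h₂⟩
  · exact key _ (h₁.trans_le hs.le) h₂
  · exact key _ h₁ h₂

theorem Kernel.lt (h : Core σ n A) {v : ℕ} (hv : Kernel σ v) : v < n := by
  rcases hv with hv | ⟨j, hj, i, hi, r, hr, ht⟩
  · exact (h.slot v hv).1
  · exact (ht.spec h hj).1

theorem Marked.congr (h : Marked σ A M K)
    (he : ∀ a ∈ [4, 5, 60, 61, 62, 63, 64, 65, 66, 80], τ a = σ a) : Marked τ A M K := by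
  obtain ⟨h₁, h₂, h₃, h₄, h₅⟩ := h
  have e4 := he 4 (by decide)
  have e5 := he 5 (by decide)
  have e60 := he 60 (by decide)
  have e64 := he 64 (by decide)
  have e65 := he 65 (by decide)
  have e66 := he 66 (by decide)
  constructor
  · rwa [e60, e64, e65]
  · rwa [e60]
  · intro l
    rw [e4, e5, e64, e65]
    exact (h₃ l).congr (SameKey.of_eq (he 61 (by decide)) (he 62 (by decide)) (he 63 (by decide)) l)
      fun _ => Iff.rfl
  · rw [e64, e65, e66]
    exact h₄.congr (he 80 (by decide)) fun _ _ => Iff.rfl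
  · rwa [e66, e64]

/-- Inside one cluster, a marked vertex is determined by the vertex of the solution and the number
that caused its marking, and by the side `P⁺` or `P⁻`; the index of the label plays no role. So a
cluster has only `O(s ^ 2)` marked vertices although the kernel may have `O(s ^ 3)`, and this saves
a factor `s` in the number of edges. -/
theorem Marked.bucket_le (hM : Marked τ A M K) (h : Core σ n A) (h4 : τ 4 = σ 4) (h5 : τ 5 = σ 5)
    (hk : ∀ v, M v → Kernel σ v) (l : ℕ) : τ 61 l ≤ 2 * (σ 10 0 * (σ 10 0 + 1)) := by
  classical
  set s := σ 10 0 with hs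
  set g : ℕ × ℕ → ℕ := fun q => σ 14 (pr l (σ 20 (pr (pr (σ 4 (σ 11 (pr 0 q.1))) l) q.2) ^^^ q.2))
  set g' : ℕ × ℕ → ℕ := fun q => σ 14 (pr l (σ 20 (pr (pr (σ 4 (σ 11 (pr 0 q.1))) l)
    (σ 19 (pr (σ 4 (σ 11 (pr 0 q.1))) l) + q.2)) ^^^ (σ 19 (pr (σ 4 (σ 11 (pr 0 q.1))) l) + q.2)))
  set D := Finset.range s ×ˢ Finset.range (s + 1) with hD
  have hcard : D.card = s * (s + 1) := by simp [hD]
  refine (SparseSet.len_le (hM.bucket l) ((D.image g ∪ D.image g').image fun v => τ 60 v - 1)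
    fun q ⟨hq, hq4, hq5⟩ => ?_).trans ?_
  · obtain ⟨m, hm⟩ := hM.elt.mem q hq
    refine Finset.mem_image.2 ⟨τ 65 q, ?_, hm⟩
    rw [h4] at hq4
    rw [h5] at hq5
    rcases hk _ m with h' | ⟨j, hj, i, hi, r, hr, ht⟩
    · exact (h' hq4).elim
    · have hl := (ht.spec h hj).2.2
      rw [hq5] at hl
      obtain ⟨-, s', l', c, rfl, rfl, rfl, h'⟩ := ht
      rw [← hl] at h'
      have hmem : (j, r) ∈ D := Finset.mem_product.2
        ⟨Finset.mem_range.2 hj, Finset.mem_range.2 hr⟩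
      rw [Finset.mem_union]
      rcases h' with ⟨-, h'⟩ | ⟨-, h'⟩
      · exact .inl (Finset.mem_image.2 ⟨(j, r), hmem, h'.symm⟩)
      · exact .inr (Finset.mem_image.2 ⟨(j, r), hmem, h'.symm⟩)
  · have h₁ := Finset.card_union_le (D.image g) (D.image g')
    have h₂ : (D.image g).card ≤ D.card := Finset.card_image_le
    have h₃ : (D.image g').card ≤ D.card := Finset.card_image_le
    have h₄ : ((D.image g ∪ D.image g').image fun v => τ 60 v - 1).card ≤
      (D.image g ∪ D.image g').card := Finset.card_image_le
    omega

/-- Here the index of the label counts as well: there are `s` vertices of the solution, `s + 2`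
labels, `s + 1` numbers and two sides, in addition to the solution itself. -/
theorem Marked.len_le (hM : Marked τ A M K) (h : Core σ n A) (hk : ∀ v, M v → Kernel σ v) :
    τ 64 0 ≤ σ 10 0 + 2 * (σ 10 0 * ((σ 10 0 + 2) * (σ 10 0 + 1))) := by
  classical
  set s := σ 10 0 with hs
  set g : ℕ × ℕ × ℕ → ℕ := fun q => σ 14 (pr (σ 17 (pr (σ 4 (σ 11 (pr 0 q.1))) q.2.1))
    (σ 20 (pr (pr (σ 4 (σ 11 (pr 0 q.1))) (σ 17 (pr (σ 4 (σ 11 (pr 0 q.1))) q.2.1))) q.2.2) ^^^ q.2.2))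
  set g' : ℕ × ℕ × ℕ → ℕ := fun q => σ 14 (pr (σ 17 (pr (σ 4 (σ 11 (pr 0 q.1))) q.2.1))
    (σ 20 (pr (pr (σ 4 (σ 11 (pr 0 q.1))) (σ 17 (pr (σ 4 (σ 11 (pr 0 q.1))) q.2.1)))
      (σ 19 (pr (σ 4 (σ 11 (pr 0 q.1))) (σ 17 (pr (σ 4 (σ 11 (pr 0 q.1))) q.2.1))) + q.2.2)) ^^^
      (σ 19 (pr (σ 4 (σ 11 (pr 0 q.1))) (σ 17 (pr (σ 4 (σ 11 (pr 0 q.1))) q.2.1))) + q.2.2)))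
  set D := Finset.range s ×ˢ Finset.range (s + 2) ×ˢ Finset.range (s + 1) with hD
  have hcard : D.card = s * ((s + 2) * (s + 1)) := by simp [hD]
  refine (hM.elt.len_le ((Finset.range s).image (fun j => σ 11 (pr 0 j)) ∪
    (D.image g ∪ D.image g')) fun v hv => ?_).trans ?_
  · rw [Finset.mem_union, Finset.mem_union]
    rcases hk v hv with h' | ⟨j, hj, i, hi, r, hr, ht⟩
    · obtain ⟨j, hj, e⟩ := (h.sol.exists_iff v).1 h'
      exact .inl (Finset.mem_image.2 ⟨j, by simpa using hj, e⟩)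
    · obtain ⟨-, s', l', c, rfl, rfl, rfl, h'⟩ := ht
      have hmem : (j, i, r) ∈ D := Finset.mem_product.2 ⟨Finset.mem_range.2 hj,
        Finset.mem_product.2 ⟨Finset.mem_range.2 hi, Finset.mem_range.2 hr⟩⟩
      rcases h' with ⟨-, h'⟩ | ⟨-, h'⟩
      · exact .inr (.inl (Finset.mem_image.2 ⟨(j, i, r), hmem, h'.symm⟩))
      · exact .inr (.inr (Finset.mem_image.2 ⟨(j, i, r), hmem, h'.symm⟩))
  · have h₀ := Finset.card_union_le ((Finset.range s).image (fun j => σ 11 (pr 0 j)))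
      (D.image g ∪ D.image g')
    have h₁ := Finset.card_union_le (D.image g) (D.image g')
    have h₂ : (D.image g).card ≤ D.card := Finset.card_image_le
    have h₃ : (D.image g').card ≤ D.card := Finset.card_image_le
    have h₄ : ((Finset.range s).image (fun j => σ 11 (pr 0 j))).card ≤ s :=
      Finset.card_image_le.trans (by simp)
    omega

end

/-- Some vertices of the kernel are marked, among them those with the property `D`. -/
def Progress (σ τ : Mem) (A : SimpleGraph ℕ) (D : ℕ → Prop) : Prop :=
  ∃ M, Marked τ A M (kernelDeg (σ 10 0)) ∧ (∀ v, M v → Kernel σ v) ∧ ∀ v, D v → M v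

theorem Progress.mono {σ τ : Mem} {A : SimpleGraph ℕ} {D D' : ℕ → Prop} (h : Progress σ τ A D)
    (hD : ∀ v, D' v → D v) : Progress σ τ A D' := by
  obtain ⟨M, h₁, h₂, h₃⟩ := h
  exact ⟨M, h₁, h₂, fun v hv => h₃ v (hD v hv)⟩

theorem Progress.congr {σ τ τ' : Mem} {A : SimpleGraph ℕ} {D : ℕ → Prop} (h : Progress σ τ A D)
    (he : ∀ a ∈ [4, 5, 60, 61, 62, 63, 64, 65, 66, 80], τ' a = τ a) : Progress σ τ' A D := by
  obtain ⟨M, h₁, h₂⟩ := h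
  exact ⟨M, h₁.congr he, h₂⟩

/-- Different requests may ask for the same vertex. Therefore `Progress` does not fix the marked
set, but bounds it from above by the kernel and from below by the requests served. -/
theorem mark_progress {w b n : ℕ} {σ τ : Mem} {A : SimpleGraph ℕ} {D : ℕ → Prop} {v : ℕ}
    (h : Core σ n A) (he : ∀ a, 2 ≤ a → a ≤ 21 → τ a = σ a) (hp : Progress σ τ A D)
    (hv : τ 71 0 = v) (hk : Kernel σ v) (hord : σ 4 v ≠ 0 → ∀ M, Marked τ A M (kernelDeg (σ 10 0)) →
      ∀ u, M u → σ 4 u ≠ 0)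
    (hb : (n + 1) * kernelDeg (σ 10 0) + n + 2 < 2 ^ b) :
    Tri w b mark τ (200 + kernelDeg (σ 10 0) * 100) (fun τ' => Progress σ τ' A (fun u => D u ∨ u = v)) := by
  obtain ⟨M, h₁, h₂, h₃⟩ := hp
  have h4 : τ 4 = σ 4 := he 4 (by decide) (by decide)
  have h5 : τ 5 = σ 5 := he 5 (by decide) (by decide)
  have h10 : τ 10 = σ 10 := he 10 (by decide) (by decide)
  refine (mark_spec (h.congr fun a h h' _ => he a h h' : Core τ n A) h₁ (by rw [hv]; exact hk.lt h)
    (fun u hu => (h₂ u hu).lt h) (fun hs u hu => ?_) ?_ hb).conseq le_rfl fun τ' _ _ hM =>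
    ⟨_, hM, fun u hu => ?_, fun u hu => ?_⟩
  · rw [h4] at hs ⊢
    rw [hv] at hs
    exact hord hs M h₁ u hu
  · have := h₁.bucket_le h h4 h5 h₂ (τ 5 (τ 71 0))
    rw [h10]
    unfold kernelDeg
    omega
  · rcases hu with hu | rfl
    · exact h₂ u hu
    · rwa [hv]
  · rcases hu with hu | rfl
    · exact .inl (h₃ u hu)
    · exact .inr hv.symm

/-- Mark two vertices for the vertex with slot `74`, the label `75` and the number `69`. -/
def markPair : Cmd := .seq
  (.ite (.lt (.var 69) (.cell 19 (.pr (.var 74) (.var 75))))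
    (.seq (.assign 71 (.const 0) (.cell 14 (.pr (.var 75)
      (permAt 20 (.pr (.var 74) (.var 75)) (.var 69))))) mark) .skip)
  (.ite (.lt (.cell 19 (.pr (.var 74) (.var 75)) + .var 69) (.cell 13 (.var 75)))
    (.seq (.assign 71 (.const 0) (.cell 14 (.pr (.var 75) (permAt 20 (.pr (.var 74) (.var 75))
      (.cell 19 (.pr (.var 74) (.var 75)) + .var 69))))) mark) .skip)

theorem markPair_spec {w b n j i r : ℕ} {σ τ : Mem} {A : SimpleGraph ℕ} {D : ℕ → Prop}
    (h : Core σ n A) (he : ∀ a, 2 ≤ a → a ≤ 21 → τ a = σ a) (hp : Progress σ τ A D)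
    (hj : j < σ 10 0) (hi : i < σ 10 0 + 2) (hr : r < σ 10 0 + 1)
    (hi' : i < σ 16 (σ 4 (σ 11 (pr 0 j)))) (h69 : τ 69 0 = r)
    (h74 : τ 74 0 = σ 4 (σ 11 (pr 0 j))) (h75 : τ 75 0 = σ 17 (pr (σ 4 (σ 11 (pr 0 j))) i))
    (hb : (n + 1) * kernelDeg (σ 10 0) + n + 2 < 2 ^ b) :
    Tri w b markPair τ (1200 + kernelDeg (σ 10 0) * 200) (fun τ' =>
      Progress σ τ' A (fun u => D u ∨ Target σ j i r u)) := by
  set s := σ 4 (σ 11 (pr 0 j)) with hs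
  set l := σ 17 (pr s i) with hl
  set c := σ 19 (pr s l) with hc
  set v₁ := σ 14 (pr l (σ 20 (pr (pr s l) r) ^^^ r)) with hv₁
  set v₂ := σ 14 (pr l (σ 20 (pr (pr s l) (c + r)) ^^^ (c + r))) with hv₂
  have hT : ∀ u, Target σ j i r u ↔ (r < c ∧ u = v₁) ∨ (c + r < σ 13 l ∧ u = v₂) := fun u =>
    ⟨fun ⟨_, s', l', c', e₁, e₂, e₃, h'⟩ => by subst e₁; subst e₂; subst e₃; exact h',
      fun h' => ⟨hi', s, l, c, rfl, rfl, rfl, h'⟩⟩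
  have kern : ∀ {u}, Target σ j i r u → Kernel σ u := fun ht => .inr ⟨j, hj, i, hi, r, hr, ht⟩
  refine Tri.seq (B₁ := 600 + kernelDeg (σ 10 0) * 100) (B₂ := 600 + kernelDeg (σ 10 0) * 100)
    (Q₁ := fun τ' => Progress σ τ' A (fun u => D u ∨ r < c ∧ u = v₁)) ?_ (fun τ₁ _ fr hp₁ => ?_)
    (by omega)
  · refine Tri.ite (B₁ := 500 + kernelDeg (σ 10 0) * 100) (by decide) (fun hlt => ?_) (fun hlt => ?_)
      (by simp [Expr.cost, Expr.var, Expr.lt, Expr.pr]; ring_nf; omega)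
    · have hlt : r < c := by
        by_contra h'
        simp [h69, h74, h75, he 19 (by decide) (by decide), ← hc, h'] at hlt
      refine Tri.seq (B₁ := 300) (B₂ := 200 + kernelDeg (σ 10 0) * 100) (Q₁ := fun τ' => τ' = τ.set 71 0 v₁)
        (Tri.exec (by decide) (by decide) (fun _ _ => by simp) fun _ _ => by
          simp [h69, h74, h75, he 14 (by decide) (by decide), he 20 (by decide) (by decide), permAt,
            hv₁]) ?_ (by omega)
      rintro _ - - rfl
      refine (mark_progress h (fun a h₁ h₂ => by rw [Mem.set_ne _ _ _ (by omega), he a h₁ h₂])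
        (hp.congr fun a ha => Mem.set_ne _ _ _ ?_) (v := v₁) (by simp [Mem.set_apply])
        (kern ((hT _).2 (.inl ⟨hlt, rfl⟩))) (fun h4 => ?_) hb).conseq le_rfl fun τ' _ _ hp' =>
        hp'.mono fun u => ?_
      · rintro rfl
        simp at ha
      -- Requested vertices lie outside of the solution, so the condition on the order of marking is
      -- void.
      · exact (h4 (((hT _).2 (.inl ⟨hlt, rfl⟩)).spec h hj).2.1).elim
      · rintro (hu | ⟨-, rfl⟩)
        · exact .inl hu
        · exact .inr rfl
    · have hlt : ¬ r < c := by
        intro h'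
        simp [h69, h74, h75, he 19 (by decide) (by decide), ← hc, h'] at hlt
      exact (Tri.skip (Q := fun τ' => Progress σ τ' A (fun u => D u ∨ r < c ∧ u = v₁))
        (hp.mono fun u hu => hu.resolve_right fun h' => hlt h'.1)).conseq (by omega) fun _ _ _ => id
  · have e₁ : ∀ a, a ∉ [60, 61, 62, 63, 64, 65, 66, 70, 71, 72, 73, 80] → τ₁ a = τ a := fun a ha => fr a (by
      simp only [List.mem_cons, List.not_mem_nil, or_false, not_or] at ha
      simp [mark, emit, setAdd, Cmd.forLoop, Cmd.block, Cmd.mods, ha])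
    have he₁ : ∀ a, 2 ≤ a → a ≤ 21 → τ₁ a = σ a := fun a h₁ h₂ => by
      rw [e₁ a (by simp; omega), he a h₁ h₂]
    rw [← e₁ 69 (by decide)] at h69
    rw [← e₁ 74 (by decide)] at h74
    rw [← e₁ 75 (by decide)] at h75
    refine Tri.ite (B₁ := 500 + kernelDeg (σ 10 0) * 100) (by decide) (fun hlt => ?_) (fun hlt => ?_)
      (by simp [Expr.cost, Expr.var, Expr.lt, Expr.pr]; ring_nf; omega)
    · have hlt : c + r < σ 13 l := by
        by_contra h'
        simp [h69, h74, h75, he₁ 19 (by decide) (by decide), he₁ 13 (by decide) (by decide), ← hc,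
          h'] at hlt
      refine Tri.seq (B₁ := 300) (B₂ := 200 + kernelDeg (σ 10 0) * 100) (Q₁ := fun τ' => τ' = τ₁.set 71 0 v₂)
        (Tri.exec (by decide) (by decide) (fun _ _ => by simp) fun _ _ => by
          simp [h69, h74, h75, he₁ 14 (by decide) (by decide), he₁ 20 (by decide) (by decide),
            he₁ 19 (by decide) (by decide), permAt, hv₂, ← hc]) ?_ (by omega)
      rintro _ - - rfl
      refine (mark_progress h (fun a h₁ h₂ => by rw [Mem.set_ne _ _ _ (by omega), he₁ a h₁ h₂])
        (hp₁.congr fun a ha => Mem.set_ne _ _ _ ?_) (v := v₂) (by simp [Mem.set_apply])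
        (kern ((hT _).2 (.inr ⟨hlt, rfl⟩))) (fun h4 => ?_) hb).conseq le_rfl fun τ' _ _ hp' =>
        hp'.mono fun u => ?_
      · rintro rfl
        simp at ha
      · exact (h4 (((hT _).2 (.inr ⟨hlt, rfl⟩)).spec h hj).2.1).elim
      · rw [hT]
        rintro (hu | hu | ⟨-, rfl⟩)
        · exact .inl (.inl hu)
        · exact .inl (.inr hu)
        · exact .inr rfl
    · have hlt : ¬ c + r < σ 13 l := by
        intro h'
        simp [h69, h74, h75, he₁ 19 (by decide) (by decide), he₁ 13 (by decide) (by decide), ← hc,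
          h'] at hlt
      refine (Tri.skip (Q := fun τ' => Progress σ τ' A (fun u => D u ∨ Target σ j i r u))
        (hp₁.mono fun u hu => ?_)).conseq (by omega) fun _ _ _ => id
      rw [hT] at hu
      tauto

end RAM


/-! ### Marking the whole kernel -/

namespace RAM

/-- Mark the solution. -/
def markSol : Cmd := .forLoop 67 (.var 10)
  (.seq (.assign 71 (.const 0) (.cell 11 (.pr (.const 0) (.var 67)))) mark)

/-- Mark the vertices for the vertex of the solution with index `67` and its label with index `68`. -/
def markLabel : Cmd := .ite (.lt (.var 68) (.cell 16 (.var 74)))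
  (.seq (.assign 75 (.const 0) (.cell 17 (.pr (.var 74) (.var 68))))
    (.forLoop 69 (.var 10 + .const 1) markPair)) .skip

/-- Mark all vertices of the kernel. -/
def markAll : Cmd := .seq (.block [.assign 64 (.const 0) (.const 0), .assign 66 (.const 0) (.const 0)])
  (.seq markSol (.forLoop 67 (.var 10)
    (.seq (.assign 74 (.const 0) (.cell 4 (.cell 11 (.pr (.const 0) (.var 67)))))
      (.forLoop 68 (.var 10 + .const 2) markLabel))))

theorem kernelDeg_le (s : ℕ) : kernelDeg s ≤ 2 * (s + 1) ^ 2 := by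
  unfold kernelDeg
  nlinarith

section

variable {w b n : ℕ} {σ τ : Mem} {A : SimpleGraph ℕ}

/-- The invariant describes the marked set exactly, since the condition on the order in `mark_spec`
requires that only vertices of the solution have been marked so far. -/
theorem markSol_spec (h : Core σ n A) (he : ∀ a, 2 ≤ a → a ≤ 21 → τ a = σ a)
    (hp : Marked τ A (fun _ => False) (kernelDeg (σ 10 0)))
    (hb : (n + 1) * kernelDeg (σ 10 0) + n + 2 < 2 ^ b) :
    Tri w b markSol τ (600 * (σ 10 0 + 1) ^ 3) (fun τ' => Progress σ τ' A (fun v => σ 4 v ≠ 0)) := by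
  set s := σ 10 0 with hs
  have hsn : s ≤ n := h.xlen_le
  have mods : ∀ {a}, 2 ≤ a → a ≤ 21 → a ∉ (Cmd.seq (.assign 71 (.const 0)
      (.cell 11 (.pr (.const 0) (.var 67)))) mark).mods := fun h₁ h₂ => by
    simp [mark, emit, setAdd, Cmd.forLoop, Cmd.block, Cmd.mods]
    omega
  refine (Tri.forLoop (N := .var 10) (v := 67) s (fun j τ' => ∃ M, Marked τ' A M (kernelDeg s) ∧
    ∀ v, M v ↔ ∃ i < j, σ 11 (pr 0 i) = v) (B₁ := 300 + kernelDeg s * 100) (by decide) (by decide)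
    (fun j τ' fr _ => by simp [fr 10 (by decide) (by decide), he 10 (by decide) (by decide), hs])
    (by omega) ⟨_, hp.congr fun a ha => Mem.set_ne _ _ _ ?_, by simp⟩ ?_ le_rfl).conseq ?_ ?_
  · rintro rfl
    simp at ha
  · rintro j hj τ₁ - fr h67 ⟨M, hM, hMj⟩
    have he₁ : ∀ a, 2 ≤ a → a ≤ 21 → τ₁ a = σ a := fun a h₁ h₂ => by
      rw [fr a (mods h₁ h₂) (by omega), he a h₁ h₂]
    have hsol := h.sol.mem j hj
    refine Tri.seq (B₁ := 50) (B₂ := 200 + kernelDeg s * 100) (Q₁ := fun τ' => τ' = τ₁.set 71 0 (σ 11 (pr 0 j)))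
      (Tri.exec (by decide) (by decide) (fun _ _ => by simp) fun _ _ => by
        simp [he₁ 11 (by decide) (by decide), h67]) ?_ (by omega)
    rintro _ - - rfl
    set τ₂ := τ₁.set 71 0 (σ 11 (pr 0 j)) with hτ₂
    have he₂ : ∀ a, 2 ≤ a → a ≤ 21 → τ₂ a = σ a := fun a h₁ h₂ => by
      rw [hτ₂, Mem.set_ne _ _ _ (by omega), he₁ a h₁ h₂]
    have hM₂ : Marked τ₂ A M (kernelDeg s) := hM.congr fun a ha => Mem.set_ne _ _ _ (by
      rintro rfl
      simp at ha)
    have h71 : τ₂ 71 0 = σ 11 (pr 0 j) := by simp [hτ₂, Mem.set_apply]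
    have hMX : ∀ v, M v → σ 4 v ≠ 0 := fun v hv => by
      obtain ⟨i, hi, rfl⟩ := (hMj v).1 hv
      exact (h.sol.mem i (by omega)).1
    have hbk := hM₂.bucket_le h (he₂ 4 (by decide) (by decide)) (he₂ 5 (by decide) (by decide))
      (fun v hv => .inl (hMX v hv)) (τ₂ 5 (τ₂ 71 0))
    refine (mark_spec (h.congr fun a h₁ h₂ _ => he₂ a h₁ h₂ : Core τ₂ n A) hM₂
      (by rw [h71]; exact (h.slot _ hsol.1).1) (fun u hu => (h.slot u (hMX u hu)).1) (fun _ u hu => by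
        rw [he₂ 4 (by decide) (by decide)]
        exact hMX u hu) ?_ hb).conseq le_rfl fun τ' _ _ hM' =>
        ⟨_, hM'.congr fun a ha => Mem.set_ne _ _ _ ?_, fun v => ?_⟩
    · rw [← hs] at hbk
      rw [he₂ 10 (by decide) (by decide), ← hs]
      unfold kernelDeg
      omega
    · rintro rfl
      simp at ha
    · rw [hMj, h71]
      constructor
      · rintro (⟨i, hi, e⟩ | rfl)
        · exact ⟨i, by omega, e⟩
        · exact ⟨j, by omega, rfl⟩
      · rintro ⟨i, hi, e⟩
        rcases Nat.lt_succ_iff_lt_or_eq.1 hi with hi | rfl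
        · exact .inl ⟨i, hi, e⟩
        · exact .inr e.symm
  · have hk := kernelDeg_le s
    have h1 : s * (300 + kernelDeg s * 100 + 2 + 10) ≤ s * (312 + 2 * (s + 1) ^ 2 * 100) :=
      Nat.mul_le_mul_left _ (by omega)
    have h2 : (Expr.var 10).cost = 2 := rfl
    rw [h2]
    nlinarith [h1]
  · rintro τ' - - ⟨M, hM, hMs⟩
    have hX : ∀ v, M v ↔ σ 4 v ≠ 0 := fun v => by rw [hMs, h.sol.exists_iff v]
    exact ⟨M, hM, fun v hv => .inl ((hX v).1 hv), fun v => (hX v).2⟩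

theorem markLabel_spec {j i : ℕ} {D : ℕ → Prop} (h : Core σ n A)
    (he : ∀ a, 2 ≤ a → a ≤ 21 → τ a = σ a) (hp : Progress σ τ A D)
    (hj : j < σ 10 0) (hi : i < σ 10 0 + 2) (h68 : τ 68 0 = i)
    (h74 : τ 74 0 = σ 4 (σ 11 (pr 0 j)))
    (hb : (n + 1) * kernelDeg (σ 10 0) + n + 2 < 2 ^ b) :
    Tri w b markLabel τ (1800 * (σ 10 0 + 1) ^ 3) (fun τ' =>
      Progress σ τ' A (fun u => D u ∨ ∃ r < σ 10 0 + 1, Target σ j i r u)) := by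
  set s := σ 10 0 with hs
  have hsn : s ≤ n := h.xlen_le
  have mods : ∀ {a}, 2 ≤ a → a ≤ 21 → a ∉ markPair.mods := fun h₁ h₂ => by
    simp [markPair, mark, emit, setAdd, Cmd.forLoop, Cmd.block, Cmd.mods]
    omega
  have hpow : 1 ≤ (s + 1) ^ 3 := Nat.one_le_pow _ _ (by omega)
  refine Tri.ite (B₁ := 1750 * (s + 1) ^ 3) (by decide) (fun hlt => ?_) (fun hlt => ?_)
    (by simp [Expr.cost, Expr.var, Expr.lt]; omega)
  · have hlt : i < σ 16 (σ 4 (σ 11 (pr 0 j))) := by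
      by_contra h'
      simp [h68, h74, he 16 (by decide) (by decide), h'] at hlt
    set l := σ 17 (pr (σ 4 (σ 11 (pr 0 j))) i) with hl
    refine Tri.seq (B₁ := 50) (B₂ := 1700 * (s + 1) ^ 3) (Q₁ := fun τ' => τ' = τ.set 75 0 l)
      (Tri.exec (by decide) (by decide) (fun _ _ => by simp) fun _ _ => by
        simp [he 17 (by decide) (by decide), h68, h74, hl]) ?_ (by omega)
    rintro _ - - rfl
    refine (Tri.forLoop (N := .var 10 + .const 1) (v := 69) (s + 1) (fun r τ' => Progress σ τ' A (fun u =>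
      D u ∨ ∃ r' < r, Target σ j i r' u)) (B₁ := 1200 + kernelDeg s * 200) (by decide) (by decide)
      (fun r τ' fr _ => ?_) (by omega) ?_ ?_ le_rfl).conseq ?_ fun _ _ _ => id
    · simp [fr 10 (by decide) (by decide), Mem.set_apply, he 10 (by decide) (by decide), hs]
    · refine (hp.congr fun a ha => ?_).mono fun u => by simp
      rw [Mem.set_ne _ _ _ (by rintro rfl; simp at ha), Mem.set_ne _ _ _ (by rintro rfl; simp at ha)]
    · intro r hr τ₁ _ fr h69 hp₁
      refine (markPair_spec h (fun a h₁ h₂ => ?_) hp₁ hj hi hr hlt h69 ?_ ?_ hb).conseq le_rfl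
        fun τ' _ _ hp' => (hp'.congr fun a ha => Mem.set_ne _ _ _ (by rintro rfl; simp at ha)).mono ?_
      · rw [fr a (mods h₁ h₂) (by omega), Mem.set_ne _ _ _ (by omega), he a h₁ h₂]
      · rw [fr 74 (by decide) (by decide), Mem.set_ne _ _ _ (by omega), h74]
      · rw [fr 75 (by decide) (by decide)]
        simp [Mem.set_apply, hl]
      · rintro u (hu | ⟨r', hr', hu⟩)
        · exact .inl (.inl hu)
        · rcases Nat.lt_succ_iff_lt_or_eq.1 hr' with hr' | rfl
          · exact .inl (.inr ⟨r', hr', hu⟩)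
          · exact .inr hu
    · have h1 : (s + 1) * (1200 + kernelDeg s * 200 + 4 + 10) ≤ (s + 1) * (1214 + 2 * (s + 1) ^ 2 * 200) :=
        Nat.mul_le_mul_left _ (by have := kernelDeg_le s; omega)
      have h2 : (Expr.var 10 + Expr.const 1).cost = 4 := rfl
      have h3 : s + 1 ≤ (s + 1) ^ 3 := Nat.le_self_pow (by norm_num) _
      have h4 : (s + 1) * (1214 + 2 * (s + 1) ^ 2 * 200) = 1214 * (s + 1) + 400 * (s + 1) ^ 3 := by ring
      rw [h2]
      omega
  · have hlt : ¬ i < σ 16 (σ 4 (σ 11 (pr 0 j))) := by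
      intro h'
      simp [h68, h74, he 16 (by decide) (by decide), h'] at hlt
    refine (Tri.skip (Q := fun τ' => Progress σ τ' A (fun u => D u ∨ ∃ r < s + 1, Target σ j i r u))
      (hp.mono fun u hu => ?_)).conseq (by omega) fun _ _ _ => id
    rcases hu with hu | ⟨r, -, hu⟩
    · exact hu
    · exact (hlt hu.1).elim

/-- The `O(s ^ 3)` requests cost `O(s ^ 2)` each. In the end the lower bound of `Progress` has
reached the upper one, so precisely the kernel is marked. -/
theorem markAll_spec (h : Core σ n A) (h60 : ∀ v, σ 60 v = 0) (h61 : ∀ l, σ 61 l = 0)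
    (h80 : ∀ i, σ 80 i = 0)
    (hb : (n + 1) * kernelDeg (σ 10 0) + n + 2 < 2 ^ b) :
    Tri w b markAll σ (5000 * (σ 10 0 + 1) ^ 5) (fun τ =>
      Marked τ A (Kernel σ) (kernelDeg (σ 10 0))) := by
  set s := σ 10 0 with hs
  have hsn : s ≤ n := h.xlen_le
  have hpow : 1 ≤ (s + 1) ^ 5 := Nat.one_le_pow _ _ (by omega)
  have hpow' : (s + 1) ^ 3 ≤ (s + 1) ^ 5 := Nat.pow_le_pow_right (by omega) (by norm_num)
  refine Tri.seq (B₁ := 50) (B₂ := 4950 * (s + 1) ^ 5) (Q₁ := fun τ => τ 64 0 = 0 ∧ τ 66 0 = 0)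
    (Tri.exec (by decide) (by decide) (fun _ _ => by simp) fun _ _ => by simp [Mem.set_apply]) ?_
    (by omega)
  rintro τ - fr ⟨h64, h66⟩
  have f : ∀ a, a ≠ 64 → a ≠ 66 → τ a = σ a := fun a h₁ h₂ => fr a (by simp [Cmd.block, Cmd.mods, h₁, h₂])
  -- Arrays `62`, `63` and `65` may contain remnants of earlier queries; with all lengths equal to
  -- zero they are irrelevant.
  have hM : Marked τ A (fun _ => False) (kernelDeg s) := by
    refine ⟨⟨fun i hi => ?_, fun v hv => hv.elim⟩, fun v => ?_, fun l => ⟨fun i hi => ?_, fun v hv => ?_⟩,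
      ⟨fun e he => ?_, fun a b hab => ?_, fun e he => ?_, fun i _ => ?_⟩, by omega⟩
    · omega
    · simp [f, h60]
    · rw [f 61 (by decide) (by decide), h61] at hi
      omega
    · omega
    · omega
    · omega
    · omega
    · rw [f 80 (by decide) (by decide), h80]
  refine Tri.seq (B₁ := 600 * (s + 1) ^ 3) (B₂ := 4350 * (s + 1) ^ 5)
    (markSol_spec h (fun a h₁ h₂ => f a (by omega) (by omega)) hM hb) ?_ (by omega)
  intro τ₁ _ fr₁ hp
  have he₁ : ∀ a, 2 ≤ a → a ≤ 21 → τ₁ a = σ a := fun a h₁ h₂ => by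
    rw [fr₁ a ?_, f a (by omega) (by omega)]
    simp [markSol, mark, emit, setAdd, Cmd.forLoop, Cmd.block, Cmd.mods]
    omega
  refine (Tri.forLoop (N := .var 10) (v := 67) s (fun j τ' => Progress σ τ' A (fun u =>
    σ 4 u ≠ 0 ∨ ∃ j' < j, ∃ i < s + 2, ∃ r < s + 1, Target σ j' i r u)) (B₁ := 4100 * (s + 1) ^ 4)
    (by decide) (by decide) (fun j τ' fr _ => ?_) (by omega) ?_ ?_ le_rfl).conseq ?_ ?_
  · simp [fr 10 (by decide) (by decide), he₁ 10 (by decide) (by decide), hs]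
  · refine (hp.congr fun a ha => ?_).mono fun u => by simp
    rw [Mem.set_ne _ _ _ (by rintro rfl; simp at ha)]
  · intro j hj τ₂ _ fr₂ h67 hp₂
    have he₂ : ∀ a, 2 ≤ a → a ≤ 21 → τ₂ a = σ a := fun a h₁ h₂ => by
      rw [fr₂ a ?_ (by omega), he₁ a h₁ h₂]
      simp [markLabel, markPair, mark, emit, setAdd, Cmd.forLoop, Cmd.block, Cmd.mods]
      omega
    have hpow4 : 1 ≤ (s + 1) ^ 4 := Nat.one_le_pow _ _ (by omega)
    refine Tri.seq (B₁ := 50) (B₂ := 4050 * (s + 1) ^ 4)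
      (Q₁ := fun τ' => τ' = τ₂.set 74 0 (σ 4 (σ 11 (pr 0 j))))
      (Tri.exec (by decide) (by decide) (fun _ _ => by simp) fun _ _ => by
        simp [he₂ 4 (by decide) (by decide), he₂ 11 (by decide) (by decide), h67]) ?_ (by omega)
    rintro _ - - rfl
    refine (Tri.forLoop (N := .var 10 + .const 2) (v := 68) (s + 2) (fun i τ' => Progress σ τ' A (fun u =>
      (σ 4 u ≠ 0 ∨ ∃ j' < j, ∃ i < s + 2, ∃ r < s + 1, Target σ j' i r u) ∨
        ∃ i' < i, ∃ r < s + 1, Target σ j i' r u)) (B₁ := 1800 * (s + 1) ^ 3) (by decide) (by decide)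
      (fun i τ' fr _ => ?_) (by omega) ?_ ?_ le_rfl).conseq ?_ ?_
    · simp [fr 10 (by decide) (by decide), Mem.set_apply, he₂ 10 (by decide) (by decide), hs]
    · refine (hp₂.congr fun a ha => ?_).mono fun u => by simp
      rw [Mem.set_ne _ _ _ (by rintro rfl; simp at ha), Mem.set_ne _ _ _ (by rintro rfl; simp at ha)]
    · intro i hi τ₃ _ fr₃ h68 hp₃
      refine (markLabel_spec h (fun a h₁ h₂ => ?_) hp₃ hj hi h68 ?_ hb).conseq le_rfl
        fun τ' _ _ hp' => (hp'.congr fun a ha => Mem.set_ne _ _ _ (by rintro rfl; simp at ha)).mono ?_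
      · rw [fr₃ a ?_ (by omega), Mem.set_ne _ _ _ (by omega), he₂ a h₁ h₂]
        simp [markLabel, markPair, mark, emit, setAdd, Cmd.forLoop, Cmd.block, Cmd.mods]
        omega
      · rw [fr₃ 74 (by decide) (by decide)]
        simp [Mem.set_apply]
      · rintro u (hu | ⟨i', hi', hu⟩)
        · exact .inl (.inl hu)
        · rcases Nat.lt_succ_iff_lt_or_eq.1 hi' with hi' | rfl
          · exact .inl (.inr ⟨i', hi', hu⟩)
          · exact .inr hu
    · have h2 : (Expr.var 10 + Expr.const 2).cost = 4 := rfl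
      rw [h2]
      have h3 : (s + 2) * (1800 * (s + 1) ^ 3 + 4 + 10) ≤ 2 * (s + 1) * (1800 * (s + 1) ^ 3 + 4 + 10) :=
        Nat.mul_le_mul_right _ (by omega)
      have h4 : 2 * (s + 1) * (1800 * (s + 1) ^ 3 + 4 + 10) = 3600 * (s + 1) ^ 4 + 28 * (s + 1) := by ring
      have h5 : s + 1 ≤ (s + 1) ^ 4 := Nat.le_self_pow (by norm_num) _
      omega
    · intro τ' _ _ hp'
      refine (hp'.congr fun a ha => Mem.set_ne _ _ _ (by rintro rfl; simp at ha)).mono ?_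
      rintro u (hu | ⟨j', hj', hu⟩)
      · exact .inl (.inl hu)
      · rcases Nat.lt_succ_iff_lt_or_eq.1 hj' with hj' | rfl
        · exact .inl (.inr ⟨j', hj', hu⟩)
        · exact .inr hu
  · have h2 : (Expr.var 10).cost = 2 := rfl
    rw [h2]
    have h3 : s * (4100 * (s + 1) ^ 4 + 2 + 10) ≤ (s + 1) * (4100 * (s + 1) ^ 4 + 2 + 10) :=
      Nat.mul_le_mul_right _ (by omega)
    have h4 : (s + 1) * (4100 * (s + 1) ^ 4 + 2 + 10) = 4100 * (s + 1) ^ 5 + 12 * (s + 1) := by ring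
    have h5 : s + 1 ≤ (s + 1) ^ 5 := Nat.le_self_pow (by norm_num) _
    omega
  · rintro τ' - - ⟨M, hM', hk, hD⟩
    have : M = Kernel σ := funext fun v => propext ⟨hk v, hD v⟩
    exact this ▸ hM'

end

end RAM


namespace RAM

/-! ### Running a program in a part of the memory -/

theorem Expr.Fits.mono {w w' : ℕ} {σ : Mem} (hw : w ≤ w') {e : Expr} (h : e.Fits w σ) :
    e.Fits w' σ := by
  have hp : 2 ^ w ≤ 2 ^ w' := Nat.pow_le_pow_right (by norm_num) hw
  induction e with
  | const c => exact lt_of_lt_of_le h hp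
  | cell a i ih => exact ⟨ih h.1, h.2.trans_le hp⟩
  | bin o e₁ e₂ h₁ h₂ => exact ⟨h₁ h.1, h₂ h.2.1, h.2.2.trans_le hp⟩

theorem Expr.Fits.eval_lt {w : ℕ} {σ : Mem} {e : Expr} (h : e.Fits w σ) : e.eval σ < 2 ^ w := by
  cases e with
  | const c => exact h
  | cell a i => exact h.2
  | bin o e₁ e₂ => exact h.2.2

/-- The expression with array `a` moved to `80 + 3 * a`. -/
def Expr.shift : Expr → Expr
  | .const c => .const c
  | .cell a i => .cell (80 + 3 * a) i.shift
  | .bin o e₁ e₂ => .bin o e₁.shift e₂.shift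

/-- The program with array `a` moved to `80 + 3 * a`. Every cell written for the first time is linked
into a list, given by the arrays `81 + 3 * a` and `82 + 3 * a`. -/
def Cmd.shift : Cmd → Cmd
  | .skip => .skip
  | .assign a i e => .seq (.assign 76 (.const 0) i.shift) (.seq (.assign 77 (.const 0) e.shift)
      (.block [.ite (.cell (81 + 3 * a) (.var 76)) .skip (.block
        [.assign (81 + 3 * a) (.var 76) (.var (82 + 3 * a) + .const 1),
          .assign (82 + 3 * a) (.const 0) (.var 76 + .const 1)]),
        .assign (80 + 3 * a) (.var 76) (.var 77)]))
  | .seq c₁ c₂ => .seq c₁.shift c₂.shift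
  | .ite b c₁ c₂ => .ite b.shift c₁.shift c₂.shift
  | .loop b c => .loop b.shift c.shift

theorem Cmd.mem_mods_shift {c : Cmd} {x : ℕ} (h : x ∈ c.shift.mods) :
    x = 76 ∨ x = 77 ∨ ∃ a ∈ c.mods, x = 80 + 3 * a ∨ x = 81 + 3 * a ∨ x = 82 + 3 * a := by
  induction c with
  | skip => simp [shift, mods] at h
  | assign a i e =>
    simp [shift, mods, block] at h ⊢
    tauto
  | seq c₁ c₂ h₁ h₂ =>
    simp only [shift, mods, List.mem_append] at h ⊢
    rcases h with h | h
    · rcases h₁ h with h | h | ⟨a, ha, h⟩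
      exacts [.inl h, .inr (.inl h), .inr (.inr ⟨a, .inl ha, h⟩)]
    · rcases h₂ h with h | h | ⟨a, ha, h⟩
      exacts [.inl h, .inr (.inl h), .inr (.inr ⟨a, .inr ha, h⟩)]
  | ite b c₁ c₂ h₁ h₂ =>
    simp only [shift, mods, List.mem_append] at h ⊢
    rcases h with h | h
    · rcases h₁ h with h | h | ⟨a, ha, h⟩
      exacts [.inl h, .inr (.inl h), .inr (.inr ⟨a, .inl ha, h⟩)]
    · rcases h₂ h with h | h | ⟨a, ha, h⟩
      exacts [.inl h, .inr (.inl h), .inr (.inr ⟨a, .inr ha, h⟩)]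
  | loop b c ih => exact ih h

/-- The list `l` is stored with the links `f` and the head `h`, both increased by one. -/
def Linked (f : ℕ → ℕ) : ℕ → List ℕ → Prop
  | h, [] => h = 0
  | h, x :: l => h = x + 1 ∧ f x ≠ 0 ∧ Linked f (f x - 1) l

theorem Linked.congr {f f' : ℕ → ℕ} {l : List ℕ} : ∀ {h : ℕ}, Linked f h l → (∀ x ∈ l, f' x = f x) →
    Linked f' h l := by
  induction l with
  | nil => exact fun hl _ => hl
  | cons x l ih =>
    intro h hl he
    obtain ⟨h₁, h₂, h₃⟩ := hl
    have hx := he x (by simp)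
    exact ⟨h₁, by rwa [hx], by rw [hx]; exact ih h₃ fun y hy => he y (by simp [hy])⟩

/-- All cells of array `80 + 3 * a` that differ from `ρ a` and from `0` are linked; there are at most
`T` links. -/
def Logged (v T : ℕ) (ρ σ : Mem) (a : ℕ) : Prop :=
  ∃ l : List ℕ, Linked (σ (81 + 3 * a)) (σ (82 + 3 * a) 0) l ∧ l.Nodup ∧
    (∀ x, σ (81 + 3 * a) x ≠ 0 ↔ x ∈ l) ∧ (∀ x ∈ l, x < 2 ^ v) ∧ l.length ≤ T ∧
    (∀ x, x ∉ l → σ (80 + 3 * a) x = 0 ∨ σ (80 + 3 * a) x = ρ a x) ∧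
    ∀ i, i ≠ 0 → σ (82 + 3 * a) i = 0

theorem Logged.mono {v T T' : ℕ} {ρ σ : Mem} {a : ℕ} (h : Logged v T ρ σ a) (hT : T ≤ T') :
    Logged v T' ρ σ a := by
  obtain ⟨l, h₁, h₂, h₃, h₄, h₅, h₆⟩ := h
  exact ⟨l, h₁, h₂, h₃, h₄, h₅.trans hT, h₆⟩

theorem Logged.congr {v T : ℕ} {ρ σ σ' : Mem} {a : ℕ} (h : Logged v T ρ σ a)
    (h₀ : σ' (80 + 3 * a) = σ (80 + 3 * a)) (h₁ : σ' (81 + 3 * a) = σ (81 + 3 * a))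
    (h₂ : σ' (82 + 3 * a) = σ (82 + 3 * a)) : Logged v T ρ σ' a := by
  unfold Logged
  rw [h₀, h₁, h₂]
  exact h

/-- Heads and links hold addresses increased by one, so the value `2 ^ v` itself may occur. This is
why `Shifted` grants one bit more than the simulated program has. -/
theorem Logged.head_le {v T : ℕ} {ρ σ : Mem} {a : ℕ} (h : Logged v T ρ σ a) :
    σ (82 + 3 * a) 0 ≤ 2 ^ v := by
  obtain ⟨l, h₁, -, -, h₄, -⟩ := h
  cases l with
  | nil => rw [show σ (82 + 3 * a) 0 = 0 from h₁]; exact Nat.zero_le _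
  | cons x l => rw [h₁.1]; exact h₄ x (by simp)

/-- The memory `σ` holds the memory `π` of a program that was started in `ρ`. -/
structure Shifted (v T : ℕ) (ρ π σ : Mem) : Prop where
  val : ∀ a, σ (80 + 3 * a) = π a
  log : ∀ a, Logged v T ρ σ a
  bd : Bd (v + 1) σ

theorem Shifted.eval {v T : ℕ} {ρ π σ : Mem} (h : Shifted v T ρ π σ) (e : Expr) :
    e.shift.eval σ = e.eval π := by
  induction e with
  | const c => rfl
  | cell a i ih => simp only [Expr.shift, Expr.eval_cell, ih, h.val]
  | bin o e₁ e₂ h₁ h₂ => simp only [Expr.shift, Expr.eval, h₁, h₂]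

theorem Shifted.fits {v T : ℕ} {ρ π σ : Mem} (h : Shifted v T ρ π σ) {e : Expr} (he : e.Fits v π) :
    e.shift.Fits v σ := by
  induction e with
  | const c => exact he
  | cell a i ih => exact ⟨ih he.1, by rw [h.eval, h.val]; exact he.2⟩
  | bin o e₁ e₂ h₁ h₂ => exact ⟨h₁ he.1, h₂ he.2.1, by rw [h.eval, h.eval]; exact he.2.2⟩

theorem Expr.cost_shift (e : Expr) : e.shift.cost = e.cost := by
  induction e with
  | const c => rfl
  | cell a i ih => simp [Expr.shift, Expr.cost, ih]
  | bin o e₁ e₂ h₁ h₂ => simp [Expr.shift, Expr.cost, h₁, h₂]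

theorem Shifted.congr {v T : ℕ} {ρ π σ σ' : Mem} (h : Shifted v T ρ π σ)
    (he : ∀ a, 80 ≤ a → σ' a = σ a) (hb : Bd (v + 1) σ') : Shifted v T ρ π σ' where
  val a := by rw [he _ (by omega), h.val]
  log a := (h.log a).congr (he _ (by omega)) (he _ (by omega)) (he _ (by omega))
  bd := hb

/-- A nonzero link tells that a cell is logged already. Links are increased by one so that even the
last cell of the list has a nonzero link; hence each cell enters the list once. Address and value
are computed before the log is touched. -/
theorem Shifted.store {w v T : ℕ} {ρ π σ : Mem} (h : Shifted v T ρ π σ) (hv : 8 ≤ v)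
    (hw : 16 * (v + 1) ≤ w) {a : ℕ} {i e : Expr} (hi : i.Fits v π) (he : e.Fits v π) :
    ∃ t σ', Run w (Cmd.assign a i e).shift σ t σ' ∧ t ≤ 30 * (i.cost + e.cost + 1) ∧
      Shifted v (T + 1) ρ (π.set a (i.eval π) (e.eval π)) σ' := by
  have hp : 2 ^ (v + 1) = 2 * 2 ^ v := by ring
  have hpv : 1 < 2 ^ v := Nat.one_lt_two_pow (by omega)
  have h0 : (Expr.const 0).Fits w σ := by simp [Expr.Fits]
  set x := i.eval π with hx
  set y := e.eval π with hy
  have hxv : x < 2 ^ v := hi.eval_lt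
  have hyv : y < 2 ^ v := he.eval_lt
  have r₁ := Run.assign 76 (.const 0) i.shift σ h0 ((h.fits hi).mono (by omega : v ≤ w))
  rw [h.eval i, ← hx, Expr.cost_shift] at r₁
  set σ₁ := σ.set 76 ((Expr.const 0).eval σ) x with hσ₁
  have b₁ : Bd (v + 1) σ₁ := h.bd.set (by omega)
  have s₁ : Shifted v T ρ π σ₁ := h.congr (fun a ha => Mem.set_ne _ _ _ (by omega)) b₁
  have r₂ := Run.assign 77 (.const 0) e.shift σ₁ (w := w) (by simp [Expr.Fits])
    ((s₁.fits he).mono (by omega : v ≤ w))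
  rw [s₁.eval e, ← hy, Expr.cost_shift] at r₂
  set σ₂ := σ₁.set 77 ((Expr.const 0).eval σ₁) y with hσ₂
  have b₂ : Bd (v + 1) σ₂ := b₁.set (by omega)
  have s₂ : Shifted v T ρ π σ₂ := s₁.congr (fun a ha => Mem.set_ne _ _ _ (by omega)) b₂
  have e76 : σ₂ 76 0 = x := by simp [hσ₂, hσ₁, Mem.set_apply]
  have e77 : σ₂ 77 0 = y := by simp [hσ₂, Mem.set_apply]
  clear_value σ₂
  have hhead := (s₂.log a).head_le
  obtain ⟨t, r₃, ht, b₃⟩ := Cmd.run_exec (w := w) (b := v + 1) (by omega) hw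
    (.block [.ite (.cell (81 + 3 * a) (.var 76)) .skip (.block
        [.assign (81 + 3 * a) (.var 76) (.var (82 + 3 * a) + .const 1),
          .assign (82 + 3 * a) (.const 0) (.var 76 + .const 1)]),
        .assign (80 + 3 * a) (.var 76) (.var 77)]) b₂ rfl (by
      simp only [Cmd.sound_cons, Cmd.sound_nil, Cmd.sound_ite, Cmd.sound_skip, Cmd.sound_assign]
      simp [Mem.set_apply, e76, show 76 ≠ 81 + 3 * a by omega]
      omega)
  have r := Run.seq _ _ _ _ _ _ _ r₁ (Run.seq _ _ _ _ _ _ _ r₂ r₃)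
  refine ⟨_, _, r, ?_, ?_⟩
  · have : t ≤ 26 := ht.trans (by simp [Cmd.block, Cmd.bound, Expr.cost, Expr.var])
    simp only [Expr.cost]
    omega
  · clear r r₁ r₂ r₃ ht
    simp only [Cmd.exec_cons, Cmd.exec_nil, Cmd.exec_ite, Cmd.exec_skip, Cmd.exec_assign, Expr.eval_cell,
      Expr.eval_var, Expr.eval_const, Expr.eval_add, e76] at b₃ ⊢
    obtain ⟨l, l₁, l₂, l₃, l₄, l₅, l₆, l₇⟩ := s₂.log a
    have vals : ∀ σ₃ : Mem, (∀ a', σ₃ (80 + 3 * a') = σ₂ (80 + 3 * a')) → ∀ a',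
        σ₃.set (80 + 3 * a) x y (80 + 3 * a') = π.set a x y a' := fun σ₃ hσ₃ a' => by
      funext j
      rw [Mem.set_apply, Mem.set_apply, hσ₃, s₂.val]
      by_cases h' : a' = a
      · subst h'
        simp
      · rw [if_neg (by omega), if_neg (by omega)]
    have logs : ∀ σ₃ : Mem, (∀ a', a' ≠ 81 + 3 * a → a' ≠ 82 + 3 * a → σ₃ a' = σ₂ a') →
        ∀ a', a' ≠ a → Logged v (T + 1) ρ (σ₃.set (80 + 3 * a) x y) a' := fun σ₃ hσ₃ a' ha' => by
      refine ((s₂.log a').mono (by omega)).congr ?_ ?_ ?_ <;>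
        rw [Mem.set_ne _ _ _ (by omega), hσ₃ _ (by omega) (by omega)]
    split at b₃
    · rename_i hne
      rw [if_pos hne]
      simp only [e76, e77] at b₃ ⊢
      refine ⟨vals _ fun _ => rfl, fun a' => ?_, b₃⟩
      by_cases ha' : a' = a
      · subst ha'
        rw [Logged, Mem.set_ne _ _ _ (by omega), Mem.set_ne _ _ _ (by omega)]
        refine ⟨l, l₁, l₂, l₃, l₄, by omega, fun z hz => ?_, l₇⟩
        rw [Mem.set_apply, if_neg]
        · exact l₆ z hz
        · rintro ⟨-, rfl⟩
          exact hz ((l₃ _).1 hne)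
      · exact logs _ (fun _ _ _ => rfl) a' ha'
    · rename_i hne
      rw [if_neg hne]
      have k₁ : (σ₂.set (81 + 3 * a) x (σ₂ (82 + 3 * a) 0 + 1)) 76 0 = x := by
        rw [Mem.set_ne _ _ _ (by omega), e76]
      rw [k₁] at b₃
      rw [k₁]
      have k₂ : ((σ₂.set (81 + 3 * a) x (σ₂ (82 + 3 * a) 0 + 1)).set (82 + 3 * a) 0 (x + 1)) 76 0 = x := by
        rw [Mem.set_ne _ _ _ (by omega), k₁]
      have k₃ : ((σ₂.set (81 + 3 * a) x (σ₂ (82 + 3 * a) 0 + 1)).set (82 + 3 * a) 0 (x + 1)) 77 0 = y := by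
        rw [Mem.set_ne _ _ _ (by omega), Mem.set_ne _ _ _ (by omega), e77]
      rw [k₂, k₃] at b₃ ⊢
      have fr : ∀ a', a' ≠ 81 + 3 * a → a' ≠ 82 + 3 * a →
          ((σ₂.set (81 + 3 * a) x (σ₂ (82 + 3 * a) 0 + 1)).set (82 + 3 * a) 0 (x + 1)) a' = σ₂ a' :=
        fun a' h₁ h₂ => by rw [Mem.set_ne _ _ _ h₂, Mem.set_ne _ _ _ h₁]
      refine ⟨vals _ fun a' => fr _ (by omega) (by omega), fun a' => ?_, b₃⟩
      by_cases ha' : a' = a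
      · subst ha'
        have hxl : x ∉ l := fun h' => hne ((l₃ x).2 h')
        have f81 : (((σ₂.set (81 + 3 * a') x (σ₂ (82 + 3 * a') 0 + 1)).set (82 + 3 * a') 0 (x + 1)).set
            (80 + 3 * a') x y) (81 + 3 * a') =
            Function.update (σ₂ (81 + 3 * a')) x (σ₂ (82 + 3 * a') 0 + 1) := by
          rw [Mem.set_ne _ _ _ (by omega), Mem.set_ne _ _ _ (by omega), Mem.set_same]
        have f82 : (((σ₂.set (81 + 3 * a') x (σ₂ (82 + 3 * a') 0 + 1)).set (82 + 3 * a') 0 (x + 1)).set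
            (80 + 3 * a') x y) (82 + 3 * a') = Function.update (σ₂ (82 + 3 * a')) 0 (x + 1) := by
          rw [Mem.set_ne _ _ _ (by omega), Mem.set_same, Mem.set_ne _ _ _ (by omega)]
        rw [Logged, f81, f82]
        refine ⟨x :: l, ⟨by simp, by simp, ?_⟩, List.nodup_cons.2 ⟨hxl, l₂⟩, fun z => ?_, ?_, ?_, ?_, ?_⟩
        · rw [Function.update_self, Nat.add_sub_cancel]
          refine l₁.congr fun z hz => Function.update_of_ne ?_ _ _
          rintro rfl
          exact hxl hz
        · by_cases hz : z = x
          · simp [hz]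
          · simp [hz, ← l₃]
        · simpa using ⟨hxv, l₄⟩
        · simpa using l₅
        · intro z hz
          simp only [List.mem_cons, not_or] at hz
          rw [Mem.set_apply, if_neg (by tauto), fr _ (by omega) (by omega)]
          exact l₆ z hz.2
        · intro j hj
          rw [Function.update_of_ne hj]
          exact l₇ j hj
      · exact logs _ fr a' ha'

theorem Run.pos {w : ℕ} {c : Cmd} {σ σ' : Mem} {t : ℕ} (h : Run w c σ t σ') : 0 < t := by
  induction h <;> omega

/-- Running the shifted program. -/
theorem Shifted.run {w v : ℕ} {c : Cmd} {ρ π π' : Mem} {t : ℕ} (hv : 8 ≤ v)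
    (hw : 16 * (v + 1) ≤ w) (h : Run v c π t π') : ∀ {T : ℕ} {σ : Mem}, Shifted v T ρ π σ →
    ∃ t' σ', Run w c.shift σ t' σ' ∧ t' ≤ 30 * t ∧ Shifted v (T + t) ρ π' σ' := by
  have up : ∀ {T T' : ℕ} {π σ : Mem}, T ≤ T' → Shifted v T ρ π σ → Shifted v T' ρ π σ := fun hT h =>
    ⟨h.val, fun a => (h.log a).mono hT, h.bd⟩
  induction h with
  | skip π => exact fun {T σ} hs => ⟨1, σ, .skip σ, by omega, up (by omega) hs⟩
  | assign a i e π hi he =>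
    intro T σ hs
    obtain ⟨t', σ', r, ht, hs'⟩ := hs.store hv hw hi he (a := a)
    exact ⟨t', σ', r, ht, up (by omega) hs'⟩
  | seq c₁ c₂ π₁ π₂ π₃ t₁ t₂ _ _ ih₁ ih₂ =>
    intro T σ hs
    obtain ⟨t', σ', r, ht, hs'⟩ := ih₁ hs
    obtain ⟨t'', σ'', r', ht', hs''⟩ := ih₂ hs'
    exact ⟨_, σ'', .seq _ _ _ _ _ _ _ r r', by omega, up (by omega) hs''⟩
  | iteTrue b c₁ c₂ π π' t hf hb _ ih =>
    intro T σ hs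
    obtain ⟨t', σ', r, ht, hs'⟩ := ih hs
    refine ⟨_, σ', .iteTrue b.shift _ c₂.shift _ _ _ ((hs.fits hf).mono (by omega)) ?_ r, ?_,
      up (by omega) hs'⟩
    · rwa [hs.eval]
    · rw [Expr.cost_shift]
      omega
  | iteFalse b c₁ c₂ π π' t hf hb _ ih =>
    intro T σ hs
    obtain ⟨t', σ', r, ht, hs'⟩ := ih hs
    refine ⟨_, σ', .iteFalse b.shift c₁.shift _ _ _ _ ((hs.fits hf).mono (by omega)) ?_ r, ?_,
      up (by omega) hs'⟩
    · rwa [hs.eval]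
    · rw [Expr.cost_shift]
      omega
  | loopDone b c π hf hb =>
    intro T σ hs
    refine ⟨_, σ, .loopDone b.shift _ _ ((hs.fits hf).mono (by omega)) (by rwa [hs.eval]), ?_,
      up (by omega) hs⟩
    rw [Expr.cost_shift]
    omega
  | loopStep b c π₁ π₂ π₃ t₁ t₂ hf hb _ _ ih₁ ih₂ =>
    intro T σ hs
    obtain ⟨t', σ', r, ht, hs'⟩ := ih₁ hs
    obtain ⟨t'', σ'', r', ht', hs''⟩ := ih₂ hs'
    refine ⟨_, σ'', .loopStep b.shift _ _ _ _ _ _ ((hs.fits hf).mono (by omega)) ?_ r r', ?_,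
      up (by omega) hs''⟩
    · rwa [hs.eval]
    · rw [Expr.cost_shift]
      omega

/-- Reset the cells of array `80 + 3 * a` that are linked, and the links. -/
def undo (a : ℕ) : Cmd := .loop (.var (82 + 3 * a)) (.block
  [.assign 76 (.const 0) (.var (82 + 3 * a) - .const 1),
    .assign (82 + 3 * a) (.const 0) (.cell (81 + 3 * a) (.var 76) - .const 1),
    .assign (81 + 3 * a) (.var 76) (.const 0), .assign (80 + 3 * a) (.var 76) (.const 0)])

/-- In the state `Logged v 0` nothing is linked, so every cell is zero or still has its initial
value. The loop pops the list from its head and takes time proportional to the number of logged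
cells, however large their addresses are. -/
theorem undo_spec {w b v T : ℕ} {ρ σ : Mem} {a : ℕ} (h : Logged v T ρ σ a) :
    Tri w b (undo a) σ (40 * (T + 1)) (fun σ' => Logged v 0 ρ σ' a) := by
  intro hb hw hσ
  obtain ⟨l, l₁, l₂, l₃, l₄, l₅, l₆, l₇⟩ := h
  suffices ∃ t σ', Run w (undo a) σ t σ' ∧ t ≤ 40 * (l.length + 1) ∧ Bd b σ' ∧ Logged v 0 ρ σ' a by
    obtain ⟨t, σ', r, ht, hb', hl⟩ := this
    exact ⟨t, σ', r, by omega, hb', fun a' ha' => r.frame ha', hl⟩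
  clear l₅
  induction l generalizing σ with
  | nil =>
    refine ⟨_, σ, .loopDone _ _ _ (Expr.eval_lt_pow hb hw hσ _ rfl).2 l₁, by simp [Expr.var, Expr.cost],
      hσ, [], l₁, l₂, l₃, l₄, by simp, l₆, l₇⟩
  | cons x l ih =>
    obtain ⟨h₁, h₂, h₃⟩ := l₁
    obtain ⟨hxl, hnd⟩ := List.nodup_cons.1 l₂
    obtain ⟨t, r, ht, b'⟩ := Cmd.run_exec hb hw (.block
      [.assign 76 (.const 0) (.var (82 + 3 * a) - .const 1),
        .assign (82 + 3 * a) (.const 0) (.cell (81 + 3 * a) (.var 76) - .const 1),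
        .assign (81 + 3 * a) (.var 76) (.const 0), .assign (80 + 3 * a) (.var 76) (.const 0)]) hσ rfl
      (by simp)
    have ex : (Cmd.block [.assign 76 (.const 0) (.var (82 + 3 * a) - .const 1),
        .assign (82 + 3 * a) (.const 0) (.cell (81 + 3 * a) (.var 76) - .const 1),
        .assign (81 + 3 * a) (.var 76) (.const 0), .assign (80 + 3 * a) (.var 76) (.const 0)]).exec σ =
        (((σ.set 76 0 x).set (82 + 3 * a) 0 (σ (81 + 3 * a) x - 1)).set (81 + 3 * a) x 0).set
          (80 + 3 * a) x 0 := by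
      rw [exec_cons_assign (x := 0) rfl (y := x) (by simp [h₁]),
        exec_cons_assign (x := 0) rfl (y := σ (81 + 3 * a) x - 1) (by
          simp [Mem.set_apply, show 81 + 3 * a ≠ 76 by omega]),
        exec_cons_assign (x := x) (by simp [Mem.set_apply, show 76 ≠ 82 + 3 * a by omega]) (y := 0) rfl,
        exec_cons_assign (x := x) (by simp [Mem.set_apply, show 76 ≠ 82 + 3 * a by omega,
          show 76 ≠ 81 + 3 * a by omega]) (y := 0) rfl, Cmd.exec_nil]
    rw [ex] at r b'
    have f81 : ((((σ.set 76 0 x).set (82 + 3 * a) 0 (σ (81 + 3 * a) x - 1)).set (81 + 3 * a) x 0).set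
        (80 + 3 * a) x 0) (81 + 3 * a) = Function.update (σ (81 + 3 * a)) x 0 := by
      rw [Mem.set_ne _ _ _ (by omega), Mem.set_same, Mem.set_ne _ _ _ (by omega),
        Mem.set_ne _ _ _ (by omega)]
    have f82 : ((((σ.set 76 0 x).set (82 + 3 * a) 0 (σ (81 + 3 * a) x - 1)).set (81 + 3 * a) x 0).set
        (80 + 3 * a) x 0) (82 + 3 * a) = Function.update (σ (82 + 3 * a)) 0 (σ (81 + 3 * a) x - 1) := by
      rw [Mem.set_ne _ _ _ (by omega), Mem.set_ne _ _ _ (by omega), Mem.set_same,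
        Mem.set_ne _ _ _ (by omega)]
    have f80 : ((((σ.set 76 0 x).set (82 + 3 * a) 0 (σ (81 + 3 * a) x - 1)).set (81 + 3 * a) x 0).set
        (80 + 3 * a) x 0) (80 + 3 * a) = Function.update (σ (80 + 3 * a)) x 0 := by
      rw [Mem.set_same, Mem.set_ne _ _ _ (by omega), Mem.set_ne _ _ _ (by omega),
        Mem.set_ne _ _ _ (by omega)]
    obtain ⟨t', σ', r', ht', hb', hl⟩ := ih b' (by
        rw [f81, f82, Function.update_self]
        exact h₃.congr fun z hz => Function.update_of_ne (by rintro rfl; exact hxl hz) _ _) hnd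
      (fun z => by
        rw [f81]
        by_cases hz : z = x
        · simp [hz, hxl]
        · rw [Function.update_of_ne hz, l₃]
          simp [hz]) (fun z hz => l₄ z (by simp [hz])) (fun z hz => by
        rw [f80]
        by_cases hzx : z = x
        · simp [hzx]
        · rw [Function.update_of_ne hzx]
          exact l₆ z (by simp [hzx, hz])) (fun j hj => by
        rw [f82, Function.update_of_ne hj]
        exact l₇ j hj)
    refine ⟨_, σ', .loopStep _ _ _ _ _ _ _ (Expr.eval_lt_pow hb hw hσ _ rfl).2 (by simp [h₁]) r r',
      ?_, hb', hl⟩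
    have : t ≤ 30 := ht.trans (by change 22 ≤ 30; norm_num)
    simp only [Expr.var, Expr.cost, List.length_cons]
    omega

theorem mem_mods_undoAll {L : List ℕ} {x : ℕ} (hx : x ∈ (Cmd.block (L.map undo)).mods) :
    x = 76 ∨ ∃ a ∈ L, x = 80 + 3 * a ∨ x = 81 + 3 * a ∨ x = 82 + 3 * a := by
  induction L with
  | nil => simp [Cmd.block, Cmd.mods] at hx
  | cons a L ih =>
    simp only [List.map_cons, Cmd.block, Cmd.mods, List.mem_append] at hx
    rcases hx with hx | hx
    · simp [undo, Cmd.block, Cmd.mods] at hx ⊢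
      tauto
    · rcases ih hx with h | ⟨a', ha', h⟩
      · exact .inl h
      · exact .inr ⟨a', by simp [ha'], h⟩

/-- An array may occur several times among the modified ones. Undoing it again is harmless, as an
empty log satisfies every bound on its length. -/
theorem undoAll_spec {w b v T : ℕ} {ρ : Mem} (L : List ℕ) : ∀ {σ : Mem},
    (∀ a ∈ L, Logged v T ρ σ a) → Tri w b (.block (L.map undo)) σ (1 + L.length * (40 * (T + 1)))
      (fun σ' => ∀ a ∈ L, Logged v 0 ρ σ' a) := by
  induction L with
  | nil => exact fun {σ} _ => (Tri.skip (by simp)).conseq (by simp) fun _ _ _ => id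
  | cons a L ih =>
    intro σ hσ
    refine Tri.seq (undo_spec (hσ a (by simp))) (fun σ₁ _ fr h₁ => (ih fun a' ha' => ?_).conseq le_rfl
      fun σ₂ _ fr₂ h₂ a' ha' => ?_) (by simp only [List.length_cons]; ring_nf; omega)
    · by_cases haa : a' = a
      · exact haa ▸ h₁.mono (by omega)
      · refine (hσ a' (by simp [ha'])).congr ?_ ?_ ?_ <;> refine fr _ ?_ <;>
          simp [undo, Cmd.block, Cmd.mods] <;> omega
    · by_cases haL : a' ∈ L
      · exact h₂ a' haL
      · have haa : a' = a := by simpa [haL] using ha'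
        subst haa
        have key : ∀ x, x = 80 + 3 * a' ∨ x = 81 + 3 * a' ∨ x = 82 + 3 * a' → σ₂ x = σ₁ x :=
          fun x hx => fr₂ x fun h' => by
            rcases mem_mods_undoAll h' with h | ⟨a'', ha'', h⟩
            · omega
            · exact haL (by rwa [show a' = a'' by omega])
        exact h₁.congr (key _ (by simp)) (key _ (by simp)) (key _ (by simp))

end RAM


namespace RAM

/-! ### Determinism and locality -/

/-- The word length decides whether a run exists, but has no influence on its result. -/
theorem Run.deterministic {w w' : ℕ} {c : Cmd} {σ σ₁ σ₂ : Mem} {t₁ t₂ : ℕ} (h₁ : Run w c σ t₁ σ₁)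
    (h₂ : Run w' c σ t₂ σ₂) : σ₁ = σ₂ := by
  induction h₁ generalizing t₂ σ₂ with
  | skip => cases h₂; rfl
  | assign => cases h₂; rfl
  | seq _ _ _ _ _ _ _ _ _ ih₁ ih₂ =>
    cases h₂ with
    | seq _ _ _ _ _ _ _ r₁ r₂ =>
      obtain rfl := ih₁ r₁
      exact ih₂ r₂
  | iteTrue _ _ _ _ _ _ _ hb _ ih =>
    cases h₂ with
    | iteTrue _ _ _ _ _ _ _ _ r => exact ih r
    | iteFalse _ _ _ _ _ _ _ hb' => exact (hb hb').elim
  | iteFalse _ _ _ _ _ _ _ hb _ ih =>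
    cases h₂ with
    | iteTrue _ _ _ _ _ _ _ hb' => exact (hb' hb).elim
    | iteFalse _ _ _ _ _ _ _ _ r => exact ih r
  | loopDone _ _ _ _ hb =>
    cases h₂ with
    | loopDone => rfl
    | loopStep _ _ _ _ _ _ _ _ hb' => exact (hb' hb).elim
  | loopStep _ _ _ _ _ _ _ _ hb _ _ ih₁ ih₂ =>
    cases h₂ with
    | loopDone _ _ _ _ hb' => exact (hb hb').elim
    | loopStep _ _ _ _ _ _ _ _ _ r₁ r₂ =>
      obtain rfl := ih₁ r₁
      exact ih₂ r₂

/-- The cells of array `0` that are read in an evaluation. -/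
def Expr.reads (σ : Mem) : Expr → Finset ℕ
  | .const _ => ∅
  | .cell a i => if a = 0 then insert (i.eval σ) (i.reads σ) else i.reads σ
  | .bin _ e₁ e₂ => e₁.reads σ ∪ e₂.reads σ

theorem Expr.card_reads_le (σ : Mem) (e : Expr) : (e.reads σ).card ≤ e.cost := by
  induction e with
  | const => simp [reads]
  | cell a i ih =>
    simp only [reads, cost]
    split
    · exact (Finset.card_insert_le _ _).trans (by omega)
    · omega
  | bin o e₁ e₂ h₁ h₂ =>
    simp only [reads, cost]
    have := Finset.card_union_le (e₁.reads σ) (e₂.reads σ)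
    omega

/-- The two memories agree except for cell `j` of array `0`. -/
def AgreeOff (j : ℕ) (σ τ : Mem) : Prop := ∀ a i, ¬ (a = 0 ∧ i = j) → τ a i = σ a i

theorem AgreeOff.eval {j : ℕ} {σ τ : Mem} (h : AgreeOff j σ τ) {e : Expr} (hj : j ∉ e.reads σ) :
    e.eval τ = e.eval σ := by
  induction e with
  | const => rfl
  | cell a i ih =>
    simp only [Expr.reads] at hj
    split at hj
    · simp only [Finset.mem_insert, not_or] at hj
      rw [Expr.eval_cell, Expr.eval_cell, ih hj.2]
      exact h _ _ fun h' => hj.1 h'.2.symm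
    · rw [Expr.eval_cell, Expr.eval_cell, ih hj]
      exact h _ _ fun h' => ‹¬ a = 0› h'.1
  | bin o e₁ e₂ h₁ h₂ =>
    simp only [Expr.reads, Finset.mem_union, not_or] at hj
    simp only [Expr.eval, h₁ hj.1, h₂ hj.2]

theorem AgreeOff.fits {j w : ℕ} {σ τ : Mem} (h : AgreeOff j σ τ) {e : Expr} (hj : j ∉ e.reads σ)
    (he : e.Fits w σ) : e.Fits w τ := by
  induction e with
  | const => exact he
  | cell a i ih =>
    have h' := h.eval hj
    simp only [Expr.eval_cell] at h'
    refine ⟨ih ?_ he.1, by rw [h']; exact he.2⟩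
    simp only [Expr.reads] at hj
    split at hj
    · exact fun h'' => hj (Finset.mem_insert_of_mem h'')
    · exact hj
  | bin o e₁ e₂ h₁ h₂ =>
    have h' := h.eval hj
    simp only [Expr.eval] at h'
    simp only [Expr.reads, Finset.mem_union, not_or] at hj
    exact ⟨h₁ hj.1 he.1, h₂ hj.2 he.2.1, by rw [h']; exact he.2.2⟩

/-- A run of `t` steps reads at most `t` cells of array `0`. -/
theorem Run.exists_reads {w : ℕ} {c : Cmd} {σ σ' : Mem} {t : ℕ} (h : Run w c σ t σ') :
    ∃ F : Finset ℕ, F.card ≤ t ∧ ∀ j, j ∉ F → ∀ τ, AgreeOff j σ τ →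
      ∃ τ', Run w c τ t τ' ∧ AgreeOff j σ' τ' := by
  -- Outside of the cells read, a change of the memory alters no test, no address and no stored
  -- value. So the same run, with the same time, goes through in the changed memory.
  induction h with
  | skip σ => exact ⟨∅, by simp, fun j _ τ hτ => ⟨τ, .skip τ, hτ⟩⟩
  | assign a i e σ hi he =>
    refine ⟨i.reads σ ∪ e.reads σ, ?_, fun j hj τ hτ => ?_⟩
    · have := Finset.card_union_le (i.reads σ) (e.reads σ)
      have := i.card_reads_le σ
      have := e.card_reads_le σ
      omega
    · simp only [Finset.mem_union, not_or] at hj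
      refine ⟨_, .assign a i e τ (hτ.fits hj.1 hi) (hτ.fits hj.2 he), fun b x hbx => ?_⟩
      rw [hτ.eval hj.1, hτ.eval hj.2, Mem.set_apply, Mem.set_apply, hτ b x hbx]
  | seq c₁ c₂ σ₁ σ₂ σ₃ t₁ t₂ _ _ ih₁ ih₂ =>
    obtain ⟨F₁, c₁, h₁⟩ := ih₁
    obtain ⟨F₂, c₂, h₂⟩ := ih₂
    refine ⟨F₁ ∪ F₂, (Finset.card_union_le _ _).trans (by omega), fun j hj τ hτ => ?_⟩
    simp only [Finset.mem_union, not_or] at hj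
    obtain ⟨τ₂, r₁, k₁⟩ := h₁ j hj.1 τ hτ
    obtain ⟨τ₃, r₂, k₂⟩ := h₂ j hj.2 τ₂ k₁
    exact ⟨τ₃, .seq _ _ _ _ _ _ _ r₁ r₂, k₂⟩
  | iteTrue b c₁ c₂ σ σ' t hf hb _ ih =>
    obtain ⟨F, hF, h⟩ := ih
    refine ⟨b.reads σ ∪ F, (Finset.card_union_le _ _).trans ?_, fun j hj τ hτ => ?_⟩
    · have := b.card_reads_le σ
      omega
    simp only [Finset.mem_union, not_or] at hj
    obtain ⟨τ', r, k⟩ := h j hj.2 τ hτ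
    exact ⟨τ', .iteTrue _ _ _ _ _ _ (hτ.fits hj.1 hf) (by rwa [hτ.eval hj.1]) r, k⟩
  | iteFalse b c₁ c₂ σ σ' t hf hb _ ih =>
    obtain ⟨F, hF, h⟩ := ih
    refine ⟨b.reads σ ∪ F, (Finset.card_union_le _ _).trans ?_, fun j hj τ hτ => ?_⟩
    · have := b.card_reads_le σ
      omega
    simp only [Finset.mem_union, not_or] at hj
    obtain ⟨τ', r, k⟩ := h j hj.2 τ hτ
    exact ⟨τ', .iteFalse _ _ _ _ _ _ (hτ.fits hj.1 hf) (by rwa [hτ.eval hj.1]) r, k⟩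
  | loopDone b c σ hf hb =>
    refine ⟨b.reads σ, (b.card_reads_le σ).trans (by omega), fun j hj τ hτ => ?_⟩
    exact ⟨τ, .loopDone _ _ _ (hτ.fits hj hf) (by rwa [hτ.eval hj]), hτ⟩
  | loopStep b c σ₁ σ₂ σ₃ t₁ t₂ hf hb _ _ ih₁ ih₂ =>
    obtain ⟨F₁, c₁, h₁⟩ := ih₁
    obtain ⟨F₂, c₂, h₂⟩ := ih₂
    refine ⟨b.reads σ₁ ∪ (F₁ ∪ F₂), (Finset.card_union_le _ _).trans ?_, fun j hj τ hτ => ?_⟩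
    · have := b.card_reads_le σ₁
      have := Finset.card_union_le F₁ F₂
      omega
    simp only [Finset.mem_union, not_or] at hj
    obtain ⟨τ₂, r₁, k₁⟩ := h₁ j hj.2.1 τ hτ
    obtain ⟨τ₃, r₂, k₂⟩ := h₂ j hj.2.2 τ₂ k₁
    exact ⟨τ₃, .loopStep _ _ _ _ _ _ _ (hτ.fits hj.1 hf) (by rwa [hτ.eval hj.1]) r₁ r₂, k₂⟩

end RAM

namespace ClusterDeletion

open RAM

/-! ### Lists of edges -/

/-- The graph with the given edges. -/
def ofList {n : ℕ} (L : List (Fin n × Fin n)) : SimpleGraph (Fin n) :=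
  SimpleGraph.fromEdgeSet {e | e ∈ L.map fun p => s(p.1, p.2)}

theorem isEdgeList_ofList {n : ℕ} {L : List (Fin n × Fin n)}
    (hnd : (L.map fun p => s(p.1, p.2)).Nodup) (hne : ∀ p ∈ L, p.1 ≠ p.2) :
    IsEdgeList (ofList L) L := by
  refine ⟨hnd, fun e => ?_⟩
  rw [ofList, SimpleGraph.edgeSet_fromEdgeSet]
  refine ⟨fun he => ⟨he, fun hd => ?_⟩, fun he => he.1⟩
  obtain ⟨p, hp, rfl⟩ := List.mem_map.1 he
  exact hne p hp (Sym2.mk_isDiag_iff.1 hd)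

theorem ofList_adj {n : ℕ} {L : List (Fin n × Fin n)} {u v : Fin n} :
    (ofList L).Adj u v ↔ (∃ p ∈ L, s(p.1, p.2) = s(u, v)) ∧ u ≠ v := by
  simp only [ofList, SimpleGraph.fromEdgeSet_adj, Set.mem_ofPred_eq, List.mem_map]

theorem IsEdgeList.size_eq {n : ℕ} {G : SimpleGraph (Fin n)} {L : List (Fin n × Fin n)}
    (h : IsEdgeList G L) : size G = n + L.length := by
  classical
  have : G.edgeSet = ((L.map fun p => s(p.1, p.2)).toFinset : Set (Sym2 (Fin n))) := by
    ext e
    rw [← h.2]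
    simp
  rw [size, this, Set.ncard_coe_finset, List.toFinset_card_of_nodup h.1, List.length_map]

theorem flatMap_getD {n : ℕ} (L : List (Fin n × Fin n)) : ∀ (e : ℕ) (h : e < L.length),
    (L.flatMap fun p => [p.1.val, p.2.val]).getD (e + e) 0 = L[e].1 ∧
      (L.flatMap fun p => [p.1.val, p.2.val]).getD (e + e + 1) 0 = L[e].2 := by
  induction L with
  | nil => simp
  | cons p L ih =>
    intro e he
    rcases e with _ | e
    · simp
    · have := ih e (by simpa using he)
      rw [show e + 1 + (e + 1) = e + e + 1 + 1 by ring]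
      simpa using this

/-- Recognises an array as an encoded graph cell by cell. Thus the edge list left by the marking,
once its header is written, is itself the input of the static program and needs no copying. -/
theorem load_encodeGraph {n : ℕ} {L : List (Fin n × Fin n)} {g : ℕ → ℕ} (h₀ : g 0 = n)
    (h₁ : g 1 = L.length) (h₂ : ∀ (e : ℕ) (h : e < L.length), g (2 + e + e) = L[e].1)
    (h₃ : ∀ (e : ℕ) (h : e < L.length), g (3 + e + e) = L[e].2)
    (h₄ : ∀ i, 2 + 2 * L.length ≤ i → g i = 0) (a i : ℕ) :
    Mem.zero.load (encodeGraph n L) a i = if a = 0 then g i else 0 := by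
  have hlen : (L.flatMap fun p => [p.1.val, p.2.val]).length = 2 * L.length := by
    simp [List.length_flatMap, mul_comm]
  by_cases ha : a = 0
  swap
  · simp [Mem.load, ha, Mem.zero]
  simp only [Mem.load, ha, if_true, Mem.zero, encodeGraph]
  rcases i with _ | _ | i
  · simp [h₀]
  · simp [h₁]
  · simp only [List.getD_cons_succ]
    by_cases hi : i < 2 * L.length
    · rcases Nat.even_or_odd' i with ⟨e, rfl | rfl⟩
      · have h := h₂ e (by omega)
        have := (flatMap_getD L e (by omega)).1
        rw [show 2 * e + 1 + 1 = 2 + e + e by omega, h, show 2 * e = e + e by omega, this]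
      · have h := h₃ e (by omega)
        have := (flatMap_getD L e (by omega)).2
        rw [show 2 * e + 1 + 1 + 1 = 3 + e + e by omega, h, show 2 * e + 1 = e + e + 1 by omega, this]
    · rw [h₄ _ (by omega), List.getD_eq_default _ _ (by omega)]

/-! ### A static algorithm reads its input -/

/-- A matching on `2 * m` vertices, in which edge `j` is redirected to vertex `0`. -/
def pairList (m j : ℕ) : List (Fin (2 * m) × Fin (2 * m)) := List.ofFn fun i : Fin m =>
  (⟨2 * i, by omega⟩, if (i : ℕ) = j then ⟨0, by have := i.2; omega⟩ else ⟨2 * i + 1, by omega⟩)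

theorem pairList_length (m j : ℕ) : (pairList m j).length = m := by simp [pairList]

theorem pairList_get {m j e : ℕ} (h : e < (pairList m j).length) :
    ((pairList m j)[e].1 : ℕ) = 2 * e ∧
      ((pairList m j)[e].2 : ℕ) = if e = j then 0 else 2 * e + 1 := by
  simp only [pairList, List.getElem_ofFn, true_and]
  split <;> rfl

theorem mem_pairList {m j : ℕ} {p : Fin (2 * m) × Fin (2 * m)} :
    p ∈ pairList m j ↔ ∃ i < m, (p.1 : ℕ) = 2 * i ∧ (p.2 : ℕ) = if i = j then 0 else 2 * i + 1 := by
  rw [List.mem_iff_getElem]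
  constructor
  · rintro ⟨i, hi, rfl⟩
    exact ⟨i, by rwa [pairList_length] at hi, pairList_get hi⟩
  · rintro ⟨i, hi, h₁, h₂⟩
    have hi' : i < (pairList m j).length := by rwa [pairList_length]
    obtain ⟨k₁, k₂⟩ := pairList_get hi'
    exact ⟨i, hi', Prod.ext (Fin.ext (k₁.trans h₁.symm)) (Fin.ext (k₂.trans h₂.symm))⟩

theorem isEdgeList_pairList {m j : ℕ} (hj : 1 ≤ j) : IsEdgeList (ofList (pairList m j)) (pairList m j) := by
  refine isEdgeList_ofList ?_ fun p hp e => ?_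
  · rw [List.nodup_iff_injective_getElem]
    rintro ⟨e, he⟩ ⟨e', he'⟩ h
    simp only [List.length_map] at he he'
    simp only [List.getElem_map, Sym2.eq_iff, Fin.ext_iff] at h
    obtain ⟨a₁, a₂⟩ := pairList_get he
    obtain ⟨b₁, b₂⟩ := pairList_get he'
    rw [a₁, a₂, b₁, b₂] at h
    rw [Fin.mk.injEq]
    split at h <;> split at h <;> omega
  · obtain ⟨i, hi, h₁, h₂⟩ := mem_pairList.1 hp
    rw [e] at h₁
    split at h₂ <;> omega

theorem load_pairList (m j a i : ℕ) : Mem.zero.load (encodeGraph (2 * m) (pairList m j)) a i =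
    if a = 0 then (if i = 0 then 2 * m else if i = 1 then m else if 2 + 2 * m ≤ i then 0 else
      if i = 3 + 2 * j then 0 else i - 2) else 0 := by
  refine load_encodeGraph (g := fun i => if i = 0 then 2 * m else if i = 1 then m else
    if 2 + 2 * m ≤ i then 0 else if i = 3 + 2 * j then 0 else i - 2) (by simp)
    (by simp [pairList_length]) (fun e h => ?_) (fun e h => ?_) (fun i hi => ?_) a i
  · rw [(pairList_get h).1]
    rw [pairList_length] at h
    rw [if_neg (by omega), if_neg (by omega), if_neg (by omega), if_neg (by omega)]
    omega
  · rw [(pairList_get h).2]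
    rw [pairList_length] at h
    rw [if_neg (by omega), if_neg (by omega), if_neg (by omega)]
    split <;> split <;> omega
  · rw [pairList_length] at hi
    rw [if_neg (by omega), if_neg (by omega), if_pos hi]

theorem OutputsSet.card_eq {n : ℕ} {σ : Mem} {S : Finset (Fin n)} (h : OutputsSet σ S) :
    σ 1 0 = S.card := by
  classical
  obtain ⟨l, h₁, h₂, h₃, -⟩ := h
  have : S = l.toFinset := by ext; simp [h₂]
  rw [h₃, List.length_map, this, List.toFinset_card_of_nodup h₁]

theorem cvd_le_card {n : ℕ} (G : SimpleGraph (Fin n)) : cvd G ≤ n := by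
  simpa using cvd_le (isCVD_univ G)

/-- A static algorithm takes linear time. -/
theorem le_time {p : Cmd} {f g : ℕ → ℕ → ℕ} (hg : MonotoneBound g) (hp : SolvesCVD p f g) (m : ℕ) :
    m ≤ f (3 * m) 0 + 1 := by
  -- Adversary argument: on a matching with `m` edges the answer is empty. A run of fewer than `m -
  -- 1` steps misses the second end of some edge, and redirecting this end creates an induced path
  -- that the run does not notice.
  by_contra hlt
  have hm : 1 ≤ m := by omega
  have hsize : ∀ j, 1 ≤ j → size (ofList (pairList m j)) = 3 * m := fun j hj => by
    rw [(isEdgeList_pairList hj).size_eq, pairList_length]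
    omega
  have hcvd : cvd (ofList (pairList m m)) = 0 := by
    refine Nat.le_zero.1 (cvd_le (S := ∅) ((isCVD_iff _ _).2 ?_))
    intro c a b _ _ _ h₁ h₂ hab
    obtain ⟨⟨p, hp, e⟩, -⟩ := ofList_adj.1 h₁
    obtain ⟨⟨q, hq, e'⟩, -⟩ := ofList_adj.1 h₂
    obtain ⟨i, hi, i₁, i₂⟩ := mem_pairList.1 hp
    obtain ⟨i', hi', i₁', i₂'⟩ := mem_pairList.1 hq
    rw [if_neg (by omega)] at i₂ i₂'
    simp only [Sym2.eq_iff, Fin.ext_iff] at e e'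
    exact (hab (Fin.ext (by omega))).elim
  -- All graphs in question have `2 * m` vertices, and hence cvd numbers of at most `2 * m`. So one
  -- word length serves for all of them.
  obtain ⟨t, σ, S, r, ht, hS, ho⟩ := hp _ _ _ (isEdgeList_pairList (m := m) hm) (g (3 * m) (2 * m))
    (by rw [hsize m hm, hcvd]; exact hg _ _ _ _ le_rfl (by omega))
  rw [hsize m hm, hcvd] at ht
  obtain ⟨F, hF, key⟩ := r.exists_reads
  -- Cell `3 + 2 * j` holds the second end of edge `j`. Edge `0` is spared, so that vertex `0` keeps
  -- its neighbour `1`.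
  obtain ⟨j, hj, hjF⟩ : ∃ j ∈ Finset.Ico 1 m, 3 + 2 * j ∉ F := by
    by_contra hno
    push Not at hno
    have := Finset.card_le_card_of_injOn (fun j => 3 + 2 * j) hno fun a _ b _ e => by
      simp only at e
      omega
    rw [Nat.card_Ico] at this
    omega
  rw [Finset.mem_Ico] at hj
  obtain ⟨τ, r', ha⟩ := key _ hjF (Mem.zero.load (encodeGraph (2 * m) (pairList m j))) fun a i hai => by
    rw [load_pairList, load_pairList]
    split_ifs <;> omega
  obtain ⟨t', τ', S', r'', -, hS', ho'⟩ := hp _ _ _ (isEdgeList_pairList (m := m) hj.1) (g (3 * m) (2 * m))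
    (by rw [hsize j hj.1]; exact hg _ _ _ _ le_rfl (cvd_le_card _))
  have hcard : S'.card = 0 := by
    rw [← ho'.card_eq, ← r'.deterministic r'', ha 1 0 (by omega), ho.card_eq, hS.2, hcvd]
  rw [Finset.card_eq_zero] at hcard
  have adj : ∀ u v : Fin (2 * m), u ≠ v → (∃ i < m, (u : ℕ) = 2 * i ∧ (v : ℕ) = if i = j then 0 else 2 * i + 1) →
      (ofList (pairList m j)).Adj u v := fun u v huv ⟨i, hi, h⟩ =>
    ofList_adj.2 ⟨⟨(u, v), mem_pairList.2 ⟨i, hi, h⟩, rfl⟩, huv⟩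
  -- In the redirected graph, the vertices `1`, `0`, `2 * j` induce a path, so the empty set is not
  -- a solution.
  have h01 := adj ⟨0, by omega⟩ ⟨1, by omega⟩ (by simp) ⟨0, by omega, rfl, by rw [if_neg (by omega)]⟩
  have hj0 := adj ⟨2 * j, by omega⟩ ⟨0, by omega⟩ (by simp; omega) ⟨j, by omega, rfl, by rw [if_pos rfl]⟩
  have h1j := (isCVD_iff _ _).1 hS'.1 _ _ _ (by simp [hcard]) (by simp [hcard]) (by simp [hcard])
    h01 hj0.symm (by simp; omega)
  obtain ⟨⟨q, hq, e⟩, -⟩ := ofList_adj.1 h1j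
  obtain ⟨i, hi, i₁, i₂⟩ := mem_pairList.1 hq
  simp only [Sym2.eq_iff, Fin.ext_iff] at e
  split at i₂ <;> omega

end ClusterDeletion


/-! ### Correctness of the kernel -/

namespace ClusterDeletion

open RAM

section

variable {n T : ℕ} {G : SimpleGraph (Fin n)} {X : Finset (Fin n)} {ℓ : Fin n → ℕ} {σ : Mem}

/-- A set that is small and meets all induced paths of the kernel is a cluster vertex deletion. -/
theorem Repr.isCVD_of_kernel (h : Repr n T G X ℓ σ) {S : Finset (Fin n)} (hS : S.card ≤ X.card)
    (hP : ∀ c a b : Fin n, Kernel σ c → Kernel σ a → Kernel σ b → c ∉ S → a ∉ S → b ∉ S →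
      G.Adj c a → G.Adj c b → a ≠ b → G.Adj a b) : IsCVD G S := by
  classical
  have hs : σ 10 0 = X.card := h.xlen
  set s := X.card
  have idx : ∀ x ∈ X, ∃ j < s, σ 11 (pr 0 j) = x := fun x hx => by
    rw [← hs]
    exact (h.core.sol.exists_iff _).1 ((h.mem x).1 hx)
  -- targets are vertices
  have tgt : ∀ x ∈ X, ∀ i < s + 2, i < σ 16 (σ 4 x) → ∀ r < s + 1, ∀ u : Fin n,
      (r < σ 19 (pr (σ 4 x) (σ 17 (pr (σ 4 x) i))) ∧ (u : ℕ) = σ 14 (pr (σ 17 (pr (σ 4 x) i))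
        (σ 20 (pr (pr (σ 4 x) (σ 17 (pr (σ 4 x) i))) r) ^^^ r))) ∨
      (σ 19 (pr (σ 4 x) (σ 17 (pr (σ 4 x) i))) + r < σ 13 (σ 17 (pr (σ 4 x) i)) ∧
        (u : ℕ) = σ 14 (pr (σ 17 (pr (σ 4 x) i)) (σ 20 (pr (pr (σ 4 x) (σ 17 (pr (σ 4 x) i)))
          (σ 19 (pr (σ 4 x) (σ 17 (pr (σ 4 x) i))) + r)) ^^^
            (σ 19 (pr (σ 4 x) (σ 17 (pr (σ 4 x) i))) + r)))) → Kernel σ u := by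
    intro x hx i hi hi' r hr u hu
    obtain ⟨j, hj, hjx⟩ := idx x hx
    refine .inr ⟨j, by omega, i, by omega, r, by omega, ?_⟩
    rw [Target, hjx]
    exact ⟨hi', _, _, _, rfl, rfl, rfl, hu⟩
  have vtx : ∀ l i, i < σ 13 l → ∃ u ∉ X, ℓ u = l ∧ σ 14 (pr l i) = u := fun l i hi => by
    obtain ⟨u, h₁, h₂, h₃⟩ := (h.cluster_iff l _).2 ⟨i, hi, rfl⟩
    exact ⟨u, h₁, h₂, h₃⟩
  have inj : ∀ l i i', i < σ 13 l → i' < σ 13 l → σ 14 (pr l i) = σ 14 (pr l i') → i = i' :=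
    fun l i i' hi hi' e => SparseSet.elt_inj (h.core.clu l) hi hi' e
  -- The first `s + 2` labels in the list of `x`, or all of them if there are fewer.
  set Λ : Fin n → Finset ℕ := fun x =>
    (Finset.range (min (s + 2) (σ 16 (σ 4 x)))).image fun i => σ 17 (pr (σ 4 x) i) with hΛ
  have memΛ : ∀ x l, l ∈ Λ x → ∃ i, i < s + 2 ∧ i < σ 16 (σ 4 x) ∧ σ 17 (pr (σ 4 x) i) = l := by
    intro x l hl
    obtain ⟨i, hi, e⟩ := Finset.mem_image.1 hl
    rw [Finset.mem_range] at hi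
    exact ⟨i, by omega, by omega, e⟩
  refine isCVD_of_marked (s := s) (X := X) (lab := ℓ) (M := fun u => Kernel σ u) (Λ := Λ)
    (fun u v hu hv huv => h.adj_iff hu hv huv) (fun x hx => .inl ((h.mem x).1 hx)) ?_ ?_ ?_ ?_ hS hP
  · intro x hx
    by_cases hc : σ 16 (σ 4 x) ≤ s + 2
    · refine .inl fun u hu hxu => ?_
      obtain ⟨i, hi, e⟩ := (h.incident_iff hx (ℓ u)).1 ⟨u, hu, hxu, rfl⟩
      exact Finset.mem_image.2 ⟨i, Finset.mem_range.2 (by omega), e⟩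
    · refine .inr ?_
      rw [hΛ, Finset.card_image_of_injOn, Finset.card_range]
      · omega
      · intro i hi i' hi' e
        simp only [Finset.coe_range, Set.mem_Iio] at hi hi'
        exact SparseSet.elt_inj (h.core.tab x ((h.mem x).1 hx)).1 (by omega) (by omega) e
  · intro x hx l hl
    obtain ⟨i, hi, hi', rfl⟩ := memΛ x l hl
    obtain ⟨π, hπ, hlt, hle, hpos, -⟩ := h.exists_perm hx (σ 17 (pr (σ 4 x) i))
    have hc : σ 19 (pr (σ 4 x) (σ 17 (pr (σ 4 x) i))) ≠ 0 := by
      rw [h.cnt_ne_zero_iff hx]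
      obtain ⟨u, hu, hxu, e⟩ := (h.incident_iff hx _).2 ⟨i, hi', rfl⟩
      exact ⟨u, hu, hxu, e⟩
    obtain ⟨u, hu, hul, hxu, e⟩ := (hpos _).2 ⟨0, Nat.pos_of_ne_zero hc, rfl⟩
    refine ⟨u, hu, tgt x hx i hi hi' 0 (by omega) u (.inl ⟨Nat.pos_of_ne_zero hc, ?_⟩), hxu, hul⟩
    rw [hπ, e]
  · intro x hx l hl
    obtain ⟨i, hi, hi', rfl⟩ := memΛ x l hl
    obtain ⟨π, hπ, hlt, hle, hpos, -⟩ := h.exists_perm hx (σ 17 (pr (σ 4 x) i))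
    set l := σ 17 (pr (σ 4 x) i)
    set c := σ 19 (pr (σ 4 x) l)
    -- Up to `s + 1` neighbours are all marked. If there are more, the first `s + 1` positions of
    -- the permutation supply the set of marked neighbours that is asked for.
    by_cases hc : c ≤ s + 1
    · refine .inl fun u hu hul hxu => ?_
      obtain ⟨r, hr, e⟩ := (hpos u).1 ⟨u, hu, hul, hxu, rfl⟩
      refine tgt x hx i hi hi' r (by omega) u (.inl ⟨hr, ?_⟩)
      rw [hπ, e]
    · have ex : ∀ r, r < s + 1 → ∃ u ∉ X, ℓ u = l ∧ G.Adj x u ∧ σ 14 (pr l (π r)) = u := fun r hr => by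
        obtain ⟨u, hu, hul, hxu, e⟩ := (hpos _).2 ⟨r, show r < c by omega, rfl⟩
        exact ⟨u, hu, hul, hxu, e⟩
      have : Nonempty (Fin n) := ⟨x⟩
      choose! p p₁ p₂ p₃ p₄ using ex
      refine .inr ⟨(Finset.range (s + 1)).image p, ?_, fun u hu => ?_⟩
      · rw [Finset.card_image_of_injOn, Finset.card_range]
        intro r hr r' hr' e
        simp only [Finset.coe_range, Set.mem_Iio] at hr hr'
        have := inj l (π r) (π r') ((hlt r).2 (by omega)) ((hlt r').2 (by omega))
          (by rw [p₄ r hr, p₄ r' hr', e])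
        exact π.injective this
      · obtain ⟨r, hr, rfl⟩ := Finset.mem_image.1 hu
        rw [Finset.mem_range] at hr
        refine ⟨p₁ r hr, tgt x hx i hi hi' r hr _ (.inl ⟨show r < c by omega, ?_⟩), p₂ r hr, p₃ r hr⟩
        rw [hπ, p₄ r hr]
  · intro x hx l hl
    obtain ⟨i, hi, hi', rfl⟩ := memΛ x l hl
    obtain ⟨π, hπ, hlt, hle, -, hneg⟩ := h.exists_perm hx (σ 17 (pr (σ 4 x) i))
    set l := σ 17 (pr (σ 4 x) i)
    set c := σ 19 (pr (σ 4 x) l)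
    by_cases hc : σ 13 l ≤ c + (s + 1)
    · refine .inl fun u hu hul hxu => ?_
      obtain ⟨q, hq, hq', e⟩ := (hneg u).1 ⟨u, hu, hul, hxu, rfl⟩
      obtain ⟨r, rfl⟩ := Nat.exists_eq_add_of_le hq
      refine tgt x hx i hi hi' r (by omega) u (.inr ⟨hq', ?_⟩)
      rw [hπ, e]
    · have ex : ∀ r, r < s + 1 → ∃ u ∉ X, ℓ u = l ∧ ¬ G.Adj x u ∧ σ 14 (pr l (π (c + r))) = u :=
        fun r hr => by
          obtain ⟨u, hu, hul, hxu, e⟩ := (hneg _).2 ⟨c + r, by omega, show c + r < σ 13 l by omega, rfl⟩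
          exact ⟨u, hu, hul, hxu, e⟩
      have : Nonempty (Fin n) := ⟨x⟩
      choose! p p₁ p₂ p₃ p₄ using ex
      refine .inr ⟨(Finset.range (s + 1)).image p, ?_, fun u hu => ?_⟩
      · rw [Finset.card_image_of_injOn, Finset.card_range]
        intro r hr r' hr' e
        simp only [Finset.coe_range, Set.mem_Iio] at hr hr'
        have := inj l (π (c + r)) (π (c + r')) ((hlt _).2 (by omega)) ((hlt _).2 (by omega))
          (by rw [p₄ r hr, p₄ r' hr', e])
        have := π.injective this
        omega
      · obtain ⟨r, hr, rfl⟩ := Finset.mem_image.1 hu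
        rw [Finset.mem_range] at hr
        refine ⟨p₁ r hr, tgt x hx i hi hi' r hr _ (.inr ⟨show c + r < σ 13 l by omega, ?_⟩), p₂ r hr,
          p₃ r hr⟩
        rw [hπ, p₄ r hr]

/-- Minimum solutions of the kernel are minimum solutions of the whole graph. -/
theorem Repr.kernel_solution (h : Repr n T G X ℓ σ) {m : ℕ} (φ : Fin m ↪ Fin n)
    (hφ : ∀ v, Kernel σ v ↔ ∃ i, (φ i : ℕ) = v) {H : SimpleGraph (Fin m)}
    (hH : ∀ a b, H.Adj a b ↔ G.Adj (φ a) (φ b)) :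
    cvd H = cvd G ∧ ∀ S, IsMinCVD H S → IsMinCVD G (S.map φ) := by
  classical
  -- A solution of `G` restricted to the kernel solves the kernel.
  have le : cvd H ≤ cvd G := by
    obtain ⟨S, hS, hc⟩ := exists_isMinCVD G
    have hcvd : IsCVD H (Finset.univ.filter fun i => φ i ∈ S) := by
      rw [isCVD_iff] at hS ⊢
      intro c a b hc ha hb h₁ h₂ hab
      simp only [Finset.mem_filter, Finset.mem_univ, true_and] at hc ha hb
      rw [hH] at h₁ h₂ ⊢
      exact hS _ _ _ hc ha hb h₁ h₂ fun e => hab (φ.injective e)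
    refine (cvd_le hcvd).trans ?_
    rw [← hc]
    refine Finset.card_le_card_of_injOn φ (fun i hi => ?_) φ.injective.injOn
    simpa using hi
  -- A minimum solution of the kernel is no larger than a minimum solution of `G`, hence no larger
  -- than `X`. So it obeys the size limit for which the marking was designed.
  have key : ∀ S, IsMinCVD H S → IsCVD G (S.map φ) := fun S ⟨hS, hc⟩ => by
    refine h.isCVD_of_kernel ?_ ?_
    · rw [Finset.card_map, hc]
      exact le.trans (cvd_le (contentSpec_repr _ _ _ _ _ _ h).1.1)
    · intro c a b kc ka kb
      obtain ⟨i, hi⟩ := (hφ _).1 kc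
      obtain ⟨j, hj⟩ := (hφ _).1 ka
      obtain ⟨k, hk⟩ := (hφ _).1 kb
      obtain rfl := Fin.ext hi
      obtain rfl := Fin.ext hj
      obtain rfl := Fin.ext hk
      rw [Finset.mem_map', Finset.mem_map', Finset.mem_map', ← hH, ← hH, ← hH]
      intro hi hj hk h₁ h₂ hne
      exact (isCVD_iff _ _).1 hS _ _ _ hi hj hk h₁ h₂ fun e => hne (by rw [e])
  have eq : cvd H = cvd G := by
    obtain ⟨S, hS⟩ := exists_isMinCVD H
    refine le_antisymm le ?_
    rw [← hS.2, ← Finset.card_map φ]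
    exact cvd_le (key S hS)
  exact ⟨eq, fun S hS => ⟨key S hS, by rw [Finset.card_map, hS.2, eq]⟩⟩

end

end ClusterDeletion


/-! ### Solving on the kernel and restoring the memory -/

namespace RAM

/-- Only cell `0` of array `a` is written. -/
def Cmd.Scalar (a : ℕ) : Cmd → Prop
  | .skip => True
  | .assign a' i _ => a' = a → i = .const 0
  | .seq c₁ c₂ => c₁.Scalar a ∧ c₂.Scalar a
  | .ite _ c₁ c₂ => c₁.Scalar a ∧ c₂.Scalar a
  | .loop _ c => c.Scalar a

/-- During a query, scratch variables may take values of more than `bits n T` bits. As only cell `0`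
of their arrays is written, resetting this cell restores the bound for the whole array. -/
theorem Run.scalar {w a : ℕ} {c : Cmd} {σ σ' : Mem} {t : ℕ} (h : Run w c σ t σ') (hc : c.Scalar a)
    {i : ℕ} (hi : i ≠ 0) : σ' a i = σ a i := by
  induction h with
  | skip => rfl
  | assign a' j e σ =>
    rw [Mem.set_apply, if_neg]
    rintro ⟨rfl, rfl⟩
    obtain rfl := hc rfl
    exact hi rfl
  | seq _ _ _ _ _ _ _ _ _ ih₁ ih₂ => rw [ih₂ hc.2, ih₁ hc.1]
  | iteTrue _ _ _ _ _ _ _ _ _ ih => exact ih hc.1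
  | iteFalse _ _ _ _ _ _ _ _ _ ih => exact ih hc.2
  | loopDone => rfl
  | loopStep _ _ _ _ _ _ _ _ _ _ _ ih₁ ih₂ => rw [ih₂ hc, ih₁ hc]

theorem Cmd.scalar_shift (c : Cmd) {a : ℕ} (ha : a < 80) : c.shift.Scalar a := by
  induction c with
  | skip => trivial
  | assign a' i e =>
    refine ⟨fun _ => rfl, fun _ => rfl, ⟨trivial, ?_, fun _ => rfl, trivial⟩, ?_, trivial⟩ <;>
      intro h <;> omega
  | seq c₁ c₂ h₁ h₂ => exact ⟨h₁, h₂⟩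
  | ite b c₁ c₂ h₁ h₂ => exact ⟨h₁, h₂⟩
  | loop b c ih => exact ih

theorem scalar_undoAll (L : List ℕ) {a : ℕ} (ha : a < 80) : (Cmd.block (L.map undo)).Scalar a := by
  induction L with
  | nil => trivial
  | cons a' L ih =>
    refine ⟨⟨fun _ => rfl, fun _ => rfl, ?_, ?_, trivial⟩, ih⟩ <;> intro h <;> omega

/-- Write the numbers of marked vertices and edges. -/
def header : Cmd := .block [.assign 80 (.const 0) (.var 64), .assign 80 (.const 1) (.var 66)]

/-- Output the vertices whose indices are listed in array `83`. -/
def translate : Cmd := .seq (.assign 1 (.const 0) (.var 83))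
  (.forLoop 67 (.var 83) (.assign 1 (.var 67 + .const 1) (.cell 65 (.cell 83 (.var 67 + .const 1)))))

/-- Reset the edges and the marks. -/
def unmark : Cmd := .seq (.forLoop 67 (.const 2 + .var 66 + .var 66) (.assign 80 (.var 67) (.const 0)))
  (.seq (.forLoop 67 (.var 64) (.block [.assign 61 (.cell 5 (.cell 65 (.var 67))) (.const 0),
    .assign 60 (.cell 65 (.var 67)) (.const 0)]))
  (.block [.assign 67 (.const 0) (.const 0), .assign 76 (.const 0) (.const 0),
    .assign 77 (.const 0) (.const 0)]))

theorem header_spec {w b : ℕ} (σ : Mem) :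
    Tri w b header σ 20 (fun τ => τ = (σ.set 80 0 (σ 64 0)).set 80 1 (σ 66 0)) :=
  Tri.exec (by decide) (by decide) (fun _ _ => by simp [header]) fun _ _ => by
    simp [header, Mem.set_apply]

/-- The output array survives the query, so its entries must obey the bound of the data structure,
which is sharper than that of the inner computation. This is the purpose of `N`. -/
theorem translate_spec {w b N : ℕ} {σ : Mem} {l : List ℕ} (hl : σ 83 0 = l.length)
    (hli : ∀ (i : ℕ) (h : i < l.length), σ 83 (i + 1) = l[i]) (hN : l.length < N)
    (hNl : ∀ i ∈ l, σ 65 i < N) (h1 : ∀ i, σ 1 i < N) (hb : N ≤ 2 ^ b) :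
    Tri w b translate σ (50 + l.length * 50) (fun τ => τ.Output (l.map (σ 65)) ∧ ∀ i, τ 1 i < N) := by
  refine Tri.seq (B₁ := 20) (B₂ := 30 + l.length * 50) (Q₁ := fun τ => τ = σ.set 1 0 l.length)
    (Tri.exec (by decide) (by decide) (fun _ _ => by simp) fun _ _ => by simp [hl]) ?_ (by omega)
  rintro _ - - rfl
  refine (Tri.forLoop (N := .var 83) (v := 67) l.length (fun j τ => τ 1 0 = l.length ∧
    (∀ (i : ℕ) (h : i < l.length), i < j → τ 1 (i + 1) = σ 65 l[i]) ∧ ∀ i, τ 1 i < N) (B₁ := 30)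
    (by decide) (by decide) (fun j τ fr _ => ?_) (by omega) ?_ ?_ ?_).conseq le_rfl ?_
  · simp [fr 83 (by decide) (by decide), Mem.set_apply, hl]
  · refine ⟨by simp [Mem.set_apply], fun i _ hi => by omega, fun i => ?_⟩
    rw [Mem.set_ne _ _ _ (by decide), Mem.set_apply]
    split
    · exact hN
    · exact h1 i
  · rintro j hj τ - fr h67 ⟨i₁, i₂, i₃⟩
    have e : ∀ a, a ≠ 1 → a ≠ 67 → τ a = σ a := fun a h₁ h₂ => by
      rw [fr a (by simpa [Cmd.mods] using h₁) h₂, Mem.set_ne _ _ _ h₁]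
    refine Tri.exec (by decide) (by decide) (fun _ _ => by simp) fun _ _ => ?_
    have ev : (Cmd.assign 1 (.var 67 + .const 1) (.cell 65 (.cell 83 (.var 67 + .const 1)))).exec τ =
        τ.set 1 (j + 1) (σ 65 l[j]) := by
      simp [e 65 (by decide) (by decide), e 83 (by decide) (by decide), h67, hli j hj]
    rw [ev]
    refine ⟨?_, fun i hi hij => ?_, fun i => ?_⟩
    · simpa [Mem.set_apply] using i₁
    · rw [Mem.set_ne _ _ _ (by decide), Mem.set_apply]
      by_cases h' : i = j
      · subst h'
        simp
      · rw [if_neg (by omega)]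
        exact i₂ i hi (by omega)
    · rw [Mem.set_ne _ _ _ (by decide), Mem.set_apply]
      split
      · exact hNl _ (List.getElem_mem hj)
      · exact i₃ i
  · simp only [Expr.cost, Expr.var]
    omega
  · rintro τ - - ⟨i₁, i₂, i₃⟩
    refine ⟨⟨by simpa using i₁, fun i hi => ?_⟩, i₃⟩
    rw [List.length_map] at hi
    simp [i₂ i hi hi]

/-- Marks and buckets are cleared by way of the list of marked vertices, in time proportional to the
kernel. It is enough to reset the lengths of the buckets. -/
theorem unmark_spec {w b : ℕ} {σ : Mem} (hb : 2 + σ 66 0 + σ 66 0 < 2 ^ b) (hm : σ 64 0 < 2 ^ b)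
    (h80 : ∀ i, 2 + σ 66 0 + σ 66 0 ≤ i → σ 80 i = 0)
    (h60 : ∀ v, σ 60 v ≠ 0 → ∃ i < σ 64 0, σ 65 i = v)
    (h61 : ∀ l, σ 61 l ≠ 0 → ∃ i < σ 64 0, σ 5 (σ 65 i) = l) :
    Tri w b unmark σ (200 + σ 66 0 * 100 + σ 64 0 * 100) (fun τ =>
      (∀ i, τ 80 i = 0) ∧ (∀ i, τ 60 i = 0) ∧ (∀ i, τ 61 i = 0) ∧ τ 67 0 = 0 ∧ τ 76 0 = 0 ∧ τ 77 0 = 0) := by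
  set e := σ 66 0 with he
  set m := σ 64 0 with hm'
  refine Tri.seq (B₁ := 100 + e * 100) (B₂ := 100 + m * 100) (Q₁ := fun τ => ∀ i, τ 80 i = 0)
    ((Tri.forLoop (2 + e + e) (fun j τ => ∀ i, σ 80 i = 0 ∨ i < j → τ 80 i = 0) (B₁ := 15) (by decide)
      (by decide) (fun j τ fr _ => by simp [fr 66 (by decide) (by decide), he]) hb ?_ ?_ ?_).conseq
      le_rfl ?_) ?_ (by omega)
  · rintro i (hi | hi)
    · rwa [Mem.set_ne _ _ _ (by decide)]
    · omega
  · intro j hj τ _ fr h67 hI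
    refine Tri.exec (by decide) (by decide) (fun _ _ => by simp) fun _ _ i hi => ?_
    simp only [Cmd.exec_assign, Expr.eval_var, h67, Expr.eval_const]
    rw [Mem.set_ne _ _ _ (by decide), Mem.set_apply]
    split
    · rfl
    · refine hI i ?_
      rename_i hne
      simp only [true_and] at hne
      omega
  · have h2 : (Expr.const 2 + Expr.var 66 + Expr.var 66).cost = 7 := rfl
    rw [h2]
    omega
  · intro τ _ _ hI i
    by_cases hi : 2 + e + e ≤ i
    · exact hI i (.inl (h80 i hi))
    · exact hI i (.inr (by omega))
  intro τ _ fr h80'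
  have f : ∀ a, a ≠ 67 → a ≠ 80 → τ a = σ a := fun a h₁ h₂ => fr a (by
    simp [Cmd.forLoop, Cmd.mods, h₁, h₂])
  refine Tri.seq (B₁ := 30 + m * 100) (B₂ := 50) (Q₁ := fun τ' => (∀ i, τ' 60 i = 0) ∧ ∀ i, τ' 61 i = 0)
    ((Tri.forLoop m (fun j τ' => (∀ v, τ' 60 v ≠ 0 → ∃ i < m, j ≤ i ∧ σ 65 i = v) ∧
      ∀ l, τ' 61 l ≠ 0 → ∃ i < m, j ≤ i ∧ σ 5 (σ 65 i) = l) (B₁ := 40) (by decide)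
      (by decide) (fun j τ' fr' _ => by
        simp [fr' 64 (by decide) (by decide), f 64 (by decide) (by decide), hm']) hm ?_ ?_ ?_).conseq
      le_rfl ?_) ?_ (by omega)
  · rw [Mem.set_ne _ _ _ (by decide), Mem.set_ne _ _ _ (by decide), f 60 (by decide) (by decide),
      f 61 (by decide) (by decide)]
    refine ⟨fun v hv => ?_, fun l hl => ?_⟩
    · obtain ⟨i, hi, h'⟩ := h60 v hv
      exact ⟨i, hi, by omega, h'⟩
    · obtain ⟨i, hi, h'⟩ := h61 l hl
      exact ⟨i, hi, by omega, h'⟩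
  · intro j hj τ₁ _ fr₁ h67 ⟨hI, hI'⟩
    refine Tri.exec (by decide) (by decide) (fun _ _ => by simp) fun _ _ => ?_
    have k : ∀ a, a = 5 ∨ a = 65 → τ₁ a = σ a := fun a ha => by
      rw [fr₁ a (by rcases ha with rfl | rfl <;> decide) (by omega), f a (by omega) (by omega)]
    rw [exec_cons_assign (x := σ 5 (σ 65 j)) (by simp [k, h67]) (y := 0) rfl,
      exec_cons_assign (x := σ 65 j) (by simp [k, h67, Mem.set_apply]) (y := 0) rfl, Cmd.exec_nil]
    refine ⟨fun v hv => ?_, fun l hl => ?_⟩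
    · rw [Mem.set_ne _ _ _ (by decide), Mem.set_apply, Mem.set_ne _ _ _ (by decide)] at hv
      split at hv
      · exact (hv rfl).elim
      · rename_i hne
        obtain ⟨i, hi, hji, h'⟩ := hI v hv
        refine ⟨i, hi, ?_, h'⟩
        rcases hji.lt_or_eq with h | rfl
        · exact h
        · exact (hne ⟨rfl, h'.symm⟩).elim
    · rw [Mem.set_ne _ _ _ (by decide), Mem.set_ne _ _ _ (by decide), Mem.set_apply] at hl
      split at hl
      · exact (hl rfl).elim
      · rename_i hne
        obtain ⟨i, hi, hji, h'⟩ := hI' l hl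
        refine ⟨i, hi, ?_, h'⟩
        rcases hji.lt_or_eq with h | rfl
        · exact h
        · exact (hne ⟨rfl, h'.symm⟩).elim
  · simp only [Expr.cost, Expr.var]
    omega
  · rintro τ' - - ⟨hI, hI'⟩
    refine ⟨fun v => ?_, fun l => ?_⟩
    · by_contra hv
      obtain ⟨i, hi, h', -⟩ := hI v hv
      omega
    · by_contra hl
      obtain ⟨i, hi, h', -⟩ := hI' l hl
      omega
  rintro τ' - fr' ⟨k₁, k₂⟩
  refine Tri.exec (by decide) (by decide) (fun _ _ => by simp) fun _ f' => ?_
  rw [f' 80 (by decide), f' 60 (by decide), f' 61 (by decide), fr' 80 (by decide)]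
  exact ⟨h80', k₁, k₂, by simp [Mem.set_apply], by simp [Mem.set_apply], by simp [Mem.set_apply]⟩

/-- Solve the problem for the marked graph and clean up. -/
def solve (p : Cmd) : Cmd := .seq header (.seq p.shift (.seq translate
  (.seq (.block (p.mods.map undo)) unmark)))

/-- The static program finds the encoded kernel in array `80`, the image of its array `0`, and
leaves its answer in array `83`, the image of its array `1`. Indices in the answer are translated to
vertices before the log and the marks are erased. Then arrays `60` and `61` and all arrays from `80`
on are zero again, as the next query requires. -/
theorem solve_spec {w v N t : ℕ} {p : Cmd} {σ ρ π : Mem} {l : List ℕ} (hv : 8 ≤ v)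
    (hw : 16 * (v + 1) ≤ w) (hN : N ≤ 2 ^ (v + 1)) (he : 2 + σ 66 0 + σ 66 0 < 2 ^ (v + 1))
    (h80 : ∀ i, 2 + σ 66 0 + σ 66 0 ≤ i → σ 80 i = 0) (hz : ∀ a, 80 < a → ∀ i, σ a i = 0)
    (h60 : ∀ v, σ 60 v ≠ 0 → ∃ i < σ 64 0, σ 65 i = v)
    (h61 : ∀ l, σ 61 l ≠ 0 → ∃ i < σ 64 0, σ 5 (σ 65 i) = l)
    (hρ : ∀ a, ρ a = ((σ.set 80 0 (σ 64 0)).set 80 1 (σ 66 0)) (80 + 3 * a))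
    (hp : Run v p ρ t π) (hl : π.Output l) (hlN : l.length < N) (hlN' : ∀ i ∈ l, σ 65 i < N)
    (h1 : ∀ i, σ 1 i < N) :
    Tri w (v + 1) (solve p) σ (300 + 30 * t + l.length * 50 + p.mods.length * (40 * (t + 1)) +
        σ 66 0 * 100 + σ 64 0 * 100) (fun τ => τ.Output (l.map (σ 65)) ∧ (∀ i, τ 1 i < N) ∧
      (∀ a, a = 60 ∨ a = 61 ∨ 80 ≤ a → ∀ i, τ a i = 0) ∧ τ 67 0 = 0 ∧ τ 76 0 = 0 ∧ τ 77 0 = 0) := by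
  refine Tri.of_bd fun _ bd => ?_
  set m := σ 64 0 with hm
  set e := σ 66 0 with he'
  refine Tri.seq (B₁ := 20) (B₂ := 280 + 30 * t + l.length * 50 + p.mods.length * (40 * (t + 1)) +
    e * 100 + m * 100) (header_spec σ) ?_ (by omega)
  rintro _ bd₁ - rfl
  set σ₁ := (σ.set 80 0 m).set 80 1 e with hσ₁
  have f₁ : ∀ a, a ≠ 80 → σ₁ a = σ a := fun a ha => by
    rw [hσ₁, Mem.set_ne _ _ _ ha, Mem.set_ne _ _ _ ha]
  have z₁ : ∀ i, 2 + e + e ≤ i → σ₁ 80 i = 0 := fun i hi => by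
    rw [hσ₁, Mem.set_apply, if_neg (by omega), Mem.set_apply, if_neg (by omega), h80 i hi]
  have logged : ∀ a, Logged v 0 ρ σ₁ a := fun a => by
    have k : ∀ a', 80 < a' → ∀ i, σ₁ a' i = 0 := fun a' ha' i => by rw [f₁ _ (by omega), hz _ ha']
    refine ⟨[], k _ (by omega) 0, by simp, fun x => by simp [k (81 + 3 * a) (by omega)], by simp, by simp,
      fun x _ => .inr (by rw [hρ]), fun i _ => k _ (by omega) i⟩
  have sh : Shifted v 0 ρ ρ σ₁ := ⟨fun a => (hρ a).symm, logged, bd₁⟩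
  clear_value σ₁
  have tri : Tri w (v + 1) p.shift σ₁ (30 * t) (Shifted v t ρ π) := fun _ _ _ => by
    obtain ⟨t', σ', r, ht, hs⟩ := sh.run hv hw hp
    rw [zero_add] at hs
    exact ⟨t', σ', r, ht, hs.bd, fun a ha => r.frame ha, hs⟩
  refine Tri.seq (B₂ := 280 + l.length * 50 + p.mods.length * (40 * (t + 1)) +
    e * 100 + m * 100) tri ?_ (by omega)
  intro σ₂ bd₂ fr₂ hs₂
  have f₂ : ∀ a, a < 80 → a ≠ 76 → a ≠ 77 → σ₂ a = σ a := fun a h₁ h₂ h₃ => by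
    rw [fr₂, f₁ _ (by omega)]
    intro h'
    rcases Cmd.mem_mods_shift h' with h | h | ⟨a', -, h⟩ <;> omega
  have e65 := f₂ 65 (by decide) (by decide) (by decide)
  refine Tri.seq (B₁ := 50 + l.length * 50) (B₂ := 230 + p.mods.length * (40 * (t + 1)) +
    e * 100 + m * 100) (translate_spec (l := l) (N := N) ?_ ?_ hlN ?_ ?_ hN) ?_ (by omega)
  · rw [hs₂.val 1, hl.1]
  · intro i hi
    rw [hs₂.val 1, hl.2 i hi]
  · rwa [e65]
  · rwa [f₂ 1 (by decide) (by decide) (by decide)]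
  rintro σ₃ - fr₃ ⟨out₃, bd1₃⟩
  have f₃ : ∀ a, a ≠ 1 → a ≠ 67 → σ₃ a = σ₂ a := fun a h₁ h₂ => fr₃ a (by
    simp [translate, Cmd.forLoop, Cmd.mods, h₁, h₂])
  have log₃ : ∀ a ∈ p.mods, Logged v t ρ σ₃ a := fun a _ =>
    (hs₂.log a).congr (f₃ _ (by omega) (by omega)) (f₃ _ (by omega) (by omega)) (f₃ _ (by omega) (by omega))
  refine Tri.seq (B₂ := 200 + e * 100 + m * 100) (undoAll_spec p.mods log₃) ?_ (by omega)
  intro σ₄ _ fr₄ log₄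
  have f₄ : ∀ a, a < 80 → a ≠ 76 → σ₄ a = σ₃ a := fun a h₁ h₂ => fr₄ a fun h' => by
    rcases mem_mods_undoAll h' with h | ⟨a', -, h⟩ <;> omega
  have fσ : ∀ a, a < 80 → a ∉ [1, 67, 76, 77] → σ₄ a = σ a := fun a h₁ h₂ => by
    simp only [List.mem_cons, List.not_mem_nil, or_false, not_or] at h₂
    rw [f₄ a h₁ h₂.2.2.1, f₃ a h₂.1 h₂.2.1, f₂ a h₁ h₂.2.2.1 h₂.2.2.2]
  have log : ∀ a, Logged v 0 ρ σ₄ a := fun a => by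
    by_cases ha : a ∈ p.mods
    · exact log₄ a ha
    -- An array that the program cannot write is as it was before the run.
    · have key : ∀ x, x = 80 + 3 * a ∨ x = 81 + 3 * a ∨ x = 82 + 3 * a → σ₄ x = σ₁ x := fun x hx => by
        rw [fr₄ x, f₃ x (by omega) (by omega), fr₂ x]
        · intro h'
          rcases Cmd.mem_mods_shift h' with h | h | ⟨a', ha', h⟩
          · omega
          · omega
          · exact ha (by rwa [show a = a' by omega])
        · intro h'
          rcases mem_mods_undoAll h' with h | ⟨a', ha', h⟩
          · omega
          · exact ha (by rwa [show a = a' by omega])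
      exact (logged a).congr (key _ (by simp)) (key _ (by simp)) (key _ (by simp))
  have val : ∀ a x, σ₄ (81 + 3 * a) x = 0 ∧ σ₄ (82 + 3 * a) x = 0 ∧
      (σ₄ (80 + 3 * a) x = 0 ∨ σ₄ (80 + 3 * a) x = ρ a x) := fun a x => by
    obtain ⟨l', h₁, -, h₃, -, h₅, h₆, h₇⟩ := log a
    obtain rfl := List.length_eq_zero_iff.1 (Nat.le_zero.1 h₅)
    refine ⟨by simpa using h₃ x, ?_, h₆ x (by simp)⟩
    by_cases hx : x = 0
    · rw [hx]
      exact h₁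
    · exact h₇ x hx
  -- Whatever survives the undoing is a part of the input, and the input lies in the first `2 + e +
  -- e` cells.
  have ρ0 : ∀ i, ρ 0 i ≠ 0 → i < 2 + e + e := fun i hi => by
    by_contra h'
    exact hi (by rw [hρ]; exact z₁ i (by omega))
  have ρz : ∀ a, a ≠ 0 → ∀ i, ρ a i = 0 := fun a ha i => by
    rw [← sh.val a, f₁ _ (by omega), hz _ (by omega)]
  have e64 := congrFun (fσ 64 (by decide) (by decide)) 0
  have e66 := congrFun (fσ 66 (by decide) (by decide)) 0
  rw [← hm] at e64
  rw [← he'] at e66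
  have un := unmark_spec (w := w) (b := v + 1) (σ := σ₄) (by rw [e66]; exact he)
    (by rw [e64]; exact bd 64 0) (fun i hi => by
      rw [e66] at hi
      rcases (val 0 i).2.2 with h | h
      · exact h
      · by_contra h0
        have := ρ0 i (by rwa [← h])
        omega) (fun v hv => by
      rw [e64, fσ 65 (by decide) (by decide)]
      rw [fσ 60 (by decide) (by decide)] at hv
      exact h60 v hv) (fun l hl => by
      rw [e64, fσ 65 (by decide) (by decide), fσ 5 (by decide) (by decide)]
      rw [fσ 61 (by decide) (by decide)] at hl
      exact h61 l hl)
  rw [e64, e66] at un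
  refine un.conseq le_rfl fun τ _ fr ⟨u₁, u₂, u₃, u₄⟩ => ?_
  have fτ : ∀ a, a ∉ [60, 61, 67, 76, 77, 80] → τ a = σ₄ a := fun a ha => fr a (by
    simp only [List.mem_cons, List.not_mem_nil, or_false, not_or] at ha
    simp [unmark, Cmd.forLoop, Cmd.block, Cmd.mods, ha])
  refine ⟨?_, ?_, ?_, u₄⟩
  · rw [Mem.Output, fτ 1 (by decide), f₄ 1 (by decide) (by decide), ← e65]
    exact out₃
  · rw [fτ 1 (by decide), f₄ 1 (by decide) (by decide)]
    exact bd1₃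
  · intro a ha i
    rcases ha with rfl | rfl | ha
    · exact u₂ i
    · exact u₃ i
    · by_cases h' : a = 80
      · rw [h']
        exact u₁ i
      · rw [fτ a (by simp; omega)]
        have hmod : a = 80 + 3 * ((a - 80) / 3) ∨ a = 81 + 3 * ((a - 80) / 3) ∨
          a = 82 + 3 * ((a - 80) / 3) := by omega
        obtain ⟨v₁, v₂, v₃⟩ := val ((a - 80) / 3) i
        rcases hmod with h | h | h
        · rw [← h, ρz _ (by omega)] at v₃
          simpa using v₃
        · rw [← h] at v₁
          exact v₁
        · rw [← h] at v₂
          exact v₂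

theorem scalar_solve (p : Cmd) {a : ℕ} (ha : a = 67 ∨ a = 76 ∨ a = 77) : (solve p).Scalar a := by
  refine ⟨?_, p.scalar_shift (by omega), ?_, scalar_undoAll _ (by omega), ?_⟩ <;>
    rcases ha with rfl | rfl | rfl <;>
    simp [header, translate, unmark, Cmd.forLoop, Cmd.block, Cmd.Scalar]

theorem mem_mods_solve {p : Cmd} {x : ℕ} (h : x ∈ (solve p).mods) :
    x = 1 ∨ x = 60 ∨ x = 61 ∨ x = 67 ∨ x = 76 ∨ x = 77 ∨ 80 ≤ x := by
  simp only [solve, Cmd.mods, List.mem_append] at h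
  rcases h with h | h | h | h | h
  · simp [header, Cmd.block, Cmd.mods] at h
    omega
  · rcases Cmd.mem_mods_shift h with h | h | ⟨a, -, h⟩ <;> omega
  · simp [translate, Cmd.forLoop, Cmd.mods] at h
    omega
  · rcases mem_mods_undoAll h with h | ⟨a, -, h⟩ <;> omega
  · simp [unmark, Cmd.forLoop, Cmd.block, Cmd.mods] at h
    omega

end RAM


/-! ### The query program -/

namespace ClusterDeletion

open RAM

/-- The query program for a static algorithm. -/
def query (p : Cmd) : Cmd := .seq markAll (solve p)

theorem markAll_frame {w t a : ℕ} {σ τ : Mem} (h : Run w markAll σ t τ)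
    (ha : a ≤ 21 ∨ a = 76 ∨ a = 77 ∨ 80 < a) : τ a = σ a := by
  refine h.frame ?_
  simp [markAll, markSol, markLabel, markPair, mark, emit, setAdd, Cmd.forLoop, Cmd.block, Cmd.mods]
  omega

/-- A static algorithm is applied to the kernel. -/
theorem querySpec_repr (p : Cmd) {f g : ℕ → ℕ → ℕ} (hf : MonotoneBound f) (hg : MonotoneBound g)
    (hp : SolvesCVD p f g) : QuerySpec @Repr (20000 + 80 * p.mods.length) (query p) f g := by
  classical
  intro n T G X ℓ σ h k hk w hw
  set D := 20000 + 80 * p.mods.length with hD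
  set s := X.card with hs
  have hxs : σ 10 0 = s := h.xlen
  have hsn : s ≤ n := by simpa using Finset.card_le_univ X
  have hs3 : s ≤ 3 * cvd G := h.card_le
  -- From `s ≤ 3 * cvd G` and `1 ≤ k` follows `s + 1 ≤ 4 * k`.
  have hS4 : (s + 1) ^ 5 ≤ 1024 * k ^ 5 := by
    calc (s + 1) ^ 5 ≤ (4 * k) ^ 5 := Nat.pow_le_pow_left (by omega) 5
      _ = 1024 * k ^ 5 := by ring
  have hS1 : 1 ≤ (s + 1) ^ 5 := Nat.one_le_pow _ _ (by omega)
  have hlog := le_bits n T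
  set g₀ := g (D * k ^ 5) (cvd G) with hg₀
  have hw' : 1000 * (Nat.log 2 (n + T + 2) + g₀) ≤ w :=
    (Nat.mul_le_mul_right _ (by omega)).trans hw
  have hbits : bits n T = 12 * Nat.log 2 (n + T + 2) := rfl
  -- marking
  have hnum : (n + 1) * kernelDeg s + n + 2 < 2 ^ bits n T := by
    refine lt_of_le_of_lt ?_ (pow_lt_bits n T)
    have h₁ : kernelDeg s ≤ 2 * (n + 1) ^ 2 :=
      (kernelDeg_le s).trans (Nat.mul_le_mul_left _ (Nat.pow_le_pow_left (by omega) 2))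
    have h₂ : (n + 1) * kernelDeg s ≤ (n + 1) * (2 * (n + 1) ^ 2) := Nat.mul_le_mul_left _ h₁
    have h₃ : 8 ≤ (n + T + 2) ^ 3 := (show 8 = 2 ^ 3 by norm_num) ▸ Nat.pow_le_pow_left (by omega) 3
    have h₄ : (n + 1) ^ 3 ≤ (n + T + 2) ^ 3 := Nat.pow_le_pow_left (by omega) 3
    have h₅ : n + 2 ≤ (n + T + 2) ^ 3 := (by omega : n + 2 ≤ n + T + 2).trans (Nat.le_self_pow (by norm_num) _)
    have h₆ : 8 * (n + T + 2) ^ 3 ≤ (n + T + 2) ^ 3 * (n + T + 2) ^ 3 := Nat.mul_le_mul_right _ h₃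
    have h₇ : (n + T + 2) ^ 6 = (n + T + 2) ^ 3 * (n + T + 2) ^ 3 := by ring
    have h₈ : (n + 1) * (2 * (n + 1) ^ 2) = 2 * (n + 1) ^ 3 := by ring
    omega
  obtain ⟨t₁, τ, r₁, ht₁, bd, -, hM⟩ := markAll_spec (w := w) h.core (fun v => h.zero 60 (by simp) v)
    (fun l => h.zero 61 (by simp) l) (fun i => h.zero 80 (by simp) i) (by rw [hxs]; exact hnum)
    (by omega) (by omega) h.bd
  rw [hxs] at ht₁ hM
  have fr₁ : ∀ a, a ≤ 21 ∨ a = 76 ∨ a = 77 ∨ 80 < a → τ a = σ a := fun a ha => markAll_frame r₁ ha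
  set m := τ 64 0 with hm
  set e := τ 66 0 with he
  have hmS : m ≤ 3 * (s + 1) ^ 3 := by
    have h₁ := hM.len_le h.core fun _ => id
    rw [hxs, ← hm] at h₁
    have h₂ : (s + 2) * (s + 1) * s ≤ (s + 1) ^ 3 := by nlinarith
    have h₃ : s + 1 ≤ (s + 1) ^ 3 := Nat.le_self_pow (by norm_num) _
    have h₄ : s * ((s + 2) * (s + 1)) = (s + 2) * (s + 1) * s := by ring
    omega
  have hm5 : m ≤ 3 * (s + 1) ^ 5 := by
    have : (s + 1) ^ 3 ≤ (s + 1) ^ 5 := Nat.pow_le_pow_right (by omega) (by norm_num)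
    omega
  have he5 : e ≤ 6 * (s + 1) ^ 5 := by
    have h₁ : e ≤ m * kernelDeg s := hM.count
    have h₂ : m * kernelDeg s ≤ 3 * (s + 1) ^ 3 * (2 * (s + 1) ^ 2) := Nat.mul_le_mul hmS (kernelDeg_le s)
    have h₃ : 3 * (s + 1) ^ 3 * (2 * (s + 1) ^ 2) = 6 * (s + 1) ^ 5 := by ring
    omega
  -- the graph of the marked vertices
  set φ : Fin m ↪ Fin n := ⟨fun i => ⟨τ 65 i, ((hM.elt.mem i i.2).1).lt h.core⟩, fun i j hij =>
    Fin.ext (hM.elt.elt_inj i.2 j.2 (congrArg Fin.val hij))⟩ with hφdef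
  have hφv : ∀ i, (φ i : ℕ) = τ 65 i := fun i => rfl
  have hφ : ∀ v, Kernel σ v ↔ ∃ i, (φ i : ℕ) = v := fun v => by
    rw [hM.elt.exists_iff]
    exact ⟨fun ⟨i, hi, h'⟩ => ⟨⟨i, hi⟩, h'⟩, fun ⟨i, h'⟩ => ⟨i, i.2, h'⟩⟩
  set L : List (Fin m × Fin m) := List.ofFn fun q : Fin e =>
    (⟨τ 80 (2 + q + q), (hM.edge.mem q q.2).1.trans (hM.edge.mem q q.2).2.1⟩,
      ⟨τ 80 (3 + q + q), (hM.edge.mem q q.2).2.1⟩) with hL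
  have hLlen : L.length = e := by simp [hL]
  have hLget : ∀ (q : ℕ) (hq : q < L.length), (L[q].1 : ℕ) = τ 80 (2 + q + q) ∧
      (L[q].2 : ℕ) = τ 80 (3 + q + q) := fun q hq => by simp [hL]
  have hLmem : ∀ x ∈ L, x.1 < x.2 ∧ G.Adj (φ x.1) (φ x.2) := fun x hx => by
    obtain ⟨q, rfl⟩ := List.mem_ofFn.1 hx
    obtain ⟨h₁, h₂, h₃⟩ := hM.edge.mem q q.2
    exact ⟨h₁, natGraph_adj.1 h₃⟩
  -- Edges are stored with the smaller index first, so equal unordered pairs come from equal ordered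
  -- pairs.
  have hLe : IsEdgeList (ofList L) L := by
    refine isEdgeList_ofList ?_ fun x hx => (hLmem x hx).1.ne
    rw [List.nodup_iff_injective_getElem]
    rintro ⟨q, hq⟩ ⟨q', hq'⟩ heq
    simp only [List.length_map] at hq hq'
    have l₁ : L[q].1 < L[q].2 := (hLmem _ (List.getElem_mem hq)).1
    have l₂ : L[q'].1 < L[q'].2 := (hLmem _ (List.getElem_mem hq')).1
    simp only [List.getElem_map, Sym2.eq_iff] at heq
    have heq' : L[q].1 = L[q'].1 ∧ L[q].2 = L[q'].2 := by
      rcases heq with h' | h'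
      · exact h'
      · rw [h'.1, h'.2] at l₁
        exact (lt_asymm l₁ l₂).elim
    rw [Fin.mk.injEq]
    refine hM.edge.inj q (hq.trans_eq hLlen) q' (hq'.trans_eq hLlen) ?_ ?_
    · rw [← (hLget q hq).1, ← (hLget q' hq').1, heq'.1]
    · rw [← (hLget q hq).2, ← (hLget q' hq').2, heq'.2]
  have hH : ∀ a b, (ofList L).Adj a b ↔ G.Adj (φ a) (φ b) := fun a b => by
    rw [ofList_adj]
    constructor
    · rintro ⟨⟨x, hx, hxab⟩, -⟩
      have := (hLmem x hx).2
      rcases Sym2.eq_iff.1 hxab with ⟨h₁, h₂⟩ | ⟨h₁, h₂⟩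
      · rwa [h₁, h₂] at this
      · rw [h₁, h₂] at this
        exact this.symm
    · intro hab
      have hne : a ≠ b := fun h' => hab.ne (by rw [h'])
      have key : ∀ {a b : Fin m}, a < b → G.Adj (φ a) (φ b) → (a, b) ∈ L := fun {a b} hlt hab => by
        obtain ⟨q, hq, h₁, h₂⟩ := hM.edge.exists_of a b ⟨hlt, b.2, natGraph_adj.2 hab⟩
        exact List.mem_ofFn.2 ⟨⟨q, hq⟩, Prod.ext (Fin.ext h₁) (Fin.ext h₂)⟩
      refine ⟨?_, hne⟩
      rcases lt_or_gt_of_ne hne with hlt | hlt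
      · exact ⟨_, key hlt hab, rfl⟩
      · exact ⟨_, key hlt hab.symm, Sym2.eq_swap⟩
  obtain ⟨hcvd, hsol⟩ := h.kernel_solution φ hφ hH
  have hsize : size (ofList L) ≤ D * k ^ 5 := by
    rw [hLe.size_eq, hLlen]
    have : 20000 * k ^ 5 ≤ D * k ^ 5 := Nat.mul_le_mul_right _ (by omega)
    omega
  -- the static algorithm
  obtain ⟨v, hv⟩ : ∃ v, w / 16 = v + 1 := ⟨w / 16 - 1, by omega⟩
  -- The inner program is run with `v` bits, about a sixteenth of the word: a factor 16 is lost to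
  -- the addresses and one bit to the links.
  obtain ⟨t, π, S, r, ht, hS, l, hnd, hmem, hout⟩ := hp m (ofList L) L hLe v (by
    have : g (size (ofList L)) (cvd (ofList L)) ≤ g₀ := hg _ _ _ _ hsize hcvd.le
    omega)
  set F := f (D * k ^ 5) (cvd G) with hF
  have htF : t ≤ F := ht.trans (hf _ _ _ _ hsize hcvd.le)
  have htpos := r.pos
  have hlow : 1024 * k ^ 5 ≤ F + 1 := by
    refine (le_time hg hp (1024 * k ^ 5)).trans (Nat.succ_le_succ (hf _ _ _ _ ?_ (Nat.zero_le _)))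
    have : 20000 * k ^ 5 ≤ D * k ^ 5 := Nat.mul_le_mul_right _ (by omega)
    omega
  have hlen : l.length ≤ m := by simpa using hnd.length_le_card
  have hbv : 2 ^ (bits n T + 2) ≤ 2 ^ (v + 1) := Nat.pow_le_pow_right (by norm_num) (by omega)
  have hb4 : 2 ^ (bits n T + 2) = 4 * 2 ^ bits n T := by ring
  have hb2 : 2 ≤ 2 ^ bits n T := (show 2 = 2 ^ 1 by norm_num) ▸ Nat.pow_le_pow_right (by norm_num) (by omega)
  have hmb : m < 2 ^ bits n T := bd 64 0
  have heb : e < 2 ^ bits n T := bd 66 0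
  have z80 : ∀ a, 80 < a → ∀ i, τ a i = 0 := fun a ha i => by
    rw [fr₁ a (by omega), h.zero a (by omega)]
  obtain ⟨t₂, σ', r₂, ht₂, -, fr₂, out₂, bd1, z₂, c67, c76, c77⟩ := solve_spec (w := w) (v := v) (N := 2 ^ bits n T)
    (t := t) (p := p) (σ := τ) (ρ := Mem.zero.load (encodeGraph m L)) (π := π) (l := l.map Fin.val)
    (by omega) (by omega) (by omega) (by omega) hM.edge.zero z80
    (fun v hv => (hM.elt.exists_iff v).1 ((hM.mark_iff v).1 hv))
    (fun l hl => by
      obtain ⟨⟨h₁, -, h₃⟩, -⟩ := (hM.bucket l).mem 0 (Nat.pos_of_ne_zero hl)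
      exact ⟨_, h₁, h₃⟩)
    (fun a => by
      funext i
      rw [load_encodeGraph (g := ((τ.set 80 0 m).set 80 1 e) 80) (by simp [Mem.set_apply])
        (by simp [Mem.set_apply, hLlen]) (fun q hq => ?_) (fun q hq => ?_) (fun i hi => ?_)]
      · split
        · simp [*]
        · rw [Mem.set_ne _ _ _ (by omega), Mem.set_ne _ _ _ (by omega), z80 _ (by omega)]
      · rw [(hLget q hq).1, Mem.set_apply, if_neg (by omega), Mem.set_apply, if_neg (by omega)]
      · rw [(hLget q hq).2, Mem.set_apply, if_neg (by omega), Mem.set_apply, if_neg (by omega)]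
      · rw [Mem.set_apply, if_neg (by omega), Mem.set_apply, if_neg (by omega)]
        exact hM.edge.zero i (by omega))
    r hout (by rw [List.length_map]; omega) (fun i _ => bd 65 i) (fun i => bd 1 i)
    (by omega) (by omega) (bd.mono (by omega))
  rw [List.length_map] at ht₂
  refine ⟨_, σ', S.map φ, .seq _ _ _ _ _ _ _ r₁ r₂, ?_, hsol S hS, ⟨l.map φ, hnd.map φ.injective,
    fun v => ?_, ?_⟩, h.congr (fun a i => ?_) (fun a h₁ h₂ => ?_) z₂⟩
  -- Undoing costs up to `40 * (t + 1)` for each listed array. This is the only place where the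
  -- constant depends on the program.
  · have a₁ : p.mods.length * (40 * (t + 1)) ≤ p.mods.length * (40 * (F + F)) :=
      Nat.mul_le_mul_left _ (by omega)
    have a₂ : D * F = 20000 * F + p.mods.length * (40 * (F + F)) := by rw [hD]; ring
    omega
  · simp only [List.mem_map, Finset.mem_map, hmem]
  · have : (l.map φ).map Fin.val = (l.map Fin.val).map (τ 65) := by simp [Function.comp_def, hφv]
    rwa [this]
  · by_cases ha : a ∈ (solve p).mods
    · rcases mem_mods_solve ha with rfl | rfl | rfl | h' | h' | h' | h'
      · exact bd1 i
      · rw [z₂ 60 (by simp)]; omega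
      · rw [z₂ 61 (by simp)]; omega
      · subst h'
        by_cases hi : i = 0
        · rw [hi, c67]; omega
        · rw [r₂.scalar (scalar_solve p (by simp)) hi]
          exact bd _ i
      · subst h'
        by_cases hi : i = 0
        · rw [hi, c76]; omega
        · rw [r₂.scalar (scalar_solve p (by simp)) hi]
          exact bd _ i
      · subst h'
        by_cases hi : i = 0
        · rw [hi, c77]; omega
        · rw [r₂.scalar (scalar_solve p (by simp)) hi]
          exact bd _ i
      · rw [z₂ a (by omega)]; omega
    · rw [r₂.frame ha]
      exact bd a i
  · rw [fr₂, fr₁ a (by omega)]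
    intro h'
    rcases mem_mods_solve h' with h | h | h | h | h | h | h <;> omega

end ClusterDeletion

open RAM ClusterDeletion in
theorem theorem2 :
    ∃ (R : Representation) (init insert remove report : Cmd) (C : ℕ),
      InitSpec R C init ∧
      ContentSpec R ∧
      UpdateSpec R C insert addEdge ∧
      UpdateSpec R C remove removeEdge ∧
      ReportSpec R C report ∧
      ∀ p : Cmd, ∃ (query : Cmd) (D : ℕ), ∀ f g : ℕ → ℕ → ℕ,
        MonotoneBound f → MonotoneBound g → SolvesCVD p f g → QuerySpec R D query f g := by
  refine ⟨@Repr, setUp, update 1, update 0, reporter, 1000000, initSpec_repr (by norm_num),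
    contentSpec_repr, updateSpec_repr le_rfl (by norm_num) _ addEdge_adj,
    updateSpec_repr le_rfl (by norm_num) _ removeEdge_adj, reportSpec_repr (by norm_num), fun p => ?_⟩
  exact ⟨query p, _, fun f g hf hg hp => querySpec_repr p hf hg hp⟩
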